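/- **Setting.** Let $\tilde a>0$ and $L=M\tilde a$ with an integer $M\ge 1$. Signs $r,s,\alpha=\pm$ label chirality, direction and spin. A vector $\mathbf x\in\mathbb R^2$ has coordinates $(x_+,x_-)$, and $\mathbf k\cdot\mathbf x=k_+x_++k_-x_-$. Put $$\Lambda_{1D}=\{x\in\tilde a\mathbb Z: -\tfrac L2\le x<\tfrac L2\},\qquad \Lambda_s=\{\mathbf x: -\tfrac L2\le x_s<\tfrac L2,\ x_{-s}\in\Lambda_{1D}\},$$ $$\Lambda_s^*=\{\mathbf k: k_\pm\in\tfrac{2\pi}L(\mathbb Z+\tfrac12),\ -\tfrac\pi{\tilde a}\le k_{-s}<\tfrac\pi{\tilde a}\},\qquad \tilde\Lambda_s^*=\{\mathbf p: p_\pm\in\tfrac{2\pi}L\mathbb Z,\ -\tfrac\pi{\tilde a}\le p_{-s}<\tfrac\pi{\tilde a}\},$$ and $\hat\Lambda_s^*=\{\mathbf p\in\tilde\Lambda_s^*:p_s\ne0\}$. On the fermion Fock space $\mathcal F$ over the Dirac sea $\Omega$ there are operators $c_A(k)$, $A=(r,s,\alpha,x)$ with $x\in\Lambda_{1D}$, $k\in\frac{2\pi}L(\mathbb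 Z+\frac12)$, with $\{c_A(k),c_B(k')^\dagger\}=\delta_{A,B}\delta_{k,k'}$, $\{c_A(k),c_B(k')\}=0$ and $c_A(k)\Omega=c_A(-k)^\dagger\Omega=0$ if $rk>0$. The nodal fermion operators are $$\hat\psi_{r,s,\alpha}(\mathbf k)=\frac L{2\pi}\sqrt{\frac{\tilde a}L}\sum_{x\in\Lambda_{1D}}c_{r,s,\alpha,x}(k_s)\,e^{-ik_{-s}x}\qquad(\mathbf k\in\Lambda_s^*).$$ Let $\mathcal D$ be the span of the occupation number states, i.e. of the vectors obtained from $\Omega$ by applying finitely many $c_A(k)$ and $c_A(k)^\dagger$. With $:\!O\!:\,=O-\langle\Omega,O\Omega\rangle$ define on $\mathcal D$ the densities $$\hat J_{r,s,\alpha}(\mathbf p)=\sum_{\mathbf k_1,\mathbf k_2\in\Lambda_s^*}\sum_{n\in\mathbb Z}\Bigl(\frac{2\pi}L\Bigr)^2:\!\hat\psi^\dagger_{r,s,\alpha}(\mathbf k_1)\hat\psi_{r,s,\alpha}(\mathbf k_2)\!:\ \delta_{\mathbf k_1+\mathbf p,\ \mathbf k_2+2\pi n\mathbf e_{-s}/\tilde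 a}\qquad(\mathbf p\in\tilde\Lambda_s^*)$$ and the zero modes $N_{r,s,\alpha}(x)=\frac{\tilde a}L\sum_{p}\hat J_{r,s,\alpha}(\mathbf p)|_{p_s=0,\,p_{-s}=p}\;e^{ipx}$, where $p\in\frac{2\pi}L\mathbb Z$, $-\frac\pi{\tilde a}\le p<\frac\pi{\tilde a}$. For $A=(r,s,\alpha,x)$ the Klein factor $R_A=R_{r,s,\alpha}(x)$ is the unitary operator on $\mathcal F$ with $$R_Ac_A(k)R_A^\dagger=c_A(k+\tfrac{2\pi}L),\qquad R_Ac_B(k)R_A^\dagger=-c_B(k)\ (B\ne A),\qquad R_A\Omega=\begin{cases}c_A(\pi/L)^\dagger\Omega&r=+\\ c_A(\pi/L)\Omega&r=-.\end{cases}$$ For an operator $T$ on $\mathcal D$ with skew-adjoint closure $\bar T$, $\exp(T)$ denotes the value at $t=1$ of the strongly continuous unitary group $e^{t\bar T}$. **Proposition.** The operators $R_{r,s,\alpha}(x)$ are Klein factors: they commute with all $\hat J_{r',s',\alpha'}(\mathbf p)$, $\mathbf p\in\hat\Lambda_{s'}^*$, and $$[N_{r,s,\alpha}(x),R_{r',s',\alpha'}(x')]=r\,\delta_{r,r'}\delta_{s,s'}\delta_{\alpha,\alpha'}\delta_{x,x'}R_{r,s,\alpha}(x),\qquad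 \{R_{r,s,\alpha}(x),R_{r',s',\alpha'}(x')^\dagger\}=2\,\delta_{r,r'}\delta_{s,s'}\delta_{\alpha,\alpha'}\delta_{x,x'}.$$ For all $r,s,\alpha=\pm$, $\mathbf x\in\Lambda_s$ and $\epsilon>0$, the exponentials in $$\psi_{r,s,\alpha}(\mathbf x;\epsilon)=\frac1{\sqrt{2\pi\tilde a\epsilon}}\,e^{ir\pi x_sN_{r,s,\alpha}(x_{-s})/L}\,R_{r,s,\alpha}(x_{-s})^{-r}\,e^{ir\pi x_sN_{r,s,\alpha}(x_{-s})/L}\,\exp\Bigl(r\frac{\tilde a}{2\pi}\sum_{\mathbf p\in\hat\Lambda_s^*}\Bigl(\frac{2\pi}L\Bigr)^2\frac1{p_s}\hat J_{r,s,\alpha}(\mathbf p)\,e^{i\mathbf p\cdot\mathbf x}e^{-\epsilon|p_s|/2}\Bigr)$$ are well defined, and $\sqrt{2\pi\tilde a\epsilon}\,\psi_{r,s,\alpha}(\mathbf x;\epsilon)$ is a unitary operator on $\mathcal F$. Moreover, for every $\mathbf k\in\Lambda_s^*$ and every $v\in\mathcal F$ the function $x_s\mapsto\psi_{r,s,\alpha}(\mathbf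 x;\epsilon)v\,e^{-i\mathbf k\cdot\mathbf x}$ is integrable on $[-\frac L2,\frac L2]$ for all $\epsilon>0$ and $x_{-s}\in\Lambda_{1D}$, and $$\hat\psi_{r,s,\alpha}(\mathbf k)\,v=\lim_{\epsilon\to0^+}\frac1{2\pi}\sum_{x_{-s}\in\Lambda_{1D}}\tilde a\int_{-L/2}^{L/2}dx_s\ \psi_{r,s,\alpha}(\mathbf x;\epsilon)\,v\;e^{-i\mathbf k\cdot\mathbf x}$$ in the norm of $\mathcal F$; that is, the limit holds in the strong operator topology. -/

import Mathlib

namespace NodalBoson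

noncomputable section

open scoped InnerProductSpace ENNReal

/-! ### Unbounded operators: series and exponentials -/

section Operators

variable {E : Type*} [NormedAddCommGroup E] [InnerProductSpace ℂ E]

/-- The sum of a family of (unbounded) operators. It acts on those vectors of the common domain on
which the series converges unconditionally. -/
def seriesOp {β : Type*} (T : β → E →ₗ.[ℂ] E) : E →ₗ.[ℂ] E where
  domain :=
    { carrier := {v | ∃ h : ∀ i, v ∈ (T i).domain, Summable fun i => T i ⟨v, h i⟩}
      add_mem' := by
        rintro u v ⟨hu, su⟩ ⟨hv, sv⟩
        refine ⟨fun i => add_mem (hu i) (hv i), (su.add sv).congr fun i => ?_⟩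
        rw [← LinearPMap.map_add]
        rfl
      zero_mem' := by
        refine ⟨fun i => zero_mem _, summable_zero.congr fun i => ?_⟩
        exact (LinearPMap.map_zero (T i)).symm
      smul_mem' := by
        rintro c v ⟨hv, sv⟩
        refine ⟨fun i => Submodule.smul_mem _ c (hv i), (sv.const_smul c).congr fun i => ?_⟩
        rw [← LinearPMap.map_smul]
        rfl }
  toFun :=
    { toFun := fun v => ∑' i, T i ⟨v.1, v.2.choose i⟩
      map_add' := by
        rintro ⟨u, hu⟩ ⟨v, hv⟩
        rw [← hu.choose_spec.tsum_add hv.choose_spec]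
        refine tsum_congr fun i => ?_
        rw [← LinearPMap.map_add]
        rfl
      map_smul' := by
        rintro c ⟨v, hv⟩
        rw [RingHom.id_apply, ← hv.choose_spec.tsum_const_smul c]
        refine tsum_congr fun i => ?_
        rw [← LinearPMap.map_smul]
        rfl }

/-- `U` is a strongly continuous one-parameter unitary group and its generator
`v ↦ d/dt U(t) v` at `t = 0`, on its maximal domain, is the closure of the operator `T`. -/
def GeneratesUnitaryGroup (T : E →ₗ.[ℂ] E) (U : ℝ → E ≃ₗᵢ[ℂ] E) : Prop :=
  (∀ t u : ℝ, U (t + u) = U t * U u) ∧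
  (∀ v : E, Continuous fun t : ℝ => U t v) ∧
  ∀ v w : E, HasDerivAt (fun t : ℝ => U t v) w 0 ↔ (v, w) ∈ T.graph.topologicalClosure

open Classical in
/-- The exponential `exp T` of an operator `T` whose closure is skew-adjoint: the value at time `1`
of the unitary group generated by the closure of `T` (there is at most one such group).
It is `0` if the closure of `T` generates no unitary group. -/
def expOp (T : E →ₗ.[ℂ] E) : E →L[ℂ] E :=
  if h : ∃ U : ℝ → E ≃ₗᵢ[ℂ] E, GeneratesUnitaryGroup T U then
    ((h.choose 1).toContinuousLinearEquiv : E →L[ℂ] E)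
  else 0

end Operators

/-! ### Weighted composition operators on `ℓ²` -/

section Weighted

variable {ι : Type*}

theorem sum_weighted_le (w : ι → ℂ) (φ : ι → ι) (hw : ∀ i, ‖w i‖ ≤ 1)
    (hφ : Set.InjOn φ {i | w i ≠ 0}) (f : lp (fun _ : ι => ℂ) 2) (s : Finset ι) :
    ∑ i ∈ s, ‖w i * f (φ i)‖ ^ (2 : ℝ≥0∞).toReal ≤ ‖f‖ ^ (2 : ℝ≥0∞).toReal := by
  classical
  have h2 : 0 < (2 : ℝ≥0∞).toReal := by norm_num
  calc ∑ i ∈ s, ‖w i * f (φ i)‖ ^ (2 : ℝ≥0∞).toReal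
      = ∑ i ∈ s.filter (fun i => w i ≠ 0), ‖w i * f (φ i)‖ ^ (2 : ℝ≥0∞).toReal := by
        refine (Finset.sum_subset (Finset.filter_subset _ _) ?_).symm
        intro i hi hn
        have h0 : w i = 0 := by
          by_contra h
          exact hn (Finset.mem_filter.2 ⟨hi, h⟩)
        rw [h0, zero_mul, norm_zero, Real.zero_rpow h2.ne']
    _ ≤ ∑ i ∈ s.filter (fun i => w i ≠ 0), ‖f (φ i)‖ ^ (2 : ℝ≥0∞).toReal := by
        refine Finset.sum_le_sum fun i _ => ?_
        refine Real.rpow_le_rpow (norm_nonneg _) ?_ h2.le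
        rw [norm_mul]
        exact mul_le_of_le_one_left (norm_nonneg _) (hw i)
    _ = ∑ j ∈ (s.filter (fun i => w i ≠ 0)).image φ, ‖f j‖ ^ (2 : ℝ≥0∞).toReal := by
        rw [Finset.sum_image]
        intro i hi j hj hij
        exact hφ (Finset.mem_filter.1 hi).2 (Finset.mem_filter.1 hj).2 hij
    _ ≤ ‖f‖ ^ (2 : ℝ≥0∞).toReal := lp.sum_rpow_le_norm_rpow h2 f _

/-- The bounded operator `(W f)(i) = w i * f (φ i)` on `ℓ²`, for weights of modulus at most one and
a map `φ` that is injective where the weight does not vanish. -/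
def weightedComp (w : ι → ℂ) (φ : ι → ι) (hw : ∀ i, ‖w i‖ ≤ 1)
    (hφ : Set.InjOn φ {i | w i ≠ 0}) :
    lp (fun _ : ι => ℂ) 2 →L[ℂ] lp (fun _ : ι => ℂ) 2 :=
  LinearMap.mkContinuous
    { toFun := fun f => ⟨fun i => w i * f (φ i), memℓp_gen' (sum_weighted_le w φ hw hφ f)⟩
      map_add' := by
        intro f g
        ext i
        exact mul_add _ _ _
      map_smul' := by
        intro c f
        ext i
        exact mul_left_comm _ _ _ }
    1
    (by
      intro f
      rw [one_mul]
      exact lp.norm_le_of_forall_sum_le (by norm_num) (norm_nonneg _)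
        (sum_weighted_le w φ hw hφ f))

/-- The unitary operator on `ℓ²` that maps the basis vector `e_i` to `η i • e_(τ i)`, for a
permutation `τ` and signs `η`. -/
def signedPerm (η : ι → ℤˣ) (τ : ι ≃ ι) :
    lp (fun _ : ι => ℂ) 2 ≃ₗᵢ[ℂ] lp (fun _ : ι => ℂ) 2 :=
  have hη : ∀ i, ‖(((η i : ℤˣ) : ℤ) : ℂ)‖ ≤ 1 := fun i => by
    rcases Int.units_eq_one_or (η i) with h | h <;> simp [h]
  have hηη : ∀ i, (((η i : ℤˣ) : ℤ) : ℂ) * (((η i : ℤˣ) : ℤ) : ℂ) = 1 := fun i => by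
    rcases Int.units_eq_one_or (η i) with h | h <;> simp [h]
  let F := weightedComp (fun i => (((η (τ.symm i) : ℤˣ) : ℤ) : ℂ)) τ.symm (fun _ => hη _)
    τ.symm.injective.injOn
  let G := weightedComp (fun i => (((η i : ℤˣ) : ℤ) : ℂ)) τ (fun _ => hη _) τ.injective.injOn
  have hF : ∀ f, ‖F f‖ ≤ ‖f‖ := fun f => by
    simpa using F.le_of_opNorm_le (LinearMap.mkContinuous_norm_le _ zero_le_one _) f
  have hG : ∀ f, ‖G f‖ ≤ ‖f‖ := fun f => by
    simpa using G.le_of_opNorm_le (LinearMap.mkContinuous_norm_le _ zero_le_one _) f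
  have hGF : ∀ f, G (F f) = f := fun f => by
    ext i
    change (((η i : ℤˣ) : ℤ) : ℂ) *
      ((((η (τ.symm (τ i)) : ℤˣ) : ℤ) : ℂ) * f (τ.symm (τ i))) = f i
    rw [Equiv.symm_apply_apply, ← mul_assoc, hηη, one_mul]
  have hFG : ∀ f, F (G f) = f := fun f => by
    ext i
    change (((η (τ.symm i) : ℤˣ) : ℤ) : ℂ) *
      ((((η (τ.symm i) : ℤˣ) : ℤ) : ℂ) * f (τ (τ.symm i))) = f i
    rw [Equiv.apply_symm_apply, ← mul_assoc, hηη, one_mul]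
  { toFun := F
    invFun := G
    left_inv := hGF
    right_inv := hFG
    map_add' := F.map_add
    map_smul' := F.map_smul
    norm_map' := fun f => by
      have h := hG (F f)
      rw [hGF] at h
      exact le_antisymm (hF f) h }

end Weighted

/-! ### Index sets

The signs `r, s, α = ±` are elements of `ℤˣ`. The lengths `L` and `a` (the latter also written
`ã`) are related by `L = M a` with an integer `M ≥ 1`. -/

/-- The integers `n` with `-M/2 ≤ n < M/2`. They label the points `x = a n` of the lattice
`{x ∈ a ℤ : -L/2 ≤ x < L/2}`, and also the momenta `p = (2π/L) n` in
`{p ∈ (2π/L) ℤ : -π/a ≤ p < π/a}`. -/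
abbrev Cell (M : ℕ) : Type :=
  {n : ℤ // n ∈ (Finset.Icc (-(M : ℤ)) M).filter fun n => -(M : ℤ) ≤ 2 * n ∧ 2 * n < M}

/-- The integers `n` with `-M/2 ≤ n + 1/2 < M/2`. They label the momenta `k = (2π/L) (n + 1/2)`
with `-π/a ≤ k < π/a`. -/
abbrev HalfCell (M : ℕ) : Type :=
  {n : ℤ // n ∈ (Finset.Icc (-(M : ℤ) - 1) M).filter fun n =>
    -(M : ℤ) ≤ 2 * n + 1 ∧ 2 * n + 1 < M}

/-- Fermion momenta `𝐤 ∈ Λ_s^*`: the pair `(n, m)` stands for `k_s = (2π/L) (n + 1/2)` and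
`k_{-s} = (2π/L) (m + 1/2)`. -/
abbrev FermiMom (M : ℕ) : Type := ℤ × HalfCell M

/-- Boson momenta `𝐩` with `p_s ∈ (2π/L) ℤ` and `-π/a ≤ p_{-s} < π/a`: the pair `(n, m)` stands for
`p_s = (2π/L) n` and `p_{-s} = (2π/L) m`. -/
abbrev BoseMom (M : ℕ) : Type := ℤ × Cell M

/-- The set `{x ∈ a ℤ : -L/2 ≤ x < L/2}`, as real numbers. -/
def sitePos (a : ℝ) {M : ℕ} (x : Cell M) : ℝ := a * ((x : ℤ) : ℝ)

/-- The momentum `(2π/L) n`. -/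
def boseK (L : ℝ) (n : ℤ) : ℝ := 2 * Real.pi / L * (n : ℝ)

/-- The momentum `(2π/L) (n + 1/2)`. -/
def fermiK (L : ℝ) (n : ℤ) : ℝ := 2 * Real.pi / L * ((n : ℝ) + 1 / 2)

/-- Flavor indices `(r, s, α, x)`. -/
@[ext]
structure Flavor (M : ℕ) where
  /-- the chirality -/
  r : ℤˣ
  /-- the label of the direction -/
  s : ℤˣ
  /-- the spin -/
  α : ℤˣ
  /-- the position in the direction `-s` -/
  x : Cell M

/-- The lexicographic order of the flavors. -/
instance (M : ℕ) : LinearOrder (Flavor M) :=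
  LinearOrder.lift' (fun A => toLex (A.r, toLex (A.s, toLex (A.α, A.x)))) fun A B h => by
    simpa [Flavor.ext_iff] using h

/-- One-particle modes: a flavor and the label `n` of the Fourier mode `k = (2π/L) (n + 1/2)`. -/
@[ext]
structure Mode (M : ℕ) where
  /-- the flavor -/
  flavor : Flavor M
  /-- the label of the Fourier mode -/
  n : ℤ

/-- The lexicographic order of the modes, needed for the signs in the Fock space. -/
instance (M : ℕ) : LinearOrder (Mode M) :=
  LinearOrder.lift' (fun i => toLex (i.flavor, i.n)) fun i j h => by
    simpa [Mode.ext_iff] using h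

/-! ### The fermion Fock space and the nodal fermion operators -/

/-- The fermion Fock space over the Dirac sea, in the occupation number representation. The basis
vector labelled by a finite set `S` of modes is the state that differs from the Dirac sea exactly
in the modes of `S`: a mode with `r k > 0`, empty in the sea, is filled, and a mode with `r k < 0`,
filled in the sea, is empty. -/
abbrev Fock (M : ℕ) : Type := lp (fun _ : Finset (Mode M) => ℂ) 2

/-- The basis state labelled by `S`. -/
def state {M : ℕ} (S : Finset (Mode M)) : Fock M := lp.single 2 S (1 : ℂ)

/-- The Dirac sea `Ω`. -/
def vacuum (M : ℕ) : Fock M := state ∅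

/-- The dense domain of finite linear combinations of the basis states. -/
def finiteStates (M : ℕ) : Submodule ℂ (Fock M) := Submodule.span ℂ (Set.range state)

/-- The operator that removes the excitation `i`:
`|S⟩ ↦ (-1)^#{j ∈ S : j < i} |S \ {i}⟩` if `i ∈ S`, and `|S⟩ ↦ 0` otherwise. -/
def removeExc {M : ℕ} (i : Mode M) : Fock M →L[ℂ] Fock M :=
  weightedComp (fun S => if i ∈ S then 0 else (-1) ^ (S.filter fun j => j < i).card)
    (fun S => insert i S)
    (fun S => by split_ifs <;> simp)
    (fun S hS T hT h => by
      have hS' : i ∉ S := fun hi => hS (if_pos hi)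
      have hT' : i ∉ T := fun hi => hT (if_pos hi)
      have h' : insert i S = insert i T := h
      rw [← Finset.erase_insert hS', h', Finset.erase_insert hT'])

/-- The fermion operator `c_{r,s,x,α}(k)`, `k = (2π/L) (n + 1/2)`. It annihilates the Dirac sea if
`r k > 0`, and its adjoint annihilates the Dirac sea if `r k < 0`. -/
def fermionC {M : ℕ} (A : Flavor M) (n : ℤ) : Fock M →L[ℂ] Fock M :=
  if 0 < ((A.r : ℤˣ) : ℤ) * (2 * n + 1) then removeExc ⟨A, n⟩
  else ContinuousLinearMap.adjoint (removeExc ⟨A, n⟩)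

/-- The nodal fermion operator `ψ̂_{r,s,α}(𝐤)`, `𝐤 ∈ Λ_s^*`. -/
def psiHat (L a : ℝ) {M : ℕ} (r s α : ℤˣ) (k : FermiMom M) : Fock M →L[ℂ] Fock M :=
  ((L / (2 * Real.pi) * √(a / L) : ℝ) : ℂ) •
    ∑ x : Cell M, Complex.exp (-Complex.I * ((fermiK L k.2 * sitePos a x : ℝ) : ℂ)) •
      fermionC ⟨r, s, α, x⟩ k.1

/-! ### Densities and zero modes -/

/-- Fermion normal ordering `:O: = O - ⟨Ω, O Ω⟩` of a bilinear `O`. -/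
def normalOrder {M : ℕ} (O : Fock M →L[ℂ] Fock M) : Fock M →L[ℂ] Fock M :=
  O - inner ℂ (vacuum M) (O (vacuum M)) • ContinuousLinearMap.id ℂ (Fock M)

/-- The nodal bilinear
`∑_{α,β} ∑_{𝐤₁,𝐤₂ ∈ Λ_s^*} ∑_{n ∈ ℤ} (2π/L)² :ψ̂†_{r,s,α}(𝐤₁) σ_{α,β} ψ̂_{r,s,β}(𝐤₂):`
over all `𝐤₁, 𝐤₂, n` with `𝐤₁ + 𝐩 = 𝐤₂ + (2π n/a) e_{-s}`, as an operator on `finiteStates`. -/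
def nodalBilinear (L a : ℝ) {M : ℕ} (σ : Matrix ℤˣ ℤˣ ℂ) (r s : ℤˣ) (p : BoseMom M) :
    Fock M →ₗ.[ℂ] Fock M :=
  seriesOp fun q : FermiMom M × FermiMom M × ℤ =>
    LinearMap.toPMap
      (((if q.1.1 + p.1 = q.2.1.1 ∧
            (q.1.2 : ℤ) + (p.2 : ℤ) = (q.2.1.2 : ℤ) + (M : ℤ) * q.2.2 then
          ∑ α : ℤˣ, ∑ β : ℤˣ, (((2 * Real.pi / L) ^ 2 : ℝ) * σ α β : ℂ) •
            normalOrder ((ContinuousLinearMap.adjoint (psiHat L a r s α q.1)).comp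
              (psiHat L a r s β q.2.1))
        else 0 : Fock M →L[ℂ] Fock M) : Fock M →ₗ[ℂ] Fock M))
      (finiteStates M)

/-- The density `Ĵ⁰_{r,s}(𝐩)`. -/
def densityJ0 (L a : ℝ) {M : ℕ} (r s : ℤˣ) (p : BoseMom M) : Fock M →ₗ.[ℂ] Fock M :=
  nodalBilinear L a 1 r s p

/-- The density `Ĵ³_{r,s}(𝐩)`, with the third Pauli matrix. -/
def densityJ3 (L a : ℝ) {M : ℕ} (r s : ℤˣ) (p : BoseMom M) : Fock M →ₗ.[ℂ] Fock M :=
  nodalBilinear L a (Matrix.diagonal fun α : ℤˣ => (((α : ℤˣ) : ℤ) : ℂ)) r s p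

/-- The spin dependent density `Ĵ_{r,s,α}(𝐩) = (Ĵ⁰_{r,s}(𝐩) + α Ĵ³_{r,s}(𝐩))/2`. -/
def densityJ (L a : ℝ) {M : ℕ} (r s α : ℤˣ) (p : BoseMom M) : Fock M →ₗ.[ℂ] Fock M :=
  (1 / 2 : ℂ) • (densityJ0 L a r s p + (((α : ℤˣ) : ℤ) : ℂ) • densityJ3 L a r s p)

/-- The zero mode `N̂_{r,s,α}(p) = √(a/2π) Ĵ_{r,s,α}(𝐩)` at `p_s = 0`, `p_{-s} = p`. -/
def zeroModeHat (L a : ℝ) {M : ℕ} (r s α : ℤˣ) (p : Cell M) : Fock M →ₗ.[ℂ] Fock M :=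
  ((√(a / (2 * Real.pi)) : ℝ) : ℂ) • densityJ L a r s α (0, p)

/-- The zero mode `N_{r,s,α}(x) = √(2πa) ∑_p (1/L) N̂_{r,s,α}(p) e^{ipx}`. -/
def zeroMode (L a : ℝ) {M : ℕ} (r s α : ℤˣ) (x : Cell M) : Fock M →ₗ.[ℂ] Fock M :=
  ((√(2 * Real.pi * a) : ℝ) : ℂ) •
    ∑ p : Cell M, ((1 / L : ℝ) * Complex.exp (Complex.I * ((boseK L p * sitePos a x : ℝ) : ℂ))) •
      zeroModeHat L a r s α p

/-! ### Klein factors -/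

/-- The shift `(A, n) ↦ (A, n + 1)` of the modes of flavor `A`; other modes stay fixed. -/
def shiftMode {M : ℕ} (A : Flavor M) : Mode M ≃ Mode M where
  toFun i := if i.flavor = A then ⟨A, i.n + 1⟩ else i
  invFun i := if i.flavor = A then ⟨A, i.n - 1⟩ else i
  left_inv i := by
    by_cases h : i.flavor = A
    · subst h
      simp
    · simp [h]
  right_inv i := by
    by_cases h : i.flavor = A
    · subst h
      simp
    · simp [h]

/-- The effect on excitations of moving every fermion of flavor `A` from mode `n` to mode `n + 1`:
shift the excitations and toggle the mode `(A, 0)`, as the sea itself moves by one step. -/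
def shiftState {M : ℕ} (A : Flavor M) : Finset (Mode M) ≃ Finset (Mode M) :=
  (shiftMode A).finsetCongr.trans
    { toFun := fun S => symmDiff S {⟨A, 0⟩}
      invFun := fun S => symmDiff S {⟨A, 0⟩}
      left_inv := fun S => by
        ext i
        simp only [Finset.mem_symmDiff]
        tauto
      right_inv := fun S => by
        ext i
        simp only [Finset.mem_symmDiff]
        tauto }

/-- The Klein factor `R_{r,s,α}(x)` of the flavor `A = (r, s, α, x)`: the unitary operator with
`R Ω = |{(A, 0)}⟩`, `R c_A(n) R† = c_A(n + 1)` and `R c_B(n) R† = -c_B(n)` for `B ≠ A`. -/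
def klein {M : ℕ} (A : Flavor M) : Fock M ≃ₗᵢ[ℂ] Fock M :=
  signedPerm
    (fun S => (-1) ^ ((S.filter fun j => j.flavor < A).card +
      (S.filter fun j => j.flavor = A ∧ 0 ≤ j.n).card))
    (shiftState A)

/-- The defining properties of a family of Klein factors: the `R_A` commute with the boson operators
(proportional to the densities `Ĵ_{r,s,α}(𝐩)` with `p_s ≠ 0`), `[N_A, R_B] = r δ_{A,B} R_A`, and
`{R_A, R_B†} = 2 δ_{A,B}`. Relations between unbounded operators include equality of domains. -/
structure IsKleinFamily (L a : ℝ) (M : ℕ) (R : Flavor M → Fock M ≃ₗᵢ[ℂ] Fock M) : Prop where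
  comm_boson : ∀ (A : Flavor M) (r s α : ℤˣ) (p : BoseMom M), p.1 ≠ 0 → ∀ v w : Fock M,
    ((v, w) ∈ (densityJ L a r s α p).graph ↔ (R A v, R A w) ∈ (densityJ L a r s α p).graph)
  comm_zeroMode : ∀ (A : Flavor M) (r s α : ℤˣ) (x : Cell M) (v w : Fock M),
    ((v, w) ∈ (zeroMode L a r s α x).graph ↔
      (R A v, R A w + (if (⟨r, s, α, x⟩ : Flavor M) = A then (((r : ℤˣ) : ℤ) : ℂ) else 0) • R A v) ∈
        (zeroMode L a r s α x).graph)
  anticomm : ∀ (A B : Flavor M) (v : Fock M),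
    R A ((R B).symm v) + (R B).symm (R A v) = (if A = B then (2 : ℂ) else 0) • v

/-! ### The regularized field operator -/

/-- The exponent
`r (a/2π) ∑_{𝐩, p_s ≠ 0} (2π/L)² (1/p_s) Ĵ_{r,s,α}(𝐩) e^{i 𝐩·𝐱} e^{-ε|p_s|/2}`
at the position `x_s = y`, `x_{-s} = x`. -/
def vertexExponent (L a : ℝ) {M : ℕ} (r s α : ℤˣ) (y : ℝ) (x : Cell M) (ε : ℝ) :
    Fock M →ₗ.[ℂ] Fock M :=
  ((((r : ℤˣ) : ℤ) : ℂ) * ((a / (2 * Real.pi) : ℝ) : ℂ)) •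
    seriesOp fun p : {p : BoseMom M // p.1 ≠ 0} =>
      ((((2 * Real.pi / L) ^ 2 * (1 / boseK L p.1.1) : ℝ) : ℂ) *
        Complex.exp (Complex.I * ((boseK L p.1.1 * y + boseK L p.1.2 * sitePos a x : ℝ) : ℂ)) *
        ((Real.exp (-ε * |boseK L p.1.1| / 2) : ℝ) : ℂ)) • densityJ L a r s α p.1

/-- The phase `e^{i r π x_s N_{r,s,α}(x_{-s})/L}` at `x_s = y`, `x_{-s} = x`. -/
def zeroModePhase (L a : ℝ) {M : ℕ} (r s α : ℤˣ) (y : ℝ) (x : Cell M) : Fock M →L[ℂ] Fock M :=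
  expOp ((Complex.I * (((((r : ℤˣ) : ℤ) : ℝ) * Real.pi * y / L : ℝ) : ℂ)) •
    zeroMode L a r s α x)

/-- The operator `ψ_{r,s,α}(𝐱; ε)` at `x_s = y`, `x_{-s} = x`. -/
def psiReg (L a : ℝ) {M : ℕ} (r s α : ℤˣ) (y : ℝ) (x : Cell M) (ε : ℝ) : Fock M →L[ℂ] Fock M :=
  ((1 / √(2 * Real.pi * a * ε) : ℝ) : ℂ) •
    (zeroModePhase L a r s α y x *
      (((klein ⟨r, s, α, x⟩ ^ (-((r : ℤˣ) : ℤ))).toContinuousLinearEquiv :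
        Fock M →L[ℂ] Fock M)) *
      zeroModePhase L a r s α y x *
      expOp (vertexExponent L a r s α y x ε))

/-- The integrand `y ↦ ψ_{r,s,α}(𝐱; ε) v e^{-i 𝐤·𝐱}` at `x_s = y`, `x_{-s} = x`. -/
def fourierIntegrand (L a : ℝ) {M : ℕ} (r s α : ℤˣ) (k : FermiMom M) (ε : ℝ) (x : Cell M)
    (v : Fock M) (y : ℝ) : Fock M :=
  Complex.exp (-Complex.I * ((fermiK L k.1 * y + fermiK L k.2 * sitePos a x : ℝ) : ℂ)) •
    psiReg L a r s α y x ε v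

/-- The Fourier transform `(1/2π) ∑_x a ∫_{-L/2}^{L/2} dy ψ_{r,s,α}(𝐱; ε) e^{-i 𝐤·𝐱}`, applied to
the vector `v`. -/
def psiRegFourier (L a : ℝ) {M : ℕ} (r s α : ℤˣ) (k : FermiMom M) (ε : ℝ) (v : Fock M) : Fock M :=
  ((1 / (2 * Real.pi) : ℝ) : ℂ) •
    ∑ x : Cell M, (a : ℂ) • ∫ y in (-L / 2)..(L / 2), fourierIntegrand L a r s α k ε x v y

end

end NodalBoson

namespace NodalBoson

open scoped InnerProductSpace ENNReal

/-! ### One-parameter unitary groups and their generators -/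

section Generators

variable {E : Type*} [NormedAddCommGroup E] [InnerProductSpace ℂ E]

/-! This is the boson-fermion correspondence, carried out for each flavor A = (r, s, α, x)
separately. Summing over the momenta in the direction -s gives Kronecker deltas in the sites. Hence
on finite combinations of basis states the densities are lattice Fourier transforms of one-site
densities `rho A m` (`actsAs_nodalBilinear`), the zero mode at x is `rho A 0`, and the vertex
exponent at x contains the bosons of the flavor of x only. The reflection `modeIdx` of the labels
for r = - makes every flavor look like r = +.

Algebra. On finite vectors all operators are endomorphisms, and the infinite sums are locally finite
because the energy is bounded below. The commutator of two densities commutes with every fermion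
operator, so it is a scalar; evaluation on the vacuum gives [ρ(m), ρ(n)] = m δ_{m+n,0}
(`rho_commutator`). A Klein factor moves all fermions of one flavor by one level, so it commutes
with ρ(m) for m ≠ 0 and changes the charge ρ(0) by one. Recursions of Newton type write a fermion
operator on a charged vacuum through densities, whence the bosons are complete: shifted vacua and
densities span everything (`bosonSpan_eq_top`).

Exponentials. The vertex exponent is creation minus annihilation, `creatInf` minus `annih`. Its
unitary group is built directly: the normal ordered matrix elements `weylForm` define isometries
obeying the Weyl relations, and the derivative of the group at 0 is the exponent. To see that finite
vectors form a core, orbits are approximated by truncated exponential series with bounded graph norm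
(`exists_near_weylFin`, `generatesUnitaryGroup_of_core`). Since a generator determines its group,
`expOp` is this Weyl operator. So √(2πaε) ψ is a product `vertexOp` of unitaries, depending on q =
e^{-πε/L} and θ = 2π r x_s/L.

Matrix elements. Conjugation by the energy carries the whole dependence on θ (`vertexOp_eq`), so a
Fourier mode in θ selects one energy difference. After division by the Weyl normalization √(1-q²)
the remaining matrix elements converge as q → 1 to `bosonForm`. This form equals `fermionForm`, the
form of the sum of all fermion modes: both have the same commutator with each ρ(m), m ≠ 0, and agree
between lowest states, and completeness leaves no room for a difference
(`bosonForm_eq_fermionForm`). Only finitely many basis states have a given energy, so this is norm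
convergence on basis states.

Uniformity. Strong convergence on the whole Fock space needs a bound on the modes independent of q.
The vertex operators V(θ) satisfy an exchange relation between V(θ')† V(θ) and V(θ) V(θ')†
(`vertexOp_exchange`), a regularized form of the anticommutation relations. Integrated against
Fourier exponentials, it becomes a recurrence for the norms of the modes of V v and V† v;
telescoping it and using Bessel's inequality bounds a normalized mode by ‖v‖ (`norm_vertexMode_le`).
Density of the finite vectors then finishes the proof, the prefactor converging because (1-q²)/ε →
2π/L. -/

theorem group_zero {U : ℝ → E ≃ₗᵢ[ℂ] E} (hU : ∀ t u : ℝ, U (t + u) = U t * U u) : U 0 = 1 := by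
  have h := hU 0 0
  rw [add_zero] at h
  exact left_eq_mul.1 h

theorem group_hasDerivAt {U : ℝ → E ≃ₗᵢ[ℂ] E} (hU : ∀ t u : ℝ, U (t + u) = U t * U u) {v w : E}
    (h : HasDerivAt (fun t => U t v) w 0) (t : ℝ) : HasDerivAt (fun t => U t v) (U t w) t := by
  have h1 : HasDerivAt (fun s => U (s - t) v) w t := by
    have := HasDerivAt.comp_sub_const t t (f := fun s => U s v) (f' := w) (by simpa using h)
    simpa using this
  have h2 := ((U t).toContinuousLinearEquiv : E →L[ℂ] E).hasFDerivAt.restrictScalars ℝ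
    |>.comp_hasDerivAt t h1
  refine h2.congr_of_eventuallyEq (Filter.Eventually.of_forall fun s => ?_)
  change U s v = U t (U (s - t) v)
  conv_lhs => rw [show s = t + (s - t) by ring, hU]
  rfl

/-- Inner products along two orbits of a unitary group are constant in time; differentiating at 0
gives the skew-symmetry of the generator. -/
theorem generator_skew {U : ℝ → E ≃ₗᵢ[ℂ] E} (h0 : U 0 = 1) {v w v' w' : E}
    (h : HasDerivAt (fun t => U t v) w 0) (h' : HasDerivAt (fun t => U t v') w' 0) :
    ⟪v, w'⟫_ℂ + ⟪w, v'⟫_ℂ = 0 := by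
  have h1 := h.inner ℂ h'
  have h2 : (fun t => ⟪U t v, U t v'⟫_ℂ) = fun _ => ⟪v, v'⟫_ℂ := by
    ext t
    exact (U t).inner_map_map v v'
  rw [h2] at h1
  have := h1.unique (hasDerivAt_const _ _)
  simpa [h0] using this

/-- The integrated form involves no limit in t. It is therefore a closed condition on (v, w), and it
can be checked weakly, which later upgrades derivatives of matrix elements to derivatives in norm.
-/
theorem group_sub_eq_integral {U : ℝ → E ≃ₗᵢ[ℂ] E} (hU : ∀ t u : ℝ, U (t + u) = U t * U u)
    (hc : ∀ v : E, Continuous fun t : ℝ => U t v) [CompleteSpace E] {v w : E} :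
    HasDerivAt (fun t => U t v) w 0 ↔ ∀ t : ℝ, U t v - v = ∫ s in (0 : ℝ)..t, U s w := by
  have h0 := group_zero hU
  constructor
  · intro h t
    have := intervalIntegral.integral_eq_sub_of_hasDerivAt
      (fun s _ => group_hasDerivAt hU h s) ((hc w).intervalIntegrable 0 t)
    rw [this, h0]
    rfl
  · intro h
    have h1 : HasDerivAt (fun t => ∫ s in (0 : ℝ)..t, U s w) (U 0 w) 0 :=
      intervalIntegral.integral_hasDerivAt_right ((hc w).intervalIntegrable 0 0)
        ((hc w).stronglyMeasurableAtFilter _ _) (hc w).continuousAt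
    rw [h0] at h1
    have h2 := h1.add_const v
    refine h2.congr_of_eventuallyEq (Filter.Eventually.of_forall fun s => ?_)
    change U s v = (∫ s in (0 : ℝ)..s, U s w) + v
    rw [← h s, sub_add_cancel]

theorem isClosed_generator {U : ℝ → E ≃ₗᵢ[ℂ] E} (hU : ∀ t u : ℝ, U (t + u) = U t * U u)
    (hc : ∀ v : E, Continuous fun t : ℝ => U t v) [CompleteSpace E] :
    IsClosed {x : E × E | HasDerivAt (fun t => U t x.1) x.2 0} := by
  simp_rw [group_sub_eq_integral hU hc, Set.ofPred_forall]
  refine isClosed_iInter fun t => isClosed_eq ?_ ?_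
  · exact ((U t).continuous.comp continuous_fst).sub continuous_fst
  · have hlip : LipschitzWith (Real.nnabs t) fun w : E => ∫ s in (0 : ℝ)..t, U s w := by
      refine LipschitzWith.of_dist_le_mul fun w w' => ?_
      rw [dist_eq_norm, ← intervalIntegral.integral_sub ((hc w).intervalIntegrable _ _)
        ((hc w').intervalIntegrable _ _)]
      have := intervalIntegral.norm_integral_le_of_norm_le_const (a := (0 : ℝ)) (b := t)
        (f := fun s => U s w - U s w') (C := dist w w') fun s _ => by
          rw [← map_sub, LinearIsometryEquiv.norm_map, dist_eq_norm]
      simpa [mul_comm] using this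
    exact hlip.continuous.comp continuous_snd

/-- A strongly continuous unitary group whose derivative at `0` is `T` on the domain of `T` is
generated by the closure of `T`, if `T - 1` has dense range. -/
theorem generatesUnitaryGroup_of_dense [CompleteSpace E] {T : E →ₗ.[ℂ] E} {U : ℝ → E ≃ₗᵢ[ℂ] E}
    (hU : ∀ t u : ℝ, U (t + u) = U t * U u) (hc : ∀ v : E, Continuous fun t : ℝ => U t v)
    (hd : ∀ v : T.domain, HasDerivAt (fun t : ℝ => U t v) (T v) 0)
    (hr : ∀ w : E, (∀ v : T.domain, ⟪w, T v - v⟫_ℂ = 0) → w = 0) :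
    GeneratesUnitaryGroup T U := by
  have h0 := group_zero hU
  have hsub : ∀ x ∈ T.graph.topologicalClosure, HasDerivAt (fun t => U t x.1) x.2 0 := by
    intro x hx
    refine closure_minimal (fun y hy => ?_) (isClosed_generator hU hc) hx
    obtain ⟨v, hv, hv'⟩ := (LinearPMap.mem_graph_iff T).1 hy
    change HasDerivAt _ _ _
    rw [← hv, ← hv']
    exact hd v
  refine ⟨hU, hc, fun v w => ⟨fun h => ?_, fun h => hsub _ h⟩⟩
  -- Range criterion: T is skew, so ‖(T - 1)z‖² = ‖Tz‖² + ‖z‖². Preimages of a convergent sequence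
  -- in the range of T - 1 thus converge, and the closure of T - 1 attains w - v at some v'.
  let R : T.domain →ₗ[ℂ] E := T.toFun - T.domain.subtype
  have hdense : (LinearMap.range R).topologicalClosure = ⊤ := by
    rw [Submodule.topologicalClosure_eq_top_iff, Submodule.eq_bot_iff]
    intro x hx
    refine hr x fun v => ?_
    exact (Submodule.mem_orthogonal' _ _).1 hx _ ⟨v, rfl⟩
  have hwv : w - v ∈ closure (LinearMap.range R : Set E) := by
    have : w - v ∈ (LinearMap.range R).topologicalClosure := by rw [hdense]; trivial
    exact this
  obtain ⟨x, hx, hlim⟩ := mem_closure_iff_seq_limit.1 hwv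
  choose y hy using hx
  have hbound : ∀ z : T.domain, ‖(z : E)‖ ≤ ‖R z‖ := by
    intro z
    have hs := generator_skew h0 (hd z) (hd z)
    have hre : RCLike.re ⟪T z, (z : E)⟫_ℂ = 0 := by
      have h1 := congrArg RCLike.re hs
      rw [map_add, inner_re_symm] at h1
      simp only [map_zero] at h1
      linarith
    have h1 : ‖R z‖ ^ 2 = ‖T z‖ ^ 2 + ‖(z : E)‖ ^ 2 := by
      change ‖T z - (z : E)‖ ^ 2 = _
      rw [@norm_sub_sq ℂ, hre]
      ring
    refine le_of_sq_le_sq ?_ (norm_nonneg _)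
    nlinarith [sq_nonneg ‖T z‖]
  have hcau : CauchySeq fun n => ((y n : T.domain) : E) := by
    have h1 := hlim.cauchySeq
    rw [Metric.cauchySeq_iff] at h1 ⊢
    intro ε hε
    obtain ⟨N, hN⟩ := h1 ε hε
    refine ⟨N, fun m hm n hn => lt_of_le_of_lt ?_ (hN m hm n hn)⟩
    rw [dist_eq_norm, dist_eq_norm, ← hy m, ← hy n, ← map_sub]
    exact hbound (y m - y n)
  obtain ⟨v', hv'⟩ := cauchySeq_tendsto_of_complete hcau
  have hT : Filter.Tendsto (fun n => T (y n)) Filter.atTop (nhds (w - v + v')) := by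
    refine (hlim.add hv').congr fun n => ?_
    rw [← hy n]
    change T (y n) - (y n : E) + y n = T (y n)
    simp
  have hmem : (v', w - v + v') ∈ T.graph.topologicalClosure :=
    mem_closure_of_tendsto (hv'.prodMk_nhds hT) (Filter.Eventually.of_forall fun n =>
      LinearPMap.mem_graph T (y n))
  -- The vector v - v' is an eigenvector of the skew generator with the real eigenvalue 1, so it is
  -- zero.
  have hg := h.sub (hsub _ hmem)
  have hg' : HasDerivAt (fun t => U t (v - v')) (v - v') 0 := by
    convert hg using 1
    · ext t
      simp
    · simp only
      abel
  have hz := generator_skew h0 hg' hg'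
  rw [← two_mul, mul_eq_zero, inner_self_eq_zero] at hz
  have hz' : v = v' := by
    rcases hz with h | h
    · norm_num at h
    · exact sub_eq_zero.1 h
  rw [← hz'] at hmem
  simpa using hmem

/-- For v in the domain, ⟨U_s v, V_s v⟩ has derivative zero by skew-symmetry, so it keeps the value
‖v‖². As both vectors have norm ‖v‖, they coincide. -/
theorem generatesUnitaryGroup_unique [CompleteSpace E] {T : E →ₗ.[ℂ] E}
    {U V : ℝ → E ≃ₗᵢ[ℂ] E} (hT : Dense (T.domain : Set E)) (hU : GeneratesUnitaryGroup T U)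
    (hV : GeneratesUnitaryGroup T V) (t : ℝ) (v : E) : U t v = V t v := by
  have hU0 := group_zero hU.1
  have hV0 := group_zero hV.1
  have key : ∀ v : T.domain, U t v = V t v := by
    intro v
    have hv : ((v : E), T v) ∈ T.graph.topologicalClosure :=
      Submodule.le_topologicalClosure _ (LinearPMap.mem_graph T v)
    have hUd := group_hasDerivAt hU.1 ((hU.2.2 _ _).2 hv)
    have hVd := group_hasDerivAt hV.1 ((hV.2.2 _ _).2 hv)
    have hder : ∀ s, HasDerivAt (fun s => ⟪U s v, V s v⟫_ℂ) 0 s := by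
      intro s
      have h1 := (hUd s).inner ℂ (hVd s)
      have hu : HasDerivAt (fun r => U r (U s v)) (U s (T v)) 0 := by
        have := ((U s).toContinuousLinearEquiv : E →L[ℂ] E).hasFDerivAt.restrictScalars ℝ
          |>.comp_hasDerivAt 0 ((hU.2.2 _ _).2 hv)
        refine this.congr_of_eventuallyEq (Filter.Eventually.of_forall fun r => ?_)
        change (U r * U s) v = (U s * U r) v
        rw [← hU.1, ← hU.1, add_comm]
      have hw : HasDerivAt (fun r => V r (V s v)) (V s (T v)) 0 := by
        have := ((V s).toContinuousLinearEquiv : E →L[ℂ] E).hasFDerivAt.restrictScalars ℝ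
          |>.comp_hasDerivAt 0 ((hV.2.2 _ _).2 hv)
        refine this.congr_of_eventuallyEq (Filter.Eventually.of_forall fun r => ?_)
        change (V r * V s) v = (V s * V r) v
        rw [← hV.1, ← hV.1, add_comm]
      -- Both groups have the closure of T as generator, so V_s v is differentiable along U as well,
      -- and the skew-symmetry of a single generator applies.
      have hw' := (hU.2.2 _ _).2 ((hV.2.2 _ _).1 hw)
      rw [generator_skew hU0 hu hw'] at h1
      exact h1
    have hconst : ⟪U t v, V t v⟫_ℂ = ⟪(v : E), (v : E)⟫_ℂ := by
      have := is_const_of_deriv_eq_zero (fun s => (hder s).differentiableAt)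
        (fun s => (hder s).deriv) t 0
      simpa [hU0, hV0] using this
    have h1 : ‖U t v - V t v‖ ^ 2 = 0 := by
      rw [@norm_sub_sq ℂ, hconst, inner_self_eq_norm_sq]
      simp
      ring
    rwa [sq_eq_zero_iff, norm_eq_zero, sub_eq_zero] at h1
  have := Continuous.ext_on hT (U t).continuous (V t).continuous (fun x hx => key ⟨x, hx⟩)
  exact congrFun this v

/-- `expOp` chooses some generated group; by uniqueness any explicit group with the right generator
computes it. The zero mode phases and the exponential of the vertex exponent are evaluated in this
way. -/
theorem expOp_eq [CompleteSpace E] {T : E →ₗ.[ℂ] E} {U : ℝ → E ≃ₗᵢ[ℂ] E}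
    (hT : Dense (T.domain : Set E)) (hU : GeneratesUnitaryGroup T U) :
    expOp T = ((U 1).toContinuousLinearEquiv : E →L[ℂ] E) := by
  have h : ∃ U : ℝ → E ≃ₗᵢ[ℂ] E, GeneratesUnitaryGroup T U := ⟨U, hU⟩
  rw [expOp, dif_pos h]
  ext v
  exact generatesUnitaryGroup_unique hT h.choose_spec hU 1 v

end Generators

/-! ### Operators on finite linear combinations of basis states -/

section FiniteVectors

variable {M : ℕ}

theorem state_mem (S : Finset (Mode M)) : state S ∈ finiteStates M :=
  Submodule.subset_span ⟨S, rfl⟩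

/-- Finite linear combinations of basis states. -/
def FinVec (M : ℕ) : Type := ↥(finiteStates M)

noncomputable instance : NormedAddCommGroup (FinVec M) :=
  inferInstanceAs (NormedAddCommGroup ↥(finiteStates M))

noncomputable instance : InnerProductSpace ℂ (FinVec M) :=
  inferInstanceAs (InnerProductSpace ℂ ↥(finiteStates M))

noncomputable instance (priority := high) : Inner ℂ (FinVec M) := InnerProductSpace.toInner

/-- A finite linear combination of basis states as a vector of the Fock space. -/
@[coe] def FinVec.toFock (v : FinVec M) : Fock M := Subtype.val v

instance : CoeOut (FinVec M) (Fock M) := ⟨FinVec.toFock⟩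

theorem FinVec.mem (v : FinVec M) : (v : Fock M) ∈ finiteStates M := Subtype.property v

/-- A vector of `finiteStates` as an element of `FinVec`. -/
def FinVec.mk (v : Fock M) (h : v ∈ finiteStates M) : FinVec M := ⟨v, h⟩

theorem FinVec.ext {u v : FinVec M} (h : (u : Fock M) = v) : u = v := Subtype.ext h

theorem FinVec.coe_add (u v : FinVec M) : ((u + v : FinVec M) : Fock M) = u + v := rfl

theorem FinVec.coe_zero : ((0 : FinVec M) : Fock M) = 0 := rfl

theorem FinVec.coe_smul (c : ℂ) (u : FinVec M) : ((c • u : FinVec M) : Fock M) = c • (u : Fock M) :=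
  rfl

theorem FinVec.inner_coe (u v : FinVec M) : ⟪(u : Fock M), (v : Fock M)⟫_ℂ = ⟪u, v⟫_ℂ := rfl

theorem FinVec.norm_coe (u : FinVec M) : ‖(u : Fock M)‖ = ‖u‖ := rfl

/-- The embedding of `FinVec` into the Fock space. -/
noncomputable def FinVec.incl (M : ℕ) : FinVec M →ₗ[ℂ] Fock M where
  toFun v := v
  map_add' := FinVec.coe_add
  map_smul' := FinVec.coe_smul

theorem FinVec.coe_sum {ι : Type*} (s : Finset ι) (f : ι → FinVec M) :
    ((∑ i ∈ s, f i : FinVec M) : Fock M) = ∑ i ∈ s, (f i : Fock M) :=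
  map_sum (FinVec.incl M) f s

/-- The basis state as an element of `FinVec`. -/
noncomputable def fs (S : Finset (Mode M)) : FinVec M := FinVec.mk (state S) (state_mem S)

@[simp] theorem coe_fs (S : Finset (Mode M)) : ((fs S : FinVec M) : Fock M) = state S := rfl

theorem FinVec.induction {p : FinVec M → Prop} (h0 : p 0) (hadd : ∀ u v, p u → p v → p (u + v))
    (hsmul : ∀ (c : ℂ) u, p u → p (c • u)) (hs : ∀ S, p (fs S)) (v : FinVec M) : p v := by
  have hv := v.mem
  change p (FinVec.mk v hv)
  refine Submodule.span_induction (p := fun v hv => p (FinVec.mk v hv)) ?_ h0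
    (fun x y hx hy => hadd (FinVec.mk x hx) (FinVec.mk y hy))
    (fun c x hx => hsmul c (FinVec.mk x hx)) hv
  rintro _ ⟨S, rfl⟩
  exact hs S

theorem FinVec.submodule_eq_top {W : Submodule ℂ (FinVec M)} (h : ∀ S, fs S ∈ W) : W = ⊤ :=
  Submodule.eq_top_iff'.2 fun v =>
    FinVec.induction (p := fun v => v ∈ W) W.zero_mem (fun _ _ => W.add_mem)
      (fun c _ => W.smul_mem c) h v

theorem FinVec.linearMap_ext {F : Type*} [AddCommGroup F] [Module ℂ F] {X Y : FinVec M →ₗ[ℂ] F}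
    (h : ∀ S, X (fs S) = Y (fs S)) : X = Y := by
  ext v
  refine FinVec.induction (p := fun v => X v = Y v) (by simp) ?_ ?_ h v
  · intro u v hu hv
    rw [map_add, map_add, hu, hv]
  · intro c u hu
    rw [map_smul, map_smul, hu]

theorem state_apply (S T : Finset (Mode M)) : (state S : Fock M) T = if T = S then 1 else 0 := by
  by_cases h : T = S
  · subst h
    simp [state]
  · simp [state, h]

theorem inner_state_left (S : Finset (Mode M)) (v : Fock M) : ⟪state S, v⟫_ℂ = v S := by
  rw [state, lp.inner_single_left]
  simp

theorem inner_state_state (S T : Finset (Mode M)) :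
    ⟪(state S : Fock M), state T⟫_ℂ = if S = T then 1 else 0 := by
  rw [inner_state_left, state_apply]

theorem fock_ext {v w : Fock M} (h : ∀ S, ⟪state S, v⟫_ℂ = ⟪state S, w⟫_ℂ) : v = w := by
  ext S
  rw [← inner_state_left, ← inner_state_left, h]

theorem dense_finiteStates : Dense (finiteStates M : Set (Fock M)) := by
  have h : (finiteStates M).topologicalClosure = ⊤ := by
    rw [Submodule.topologicalClosure_eq_top_iff, Submodule.eq_bot_iff]
    intro x hx
    refine fock_ext fun S => ?_
    rw [inner_zero_right]
    exact (Submodule.mem_orthogonal _ _).1 hx _ (state_mem S)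
  exact (Submodule.dense_iff_topologicalClosure_eq_top).2 h

theorem fock_ext_fin {v w : Fock M} (h : ∀ u : FinVec M, ⟪(u : Fock M), v⟫_ℂ = ⟪(u : Fock M), w⟫_ℂ) :
    v = w :=
  fock_ext fun S => h (fs S)

theorem FinVec.ext_inner {v w : FinVec M} (h : ∀ u : FinVec M, ⟪u, v⟫_ℂ = ⟪u, w⟫_ℂ) : v = w :=
  ext_inner_left ℂ h

/-- `Y` is a formal adjoint of `X` on finite linear combinations of basis states. -/
def IsAdj (X Y : Module.End ℂ (FinVec M)) : Prop := ∀ u v : FinVec M, ⟪X u, v⟫_ℂ = ⟪u, Y v⟫_ℂ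

theorem IsAdj.symm {X Y : Module.End ℂ (FinVec M)} (h : IsAdj X Y) : IsAdj Y X := fun u v => by
  rw [← inner_conj_symm, ← h, inner_conj_symm]

theorem IsAdj.mul {X Y X' Y' : Module.End ℂ (FinVec M)} (h : IsAdj X Y) (h' : IsAdj X' Y') :
    IsAdj (X * X') (Y' * Y) := fun u v => by
  rw [Module.End.mul_apply, Module.End.mul_apply, h, h']

theorem IsAdj.add {X Y X' Y' : Module.End ℂ (FinVec M)} (h : IsAdj X Y) (h' : IsAdj X' Y') :
    IsAdj (X + X') (Y + Y') := fun u v => by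
  rw [LinearMap.add_apply, LinearMap.add_apply, inner_add_left, inner_add_right, h, h']

theorem IsAdj.neg {X Y : Module.End ℂ (FinVec M)} (h : IsAdj X Y) : IsAdj (-X) (-Y) := fun u v => by
  rw [LinearMap.neg_apply, LinearMap.neg_apply, inner_neg_left, inner_neg_right, h]

theorem IsAdj.sub {X Y X' Y' : Module.End ℂ (FinVec M)} (h : IsAdj X Y) (h' : IsAdj X' Y') :
    IsAdj (X - X') (Y - Y') := by
  rw [sub_eq_add_neg, sub_eq_add_neg]
  exact h.add h'.neg

theorem IsAdj.smul {X Y : Module.End ℂ (FinVec M)} (c : ℂ) (h : IsAdj X Y) :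
    IsAdj (c • X) (starRingEnd ℂ c • Y) := fun u v => by
  rw [LinearMap.smul_apply, LinearMap.smul_apply, inner_smul_left, inner_smul_right, h]

theorem IsAdj.zero : IsAdj (0 : Module.End ℂ (FinVec M)) 0 := fun u v => by simp

theorem IsAdj.one : IsAdj (1 : Module.End ℂ (FinVec M)) 1 := fun _ _ => rfl

/-- Uniqueness of formal adjoints lets an operator identity be replaced by its adjoint; half of the
relations below are obtained so. -/
theorem IsAdj.eq {X Y Y' : Module.End ℂ (FinVec M)} (h : IsAdj X Y) (h' : IsAdj X Y') : Y = Y' := by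
  refine LinearMap.ext fun v => FinVec.ext_inner fun u => ?_
  rw [← h, ← h']

theorem IsAdj.sum {ι : Type*} (s : Finset ι) {X Y : ι → Module.End ℂ (FinVec M)}
    (h : ∀ i ∈ s, IsAdj (X i) (Y i)) : IsAdj (∑ i ∈ s, X i) (∑ i ∈ s, Y i) := fun u v => by
  rw [LinearMap.sum_apply, LinearMap.sum_apply, sum_inner, inner_sum]
  exact Finset.sum_congr rfl fun i hi => h i hi u v

end FiniteVectors

/-! ### Canonical anticommutation relations -/

section CAR

variable {M : ℕ}

/-- The sign `(-1)^#{j ∈ S : j < i}`. -/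
noncomputable def sgn (i : Mode M) (S : Finset (Mode M)) : ℂ := ∏ j ∈ S, if j < i then -1 else 1

theorem sgn_eq (i : Mode M) (S : Finset (Mode M)) :
    sgn i S = (-1) ^ (S.filter fun j => j < i).card := by
  rw [sgn, Finset.prod_ite, Finset.prod_const, Finset.prod_const_one, mul_one]

theorem sgn_mul_self (i : Mode M) (S : Finset (Mode M)) : sgn i S * sgn i S = 1 := by
  rw [sgn_eq, ← pow_add, ← two_mul, pow_mul]
  simp

theorem conj_sgn (i : Mode M) (S : Finset (Mode M)) : starRingEnd ℂ (sgn i S) = sgn i S := by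
  rw [sgn_eq]
  simp

theorem sgn_insert (i j : Mode M) {S : Finset (Mode M)} (h : j ∉ S) :
    sgn i (insert j S) = (if j < i then -1 else 1) * sgn i S := Finset.prod_insert h

theorem sgn_erase (i j : Mode M) {S : Finset (Mode M)} (h : j ∈ S) :
    sgn i (S.erase j) = (if j < i then -1 else 1) * sgn i S := by
  have := sgn_insert i j (Finset.notMem_erase j S)
  rw [Finset.insert_erase h] at this
  rw [this, ← mul_assoc]
  split_ifs <;> simp

theorem removeExc_state (i : Mode M) (S : Finset (Mode M)) :
    removeExc i (state S) = if i ∈ S then sgn i S • state (S.erase i) else 0 := by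
  ext T
  change (if i ∈ T then 0 else (-1) ^ (T.filter fun j => j < i).card) *
    (state S : Fock M) (insert i T) = _
  rw [state_apply]
  by_cases hT : i ∈ T
  · rw [if_pos hT, zero_mul]
    split_ifs with h
    · have : T ≠ S.erase i := fun h' => by simp [h'] at hT
      simp [state_apply, this]
    · rfl
  · rw [if_neg hT, ← sgn_eq]
    by_cases h : insert i T = S
    · subst h
      simp [state_apply, sgn_insert _ _ hT, hT]
    · rw [if_neg h, mul_zero]
      split_ifs with hS
      · have : T ≠ S.erase i := fun h' => h (by rw [h', Finset.insert_erase hS])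
        simp [state_apply, this]
      · rfl

theorem adjoint_removeExc_state (i : Mode M) (S : Finset (Mode M)) :
    ContinuousLinearMap.adjoint (removeExc i) (state S) =
      if i ∈ S then 0 else sgn i S • state (insert i S) := by
  refine fock_ext fun T => ?_
  rw [ContinuousLinearMap.adjoint_inner_right, removeExc_state]
  by_cases hT : i ∈ T
  · rw [if_pos hT, inner_smul_left, inner_state_state, conj_sgn]
    by_cases hS : i ∈ S
    · have : T.erase i ≠ S := fun h' => by simp [← h'] at hS
      rw [if_pos hS, if_neg this]
      simp
    · rw [if_neg hS, inner_smul_right, inner_state_state]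
      by_cases h : T = insert i S
      · subst h
        rw [sgn_insert _ _ hS, Finset.erase_insert hS]
        simp
      · have : T.erase i ≠ S := fun h' => h (by rw [← h', Finset.insert_erase hT])
        rw [if_neg h, if_neg this]
        simp
  · rw [if_neg hT, inner_zero_left]
    split_ifs with hS
    · simp
    · have : T ≠ insert i S := fun h' => by simp [h'] at hT
      rw [inner_smul_right, inner_state_state, if_neg this, mul_zero]

theorem map_finiteStates {X : Fock M →L[ℂ] Fock M} (h : ∀ S, X (state S) ∈ finiteStates M) :
    ∀ v ∈ finiteStates M, (X : Fock M →ₗ[ℂ] Fock M) v ∈ finiteStates M := by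
  intro v hv
  have : finiteStates M ≤ (finiteStates M).comap (X : Fock M →ₗ[ℂ] Fock M) := by
    refine Submodule.span_le.2 ?_
    rintro _ ⟨S, rfl⟩
    exact h S
  exact this hv

theorem removeExc_mem (i : Mode M) (S : Finset (Mode M)) :
    removeExc i (state S) ∈ finiteStates M := by
  rw [removeExc_state]
  split_ifs
  · exact Submodule.smul_mem _ _ (state_mem _)
  · exact Submodule.zero_mem _

theorem adjoint_removeExc_mem (i : Mode M) (S : Finset (Mode M)) :
    ContinuousLinearMap.adjoint (removeExc i) (state S) ∈ finiteStates M := by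
  rw [adjoint_removeExc_state]
  split_ifs
  · exact Submodule.zero_mem _
  · exact Submodule.smul_mem _ _ (state_mem _)

/-- The restriction of a bounded operator to finite linear combinations of basis states. -/
noncomputable def restrictFin (X : Fock M →L[ℂ] Fock M)
    (h : ∀ S, X (state S) ∈ finiteStates M) : Module.End ℂ (FinVec M) where
  toFun v := FinVec.mk (X v) (map_finiteStates h _ v.mem)
  map_add' u v := FinVec.ext (map_add X (u : Fock M) v)
  map_smul' c u := FinVec.ext (map_smul X c (u : Fock M))

/-- Removal of the excitation `i`. -/
noncomputable def exc (i : Mode M) : Module.End ℂ (FinVec M) :=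
  restrictFin (removeExc i) (removeExc_mem i)

/-- Creation of the excitation `i`. -/
noncomputable def excDag (i : Mode M) : Module.End ℂ (FinVec M) :=
  restrictFin (ContinuousLinearMap.adjoint (removeExc i)) (adjoint_removeExc_mem i)

theorem coe_exc (i : Mode M) (v : FinVec M) : (exc i v : Fock M) = removeExc i v := rfl

theorem coe_excDag (i : Mode M) (v : FinVec M) :
    (excDag i v : Fock M) = ContinuousLinearMap.adjoint (removeExc i) v := rfl

theorem exc_fs (i : Mode M) (S : Finset (Mode M)) :
    exc i (fs S) = if i ∈ S then sgn i S • fs (S.erase i) else 0 := by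
  refine FinVec.ext ?_
  rw [coe_exc, coe_fs, removeExc_state]
  split_ifs <;> rfl

theorem excDag_fs (i : Mode M) (S : Finset (Mode M)) :
    excDag i (fs S) = if i ∈ S then 0 else sgn i S • fs (insert i S) := by
  refine FinVec.ext ?_
  rw [coe_excDag, coe_fs, adjoint_removeExc_state]
  split_ifs <;> rfl

theorem isAdj_exc (i : Mode M) : IsAdj (exc i) (excDag i) := fun u v => by
  change ⟪removeExc i (u : Fock M), (v : Fock M)⟫_ℂ = _
  rw [← ContinuousLinearMap.adjoint_inner_right]
  rfl

/-- For i ≠ j, deleting the smaller mode first flips the sign attached to the larger one, while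
deleting the larger mode first changes nothing. The two orders therefore differ by a sign. -/
theorem exc_mul_exc (i j : Mode M) : exc i * exc j + exc j * exc i = 0 := by
  refine FinVec.linearMap_ext fun S => ?_
  simp only [LinearMap.add_apply, Module.End.mul_apply, exc_fs, LinearMap.zero_apply]
  rcases eq_or_ne i j with rfl | hij
  · by_cases hi : i ∈ S <;> simp [hi, exc_fs]
  · by_cases hi : i ∈ S <;> by_cases hj : j ∈ S <;>
      simp [hi, hj, exc_fs, hij, hij.symm, sgn_erase, smul_smul, Finset.erase_right_comm (a := i)]
    rcases lt_or_gt_of_ne hij with h | h <;> simp [h, h.not_gt, mul_comm]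

theorem excDag_mul_excDag (i j : Mode M) : excDag i * excDag j + excDag j * excDag i = 0 :=
  (((isAdj_exc j).mul (isAdj_exc i)).add ((isAdj_exc i).mul (isAdj_exc j))).eq
    (by rw [exc_mul_exc]; exact IsAdj.zero)

theorem exc_mul_excDag_of_ne {i j : Mode M} (hij : i ≠ j) :
    exc i * excDag j + excDag j * exc i = 0 := by
  refine FinVec.linearMap_ext fun S => ?_
  simp only [LinearMap.add_apply, Module.End.mul_apply, exc_fs, excDag_fs, LinearMap.zero_apply]
  by_cases hi : i ∈ S <;> by_cases hj : j ∈ S <;>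
    simp [hi, hj, exc_fs, excDag_fs, hij, hij.symm, sgn_erase, sgn_insert, smul_smul,
      Finset.erase_insert_of_ne hij.symm]
  rcases lt_or_gt_of_ne hij with h | h <;> simp [h, h.not_gt, mul_comm]

theorem exc_mul_excDag_self (i : Mode M) : exc i * excDag i + excDag i * exc i = 1 := by
  refine FinVec.linearMap_ext fun S => ?_
  simp only [LinearMap.add_apply, Module.End.mul_apply, exc_fs, excDag_fs]
  by_cases hi : i ∈ S <;>
    simp [hi, exc_fs, excDag_fs, sgn_erase, sgn_insert, smul_smul, sgn_mul_self]

end CAR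

/-! ### Fermion modes of one flavor and the action of the Klein factors on them -/

section Modes

variable {M : ℕ}

theorem Mode.lt_iff (i j : Mode M) :
    i < j ↔ i.flavor < j.flavor ∨ i.flavor = j.flavor ∧ i.n < j.n := by
  change toLex (i.flavor, i.n) < toLex (j.flavor, j.n) ↔ _
  exact Prod.Lex.lt_iff

/-! ### Fermion operators of one flavor -/

/-- The involution of mode labels that makes all flavors behave as for `r = +`. -/
def modeIdx (A : Flavor M) (n : ℤ) : ℤ := if A.r = 1 then n else -n - 1

theorem modeIdx_modeIdx (A : Flavor M) (n : ℤ) : modeIdx A (modeIdx A n) = n := by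
  unfold modeIdx
  split_ifs <;> ring

theorem modeIdx_inj (A : Flavor M) {n m : ℤ} : modeIdx A n = modeIdx A m ↔ n = m :=
  (Function.LeftInverse.injective (modeIdx_modeIdx A)).eq_iff

/-- The fermion operator of flavor `A`, with the label `n` counted in the direction of `r`. -/
noncomputable def dn (A : Flavor M) (n : ℤ) : Module.End ℂ (FinVec M) :=
  if 0 ≤ n then exc ⟨A, modeIdx A n⟩ else excDag ⟨A, modeIdx A n⟩

/-- The adjoint of `dn A n`. -/
noncomputable def dd (A : Flavor M) (n : ℤ) : Module.End ℂ (FinVec M) :=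
  if 0 ≤ n then excDag ⟨A, modeIdx A n⟩ else exc ⟨A, modeIdx A n⟩

theorem isAdj_dn (A : Flavor M) (n : ℤ) : IsAdj (dn A n) (dd A n) := by
  unfold dn dd
  split_ifs
  · exact isAdj_exc _
  · exact (isAdj_exc _).symm

theorem sign_pos_iff (A : Flavor M) (n : ℤ) :
    0 < ((A.r : ℤˣ) : ℤ) * (2 * n + 1) ↔ 0 ≤ modeIdx A n := by
  unfold modeIdx
  rcases Int.units_eq_one_or A.r with h | h
  · simp only [h]
    simp
  · have h1 : (-1 : ℤˣ) ≠ 1 := by decide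
    simp only [h, if_neg h1]
    push_cast
    omega

theorem coe_dn_modeIdx (A : Flavor M) (n : ℤ) (v : FinVec M) :
    (dn A (modeIdx A n) v : Fock M) = fermionC A n v := by
  unfold dn fermionC
  rw [modeIdx_modeIdx]
  simp only [sign_pos_iff]
  split_ifs <;> rfl

theorem coe_dd_modeIdx (A : Flavor M) (n : ℤ) (v : FinVec M) :
    (dd A (modeIdx A n) v : Fock M) = ContinuousLinearMap.adjoint (fermionC A n) v := by
  unfold dd fermionC
  rw [modeIdx_modeIdx]
  simp only [sign_pos_iff]
  split_ifs
  · rfl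
  · rw [ContinuousLinearMap.adjoint_adjoint]
    rfl

theorem dn_mul_dn (A B : Flavor M) (n m : ℤ) : dn A n * dn B m + dn B m * dn A n = 0 := by
  unfold dn
  split_ifs with h1 h2 h2
  · exact exc_mul_exc _ _
  -- The labels lie on opposite sides of zero, so the two excitations are distinct and no
  -- contraction arises.
  · refine exc_mul_excDag_of_ne fun h => ?_
    simp only [Mode.mk.injEq] at h
    obtain ⟨rfl, h⟩ := h
    rw [modeIdx_inj] at h
    omega
  · rw [add_comm]
    refine exc_mul_excDag_of_ne fun h => ?_
    simp only [Mode.mk.injEq] at h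
    obtain ⟨rfl, h⟩ := h
    rw [modeIdx_inj] at h
    omega
  · exact excDag_mul_excDag _ _

theorem dd_mul_dd (A B : Flavor M) (n m : ℤ) : dd A n * dd B m + dd B m * dd A n = 0 :=
  (((isAdj_dn B m).mul (isAdj_dn A n)).add ((isAdj_dn A n).mul (isAdj_dn B m))).eq
    (by rw [dn_mul_dn]; exact IsAdj.zero)

theorem dn_mul_dd_self (A : Flavor M) (n : ℤ) : dn A n * dd A n + dd A n * dn A n = 1 := by
  unfold dn dd
  split_ifs
  · exact exc_mul_excDag_self _
  · rw [add_comm]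
    exact exc_mul_excDag_self _

theorem dn_mul_dd_of_ne {A B : Flavor M} {n m : ℤ} (h : ¬(A = B ∧ n = m)) :
    dn A n * dd B m + dd B m * dn A n = 0 := by
  have hne : (⟨A, modeIdx A n⟩ : Mode M) ≠ ⟨B, modeIdx B m⟩ := fun h' => by
    simp only [Mode.mk.injEq] at h'
    obtain ⟨rfl, h'⟩ := h'
    exact h ⟨rfl, (modeIdx_inj _).1 h'⟩
  unfold dn dd
  split_ifs with h1 h2 h2
  · exact exc_mul_excDag_of_ne hne
  · exact exc_mul_exc _ _
  · exact excDag_mul_excDag _ _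
  · rw [add_comm]
    exact exc_mul_excDag_of_ne hne.symm

theorem dn_mul_dn_eq (A B : Flavor M) (n m : ℤ) : dn A n * dn B m = -(dn B m * dn A n) :=
  eq_neg_of_add_eq_zero_left (dn_mul_dn A B n m)

theorem dd_mul_dd_eq (A B : Flavor M) (n m : ℤ) : dd A n * dd B m = -(dd B m * dd A n) :=
  eq_neg_of_add_eq_zero_left (dd_mul_dd A B n m)

theorem dn_mul_dd_eq {A B : Flavor M} {n m : ℤ} (h : ¬(A = B ∧ n = m)) :
    dn A n * dd B m = -(dd B m * dn A n) := eq_neg_of_add_eq_zero_left (dn_mul_dd_of_ne h)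

/-! ### Klein factors on basis states -/

/-- The sign by which `klein A` acts on the basis state `S`. -/
noncomputable def kleinSign (A : Flavor M) (S : Finset (Mode M)) : ℂ :=
  ∏ j ∈ S, if j.flavor < A ∨ j.flavor = A ∧ 0 ≤ j.n then -1 else 1

theorem kleinSign_mul_self (A : Flavor M) (S : Finset (Mode M)) :
    kleinSign A S * kleinSign A S = 1 := by
  rw [kleinSign, ← Finset.prod_mul_distrib]
  refine Finset.prod_eq_one fun j _ => ?_
  split_ifs <;> simp

theorem kleinSign_eq (A : Flavor M) (S : Finset (Mode M)) :
    ((((-1) ^ ((S.filter fun j => j.flavor < A).card +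
      (S.filter fun j => j.flavor = A ∧ 0 ≤ j.n).card) : ℤˣ) : ℤ) : ℂ) = kleinSign A S := by
  have hd : Disjoint (S.filter fun j => j.flavor < A)
      (S.filter fun j => j.flavor = A ∧ 0 ≤ j.n) := by
    rw [Finset.disjoint_filter]
    rintro j _ h1 ⟨h2, _⟩
    exact h1.ne h2
  rw [kleinSign, Finset.prod_ite, Finset.prod_const, Finset.prod_const_one, mul_one,
    Finset.filter_or, Finset.card_union_of_disjoint hd]
  push_cast
  rfl

theorem klein_state (A : Flavor M) (S : Finset (Mode M)) :
    klein A (state S) = kleinSign A S • state (shiftState A S) := by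
  ext T
  have h : (klein A (state S) : Fock M) T =
      kleinSign A ((shiftState A).symm T) * (state S : Fock M) ((shiftState A).symm T) := by
    rw [← kleinSign_eq]
    rfl
  rw [h, lp.coeFn_smul, Pi.smul_apply, smul_eq_mul, state_apply, state_apply]
  by_cases hT : T = shiftState A S
  · subst hT
    simp
  · have : (shiftState A).symm T ≠ S := fun h' => hT (by rw [← h', Equiv.apply_symm_apply])
    simp [this, hT]

theorem klein_symm_state (A : Flavor M) (T : Finset (Mode M)) :
    (klein A).symm (state T) =
      kleinSign A ((shiftState A).symm T) • state ((shiftState A).symm T) := by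
  rw [LinearIsometryEquiv.symm_apply_eq, map_smul, klein_state, smul_smul, kleinSign_mul_self,
    one_smul, Equiv.apply_symm_apply]

theorem klein_mem (A : Flavor M) (S : Finset (Mode M)) :
    ((klein A).toContinuousLinearEquiv : Fock M →L[ℂ] Fock M) (state S) ∈ finiteStates M := by
  change klein A (state S) ∈ _
  rw [klein_state]
  exact Submodule.smul_mem _ _ (state_mem _)

theorem klein_symm_mem (A : Flavor M) (S : Finset (Mode M)) :
    ((klein A).symm.toContinuousLinearEquiv : Fock M →L[ℂ] Fock M) (state S) ∈ finiteStates M := by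
  change (klein A).symm (state S) ∈ _
  rw [klein_symm_state]
  exact Submodule.smul_mem _ _ (state_mem _)

/-- The Klein factor on finite linear combinations of basis states. -/
noncomputable def kleinFin (A : Flavor M) : Module.End ℂ (FinVec M) :=
  restrictFin ((klein A).toContinuousLinearEquiv : Fock M →L[ℂ] Fock M) (klein_mem A)

/-- The inverse Klein factor on finite linear combinations of basis states. -/
noncomputable def kleinInvFin (A : Flavor M) : Module.End ℂ (FinVec M) :=
  restrictFin ((klein A).symm.toContinuousLinearEquiv : Fock M →L[ℂ] Fock M) (klein_symm_mem A)

theorem coe_kleinInvFin (A : Flavor M) (v : FinVec M) :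
    (kleinInvFin A v : Fock M) = (klein A).symm v := rfl

theorem kleinFin_fs (A : Flavor M) (S : Finset (Mode M)) :
    kleinFin A (fs S) = kleinSign A S • fs (shiftState A S) :=
  FinVec.ext (klein_state A S)

theorem kleinFin_mul_inv (A : Flavor M) : kleinFin A * kleinInvFin A = 1 := by
  refine LinearMap.ext fun v => FinVec.ext ?_
  exact (klein A).apply_symm_apply _

theorem kleinInvFin_mul (A : Flavor M) : kleinInvFin A * kleinFin A = 1 := by
  refine LinearMap.ext fun v => FinVec.ext ?_
  exact (klein A).symm_apply_apply _

theorem isAdj_kleinFin (A : Flavor M) : IsAdj (kleinFin A) (kleinInvFin A) := fun u v => by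
  change ⟪klein A (u : Fock M), (v : Fock M)⟫_ℂ = ⟪(u : Fock M), (klein A).symm v⟫_ℂ
  rw [← (klein A).inner_map_map (u : Fock M), (klein A).apply_symm_apply]

theorem shiftMode_lt_iff (A : Flavor M) (i j : Mode M) :
    shiftMode A i < shiftMode A j ↔ i < j := by
  rw [Mode.lt_iff, Mode.lt_iff]
  simp only [shiftMode, Equiv.coe_fn_mk]
  by_cases hi : i.flavor = A <;> by_cases hj : j.flavor = A <;>
    simp [hi, hj, eq_comm (a := A)]

theorem mem_shiftState (A : Flavor M) (S : Finset (Mode M)) (i : Mode M) :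
    shiftMode A i ∈ shiftState A S ↔ (i ∈ S ↔ shiftMode A i ≠ ⟨A, 0⟩) := by
  have : shiftState A S = symmDiff (S.map (shiftMode A).toEmbedding) {⟨A, 0⟩} := rfl
  rw [this, Finset.mem_symmDiff, Finset.mem_singleton]
  have h : shiftMode A i ∈ S.map (shiftMode A).toEmbedding ↔ i ∈ S := by simp
  rw [h]
  tauto

theorem shiftMode_eq_iff (A : Flavor M) (i : Mode M) : shiftMode A i = ⟨A, 0⟩ ↔ i = ⟨A, -1⟩ := by
  rw [← (shiftMode A).eq_symm_apply]
  simp [shiftMode]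

theorem shiftState_ext (A : Flavor M) {S T : Finset (Mode M)}
    (h : ∀ i, shiftMode A i ∈ S ↔ shiftMode A i ∈ T) : S = T := by
  ext j
  have := h ((shiftMode A).symm j)
  rwa [Equiv.apply_symm_apply] at this

theorem shiftState_erase {A : Flavor M} {S : Finset (Mode M)} {i : Mode M} (hi : i ≠ ⟨A, -1⟩) :
    shiftState A (S.erase i) = (shiftState A S).erase (shiftMode A i) := by
  refine shiftState_ext A fun j => ?_
  rw [Finset.mem_erase, mem_shiftState, mem_shiftState, Finset.mem_erase,
    (shiftMode A).injective.ne_iff]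
  simp only [Ne, shiftMode_eq_iff]
  by_cases hj : j = i
  · subst hj
    simp [hi]
  · simp [hj]

theorem shiftState_insert {A : Flavor M} {S : Finset (Mode M)} :
    shiftState A (insert ⟨A, -1⟩ S) = (shiftState A S).erase ⟨A, 0⟩ := by
  refine shiftState_ext A fun j => ?_
  rw [Finset.mem_erase, mem_shiftState, mem_shiftState, Finset.mem_insert, Ne, shiftMode_eq_iff]
  tauto

/-- The shift preserves the order of the modes, so the only change of sign comes from the toggled
mode (A, 0). -/
theorem sgn_shiftState (A : Flavor M) (i : Mode M) (S : Finset (Mode M)) :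
    sgn (shiftMode A i) (shiftState A S) =
      (if (⟨A, 0⟩ : Mode M) < shiftMode A i then -1 else 1) * sgn i S := by
  have h1 : sgn (shiftMode A i) (S.map (shiftMode A).toEmbedding) = sgn i S := by
    rw [sgn, sgn, Finset.prod_map]
    refine Finset.prod_congr rfl fun j _ => ?_
    simp [shiftMode_lt_iff]
  have h2 : shiftState A S = symmDiff (S.map (shiftMode A).toEmbedding) {⟨A, 0⟩} := rfl
  rw [h2, ← h1]
  generalize S.map (shiftMode A).toEmbedding = T
  by_cases hT : (⟨A, 0⟩ : Mode M) ∈ T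
  · have : symmDiff T {⟨A, 0⟩} = T.erase ⟨A, 0⟩ := by
      ext j
      simp only [Finset.mem_symmDiff, Finset.mem_singleton, Finset.mem_erase]
      by_cases hj : j = ⟨A, 0⟩
      · subst hj
        simp [hT]
      · simp [hj]
    rw [this, sgn_erase _ _ hT]
  · have : symmDiff T {⟨A, 0⟩} = insert ⟨A, 0⟩ T := by
      ext j
      simp only [Finset.mem_symmDiff, Finset.mem_singleton, Finset.mem_insert]
      by_cases hj : j = ⟨A, 0⟩
      · subst hj
        simp [hT]
      · simp [hj]
    rw [this, sgn_insert _ _ hT]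

theorem kleinSign_insert (A : Flavor M) {S : Finset (Mode M)} {i : Mode M} (hi : i ∉ S) :
    kleinSign A (insert i S) =
      (if i.flavor < A ∨ i.flavor = A ∧ 0 ≤ i.n then -1 else 1) * kleinSign A S :=
  Finset.prod_insert hi

theorem kleinSign_erase (A : Flavor M) {S : Finset (Mode M)} {i : Mode M} (hi : i ∈ S) :
    kleinSign A (S.erase i) =
      (if i.flavor < A ∨ i.flavor = A ∧ 0 ≤ i.n then -1 else 1) * kleinSign A S := by
  have := kleinSign_insert A (Finset.notMem_erase i S)
  rw [Finset.insert_erase hi] at this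
  rw [this, ← mul_assoc]
  split_ifs <;> simp

/-- Two signs compete: the weight of i in `kleinSign`, and the position of the toggled mode (A, 0)
relative to the shifted i. For flavor A they cancel; for a smaller flavor only the first is present,
for a larger one only the second, so exactly one factor -1 survives. The mode (A, -1) is excluded
because it crosses the Fermi point. -/
theorem kleinFin_mul_exc {A : Flavor M} {i : Mode M} (hi : i ≠ ⟨A, -1⟩) :
    kleinFin A * exc i =
      (if i.flavor = A then (1 : ℂ) else -1) • (exc (shiftMode A i) * kleinFin A) := by
  refine FinVec.linearMap_ext fun S => ?_
  have h1 : shiftMode A i ∈ shiftState A S ↔ i ∈ S := by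
    rw [mem_shiftState, Ne, shiftMode_eq_iff]
    simp [hi]
  simp only [LinearMap.smul_apply, Module.End.mul_apply, kleinFin_fs, exc_fs, map_smul, h1]
  by_cases hS : i ∈ S
  · simp only [hS, if_true, map_smul, kleinFin_fs, shiftState_erase hi, smul_smul,
      kleinSign_erase A hS, sgn_shiftState]
    congr 1
    have key : (if i.flavor < A ∨ i.flavor = A ∧ 0 ≤ i.n then (-1 : ℂ) else 1) =
        (if i.flavor = A then (1 : ℂ) else -1) *
          (if (⟨A, 0⟩ : Mode M) < shiftMode A i then -1 else 1) := by
      rcases lt_trichotomy i.flavor A with h | h | h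
      · have h2 : ¬ (⟨A, 0⟩ : Mode M) < shiftMode A i := by
          rw [Mode.lt_iff]
          simp [shiftMode, h.ne, h.not_gt, h.ne']
        simp [h, h.ne, h2]
      · have hn : i.n ≠ -1 := fun h' => hi (Mode.ext h h')
        have h2 : (⟨A, 0⟩ : Mode M) < shiftMode A i ↔ 0 ≤ i.n := by
          rw [Mode.lt_iff]
          simp [shiftMode, h]
          try omega
        simp [h, h2]
      · have h2 : (⟨A, 0⟩ : Mode M) < shiftMode A i := by
          rw [Mode.lt_iff]
          simp [shiftMode, h.ne', h]
        simp [h.not_gt, h.ne', h2]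
    rw [key]
    ring
  · simp [hS]

/-- The shift carries level -1 across the Fermi point, where the roles of filled and empty are
exchanged: creating an excitation below becomes removing one above. -/
theorem kleinFin_mul_excDag (A : Flavor M) :
    kleinFin A * excDag ⟨A, -1⟩ = exc ⟨A, 0⟩ * kleinFin A := by
  refine FinVec.linearMap_ext fun S => ?_
  have h0 : shiftMode A ⟨A, -1⟩ = ⟨A, 0⟩ := by simp [shiftMode]
  have h1 : (⟨A, 0⟩ : Mode M) ∈ shiftState A S ↔ (⟨A, -1⟩ : Mode M) ∉ S := by
    have := mem_shiftState A S ⟨A, -1⟩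
    rw [h0] at this
    simpa using this
  have h2 : sgn ⟨A, 0⟩ (shiftState A S) = sgn ⟨A, -1⟩ S := by
    have := sgn_shiftState A ⟨A, -1⟩ S
    rw [h0] at this
    simpa using this
  simp only [Module.End.mul_apply, kleinFin_fs, exc_fs, excDag_fs, map_smul, h1]
  by_cases hS : (⟨A, -1⟩ : Mode M) ∈ S
  · simp [hS]
  · simp [hS, kleinFin_fs, shiftState_insert, smul_smul, kleinSign_insert A hS, h2, mul_comm]

/-- Conjugation relations pass to adjoints. -/
theorem kleinFin_adj {A : Flavor M} {X X' Y Y' : Module.End ℂ (FinVec M)} (hX : IsAdj X X')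
    (hY : IsAdj Y Y') (h : kleinFin A * X = Y * kleinFin A) :
    kleinFin A * X' = Y' * kleinFin A := by
  have h1 := (isAdj_kleinFin A).mul hX
  rw [h] at h1
  have h2 := h1.eq (hY.mul (isAdj_kleinFin A))
  calc kleinFin A * X' = kleinFin A * (X' * kleinInvFin A) * kleinFin A := by
        rw [mul_assoc, mul_assoc, kleinInvFin_mul, mul_one]
    _ = Y' * kleinFin A := by rw [h2, ← mul_assoc, kleinFin_mul_inv, one_mul]

theorem kleinFin_mul_exc_same {A : Flavor M} {n : ℤ} (hn : n ≠ -1) :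
    kleinFin A * exc ⟨A, n⟩ = exc ⟨A, n + 1⟩ * kleinFin A := by
  rw [kleinFin_mul_exc (by simpa using hn), if_pos rfl, one_smul]
  simp [shiftMode]

theorem kleinFin_mul_exc_other {A : Flavor M} {i : Mode M} (hi : i.flavor ≠ A) :
    kleinFin A * exc i = -(exc i * kleinFin A) := by
  rw [kleinFin_mul_exc (fun h => hi (by rw [h])), if_neg hi]
  ext v
  simp [shiftMode, hi]

theorem kleinFin_mul_excDag_other {A : Flavor M} {i : Mode M} (hi : i.flavor ≠ A) :
    kleinFin A * excDag i = -(excDag i * kleinFin A) := by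
  refine Eq.trans ?_ (neg_mul (excDag i) (kleinFin A))
  refine kleinFin_adj (isAdj_exc i) (isAdj_exc i).neg ?_
  rw [kleinFin_mul_exc_other hi]
  exact (neg_mul (exc i) (kleinFin A)).symm

end Modes

/-! ### Locally finite sums of operators -/

section LocallyFinite

variable {ι κ V : Type*} [AddCommGroup V] [Module ℂ V]

/-- Only finitely many operators of the family are nonzero on a given vector. -/
def LocFin (X : ι → Module.End ℂ V) : Prop := ∀ v, (Function.support fun i => X i v).Finite

open Classical in
/-- The sum of a locally finite family of operators. -/
noncomputable def lfSum (X : ι → Module.End ℂ V) : Module.End ℂ V :=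
  if h : LocFin X then
    { toFun := fun v => ∑ᶠ i, X i v
      map_add' := fun u v => by
        rw [← finsum_add_distrib (h u) (h v)]
        exact finsum_congr fun i => map_add _ _ _
      map_smul' := fun c v => by
        rw [RingHom.id_apply, smul_finsum]
        exact finsum_congr fun i => map_smul _ _ _ }
  else 0

theorem lfSum_apply {X : ι → Module.End ℂ V} (h : LocFin X) (v : V) :
    lfSum X v = ∑ᶠ i, X i v := by
  rw [lfSum, dif_pos h]
  rfl

theorem lfSum_apply_eq_sum {X : ι → Module.End ℂ V} (h : LocFin X) {v : V} {s : Finset ι}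
    (hs : ∀ i ∉ s, X i v = 0) : lfSum X v = ∑ i ∈ s, X i v := by
  rw [lfSum_apply h]
  refine finsum_eq_sum_of_support_subset _ fun i hi => ?_
  by_contra hn
  exact hi (hs i hn)

theorem LocFin.exists_finset {X : ι → Module.End ℂ V} (h : LocFin X) (v : V) :
    ∃ s : Finset ι, ∀ i ∉ s, X i v = 0 := by
  refine ⟨(h v).toFinset, fun i hi => ?_⟩
  simpa using hi

theorem locFin_of_finset {X : ι → Module.End ℂ V} (h : ∀ v, ∃ s : Finset ι, ∀ i ∉ s, X i v = 0) :
    LocFin X := fun v => by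
  obtain ⟨s, hs⟩ := h v
  refine s.finite_toSet.subset fun i hi => ?_
  by_contra hn
  exact hi (hs i hn)

theorem LocFin.mul_left {X : ι → Module.End ℂ V} (h : LocFin X) (Y : Module.End ℂ V) :
    LocFin fun i => Y * X i := fun v =>
  (h v).subset fun i hi h0 => hi (by
    change Y (X i v) = 0
    rw [show X i v = 0 from h0, map_zero])

theorem LocFin.mul_right {X : ι → Module.End ℂ V} (h : LocFin X) (Y : Module.End ℂ V) :
    LocFin fun i => X i * Y := fun v => h (Y v)

theorem mul_lfSum {X : ι → Module.End ℂ V} (h : LocFin X) (Y : Module.End ℂ V) :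
    Y * lfSum X = lfSum fun i => Y * X i := by
  ext v
  obtain ⟨s, hs⟩ := h.exists_finset v
  rw [Module.End.mul_apply, lfSum_apply_eq_sum h hs, lfSum_apply_eq_sum (h.mul_left Y) (s := s)
    (fun i hi => by rw [Module.End.mul_apply, hs i hi, map_zero]), map_sum]
  rfl

theorem lfSum_mul {X : ι → Module.End ℂ V} (h : LocFin X) (Y : Module.End ℂ V) :
    lfSum X * Y = lfSum fun i => X i * Y := by
  ext v
  rw [Module.End.mul_apply, lfSum_apply h, lfSum_apply (h.mul_right Y)]
  rfl

theorem LocFin.add {X Y : ι → Module.End ℂ V} (h : LocFin X) (h' : LocFin Y) :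
    LocFin fun i => X i + Y i := fun v =>
  ((h v).union (h' v)).subset (Function.support_add _ _)

theorem lfSum_add {X Y : ι → Module.End ℂ V} (h : LocFin X) (h' : LocFin Y) :
    lfSum (fun i => X i + Y i) = lfSum X + lfSum Y := by
  ext v
  rw [LinearMap.add_apply, lfSum_apply h, lfSum_apply h', lfSum_apply (h.add h'),
    ← finsum_add_distrib (h v) (h' v)]
  rfl

theorem LocFin.smul {X : ι → Module.End ℂ V} (h : LocFin X) (c : ℂ) :
    LocFin fun i => c • X i := fun v =>
  (h v).subset fun i hi h0 => hi (by
    change c • X i v = 0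
    rw [show X i v = 0 from h0, smul_zero])

theorem lfSum_smul {X : ι → Module.End ℂ V} (h : LocFin X) (c : ℂ) :
    lfSum (fun i => c • X i) = c • lfSum X := by
  ext v
  rw [LinearMap.smul_apply, lfSum_apply h, lfSum_apply (h.smul c), smul_finsum]
  rfl

theorem LocFin.comp_equiv {X : ι → Module.End ℂ V} (h : LocFin X) (e : κ ≃ ι) :
    LocFin fun k => X (e k) := fun v =>
  ((h v).preimage e.injective.injOn).subset fun _ hi => hi

theorem lfSum_comp_equiv {X : ι → Module.End ℂ V} (h : LocFin X) (e : κ ≃ ι) :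
    lfSum (fun k => X (e k)) = lfSum X := by
  ext v
  rw [lfSum_apply h, lfSum_apply (h.comp_equiv e)]
  exact finsum_comp_equiv (f := fun i => X i v) e

theorem locFin_single [DecidableEq ι] (i : ι) (Y : Module.End ℂ V) :
    LocFin fun j => if j = i then Y else 0 :=
  locFin_of_finset fun v => ⟨{i}, fun j hj => by
    rw [if_neg (by simpa using hj), LinearMap.zero_apply]⟩

theorem lfSum_single [DecidableEq ι] (i : ι) (Y : Module.End ℂ V) :
    lfSum (fun j => if j = i then Y else 0) = Y := by
  ext v
  rw [lfSum_apply_eq_sum (locFin_single i Y) (s := {i}) (fun j hj => by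
    rw [if_neg (by simpa using hj), LinearMap.zero_apply])]
  simp

theorem IsAdj.lfSum {M : ℕ} {X Y : ι → Module.End ℂ (FinVec M)} (hX : LocFin X) (hY : LocFin Y)
    (h : ∀ i, IsAdj (X i) (Y i)) : IsAdj (lfSum X) (lfSum Y) := fun u v => by
  classical
  obtain ⟨s, hs⟩ := hX.exists_finset u
  obtain ⟨t, ht⟩ := hY.exists_finset v
  rw [lfSum_apply_eq_sum hX (s := s ∪ t) (fun i hi => hs i fun h => hi (Finset.mem_union_left _ h)),
    lfSum_apply_eq_sum hY (s := s ∪ t) (fun i hi => ht i fun h => hi (Finset.mem_union_right _ h)),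
    sum_inner, inner_sum]
  exact Finset.sum_congr rfl fun i _ => h i u v

end LocallyFinite

/-! ### Energy filtration -/

section Energy

variable {M : ℕ}

/-- Twice the energy of the basis state `S`, in units of `2π/L`. -/
def energy (S : Finset (Mode M)) : ℤ := ∑ i ∈ S, |2 * i.n + 1|

theorem energy_nonneg (S : Finset (Mode M)) : 0 ≤ energy S :=
  Finset.sum_nonneg fun _ _ => abs_nonneg _

theorem energy_insert {i : Mode M} {S : Finset (Mode M)} (h : i ∉ S) :
    energy (insert i S) = |2 * i.n + 1| + energy S := Finset.sum_insert h

theorem energy_erase {i : Mode M} {S : Finset (Mode M)} (h : i ∈ S) :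
    energy (S.erase i) = energy S - |2 * i.n + 1| := by
  rw [energy, energy, ← Finset.add_sum_erase S _ h]
  ring

/-- The span of the basis states of energy at most `k`. -/
noncomputable def energyLE (M : ℕ) (k : ℤ) : Submodule ℂ (FinVec M) :=
  Submodule.span ℂ {v | ∃ S, energy S ≤ k ∧ fs S = v}

theorem fs_mem_energyLE {S : Finset (Mode M)} {k : ℤ} (h : energy S ≤ k) : fs S ∈ energyLE M k :=
  Submodule.subset_span ⟨S, h, rfl⟩

theorem energyLE_mono {k l : ℤ} (h : k ≤ l) : energyLE M k ≤ energyLE M l :=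
  Submodule.span_mono fun _ ⟨S, hS, hv⟩ => ⟨S, hS.trans h, hv⟩

theorem eq_zero_of_mem_energyLE {k : ℤ} (hk : k < 0) {v : FinVec M} (hv : v ∈ energyLE M k) :
    v = 0 := by
  have : energyLE M k ≤ ⊥ := Submodule.span_le.2 (by
    rintro _ ⟨S, hS, -⟩
    have := energy_nonneg S
    omega)
  exact (Submodule.mem_bot ℂ).1 (this hv)

theorem exists_mem_energyLE (v : FinVec M) : ∃ k : ℕ, v ∈ energyLE M k := by
  refine FinVec.induction (p := fun v => ∃ k : ℕ, v ∈ energyLE M k) ⟨0, Submodule.zero_mem _⟩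
    ?_ ?_ ?_ v
  · rintro u v ⟨k, hk⟩ ⟨l, hl⟩
    exact ⟨max k l, Submodule.add_mem _ (energyLE_mono (by simp) hk)
      (energyLE_mono (by simp) hl)⟩
  · rintro c u ⟨k, hk⟩
    exact ⟨k, Submodule.smul_mem _ _ hk⟩
  · intro S
    exact ⟨(energy S).toNat, fs_mem_energyLE (by
      rw [Int.toNat_of_nonneg (energy_nonneg S)])⟩

theorem map_energyLE {X : Module.End ℂ (FinVec M)} {k l : ℤ}
    (h : ∀ S, energy S ≤ k → X (fs S) ∈ energyLE M l) {v : FinVec M} (hv : v ∈ energyLE M k) :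
    X v ∈ energyLE M l := by
  have : energyLE M k ≤ (energyLE M l).comap X := Submodule.span_le.2 (by
    rintro _ ⟨S, hS, rfl⟩
    exact h S hS)
  exact this hv

theorem exc_mem_energyLE (i : Mode M) {k : ℤ} {v : FinVec M} (hv : v ∈ energyLE M k) :
    exc i v ∈ energyLE M (k - |2 * i.n + 1|) := by
  refine map_energyLE (fun S hS => ?_) hv
  rw [exc_fs]
  split_ifs with h
  · refine Submodule.smul_mem _ _ (fs_mem_energyLE ?_)
    rw [energy_erase h]
    omega
  · exact Submodule.zero_mem _

theorem excDag_mem_energyLE (i : Mode M) {k : ℤ} {v : FinVec M} (hv : v ∈ energyLE M k) :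
    excDag i v ∈ energyLE M (k + |2 * i.n + 1|) := by
  refine map_energyLE (fun S hS => ?_) hv
  rw [excDag_fs]
  split_ifs with h
  · exact Submodule.zero_mem _
  · refine Submodule.smul_mem _ _ (fs_mem_energyLE ?_)
    rw [energy_insert h]
    omega

theorem abs_modeIdx (A : Flavor M) (n : ℤ) : |2 * modeIdx A n + 1| = |2 * n + 1| := by
  unfold modeIdx
  split_ifs
  · rfl
  · rw [← abs_neg]
    congr 1
    ring

theorem dn_mem_energyLE (A : Flavor M) (n : ℤ) {k : ℤ} {v : FinVec M} (hv : v ∈ energyLE M k) :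
    dn A n v ∈ energyLE M (k - (2 * n + 1)) := by
  unfold dn
  split_ifs with h
  · have := exc_mem_energyLE ⟨A, modeIdx A n⟩ hv
    rw [abs_modeIdx, abs_of_nonneg (by omega)] at this
    exact this
  · have := excDag_mem_energyLE ⟨A, modeIdx A n⟩ hv
    rw [abs_modeIdx, abs_of_neg (by omega)] at this
    exact this

theorem dd_mem_energyLE (A : Flavor M) (n : ℤ) {k : ℤ} {v : FinVec M} (hv : v ∈ energyLE M k) :
    dd A n v ∈ energyLE M (k + (2 * n + 1)) := by
  unfold dd
  split_ifs with h
  · have := excDag_mem_energyLE ⟨A, modeIdx A n⟩ hv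
    rw [abs_modeIdx, abs_of_nonneg (by omega)] at this
    exact this
  · have := exc_mem_energyLE ⟨A, modeIdx A n⟩ hv
    rw [abs_modeIdx, abs_of_neg (by omega)] at this
    rwa [sub_neg_eq_add] at this

theorem vacuum_mem_energyLE : fs (∅ : Finset (Mode M)) ∈ energyLE M 0 :=
  fs_mem_energyLE (by simp [energy])

end Energy

/-! ### Generation from the vacuum and irreducibility -/

section Irreducible

variable {M : ℕ}

theorem fs_insert {i : Mode M} {S : Finset (Mode M)} (h : i ∉ S) :
    fs (insert i S) = sgn i S • excDag i (fs S) := by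
  rw [excDag_fs, if_neg h, smul_smul, sgn_mul_self, one_smul]

theorem excDag_eq (i : Mode M) : excDag i =
    if 0 ≤ modeIdx i.flavor i.n then dd i.flavor (modeIdx i.flavor i.n)
    else dn i.flavor (modeIdx i.flavor i.n) := by
  unfold dd dn
  split_ifs <;> rw [modeIdx_modeIdx]

/-- An operator that commutes with all fermion operators is a multiple of the identity. -/
theorem eq_smul_one_of_commute {X : Module.End ℂ (FinVec M)}
    (h1 : ∀ i : Mode M, X * exc i = exc i * X) (h2 : ∀ i : Mode M, X * excDag i = excDag i * X) :
    X = ⟪fs ∅, X (fs ∅)⟫_ℂ • (1 : Module.End ℂ (FinVec M)) := by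
  have hΩ : X (fs ∅) = ⟪fs ∅, X (fs ∅)⟫_ℂ • fs ∅ := by
    have h : ∀ S, ⟪fs S, X (fs ∅)⟫_ℂ = ⟪fs S, ⟪fs ∅, X (fs ∅)⟫_ℂ • fs ∅⟫_ℂ := by
      intro S
      have hS : ⟪fs S, fs ∅⟫_ℂ = if S = ∅ then (1 : ℂ) else 0 := inner_state_state S ∅
      rw [inner_smul_right, hS]
      split_ifs with h0
      · rw [h0, mul_one]
      · obtain ⟨i, hi⟩ := Finset.nonempty_iff_ne_empty.2 h0
        rw [← Finset.insert_erase hi, fs_insert (Finset.notMem_erase i S), inner_smul_left,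
          (isAdj_exc i).symm, ← Module.End.mul_apply, ← h1, Module.End.mul_apply, exc_fs]
        simp
    refine FinVec.ext_inner fun u => ?_
    refine FinVec.induction (p := fun u => ⟪u, X (fs ∅)⟫_ℂ = ⟪u, ⟪fs ∅, X (fs ∅)⟫_ℂ • fs ∅⟫_ℂ)
      (by rw [inner_zero_left, inner_zero_left]) ?_ ?_ h u
    · intro u v hu hv
      rw [inner_add_left, inner_add_left, hu, hv]
    · intro c u hu
      rw [inner_smul_left, inner_smul_left, hu]
  refine FinVec.linearMap_ext fun S => ?_
  rw [LinearMap.smul_apply, Module.End.one_apply]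
  induction S using Finset.induction_on with
  | empty => exact hΩ
  | insert i S hi ih =>
    rw [fs_insert hi, map_smul, ← Module.End.mul_apply, h2, Module.End.mul_apply, ih, map_smul,
      smul_comm]

end Irreducible

/-! ### Densities of one flavor -/

section Density

variable {M : ℕ}

/-- The normal ordered bilinear of `dd A l` and `dn A (l + m)`. -/
noncomputable def rhoTerm (A : Flavor M) (m l : ℤ) : Module.End ℂ (FinVec M) :=
  dd A l * dn A (l + m) - (if m = 0 ∧ l < 0 then (1 : ℂ) else 0) • 1

theorem rhoTerm_eq_of_nonneg (A : Flavor M) (m : ℤ) {l : ℤ} (hl : 0 ≤ l) :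
    rhoTerm A m l = dd A l * dn A (l + m) := by
  rw [rhoTerm, if_neg (by omega), zero_smul, sub_zero]

theorem rhoTerm_eq_of_neg (A : Flavor M) (m : ℤ) {l : ℤ} (hl : l < 0) :
    rhoTerm A m l = -(dn A (l + m) * dd A l) := by
  rw [rhoTerm]
  by_cases hm : m = 0
  · subst hm
    rw [if_pos ⟨rfl, hl⟩, one_smul, add_zero, ← dn_mul_dd_self A l]
    abel
  · rw [if_neg (by tauto), zero_smul, sub_zero, dn_mul_dd_eq (by omega), neg_neg]

/-- In normal order the factor acting first lowers the energy: by 2(l+m)+1 in the first alternative,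
where l ≥ 0 and `dn A (l + m)` acts first, and by -(2l+1) in the second, where l < 0 and `dd A l`
does. Beyond these bounds the energy of the image would be negative. -/
theorem rhoTerm_apply_eq_zero (A : Flavor M) {m l k : ℤ} {v : FinVec M} (hv : v ∈ energyLE M k)
    (hk : 0 ≤ k) (hl : k < 2 * (l + m) + 1 ∧ 0 ≤ l ∨ 2 * l + 1 < -k) : rhoTerm A m l v = 0 := by
  rcases hl with ⟨h, h0⟩ | h
  · rw [rhoTerm_eq_of_nonneg A m h0, Module.End.mul_apply,
      eq_zero_of_mem_energyLE (by omega) (dn_mem_energyLE A (l + m) hv), map_zero]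
  · rw [rhoTerm_eq_of_neg A m (by omega), LinearMap.neg_apply, Module.End.mul_apply,
      eq_zero_of_mem_energyLE (by omega) (dd_mem_energyLE A l hv), map_zero, neg_zero]

theorem rhoTerm_apply_eq_zero_of_notMem (A : Flavor M) {m l : ℤ} {k : ℕ} {v : FinVec M}
    (hv : v ∈ energyLE M k) (hl : l ∉ Finset.Icc (-(k : ℤ)) (k + |m|)) : rhoTerm A m l v = 0 := by
  refine rhoTerm_apply_eq_zero A hv (by omega) ?_
  rw [Finset.mem_Icc, not_and_or] at hl
  have h1 := neg_abs_le m
  have h2 := le_abs_self m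
  rcases hl with h | h
  · right
    omega
  · left
    omega

theorem locFin_rhoTerm (A : Flavor M) (m : ℤ) : LocFin (rhoTerm A m) :=
  locFin_of_finset fun v => by
    obtain ⟨k, hk⟩ := exists_mem_energyLE v
    exact ⟨_, fun l hl => rhoTerm_apply_eq_zero_of_notMem A hk hl⟩

/-- The Fourier mode `m` of the density of flavor `A`. -/
noncomputable def rho (A : Flavor M) (m : ℤ) : Module.End ℂ (FinVec M) := lfSum (rhoTerm A m)

theorem isAdj_rhoTerm (A : Flavor M) (m l : ℤ) : IsAdj (rhoTerm A m l) (rhoTerm A (-m) (l + m)) := by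
  unfold rhoTerm
  rw [add_neg_cancel_right]
  refine (((isAdj_dn A l).symm.mul (isAdj_dn A (l + m)))).sub ?_
  have : (if -m = 0 ∧ l + m < 0 then (1 : ℂ) else 0) =
      starRingEnd ℂ (if m = 0 ∧ l < 0 then (1 : ℂ) else 0) := by
    by_cases h : m = 0 <;> by_cases h' : l < 0 <;> simp [h, h']
  rw [this]
  exact IsAdj.one.smul _

theorem isAdj_rho (A : Flavor M) (m : ℤ) : IsAdj (rho A m) (rho A (-m)) := by
  have h := IsAdj.lfSum (locFin_rhoTerm A m)
    ((locFin_rhoTerm A (-m)).comp_equiv (Equiv.addRight m)) fun l => isAdj_rhoTerm A m l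
  rwa [lfSum_comp_equiv (locFin_rhoTerm A (-m))] at h

/-- The normal ordering constant commutes with everything, and the only contraction pairs `dd A l`
with `dn A l`. -/
theorem rhoTerm_mul_dn (A B : Flavor M) (m l n : ℤ) :
    rhoTerm A m l * dn B n = dn B n * rhoTerm A m l +
      (if l = n then (if A = B then -dn A (n + m) else 0) else 0) := by
  have key : dd A l * dn A (l + m) * dn B n = dn B n * (dd A l * dn A (l + m)) +
      (if l = n then (if A = B then -dn A (n + m) else 0) else 0) := by
    rw [mul_assoc, dn_mul_dn_eq A B (l + m) n, mul_neg, ← mul_assoc, ← mul_assoc]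
    by_cases h : A = B ∧ l = n
    · obtain ⟨rfl, rfl⟩ := h
      rw [if_pos rfl, if_pos rfl]
      have := dn_mul_dd_self A l
      rw [eq_sub_of_add_eq' this]
      noncomm_ring
    · have h' : ¬(B = A ∧ n = l) := fun h' => h ⟨h'.1.symm, h'.2.symm⟩
      have h0 : (if l = n then (if A = B then -dn A (n + m) else 0) else 0) = 0 := by
        split_ifs <;> tauto
      rw [dn_mul_dd_eq h', h0]
      noncomm_ring
  rw [rhoTerm, sub_mul, mul_sub, key, smul_mul_assoc, mul_smul_comm, one_mul, mul_one]
  abel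

theorem rho_mul_dn (A B : Flavor M) (m n : ℤ) :
    rho A m * dn B n = dn B n * rho A m + (if A = B then -dn A (n + m) else 0) := by
  rw [rho, lfSum_mul (locFin_rhoTerm A m), mul_lfSum (locFin_rhoTerm A m)]
  simp_rw [rhoTerm_mul_dn]
  rw [lfSum_add ((locFin_rhoTerm A m).mul_left _) (locFin_single _ _), lfSum_single]

theorem rho_mul_dn_self (A : Flavor M) (m n : ℤ) :
    rho A m * dn A n = dn A n * rho A m - dn A (n + m) := by
  rw [rho_mul_dn, if_pos rfl, sub_eq_add_neg]

theorem rho_mul_dd (A B : Flavor M) (m n : ℤ) :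
    rho A m * dd B n = dd B n * rho A m + (if A = B then dd A (n - m) else 0) := by
  have h1 := (isAdj_dn B n).mul (isAdj_rho A (-m))
  have h2 := (isAdj_rho A (-m)).mul (isAdj_dn B n)
  rw [rho_mul_dn] at h2
  have h3 : IsAdj (dn B n * rho A (-m) + (if A = B then -dn A (n + -m) else 0))
      (rho A (- -m) * dd B n + (if A = B then -dd A (n + -m) else 0)) := by
    refine h1.add ?_
    split_ifs
    · exact (isAdj_dn A _).neg
    · exact IsAdj.zero
  have h4 := h3.eq h2
  rw [neg_neg, ← sub_eq_add_neg] at h4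
  rw [← h4]
  split_ifs <;> abel

theorem rho_mul_dd_self (A : Flavor M) (m n : ℤ) :
    rho A m * dd A n = dd A n * rho A m + dd A (n - m) := by
  rw [rho_mul_dd, if_pos rfl]

theorem rho_mem_energyLE (A : Flavor M) (m : ℤ) {k : ℤ} {v : FinVec M} (hv : v ∈ energyLE M k) :
    rho A m v ∈ energyLE M (k - 2 * m) := by
  obtain ⟨s, hs⟩ := (locFin_rhoTerm A m).exists_finset v
  rw [rho, lfSum_apply_eq_sum (locFin_rhoTerm A m) hs]
  refine Submodule.sum_mem _ fun l _ => ?_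
  rcases le_or_gt 0 l with h | h
  · rw [rhoTerm_eq_of_nonneg A m h, Module.End.mul_apply]
    have := dd_mem_energyLE A l (dn_mem_energyLE A (l + m) hv)
    exact energyLE_mono (by omega) this
  · rw [rhoTerm_eq_of_neg A m h, LinearMap.neg_apply, Module.End.mul_apply]
    have := dn_mem_energyLE A (l + m) (dd_mem_energyLE A l hv)
    exact Submodule.neg_mem _ (energyLE_mono (by omega) this)

/-- The vacuum property with respect to the fermions of flavor `A`. -/
def IsVac (A : Flavor M) (v : FinVec M) : Prop :=
  (∀ n : ℤ, 0 ≤ n → dn A n v = 0) ∧ ∀ n : ℤ, n < 0 → dd A n v = 0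

theorem isVac_fs {A : Flavor M} {S : Finset (Mode M)} (hS : ∀ i ∈ S, i.flavor ≠ A) :
    IsVac A (fs S) := by
  constructor
  · intro n hn
    rw [dn, if_pos hn, exc_fs, if_neg fun h => hS _ h rfl]
  · intro n hn
    rw [dd, if_neg hn.not_ge, exc_fs, if_neg fun h => hS _ h rfl]

theorem rho_vac (A : Flavor M) {v : FinVec M} (hv : IsVac A v) {m : ℤ} (hm : 0 ≤ m) :
    rho A m v = 0 := by
  rw [rho, lfSum_apply_eq_sum (locFin_rhoTerm A m) (s := ∅), Finset.sum_empty]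
  intro l _
  rcases le_or_gt 0 l with h | h
  · rw [rhoTerm_eq_of_nonneg A m h, Module.End.mul_apply, hv.1 _ (by omega), map_zero]
  · rw [rhoTerm_eq_of_neg A m h, LinearMap.neg_apply, Module.End.mul_apply, hv.2 _ h, map_zero,
      neg_zero]

theorem rho_neg_vac (A : Flavor M) {v : FinVec M} (hv : IsVac A v) (m : ℕ) :
    rho A (-m) v = ∑ l ∈ Finset.range m, dd A l (dn A (l - m) v) := by
  rw [rho, lfSum_apply_eq_sum (locFin_rhoTerm A (-m)) (s := (Finset.range m).map Nat.castEmbedding),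
    Finset.sum_map]
  · refine Finset.sum_congr rfl fun l _ => ?_
    rw [rhoTerm_eq_of_nonneg A _ (by simp)]
    rfl
  · intro l hl
    rcases le_or_gt 0 l with h | h
    · rw [rhoTerm_eq_of_nonneg A _ h, Module.End.mul_apply]
      have : (m : ℤ) ≤ l := by
        by_contra hlt
        refine hl (Finset.mem_map.2 ⟨l.toNat, ?_, ?_⟩)
        · rw [Finset.mem_range]
          omega
        · exact Int.toNat_of_nonneg h
      rw [hv.1 _ (by omega), map_zero]
    · rw [rhoTerm_eq_of_neg A _ h, LinearMap.neg_apply, Module.End.mul_apply, hv.2 _ h, map_zero,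
        neg_zero]

theorem commute_exc_of_dn {X : Module.End ℂ (FinVec M)}
    (h1 : ∀ B n, X * dn B n = dn B n * X) (h2 : ∀ B n, X * dd B n = dd B n * X) (i : Mode M) :
    X * exc i = exc i * X ∧ X * excDag i = excDag i * X := by
  have e : exc i = if 0 ≤ modeIdx i.flavor i.n then dn i.flavor (modeIdx i.flavor i.n)
      else dd i.flavor (modeIdx i.flavor i.n) := by
    unfold dd dn
    split_ifs <;> rw [modeIdx_modeIdx]
  rw [e, excDag_eq]
  split_ifs
  · exact ⟨h1 _ _, h2 _ _⟩
  · exact ⟨h2 _ _, h1 _ _⟩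

/-- Commuting past a fermion operator, a density only shifts its label, and two such shifts commute.
The commutator of two densities therefore commutes with all fermion operators and is a scalar by
irreducibility. -/
theorem rho_commutator_eq_smul (A : Flavor M) (m n : ℤ) :
    rho A m * rho A n - rho A n * rho A m =
      ⟪fs ∅, (rho A m * rho A n - rho A n * rho A m) (fs ∅)⟫_ℂ • 1 := by
  have h1 : ∀ m n B k, (rho A m * rho A n - rho A n * rho A m) * dn B k =
      dn B k * (rho A m * rho A n - rho A n * rho A m) := by
    intro m n B k
    rw [sub_mul, mul_assoc, mul_assoc, rho_mul_dn, rho_mul_dn, mul_add, mul_add, ← mul_assoc,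
      ← mul_assoc, rho_mul_dn, rho_mul_dn]
    split_ifs with h
    · subst h
      rw [mul_neg, mul_neg, rho_mul_dn_self, rho_mul_dn_self, add_right_comm k n m]
      noncomm_ring
    · noncomm_ring
  have h2 : ∀ B k, (rho A m * rho A n - rho A n * rho A m) * dd B k =
      dd B k * (rho A m * rho A n - rho A n * rho A m) := by
    intro B k
    have a := h1 (-n) (-m) B k
    have hadj : IsAdj (rho A (-n) * rho A (-m) - rho A (-m) * rho A (-n))
        (rho A m * rho A n - rho A n * rho A m) := by
      have := ((isAdj_rho A (-n)).mul (isAdj_rho A (-m))).sub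
        ((isAdj_rho A (-m)).mul (isAdj_rho A (-n)))
      simpa only [neg_neg] using this
    have b := hadj.mul (isAdj_dn B k)
    rw [a] at b
    exact ((((isAdj_dn B k).mul hadj)).eq b)
  exact eq_smul_one_of_commute (fun i => (commute_exc_of_dn (h1 m n) h2 i).1)
    fun i => (commute_exc_of_dn (h1 m n) h2 i).2

theorem isVac_vacuum (A : Flavor M) : IsVac A (fs ∅) := isVac_fs (by simp)

theorem inner_fs (S T : Finset (Mode M)) : ⟪fs S, fs T⟫_ℂ = if S = T then (1 : ℂ) else 0 :=
  inner_state_state S T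

/-- The scalar operator would lower the energy of the vacuum by 2(m + n) > 0, so the scalar is zero.
-/
theorem rho_commutator_of_pos (A : Flavor M) {m n : ℤ} (h : 0 < m + n) :
    rho A m * rho A n - rho A n * rho A m = 0 := by
  rw [rho_commutator_eq_smul]
  have h1 : (rho A m * rho A n - rho A n * rho A m) (fs ∅) ∈ energyLE M (-2 * (m + n)) := by
    rw [LinearMap.sub_apply, Module.End.mul_apply, Module.End.mul_apply]
    refine Submodule.sub_mem _ ?_ ?_
    · have := rho_mem_energyLE A m (rho_mem_energyLE A n (vacuum_mem_energyLE (M := M)))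
      exact energyLE_mono (by omega) this
    · have := rho_mem_energyLE A n (rho_mem_energyLE A m (vacuum_mem_energyLE (M := M)))
      exact energyLE_mono (by omega) this
  rw [eq_zero_of_mem_energyLE (by omega) h1, inner_zero_right, zero_smul]

/-- The Schwinger term: ρ(-m) creates on the vacuum exactly m particle-hole pairs, those with 0 ≤ l
< m, and ρ(m) turns each of them back into the vacuum. -/
theorem rho_neg_mul (A : Flavor M) (m : ℕ) :
    rho A m * rho A (-m) - rho A (-m) * rho A m = (m : ℂ) • 1 := by
  rw [rho_commutator_eq_smul]
  have hΩ := isVac_vacuum A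
  have h : (rho A m * rho A (-m) - rho A (-m) * rho A m) (fs ∅) = (m : ℂ) • fs ∅ := by
    rw [LinearMap.sub_apply, Module.End.mul_apply, Module.End.mul_apply,
      rho_vac A hΩ (by omega : (0 : ℤ) ≤ m), map_zero, sub_zero, rho_neg_vac A hΩ, map_sum]
    have : ∀ l ∈ Finset.range m, rho A m (dd A l (dn A (l - m) (fs ∅))) = fs ∅ := by
      intro l hl
      rw [Finset.mem_range] at hl
      have e : rho A m * (dd A l * dn A (l - m)) =
          dd A l * dn A (l - m) * rho A m - dd A l * dn A l + dd A (l - m) * dn A (l - m) := by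
        rw [← mul_assoc, rho_mul_dd_self, add_mul, mul_assoc, rho_mul_dn_self, sub_add_cancel]
        noncomm_ring
      have e' := LinearMap.congr_fun e (fs ∅)
      rw [LinearMap.add_apply, LinearMap.sub_apply, Module.End.mul_apply, Module.End.mul_apply,
        Module.End.mul_apply, Module.End.mul_apply, rho_vac A hΩ (by omega : (0 : ℤ) ≤ m),
        Module.End.mul_apply (dd A l) (dn A l), hΩ.1 l (by omega), map_zero, map_zero, sub_zero, zero_add] at e'
      rw [e']
      have e2 := LinearMap.congr_fun (dn_mul_dd_self A (l - m)) (fs ∅)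
      rw [LinearMap.add_apply, Module.End.mul_apply, Module.End.mul_apply, hΩ.2 _ (by omega),
        map_zero, zero_add] at e2
      exact e2
    rw [Finset.sum_congr rfl this, Finset.sum_const, Finset.card_range]
    exact (Nat.cast_smul_eq_nsmul ℂ m (fs ∅)).symm
  rw [h, inner_smul_right, inner_fs, if_pos rfl, mul_one]

/-- The commutation relations of the densities. -/
theorem rho_commutator (A : Flavor M) (m n : ℤ) :
    rho A m * rho A n - rho A n * rho A m = (if m + n = 0 then (m : ℂ) else 0) • 1 := by
  rcases lt_trichotomy (m + n) 0 with h | h | h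
  -- For m + n < 0 the relation is the adjoint of one with positive total index.
  · rw [if_neg h.ne, zero_smul]
    have h1 := ((isAdj_rho A (-n)).mul (isAdj_rho A (-m))).sub
        ((isAdj_rho A (-m)).mul (isAdj_rho A (-n)))
    rw [rho_commutator_of_pos A (by omega)] at h1
    simp only [neg_neg] at h1
    exact h1.eq IsAdj.zero
  · rw [if_pos h]
    obtain rfl : n = -m := by omega
    rcases le_or_gt 0 m with hm | hm
    · lift m to ℕ using hm
      exact_mod_cast rho_neg_mul A m
    · obtain ⟨k, hk⟩ : ∃ k : ℕ, m = -k := ⟨m.natAbs, by omega⟩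
      subst hk
      have := rho_neg_mul A k
      rw [neg_neg]
      rw [← neg_sub, this, ← neg_smul]
      push_cast
      rfl
  · rw [if_neg h.ne', zero_smul, rho_commutator_of_pos A h]

end Density

/-! ### Klein factors as shifts -/

section Shift

variable {M : ℕ}

theorem units_ne {u : ℤˣ} (h : u ≠ 1) : u = -1 := (Int.units_eq_one_or u).resolve_left h

theorem kleinFin_mul_dn (A : Flavor M) (n : ℤ) :
    kleinFin A * dn A n = dn A (n + ((A.r : ℤˣ) : ℤ)) * kleinFin A := by
  by_cases hr : A.r = 1
  · rw [hr]
    simp only [dn, modeIdx, hr, if_true, Units.val_one]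
    -- Away from the Fermi point hole labels stay hole labels and particle labels stay particle
    -- labels; only n = -1 changes type.
    rcases lt_trichotomy n (-1) with h | rfl | h
    · rw [if_neg (by omega), if_neg (by omega)]
      exact kleinFin_adj (isAdj_exc _) (isAdj_exc _) (kleinFin_mul_exc_same (by omega))
    · simpa using kleinFin_mul_excDag A
    · rw [if_pos (by omega), if_pos (by omega)]
      exact kleinFin_mul_exc_same (by omega)
  · have hr1 := units_ne hr
    simp only [dn, modeIdx, if_neg hr]
    rw [hr1, Units.val_neg, Units.val_one]
    have e : -(n + -1) - 1 = -n - 1 + 1 := by ring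
    rw [e]
    rcases lt_trichotomy n 0 with h | rfl | h
    · rw [if_neg (by omega), if_neg (by omega)]
      exact kleinFin_adj (isAdj_exc _) (isAdj_exc _) (kleinFin_mul_exc_same (by omega))
    · simpa using kleinFin_adj (isAdj_exc _).symm (isAdj_exc _) (kleinFin_mul_excDag A)
    · rw [if_pos (by omega), if_pos (by omega)]
      exact kleinFin_mul_exc_same (by omega)

theorem kleinFin_mul_dd (A : Flavor M) (n : ℤ) :
    kleinFin A * dd A n = dd A (n + ((A.r : ℤˣ) : ℤ)) * kleinFin A :=
  kleinFin_adj (isAdj_dn A n) (isAdj_dn A _) (kleinFin_mul_dn A n)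

theorem kleinFin_mul_dn_other {A B : Flavor M} (h : B ≠ A) (n : ℤ) :
    kleinFin A * dn B n = -(dn B n * kleinFin A) := by
  unfold dn
  split_ifs
  · exact kleinFin_mul_exc_other h
  · exact kleinFin_mul_excDag_other h

theorem kleinFin_mul_dd_other {A B : Flavor M} (h : B ≠ A) (n : ℤ) :
    kleinFin A * dd B n = -(dd B n * kleinFin A) := by
  unfold dd
  split_ifs
  · exact kleinFin_mul_excDag_other h
  · exact kleinFin_mul_exc_other h

theorem kleinInvFin_conj {A : Flavor M} {X Y : Module.End ℂ (FinVec M)}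
    (h : kleinFin A * X = Y * kleinFin A) : kleinInvFin A * Y = X * kleinInvFin A := by
  calc kleinInvFin A * Y = kleinInvFin A * (Y * kleinFin A) * kleinInvFin A := by
        rw [mul_assoc, mul_assoc, kleinFin_mul_inv, mul_one]
    _ = X * kleinInvFin A := by rw [← h, ← mul_assoc, kleinInvFin_mul, one_mul]

theorem kleinFin_mul_rho_other {A B : Flavor M} (h : B ≠ A) (m : ℤ) :
    kleinFin A * rho B m = rho B m * kleinFin A := by
  rw [rho, mul_lfSum (locFin_rhoTerm B m), lfSum_mul (locFin_rhoTerm B m)]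
  congr 1
  ext1 l
  rw [rhoTerm, mul_sub, sub_mul, ← mul_assoc, kleinFin_mul_dd_other h, neg_mul, mul_assoc,
    kleinFin_mul_dn_other h, mul_neg, neg_neg, mul_assoc, mul_smul_comm, smul_mul_assoc, mul_one,
    one_mul]

/-- The Klein factor or its inverse, whichever raises the charge of flavor `A`. -/
noncomputable def up (A : Flavor M) : Module.End ℂ (FinVec M) :=
  if A.r = 1 then kleinFin A else kleinInvFin A

/-- The inverse of `up A`. -/
noncomputable def down (A : Flavor M) : Module.End ℂ (FinVec M) :=
  if A.r = 1 then kleinInvFin A else kleinFin A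

theorem up_mul_down (A : Flavor M) : up A * down A = 1 := by
  unfold up down
  split_ifs
  · exact kleinFin_mul_inv A
  · exact kleinInvFin_mul A

theorem down_mul_up (A : Flavor M) : down A * up A = 1 := by
  unfold up down
  split_ifs
  · exact kleinInvFin_mul A
  · exact kleinFin_mul_inv A

theorem up_mul_dn (A : Flavor M) (n : ℤ) : up A * dn A n = dn A (n + 1) * up A := by
  unfold up
  split_ifs with h
  · have := kleinFin_mul_dn A n
    rwa [h, Units.val_one] at this
  · have := kleinInvFin_conj (kleinFin_mul_dn A (n + 1))
    rwa [units_ne h, Units.val_neg, Units.val_one, add_neg_cancel_right] at this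

theorem up_mul_dd (A : Flavor M) (n : ℤ) : up A * dd A n = dd A (n + 1) * up A := by
  unfold up
  split_ifs with h
  · have := kleinFin_mul_dd A n
    rwa [h, Units.val_one] at this
  · have := kleinInvFin_conj (kleinFin_mul_dd A (n + 1))
    rwa [units_ne h, Units.val_neg, Units.val_one, add_neg_cancel_right] at this

theorem down_conj {A : Flavor M} {X Y : Module.End ℂ (FinVec M)}
    (h : up A * X = Y * up A) : down A * Y = X * down A := by
  calc down A * Y = down A * (Y * up A) * down A := by
        rw [mul_assoc, mul_assoc, up_mul_down, mul_one]
    _ = X * down A := by rw [← h, ← mul_assoc, down_mul_up, one_mul]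

theorem down_mul_dn (A : Flavor M) (n : ℤ) : down A * dn A n = dn A (n - 1) * down A :=
  down_conj (by rw [up_mul_dn, sub_add_cancel])

theorem down_mul_dd (A : Flavor M) (n : ℤ) : down A * dd A n = dd A (n - 1) * down A :=
  down_conj (by rw [up_mul_dd, sub_add_cancel])

/-- The shift reindexes the sum over l, but the normal ordering constant is subtracted for l < 0
while the shifted fermions would need l + 1 < 0. The mismatch at l = -1 is the unit of charge
carried by the shift, and it is present only for m = 0. -/
theorem up_mul_rho' (A : Flavor M) (m : ℤ) :
    up A * rho A m = (rho A m - (if m = 0 then (1 : ℂ) else 0) • 1) * up A := by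
  have h : ∀ l, up A * rhoTerm A m l = (rhoTerm A m (l + 1) +
      (if l = -1 then (-(if m = 0 then (1 : ℂ) else 0)) • 1 else 0)) * up A := by
    intro l
    rw [rhoTerm, rhoTerm, mul_sub, ← mul_assoc, up_mul_dd, mul_assoc, up_mul_dn, add_right_comm,
      mul_smul_comm, mul_one, add_mul, sub_mul, smul_mul_assoc, one_mul, mul_assoc]
    by_cases hm : m = 0
    · rcases lt_trichotomy l (-1) with h | rfl | h
      · simp [hm, h.ne, show l < 0 by omega, show l + 1 < 0 by omega]
      · simp [hm, sub_eq_add_neg]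
      · simp [hm, h.ne', show ¬ l < 0 by omega, show ¬ l + 1 < 0 by omega]
    · simp [hm]
  have e := (locFin_rhoTerm A m).comp_equiv (Equiv.addRight (1 : ℤ))
  have e' := locFin_single (-1 : ℤ)
    ((-(if m = 0 then (1 : ℂ) else 0)) • (1 : Module.End ℂ (FinVec M)))
  calc up A * rho A m = lfSum (fun l => (rhoTerm A m (l + 1) +
      (if l = -1 then (-(if m = 0 then (1 : ℂ) else 0)) • 1 else 0)) * up A) := by
        rw [rho, mul_lfSum (locFin_rhoTerm A m)]
        simp_rw [h]
    _ = (rho A m - (if m = 0 then (1 : ℂ) else 0) • 1) * up A := by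
        refine (lfSum_mul (e.add e') (up A)).symm.trans ?_
        have h1 := lfSum_add e e'
        rw [lfSum_comp_equiv (locFin_rhoTerm A m) (Equiv.addRight (1 : ℤ)), lfSum_single,
          ← rho] at h1
        refine (congrArg (· * up A) h1).trans ?_
        simp only [neg_smul, sub_eq_add_neg]

theorem up_mul_rho (A : Flavor M) {m : ℤ} (hm : m ≠ 0) : up A * rho A m = rho A m * up A := by
  rw [up_mul_rho', if_neg hm, zero_smul, sub_zero]

theorem up_mul_rho_zero (A : Flavor M) : up A * rho A 0 = rho A 0 * up A - up A := by
  rw [up_mul_rho', if_pos rfl, one_smul, sub_mul, one_mul]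

theorem down_mul_rho (A : Flavor M) {m : ℤ} (hm : m ≠ 0) :
    down A * rho A m = rho A m * down A :=
  down_conj (up_mul_rho A hm)

theorem shiftState_of_forall_ne {A : Flavor M} {S : Finset (Mode M)}
    (hS : ∀ i ∈ S, i.flavor ≠ A) : shiftState A S = insert ⟨A, 0⟩ S := by
  refine shiftState_ext A fun i => ?_
  rw [mem_shiftState, Finset.mem_insert]
  by_cases hi : i.flavor = A
  · have h1 : i ∉ S := fun h => hS i h hi
    have h2 : shiftMode A i ∉ S := fun h => hS _ h (by simp [shiftMode, hi])
    tauto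
  · have : shiftMode A i = i := by simp [shiftMode, hi]
    rw [this]
    have h2 : i ≠ ⟨A, 0⟩ := fun h => hi (by rw [h])
    tauto

theorem kleinFin_fs_of_forall_ne {A : Flavor M} {S : Finset (Mode M)}
    (hS : ∀ i ∈ S, i.flavor ≠ A) : kleinFin A (fs S) = excDag ⟨A, 0⟩ (fs S) := by
  rw [kleinFin_fs, shiftState_of_forall_ne hS, excDag_fs, if_neg fun h => hS _ h rfl]
  congr 1
  refine Finset.prod_congr rfl fun j hj => ?_
  simp [Mode.lt_iff, hS j hj]

/-- On states without excitations of flavor `A` the shift creates the lowest fermion. -/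
theorem up_fs {A : Flavor M} {S : Finset (Mode M)} (hS : ∀ i ∈ S, i.flavor ≠ A) :
    up A (fs S) = dd A 0 (fs S) := by
  unfold up
  split_ifs with hr
  · rw [kleinFin_fs_of_forall_ne hS]
    simp [dd, modeIdx, hr]
  · have h1 : kleinFin A (dd A 0 (fs S)) = fs S := by
      have e := LinearMap.congr_fun (kleinFin_mul_dd A 0) (fs S)
      rw [Module.End.mul_apply, Module.End.mul_apply, kleinFin_fs_of_forall_ne hS] at e
      rw [e]
      have e2 : (excDag ⟨A, 0⟩ : Module.End ℂ (FinVec M)) = dn A (-1) := by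
        simp [dn, modeIdx, hr]
      have e3 := LinearMap.congr_fun (dn_mul_dd_self A (-1)) (fs S)
      rw [LinearMap.add_apply, Module.End.mul_apply, Module.End.mul_apply,
        (isVac_fs hS).2 _ (by omega), map_zero, zero_add] at e3
      rw [e2, units_ne hr, Units.val_neg, Units.val_one, zero_add]
      exact e3
    have h2 := congrArg (kleinInvFin A) h1
    rw [← Module.End.mul_apply, kleinInvFin_mul] at h2
    exact h2.symm

theorem down_fs {A : Flavor M} {S : Finset (Mode M)} (hS : ∀ i ∈ S, i.flavor ≠ A) :
    down A (fs S) = dn A (-1) (fs S) := by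
  have e := LinearMap.congr_fun (up_mul_dn A (-1)) (fs S)
  rw [Module.End.mul_apply, Module.End.mul_apply, up_fs hS, neg_add_cancel] at e
  have e3 := LinearMap.congr_fun (dn_mul_dd_self A 0) (fs S)
  rw [LinearMap.add_apply, Module.End.mul_apply, Module.End.mul_apply,
    (isVac_fs hS).1 _ le_rfl, map_zero, add_zero] at e3
  rw [e3] at e
  have h2 := congrArg (down A) e
  rw [← Module.End.mul_apply, down_mul_up] at h2
  exact h2.symm

end Shift

/-! ### States generated by the densities from the charged vacua -/

section Spanning

variable {M : ℕ}

/-- The states with lowest energy for their charge of flavor `A`: shifts of states without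
excitations of flavor `A`. -/
inductive IsLowest (A : Flavor M) : ℤ → FinVec M → Prop
  | fs {S : Finset (Mode M)} (hS : ∀ i ∈ S, i.flavor ≠ A) : IsLowest A 0 (fs S)
  | up {N : ℤ} {v : FinVec M} (hv : IsLowest A N v) : IsLowest A (N + 1) (up A v)
  | down {N : ℤ} {v : FinVec M} (hv : IsLowest A N v) : IsLowest A (N - 1) (down A v)

/-- A sum that is odd under reflection of its index equals its own negative. It removes the terms
with two equal kinds of fermion operators in the two recursions below. -/
theorem reflect_sum {V : Type*} [AddCommGroup V] [Module ℂ V] {f : ℕ → V} {a b : ℕ}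
    (h : ∀ m ∈ Finset.Ico a b, f (a + b - 1 - m) = -f m) : ∑ m ∈ Finset.Ico a b, f m = 0 := by
  have h1 : ∑ m ∈ Finset.Ico a b, f m = ∑ m ∈ Finset.Ico a b, f (a + b - 1 - m) := by
    refine Finset.sum_bij' (fun m _ => a + b - 1 - m) (fun m _ => a + b - 1 - m) ?_ ?_ ?_ ?_ ?_
    all_goals
      intro m hm
      rw [Finset.mem_Ico] at hm
    · rw [Finset.mem_Ico]
      omega
    · rw [Finset.mem_Ico]
      omega
    · omega
    · omega
    · congr 1
      omega
  have h2 : ∑ m ∈ Finset.Ico a b, f m = -∑ m ∈ Finset.Ico a b, f m := by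
    rw [← Finset.sum_neg_distrib, ← Finset.sum_congr rfl h, ← h1]
  have h3 : (2 : ℂ) • ∑ m ∈ Finset.Ico a b, f m = 0 := by
    rw [two_smul]
    nth_rw 1 [h2]
    exact neg_add_cancel _
  exact (smul_eq_zero.1 h3).resolve_left two_ne_zero

/-- Each commutator of ρ(-m) with a fermion operator contributes one copy of the left side. The
remaining terms come from the pairs that ρ(-m) creates; they contain a product of two `dn` that the
reflection m ↦ l + 1 + k - m interchanges, so they cancel. As for the Newton identities, the vector
is determined by densities acting on its predecessors. -/
theorem dn_vac_recursion (A : Flavor M) {v : FinVec M} (hv : IsVac A v) (k : ℕ) :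
    (k : ℂ) • dn A (-1 - k) v =
      -∑ m ∈ Finset.Ico 1 (k + 1), rho A (-(m : ℤ)) (dn A (-1 - k + m) v) := by
  have h1 : ∀ m ∈ Finset.Ico 1 (k + 1), rho A (-(m : ℤ)) (dn A (-1 - k + m) v) =
      -∑ l ∈ Finset.range k, (if l < m then dd A l (dn A (-1 - k + m) (dn A (l - m) v)) else 0) -
        dn A (-1 - k) v := by
    intro m hm
    rw [Finset.mem_Ico] at hm
    have e := LinearMap.congr_fun (rho_mul_dn_self A (-m) (-1 - k + m)) v
    rw [LinearMap.sub_apply, Module.End.mul_apply, Module.End.mul_apply, add_neg_cancel_right,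
      rho_neg_vac A hv, map_sum] at e
    rw [e, ← Finset.sum_filter]
    congr 1
    rw [← Finset.sum_neg_distrib]
    have : Finset.filter (fun l => l < m) (Finset.range k) = Finset.range m := by
      ext l
      simp only [Finset.mem_filter, Finset.mem_range]
      omega
    rw [this]
    refine Finset.sum_congr rfl fun l _ => ?_
    have e := LinearMap.congr_fun
      (dn_mul_dd_eq (A := A) (B := A) (n := -1 - k + m) (m := l) (by omega)) (dn A (l - m) v)
    exact e
  rw [Finset.sum_congr rfl h1, Finset.sum_sub_distrib, Finset.sum_neg_distrib, Finset.sum_comm]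
  have h2 : ∀ l ∈ Finset.range k, ∑ m ∈ Finset.Ico 1 (k + 1),
      (if l < m then dd A l (dn A (-1 - k + m) (dn A (l - m) v)) else 0) = 0 := by
    intro l hl
    rw [Finset.mem_range] at hl
    rw [← Finset.sum_filter]
    have : Finset.filter (fun m => l < m) (Finset.Ico 1 (k + 1)) = Finset.Ico (l + 1) (k + 1) := by
      ext m
      simp only [Finset.mem_filter, Finset.mem_Ico]
      omega
    rw [this]
    refine reflect_sum fun m hm => ?_
    rw [Finset.mem_Ico] at hm
    have c : ((l + 1 + (k + 1) - 1 - m : ℕ) : ℤ) = l + 1 + k - m := by omega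
    rw [c, ← map_neg]
    congr 1
    rw [show -1 - (k : ℤ) + (l + 1 + k - m) = l - m by ring,
      show (l : ℤ) - (l + 1 + k - m) = -1 - k + m by ring]
    exact LinearMap.congr_fun (dn_mul_dn_eq A A (l - m) (-1 - k + m)) v
  rw [Finset.sum_eq_zero h2, Finset.sum_const, Nat.card_Ico]
  simp [Nat.cast_smul_eq_nsmul]

/-- The particle version of the previous recursion, of the same form as k h_k = ∑ p_m h_{k-m} for
complete symmetric polynomials. Writing the pairs by the depth j of the hole makes the reflection
exchange the two `dd`. -/
theorem dd_vac_recursion (A : Flavor M) {v : FinVec M} (hv : IsVac A v) (k : ℕ) :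
    (k : ℂ) • dd A k v = ∑ m ∈ Finset.Ico 1 (k + 1), rho A (-(m : ℤ)) (dd A (k - m) v) := by
  have h1 : ∀ m ∈ Finset.Ico 1 (k + 1), rho A (-(m : ℤ)) (dd A (k - m) v) =
      ∑ j ∈ Finset.Ico 1 (k + 1),
        (if j ≤ m then dd A (k - m) (dd A (m - j) (dn A (-j) v)) else 0) + dd A k v := by
    intro m hm
    rw [Finset.mem_Ico] at hm
    have e := LinearMap.congr_fun (rho_mul_dd_self A (-m) (k - m)) v
    rw [LinearMap.add_apply, Module.End.mul_apply, Module.End.mul_apply, sub_neg_eq_add,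
      sub_add_cancel, rho_neg_vac A hv, map_sum] at e
    rw [e, ← Finset.sum_filter]
    congr 1
    refine Finset.sum_bij' (fun l _ => m - l) (fun j _ => m - j) ?_ ?_ ?_ ?_ ?_
    · intro l hl
      simp only [Finset.mem_filter, Finset.mem_Ico, Finset.mem_range] at hl ⊢
      omega
    · intro l hl
      simp only [Finset.mem_filter, Finset.mem_Ico, Finset.mem_range] at hl ⊢
      omega
    · intro l hl
      simp only [Finset.mem_range] at hl
      omega
    · intro l hl
      simp only [Finset.mem_filter, Finset.mem_Ico] at hl
      omega
    · intro l hl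
      simp only [Finset.mem_range] at hl
      rw [show (m : ℤ) - ((m - l : ℕ) : ℤ) = l by omega,
        show -((m - l : ℕ) : ℤ) = l - m by omega]
  rw [Finset.sum_congr rfl h1, Finset.sum_add_distrib, Finset.sum_comm]
  have h2 : ∀ j ∈ Finset.Ico 1 (k + 1), ∑ m ∈ Finset.Ico 1 (k + 1),
      (if j ≤ m then dd A (k - m) (dd A (m - j) (dn A (-j) v)) else 0) = 0 := by
    intro j hj
    rw [Finset.mem_Ico] at hj
    rw [← Finset.sum_filter]
    have : Finset.filter (fun m => j ≤ m) (Finset.Ico 1 (k + 1)) = Finset.Ico j (k + 1) := by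
      ext m
      simp only [Finset.mem_filter, Finset.mem_Ico]
      omega
    rw [this]
    refine reflect_sum fun m hm => ?_
    rw [Finset.mem_Ico] at hm
    have c : ((j + (k + 1) - 1 - m : ℕ) : ℤ) = j + k - m := by omega
    rw [c]
    rw [show (k : ℤ) - (j + k - m) = m - j by ring, show (j : ℤ) + k - m - j = k - m by ring]
    exact LinearMap.congr_fun (dd_mul_dd_eq A A (m - j) (k - m)) (dn A (-j) v)
  rw [Finset.sum_eq_zero h2, Finset.sum_const, Nat.card_Ico]
  simp [Nat.cast_smul_eq_nsmul]

/-- The smallest subspace that contains the lowest states and is invariant under the densities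
with `m < 0`. -/
noncomputable def bosonSpan (A : Flavor M) : Submodule ℂ (FinVec M) :=
  sInf {W | (∀ N v, IsLowest A N v → v ∈ W) ∧ ∀ m : ℤ, m < 0 → ∀ v ∈ W, rho A m v ∈ W}

theorem bosonSpan_le {A : Flavor M} {W : Submodule ℂ (FinVec M)}
    (h1 : ∀ N v, IsLowest A N v → v ∈ W) (h2 : ∀ m : ℤ, m < 0 → ∀ v ∈ W, rho A m v ∈ W) :
    bosonSpan A ≤ W := sInf_le ⟨h1, h2⟩

theorem mem_bosonSpan_of_isLowest {A : Flavor M} {N : ℤ} {v : FinVec M} (h : IsLowest A N v) :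
    v ∈ bosonSpan A := by
  rw [bosonSpan, Submodule.mem_sInf]
  exact fun W hW => hW.1 N v h

theorem rho_mem_bosonSpan {A : Flavor M} {m : ℤ} (hm : m < 0) {v : FinVec M}
    (h : v ∈ bosonSpan A) : rho A m v ∈ bosonSpan A := by
  rw [bosonSpan, Submodule.mem_sInf] at h ⊢
  exact fun W hW => hW.2 m hm v (h W hW)

theorem up_mem_bosonSpan {A : Flavor M} {v : FinVec M} (h : v ∈ bosonSpan A) :
    up A v ∈ bosonSpan A := by
  refine bosonSpan_le (W := (bosonSpan A).comap (up A)) ?_ ?_ h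
  · intro N v hv
    exact mem_bosonSpan_of_isLowest hv.up
  · intro m hm v hv
    rw [Submodule.mem_comap, ← Module.End.mul_apply, up_mul_rho A hm.ne]
    exact rho_mem_bosonSpan hm hv

theorem down_mem_bosonSpan {A : Flavor M} {v : FinVec M} (h : v ∈ bosonSpan A) :
    down A v ∈ bosonSpan A := by
  refine bosonSpan_le (W := (bosonSpan A).comap (down A)) ?_ ?_ h
  · intro N v hv
    exact mem_bosonSpan_of_isLowest hv.down
  · intro m hm v hv
    rw [Submodule.mem_comap, ← Module.End.mul_apply, down_mul_rho A hm.ne]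
    exact rho_mem_bosonSpan hm hv

/-- Strong induction on the depth k of the hole: the recursion gives k times the vector, and k is
invertible. The base case is a shifted vacuum. -/
theorem dn_vac_mem_bosonSpan {A : Flavor M} {S : Finset (Mode M)} (hS : ∀ i ∈ S, i.flavor ≠ A)
    (n : ℤ) : dn A n (fs S) ∈ bosonSpan A := by
  rcases le_or_gt 0 n with h | h
  · rw [(isVac_fs hS).1 n h]
    exact Submodule.zero_mem _
  · obtain ⟨k, rfl⟩ : ∃ k : ℕ, n = -1 - k := ⟨(-1 - n).toNat, by omega⟩
    clear h
    induction k using Nat.strong_induction_on with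
    | _ k ih =>
      rcases Nat.eq_zero_or_pos k with rfl | hk
      · have := mem_bosonSpan_of_isLowest (IsLowest.fs hS).down
        rw [down_fs hS] at this
        simpa using this
      · have hk' : (k : ℂ) ≠ 0 := by exact_mod_cast hk.ne'
        rw [← (bosonSpan A).smul_mem_iff hk', dn_vac_recursion A (isVac_fs hS)]
        refine Submodule.neg_mem _ (Submodule.sum_mem _ fun m hm => ?_)
        rw [Finset.mem_Ico] at hm
        refine rho_mem_bosonSpan (by omega) ?_
        have := ih (k - m) (by omega)
        rwa [show (-1 : ℤ) - ((k - m : ℕ) : ℤ) = -1 - k + m by omega] at this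

theorem dd_vac_mem_bosonSpan {A : Flavor M} {S : Finset (Mode M)} (hS : ∀ i ∈ S, i.flavor ≠ A)
    (n : ℤ) : dd A n (fs S) ∈ bosonSpan A := by
  rcases lt_or_ge n 0 with h | h
  · rw [(isVac_fs hS).2 n h]
    exact Submodule.zero_mem _
  · lift n to ℕ using h
    induction n using Nat.strong_induction_on with
    | _ k ih =>
      rcases Nat.eq_zero_or_pos k with rfl | hk
      · have := mem_bosonSpan_of_isLowest (IsLowest.fs hS).up
        rw [up_fs hS] at this
        simpa using this
      · have hk' : (k : ℂ) ≠ 0 := by exact_mod_cast hk.ne'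
        rw [← (bosonSpan A).smul_mem_iff hk', dd_vac_recursion A (isVac_fs hS)]
        refine Submodule.sum_mem _ fun m hm => ?_
        rw [Finset.mem_Ico] at hm
        refine rho_mem_bosonSpan (by omega) ?_
        have := ih (k - m) (by omega)
        rwa [show ((k - m : ℕ) : ℤ) = k - m by omega] at this

/-- The shifts preserve the span and conjugate fermion operators into one another, which reduces the
charged vacua to states without excitations of flavor A. -/
theorem dn_lowest_mem_bosonSpan {A : Flavor M} {N : ℤ} {v : FinVec M} (h : IsLowest A N v) :
    ∀ n, dn A n v ∈ bosonSpan A := by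
  induction h with
  | fs hS => exact dn_vac_mem_bosonSpan hS
  | @up N v hv ih =>
    intro n
    have := up_mem_bosonSpan (ih (n - 1))
    rwa [← Module.End.mul_apply, up_mul_dn, sub_add_cancel] at this
  | @down N v hv ih =>
    intro n
    have := down_mem_bosonSpan (ih (n + 1))
    rwa [← Module.End.mul_apply, down_mul_dn, add_sub_cancel_right] at this

theorem dd_lowest_mem_bosonSpan {A : Flavor M} {N : ℤ} {v : FinVec M} (h : IsLowest A N v) :
    ∀ n, dd A n v ∈ bosonSpan A := by
  induction h with
  | fs hS => exact dd_vac_mem_bosonSpan hS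
  | @up N v hv ih =>
    intro n
    have := up_mem_bosonSpan (ih (n - 1))
    rwa [← Module.End.mul_apply, up_mul_dd, sub_add_cancel] at this
  | @down N v hv ih =>
    intro n
    have := down_mem_bosonSpan (ih (n + 1))
    rwa [← Module.End.mul_apply, down_mul_dd, add_sub_cancel_right] at this

/-- A commutator of ρ(m) with a fermion operator is again a fermion operator, so the property of
being mapped into the span by all of them is inherited under densities. Membership of the vector
itself is carried along in the induction. -/
theorem dn_mem_bosonSpan {A : Flavor M} {v : FinVec M} (h : v ∈ bosonSpan A) :
    ∀ n, dn A n v ∈ bosonSpan A := by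
  have : bosonSpan A ≤ bosonSpan A ⊓ ⨅ n, (bosonSpan A).comap (dn A n) := by
    refine bosonSpan_le ?_ ?_
    · intro N v hv
      exact ⟨mem_bosonSpan_of_isLowest hv,
        (Submodule.mem_iInf _).2 fun n => dn_lowest_mem_bosonSpan hv n⟩
    · intro m hm v hv
      refine ⟨rho_mem_bosonSpan hm hv.1, (Submodule.mem_iInf _).2 fun n => ?_⟩
      have e := LinearMap.congr_fun (rho_mul_dn_self A m n) v
      rw [LinearMap.sub_apply, Module.End.mul_apply, Module.End.mul_apply, eq_sub_iff_add_eq] at e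
      rw [Submodule.mem_comap, ← e]
      have h2 := (Submodule.mem_iInf _).1 hv.2
      exact Submodule.add_mem _ (rho_mem_bosonSpan hm (h2 n)) (h2 _)
  exact (Submodule.mem_iInf _).1 (this h).2

theorem dd_mem_bosonSpan {A : Flavor M} {v : FinVec M} (h : v ∈ bosonSpan A) :
    ∀ n, dd A n v ∈ bosonSpan A := by
  have : bosonSpan A ≤ bosonSpan A ⊓ ⨅ n, (bosonSpan A).comap (dd A n) := by
    refine bosonSpan_le ?_ ?_
    · intro N v hv
      exact ⟨mem_bosonSpan_of_isLowest hv,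
        (Submodule.mem_iInf _).2 fun n => dd_lowest_mem_bosonSpan hv n⟩
    · intro m hm v hv
      refine ⟨rho_mem_bosonSpan hm hv.1, (Submodule.mem_iInf _).2 fun n => ?_⟩
      have e := LinearMap.congr_fun (rho_mul_dd_self A m n) v
      rw [LinearMap.add_apply, Module.End.mul_apply, Module.End.mul_apply, ← sub_eq_iff_eq_add] at e
      rw [Submodule.mem_comap, ← e]
      have h2 := (Submodule.mem_iInf _).1 hv.2
      exact Submodule.sub_mem _ (rho_mem_bosonSpan hm (h2 n)) (h2 _)
  exact (Submodule.mem_iInf _).1 (this h).2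

/-- Completeness of the bosons: all finite vectors are obtained from the lowest states by applying
densities. -/
theorem bosonSpan_eq_top (A : Flavor M) : bosonSpan A = ⊤ := by
  refine FinVec.submodule_eq_top fun S => ?_
  -- Only excitations of flavor A are counted: a state without them is lowest, whatever it contains
  -- of the other flavors.
  induction hn : (S.filter fun i => i.flavor = A).card generalizing S with
  | zero =>
    refine mem_bosonSpan_of_isLowest (IsLowest.fs fun i hi h => ?_)
    rw [Finset.card_eq_zero, Finset.filter_eq_empty_iff] at hn
    exact hn hi h
  | succ k ih =>
    obtain ⟨i, hi⟩ := Finset.card_pos.1 (by omega :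
      0 < (S.filter fun i => i.flavor = A).card)
    rw [Finset.mem_filter] at hi
    obtain ⟨hiS, rfl⟩ := hi
    have h1 := ih (S.erase i) (by
      rw [Finset.filter_erase, Finset.card_erase_of_mem (by simp [hiS]), hn]
      rfl)
    rw [← Finset.insert_erase hiS, fs_insert (Finset.notMem_erase i S), excDag_eq]
    refine Submodule.smul_mem _ _ ?_
    split_ifs
    · exact dd_mem_bosonSpan h1 _
    · exact dn_mem_bosonSpan h1 _

end Spanning

/-! ### Unbounded operators that act on finite vectors -/

section ActsAs

variable {M : ℕ}

/-- The domain of `T` consists of the finite linear combinations of basis states, on which `T` acts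
as `X`. -/
def ActsAs (T : Fock M →ₗ.[ℂ] Fock M) (X : FinVec M →ₗ[ℂ] Fock M) : Prop :=
  T.domain = finiteStates M ∧ ∀ (u : FinVec M) (h : (u : Fock M) ∈ T.domain), T ⟨u, h⟩ = X u

theorem ActsAs.smul {T : Fock M →ₗ.[ℂ] Fock M} {X : FinVec M →ₗ[ℂ] Fock M} (c : ℂ)
    (h : ActsAs T X) : ActsAs (c • T) (c • X) := by
  refine ⟨h.1, fun u hu => ?_⟩
  rw [LinearPMap.smul_apply, LinearMap.smul_apply, ← h.2 u hu]

theorem ActsAs.add {T T' : Fock M →ₗ.[ℂ] Fock M} {X X' : FinVec M →ₗ[ℂ] Fock M}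
    (h : ActsAs T X) (h' : ActsAs T' X') : ActsAs (T + T') (X + X') := by
  refine ⟨by rw [LinearPMap.add_domain, h.1, h'.1, inf_idem], fun u hu => ?_⟩
  rw [LinearPMap.add_apply, LinearMap.add_apply]
  exact congrArg₂ (· + ·) (h.2 u _) (h'.2 u _)

/-- An empty sum is the zero operator on the whole space, whose domain is too large; hence the
nonemptiness. -/
theorem ActsAs.sum {ι : Type*} {s : Finset ι} (hs : s.Nonempty) {T : ι → Fock M →ₗ.[ℂ] Fock M}
    {X : ι → FinVec M →ₗ[ℂ] Fock M} (h : ∀ i ∈ s, ActsAs (T i) (X i)) :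
    ActsAs (∑ i ∈ s, T i) (∑ i ∈ s, X i) := by
  classical
  induction hs using Finset.Nonempty.cons_induction with
  | singleton i => simpa using h
  | cons i s hi hs ih =>
    rw [Finset.sum_cons, Finset.sum_cons]
    exact (h i (by simp)).add (ih fun j hj => h j (by simp [hj]))

/-- One index suffices to confine the domain to the finite states, and convergence on every finite
state fills it. An empty series would be defined everywhere. -/
theorem ActsAs.seriesOp {ι : Type*} [Nonempty ι] {T : ι → Fock M →ₗ.[ℂ] Fock M}
    {X : ι → FinVec M →ₗ[ℂ] Fock M} {Y : FinVec M →ₗ[ℂ] Fock M} (h : ∀ i, ActsAs (T i) (X i))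
    (hs : ∀ u, HasSum (fun i => X i u) (Y u)) : ActsAs (seriesOp T) Y := by
  have hd : ∀ (u : FinVec M) (i : ι), (u : Fock M) ∈ (T i).domain := fun u i => by
    rw [(h i).1]
    exact u.mem
  refine ⟨?_, fun u hu => ?_⟩
  · ext v
    constructor
    · rintro ⟨hv, -⟩
      rw [← (h (Classical.arbitrary ι)).1]
      exact hv _
    · intro hv
      refine ⟨hd (FinVec.mk v hv), (hs (FinVec.mk v hv)).summable.congr fun i => ?_⟩
      exact ((h i).2 (FinVec.mk v hv) _).symm
  · rw [← (hs u).tsum_eq]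
    exact tsum_congr fun i => (h i).2 u _

theorem ActsAs.congr {T : Fock M →ₗ.[ℂ] Fock M} {X Y : FinVec M →ₗ[ℂ] Fock M}
    (h : ActsAs T X) (hXY : X = Y) : ActsAs T Y := hXY ▸ h

theorem actsAs_toPMap (B : Fock M →L[ℂ] Fock M) :
    ActsAs (LinearMap.toPMap (B : Fock M →ₗ[ℂ] Fock M) (finiteStates M))
      ((B : Fock M →ₗ[ℂ] Fock M) ∘ₗ FinVec.incl M) :=
  ⟨rfl, fun _ _ => rfl⟩

theorem ActsAs.mem_graph_iff {T : Fock M →ₗ.[ℂ] Fock M} {X : FinVec M →ₗ[ℂ] Fock M}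
    (h : ActsAs T X) (v w : Fock M) :
    (v, w) ∈ T.graph ↔ ∃ u : FinVec M, (u : Fock M) = v ∧ X u = w := by
  rw [LinearPMap.mem_graph_iff]
  constructor
  · rintro ⟨⟨y, hy⟩, rfl, rfl⟩
    have hy' := hy
    rw [h.1] at hy'
    exact ⟨FinVec.mk y hy', rfl, (h.2 (FinVec.mk y hy') hy).symm⟩
  · rintro ⟨u, rfl, rfl⟩
    have hu : (u : Fock M) ∈ T.domain := by
      rw [h.1]
      exact u.mem
    exact ⟨⟨u, hu⟩, rfl, h.2 u hu⟩

end ActsAs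

/-! ### Sums over the momenta of the lattice -/

section LatticeSums

theorem exp_two_pi_eq_one_iff {M : ℕ} (hM : 0 < M) (d : ℤ) :
    Complex.exp (2 * Real.pi * Complex.I * (d / M : ℂ)) = 1 ↔ (M : ℤ) ∣ d := by
  have hM' : (M : ℂ) ≠ 0 := by exact_mod_cast hM.ne'
  rw [Complex.exp_eq_one_iff]
  constructor
  · rintro ⟨n, hn⟩
    have h1 : (d / M : ℂ) = n := by
      have h2 : (2 * Real.pi * Complex.I : ℂ) ≠ 0 := Complex.two_pi_I_ne_zero
      refine mul_left_cancel₀ h2 ?_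
      rw [hn]
      ring
    rw [div_eq_iff hM'] at h1
    exact ⟨n, by exact_mod_cast (by rw [h1]; ring : (d : ℂ) = M * n)⟩
  · rintro ⟨n, rfl⟩
    refine ⟨n, ?_⟩
    push_cast
    field_simp

/-- A full period of powers of an M-th root of unity, which differs from 1 unless d = 0 because |d|
< M. -/
theorem sum_exp_range {M : ℕ} (hM : 0 < M) (lo d : ℤ) (hd : |d| < M) :
    ∑ j ∈ Finset.range M, Complex.exp (2 * Real.pi * Complex.I * (((lo + j : ℤ) : ℂ) * d / M)) =
      if d = 0 then (M : ℂ) else 0 := by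
  split_ifs with h
  · subst h
    simp
  · have hM' : (M : ℂ) ≠ 0 := by exact_mod_cast hM.ne'
    set ζ := Complex.exp (2 * Real.pi * Complex.I * (d / M : ℂ)) with hζ
    have h1 : ζ ≠ 1 := fun h1 => by
      have := Int.eq_zero_of_abs_lt_dvd ((exp_two_pi_eq_one_iff hM d).1 h1) hd
      exact h this
    have h2 : ζ ^ M = 1 := by
      rw [hζ, ← Complex.exp_nat_mul, Complex.exp_eq_one_iff]
      exact ⟨d, by field_simp⟩
    have h3 : ∀ j ∈ Finset.range M,
        Complex.exp (2 * Real.pi * Complex.I * (((lo + j : ℤ) : ℂ) * d / M)) =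
          Complex.exp (2 * Real.pi * Complex.I * (lo * d / M : ℂ)) * ζ ^ j := by
      intro j _
      rw [hζ, ← Complex.exp_nat_mul, ← Complex.exp_add]
      congr 1
      push_cast
      ring
    rw [Finset.sum_congr rfl h3, ← Finset.mul_sum, geom_sum_eq h1, h2, sub_self, zero_div, mul_zero]

theorem sum_subtype_eq_range {M : ℕ} {s : Finset ℤ} {lo : ℤ} (hs : ∀ n, n ∈ s ↔ lo ≤ n ∧ n < lo + M)
    (f : ℤ → ℂ) : ∑ n : {n : ℤ // n ∈ s}, f n = ∑ j ∈ Finset.range M, f (lo + j) := by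
  rw [Finset.sum_coe_sort s f]
  refine (Finset.sum_bij' (fun (j : ℕ) _ => lo + (j : ℤ)) (fun n _ => (n - lo).toNat)
    ?_ ?_ ?_ ?_ ?_).symm
  · intro j hj
    rw [Finset.mem_range] at hj
    rw [hs]
    omega
  · intro n hn
    rw [hs] at hn
    rw [Finset.mem_range]
    omega
  · intro j _
    omega
  · intro n hn
    rw [hs] at hn
    omega
  · intro j _
    rfl

/-- Both cells are windows of M consecutive integers for either parity of M, so they represent the
residues modulo M. -/
theorem mem_cell_iff {M : ℕ} (n : ℤ) :
    (n ∈ (Finset.Icc (-(M : ℤ)) M).filter fun n => -(M : ℤ) ≤ 2 * n ∧ 2 * n < M) ↔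
      -((M / 2 : ℕ) : ℤ) ≤ n ∧ n < -((M / 2 : ℕ) : ℤ) + M := by
  rw [Finset.mem_filter, Finset.mem_Icc]
  omega

theorem mem_halfCell_iff {M : ℕ} (n : ℤ) :
    (n ∈ (Finset.Icc (-(M : ℤ) - 1) M).filter fun n => -(M : ℤ) ≤ 2 * n + 1 ∧ 2 * n + 1 < M) ↔
      -(((M + 1) / 2 : ℕ) : ℤ) ≤ n ∧ n < -(((M + 1) / 2 : ℕ) : ℤ) + M := by
  rw [Finset.mem_filter, Finset.mem_Icc]
  omega

theorem cell_abs_sub_lt {M : ℕ} (x y : Cell M) : |(x : ℤ) - y| < M := by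
  have hx := (mem_cell_iff (M := M) x).1 x.2
  have hy := (mem_cell_iff (M := M) y).1 y.2
  rw [abs_lt]
  omega

theorem sum_cell_exp {M : ℕ} (hM : 0 < M) (d : ℤ) (hd : |d| < M) :
    ∑ p : Cell M, Complex.exp (2 * Real.pi * Complex.I * (((p : ℤ) : ℂ) * d / M)) =
      if d = 0 then (M : ℂ) else 0 := by
  rw [sum_subtype_eq_range (fun n => mem_cell_iff n)
    (fun n => Complex.exp (2 * Real.pi * Complex.I * ((n : ℂ) * d / M)))]
  exact sum_exp_range hM _ d hd

theorem sum_halfCell_exp {M : ℕ} (hM : 0 < M) (d : ℤ) (hd : |d| < M) :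
    ∑ p : HalfCell M, Complex.exp (2 * Real.pi * Complex.I * ((((p : ℤ) : ℂ) + 1 / 2) * d / M)) =
      if d = 0 then (M : ℂ) else 0 := by
  have h : ∀ p : HalfCell M,
      Complex.exp (2 * Real.pi * Complex.I * ((((p : ℤ) : ℂ) + 1 / 2) * d / M)) =
      Complex.exp (2 * Real.pi * Complex.I * (1 / 2 * d / M : ℂ)) *
        Complex.exp (2 * Real.pi * Complex.I * (((p : ℤ) : ℂ) * d / M)) := by
    intro p
    rw [← Complex.exp_add]
    congr 1
    ring
  rw [Finset.sum_congr rfl fun p _ => h p, ← Finset.mul_sum,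
    sum_subtype_eq_range (fun n => mem_halfCell_iff n)
      (fun n => Complex.exp (2 * Real.pi * Complex.I * ((n : ℂ) * d / M))),
    sum_exp_range hM _ d hd]
  split_ifs with h0
  · subst h0
    simp
  · rw [mul_zero]

theorem cell_nonempty {M : ℕ} (hM : 0 < M) : Nonempty (Cell M) :=
  ⟨⟨0, by rw [mem_cell_iff]; omega⟩⟩

theorem halfCell_nonempty {M : ℕ} (hM : 0 < M) : Nonempty (HalfCell M) :=
  ⟨⟨-1, by rw [mem_halfCell_iff]; omega⟩⟩

/-- Every integer is equal modulo `M` to a unique element of `HalfCell M`. -/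
theorem exists_halfCell {M : ℕ} (hM : 0 < M) (m : ℤ) :
    ∃ q : HalfCell M × ℤ, ∀ (m' : HalfCell M) (n : ℤ), m = m' + M * n ↔ (m', n) = q := by
  set lo : ℤ := -(((M + 1) / 2 : ℕ) : ℤ) with hlo
  have hM0 : (0 : ℤ) < M := by exact_mod_cast hM
  have hmod1 := Int.emod_nonneg (m - lo) hM0.ne'
  have hmod2 := Int.emod_lt_of_pos (m - lo) hM0
  have hdiv := Int.emod_add_mul_ediv (m - lo) M
  refine ⟨(⟨lo + (m - lo) % M, (mem_halfCell_iff _).2 ⟨by omega, by omega⟩⟩, (m - lo) / M), ?_⟩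
  intro m' n
  have hm' := (mem_halfCell_iff (m' : ℤ)).1 m'.2
  rw [← hlo] at hm'
  rw [Prod.mk.injEq, Subtype.ext_iff]
  constructor
  · intro h
    have e : m - lo = (m' - lo) + M * n := by omega
    have h1 : (m - lo) % M = m' - lo := by
      rw [e, Int.add_mul_emod_self_left, Int.emod_eq_of_lt (by omega) (by omega)]
    have h2 : (m - lo) / M = n := by
      rw [e, Int.add_mul_ediv_left _ _ hM0.ne', Int.ediv_eq_zero_of_lt (by omega) (by omega),
        zero_add]
    refine ⟨?_, h2.symm⟩
    simp only
    omega
  · rintro ⟨h1, h2⟩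
    simp only at h1
    rw [h1, h2]
    omega

end LatticeSums

/-! ### The densities on finite vectors -/

section Densities

variable {M : ℕ}

/-- The normal ordered bilinear in the fermions of the flavors `A` and `B`. -/
noncomputable def bilin (A B : Flavor M) (l l' : ℤ) : Module.End ℂ (FinVec M) :=
  dd A l * dn B l' - (if A = B ∧ l = l' ∧ l < 0 then (1 : ℂ) else 0) • 1

theorem bilin_self (A : Flavor M) (l m : ℤ) : bilin A A l (l + m) = rhoTerm A m l := by
  rw [bilin, rhoTerm]
  congr 2
  have : (A = A ∧ l = l + m ∧ l < 0) ↔ (m = 0 ∧ l < 0) := by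
    constructor
    · rintro ⟨-, h1, h2⟩
      exact ⟨by omega, h2⟩
    · rintro ⟨h1, h2⟩
      exact ⟨rfl, by omega, h2⟩
  exact if_congr this rfl rfl

theorem inner_vacuum_bilinear (A B : Flavor M) (l l' : ℤ) :
    ⟪fs ∅, dd A l (dn B l' (fs ∅))⟫_ℂ = if A = B ∧ l = l' ∧ l < 0 then (1 : ℂ) else 0 := by
  rcases le_or_gt 0 l with h | h
  · rw [if_neg (by omega), ← isAdj_dn, (isVac_vacuum A).1 l h, inner_zero_left]
  · by_cases h' : A = B ∧ l = l'
    · obtain ⟨rfl, rfl⟩ := h'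
      have e := LinearMap.congr_fun (dn_mul_dd_self A l) (fs ∅)
      rw [LinearMap.add_apply, Module.End.mul_apply, Module.End.mul_apply,
        (isVac_vacuum A).2 l h, map_zero, zero_add] at e
      rw [e, if_pos ⟨rfl, rfl, h⟩, Module.End.one_apply, inner_fs, if_pos rfl]
    · rw [if_neg (by tauto)]
      have h2 : ¬(B = A ∧ l' = l) := fun h2 => h' ⟨h2.1.symm, h2.2.symm⟩
      have e := LinearMap.congr_fun (dn_mul_dd_of_ne h2) (fs ∅)
      rw [LinearMap.add_apply, Module.End.mul_apply, Module.End.mul_apply,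
        (isVac_vacuum A).2 l h, map_zero, zero_add] at e
      rw [e]
      simp

theorem bilin_apply_eq_zero (A B : Flavor M) {l l' k : ℤ} {v : FinVec M} (hv : v ∈ energyLE M k)
    (hk : 0 ≤ k) (hl : k < 2 * l' + 1 ∧ 0 ≤ l ∨ 2 * l + 1 < -k) : bilin A B l l' v = 0 := by
  rcases hl with ⟨h, h0⟩ | h
  · rw [bilin, if_neg (by omega), zero_smul, sub_zero, Module.End.mul_apply,
      eq_zero_of_mem_energyLE (by omega) (dn_mem_energyLE B l' hv), map_zero]
  · have hz := eq_zero_of_mem_energyLE (by omega) (dd_mem_energyLE A l hv)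
    rw [bilin]
    by_cases h' : A = B ∧ l = l'
    · obtain ⟨rfl, rfl⟩ := h'
      rw [if_pos ⟨rfl, rfl, by omega⟩, one_smul, ← dn_mul_dd_self A l]
      simp [hz]
    · have h2 : ¬(B = A ∧ l' = l) := fun h2 => h' ⟨h2.1.symm, h2.2.symm⟩
      have e := LinearMap.congr_fun (dn_mul_dd_of_ne h2) v
      rw [LinearMap.add_apply, Module.End.mul_apply, hz, map_zero, zero_add] at e
      rw [if_neg (by tauto), zero_smul, sub_zero, e, LinearMap.zero_apply]

theorem normalOrder_add (X Y : Fock M →L[ℂ] Fock M) :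
    normalOrder (X + Y) = normalOrder X + normalOrder Y := by
  simp only [normalOrder, add_apply, inner_add_right, add_smul]
  abel

theorem normalOrder_smul (c : ℂ) (X : Fock M →L[ℂ] Fock M) :
    normalOrder (c • X) = c • normalOrder X := by
  simp only [normalOrder, smul_apply, inner_smul_right, mul_smul, smul_sub]

theorem normalOrder_zero : normalOrder (0 : Fock M →L[ℂ] Fock M) = 0 := by
  simp [normalOrder]

theorem normalOrder_sum {ι : Type*} (s : Finset ι) (X : ι → Fock M →L[ℂ] Fock M) :
    normalOrder (∑ i ∈ s, X i) = ∑ i ∈ s, normalOrder (X i) := by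
  classical
  induction s using Finset.induction_on with
  | empty => simp [normalOrder_zero]
  | insert i s hi ih => rw [Finset.sum_insert hi, Finset.sum_insert hi, normalOrder_add, ih]

theorem normalOrder_fermionC (A B : Flavor M) (n n' : ℤ) (u : FinVec M) :
    normalOrder ((ContinuousLinearMap.adjoint (fermionC A n)).comp (fermionC B n')) (u : Fock M) =
      (bilin A B (modeIdx A n) (modeIdx B n') u : FinVec M) := by
  have h : ∀ v : FinVec M, ((ContinuousLinearMap.adjoint (fermionC A n)).comp (fermionC B n'))
      (v : Fock M) = (dd A (modeIdx A n) (dn B (modeIdx B n') v) : FinVec M) := by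
    intro v
    rw [coe_dd_modeIdx, coe_dn_modeIdx]
    rfl
  have h0 : (vacuum M : Fock M) = (fs ∅ : FinVec M) := rfl
  rw [normalOrder, sub_apply, smul_apply, h0, h, h,
    FinVec.inner_coe, inner_vacuum_bilinear, bilin]
  rfl

theorem adjoint_sum {ι : Type*} (s : Finset ι) (X : ι → Fock M →L[ℂ] Fock M) :
    ContinuousLinearMap.adjoint (∑ i ∈ s, X i) = ∑ i ∈ s, ContinuousLinearMap.adjoint (X i) :=
  map_sum ContinuousLinearMap.adjoint X s

/-- The phase `e^{-i k x}` with `k = (2π/L)(m + 1/2)`, `L = M a`. -/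
noncomputable def sitePhase (L a : ℝ) {M : ℕ} (m : ℤ) (x : Cell M) : ℂ :=
  Complex.exp (-Complex.I * ((fermiK L m * sitePos a x : ℝ) : ℂ))

theorem normalOrder_psiHat (L a : ℝ) (r s α β : ℤˣ) (k k' : FermiMom M) (u : FinVec M) :
    normalOrder ((ContinuousLinearMap.adjoint (psiHat L a r s α k)).comp (psiHat L a r s β k'))
      (u : Fock M) =
    (((L / (2 * Real.pi) * √(a / L)) ^ 2 : ℝ) : ℂ) • ∑ x : Cell M, ∑ y : Cell M,
      (starRingEnd ℂ (sitePhase L a k.2 x) * sitePhase L a k'.2 y) •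
        ((bilin ⟨r, s, α, x⟩ ⟨r, s, β, y⟩ (modeIdx ⟨r, s, α, x⟩ k.1) (modeIdx ⟨r, s, β, y⟩ k'.1) u :
          FinVec M) : Fock M) := by
  have h1 : (ContinuousLinearMap.adjoint (psiHat L a r s α k)).comp (psiHat L a r s β k') =
      (((L / (2 * Real.pi) * √(a / L)) ^ 2 : ℝ) : ℂ) • ∑ x : Cell M, ∑ y : Cell M,
      (starRingEnd ℂ (sitePhase L a k.2 x) * sitePhase L a k'.2 y) •
        (ContinuousLinearMap.adjoint (fermionC ⟨r, s, α, x⟩ k.1)).comp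
          (fermionC ⟨r, s, β, y⟩ k'.1) := by
    rw [psiHat, psiHat, map_smulₛₗ, adjoint_sum, ContinuousLinearMap.smul_comp,
      ContinuousLinearMap.comp_smul, smul_smul, Complex.conj_ofReal, ← Complex.ofReal_mul, ← sq]
    congr 1
    rw [ContinuousLinearMap.finsetSum_comp]
    refine Finset.sum_congr rfl fun x _ => ?_
    rw [ContinuousLinearMap.comp_finsetSum]
    refine Finset.sum_congr rfl fun y _ => ?_
    rw [map_smulₛₗ, ContinuousLinearMap.smul_comp, ContinuousLinearMap.comp_smul, smul_smul]
    rfl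
  rw [h1, normalOrder_smul, smul_apply, normalOrder_sum,
    sum_apply]
  congr 1
  refine Finset.sum_congr rfl fun x _ => ?_
  rw [normalOrder_sum, sum_apply]
  refine Finset.sum_congr rfl fun y _ => ?_
  rw [normalOrder_smul, smul_apply, normalOrder_fermionC]

/-- Momentum conservation up to umklapp splits the two site phases into the phase of 𝐩 and a
character of x - y. Summing the latter over the fermion momenta gives δ_{x,y}. -/
theorem sitePhase_mul {L a : ℝ} (ha : 0 < a) (hL : L = M * a) (hM : 0 < M) {m m' p n : ℤ}
    (h : m + p = m' + M * n) (x y : Cell M) :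
    starRingEnd ℂ (sitePhase L a m x) * sitePhase L a m' y =
      Complex.exp (-Complex.I * ((boseK L p * sitePos a y : ℝ) : ℂ)) *
        Complex.exp (2 * Real.pi * Complex.I *
          (((m : ℂ) + 1 / 2) * (((x : ℤ) - (y : ℤ) : ℤ) : ℂ) / M)) := by
  have hM' : (M : ℂ) ≠ 0 := by exact_mod_cast hM.ne'
  have ha' : (a : ℂ) ≠ 0 := by exact_mod_cast ha.ne'
  have hm' : (m' : ℂ) = m + p - M * n := by
    rw [eq_sub_iff_add_eq]
    exact_mod_cast h.symm
  rw [sitePhase, sitePhase, ← Complex.exp_conj, ← Complex.exp_add, ← Complex.exp_add,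
    Complex.exp_eq_exp_iff_exists_int]
  -- An umklapp momentum 2πn/a is invisible at the lattice site a y: its phase is the n y-th power
  -- of e^{2πi}.
  refine ⟨n * (y : ℤ), ?_⟩
  simp only [fermiK, boseK, sitePos, hL]
  simp only [map_mul, map_neg, Complex.conj_I, Complex.conj_ofReal]
  push_cast
  rw [hm']
  field_simp
  ring

/-- The density of flavor `A` with the Fourier label counted in the direction of increasing
momentum. -/
noncomputable def rhoC (A : Flavor M) (m : ℤ) : Module.End ℂ (FinVec M) :=
  rho A (((A.r : ℤˣ) : ℤ) * m)

theorem modeIdx_add (A : Flavor M) (l m : ℤ) :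
    modeIdx A (l + m) = modeIdx A l + ((A.r : ℤˣ) : ℤ) * m := by
  unfold modeIdx
  split_ifs with h
  · rw [h]
    simp
  · rw [units_ne h]
    push_cast
    ring

/-- The involution `modeIdx A` as an equivalence. -/
def modeIdxEquiv (A : Flavor M) : ℤ ≃ ℤ where
  toFun := modeIdx A
  invFun := modeIdx A
  left_inv := modeIdx_modeIdx A
  right_inv := modeIdx_modeIdx A

theorem rhoC_apply (A : Flavor M) (m : ℤ) {u : FinVec M} {s : Finset ℤ}
    (hs : ∀ l ∉ s, bilin A A (modeIdx A l) (modeIdx A (l + m)) u = 0) :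
    rhoC A m u = ∑ l ∈ s, bilin A A (modeIdx A l) (modeIdx A (l + m)) u := by
  have h := (locFin_rhoTerm A (((A.r : ℤˣ) : ℤ) * m)).comp_equiv (modeIdxEquiv A)
  have e : ∀ l, bilin A A (modeIdx A l) (modeIdx A (l + m)) =
      rhoTerm A (((A.r : ℤˣ) : ℤ) * m) (modeIdxEquiv A l) := fun l => by
    rw [modeIdx_add, bilin_self]
    rfl
  simp_rw [e] at hs ⊢
  rw [rhoC, rho, ← lfSum_comp_equiv (locFin_rhoTerm A (((A.r : ℤˣ) : ℤ) * m)) (modeIdxEquiv A),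
    lfSum_apply_eq_sum h hs]

/-- The lattice Fourier transform of the densities. -/
noncomputable def densityFin (L a : ℝ) (r s α : ℤˣ) (p : BoseMom M) : Module.End ℂ (FinVec M) :=
  ∑ x : Cell M, Complex.exp (-Complex.I * ((boseK L p.2 * sitePos a x : ℝ) : ℂ)) •
    rhoC ⟨r, s, α, x⟩ p.1

/-- The window is symmetric, with a margin of 2, so that it also serves the reflected labels -l - 1
of the flavors with r = -. -/
theorem modeIdx_large {A B : Flavor M} (hr : A.r = B.r) {l m k : ℤ} (hk : 0 ≤ k)
    (hl : l ∉ Finset.Icc (-(k + |m| + 2)) (k + |m| + 2)) :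
    k < 2 * modeIdx B (l + m) + 1 ∧ 0 ≤ modeIdx A l ∨ 2 * modeIdx A l + 1 < -k := by
  rw [Finset.mem_Icc, not_and_or] at hl
  have h1 := neg_abs_le m
  have h2 := le_abs_self m
  have h3 := abs_nonneg m
  simp only [modeIdx, hr]
  split_ifs <;> omega

/-- Given 𝐤₁ and 𝐩, both 𝐤₂ and n are determined. The sum over the transversal component of 𝐤₁
forces x = y, leaving one density per site. On a fixed finite vector all but finitely many terms
vanish, so the unconditional convergence required by `seriesOp` is automatic. -/
theorem actsAs_nodalBilinear {L a : ℝ} (ha : 0 < a) (hL : L = M * a) (hM : 0 < M) (f : ℤˣ → ℂ)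
    (r s : ℤˣ) (p : BoseMom M) :
    ActsAs (nodalBilinear L a (Matrix.diagonal f) r s p)
      (∑ α : ℤˣ, f α • (FinVec.incl M ∘ₗ densityFin L a r s α p)) := by
  have hM' : (M : ℂ) ≠ 0 := by exact_mod_cast hM.ne'
  have := halfCell_nonempty hM
  refine ActsAs.seriesOp (fun q => actsAs_toPMap _) fun u => ?_
  choose red hred using exists_halfCell hM
  obtain ⟨k, hk⟩ := exists_mem_energyLE u
  let C : ℂ := ((2 * Real.pi / L) ^ 2 : ℝ) * (((L / (2 * Real.pi) * √(a / L)) ^ 2 : ℝ) : ℂ)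
  -- The measure (2π/L)² cancels (L/2π)² in the fermion operators; the factor a/L = 1/M left over is
  -- compensated by the M transversal momenta.
  have hC : C * M = 1 := by
    have hLpos : 0 < L := by
      rw [hL]
      positivity
    have e : (2 * Real.pi / L) ^ 2 * (L / (2 * Real.pi) * √(a / L)) ^ 2 * M = 1 := by
      rw [mul_pow, Real.sq_sqrt (by positivity)]
      have hMr : (M : ℝ) ≠ 0 := by exact_mod_cast hM.ne'
      rw [hL]
      field_simp
    simp only [C]
    exact_mod_cast e
  let b : ℤˣ → ℤ → Cell M → Cell M → Fock M := fun α l x y =>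
    ((bilin ⟨r, s, α, x⟩ ⟨r, s, α, y⟩ (modeIdx ⟨r, s, α, x⟩ l)
      (modeIdx ⟨r, s, α, y⟩ (l + p.1)) u : FinVec M) : Fock M)
  let g : FermiMom M → Fock M := fun κ => ∑ α : ℤˣ, (f α * C) • ∑ x : Cell M, ∑ y : Cell M,
    (Complex.exp (-Complex.I * ((boseK L p.2 * sitePos a y : ℝ) : ℂ)) *
        Complex.exp (2 * Real.pi * Complex.I *
          ((((κ.2 : ℤ) : ℂ) + 1 / 2) * (((x : ℤ) - (y : ℤ) : ℤ) : ℂ) / M))) • b α κ.1 x y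
  -- The constraint holds exactly on the image of ι, where `red` reduces the transversal momentum
  -- modulo M and records the umklapp integer.
  let ι : FermiMom M → FermiMom M × FermiMom M × ℤ := fun κ =>
    (κ, (κ.1 + p.1, (red (κ.2 + p.2)).1), (red (κ.2 + p.2)).2)
  have hι : Function.Injective ι := fun κ κ' h => congrArg Prod.fst h
  have hg : HasSum g (∑ κ ∈ (Finset.Icc (-(k + |p.1| + 2)) (k + |p.1| + 2)) ×ˢ
      (Finset.univ : Finset (HalfCell M)), g κ) := by
    refine hasSum_sum_of_ne_finset_zero fun κ hκ => ?_
    rw [Finset.mem_product, not_and_or] at hκ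
    have hκ' := hκ.resolve_right (by simp)
    refine Finset.sum_eq_zero fun α _ => ?_
    rw [Finset.sum_eq_zero, smul_zero]
    intro x _
    refine Finset.sum_eq_zero fun y _ => ?_
    have : b α κ.1 x y = 0 := by
      simp only [b]
      rw [bilin_apply_eq_zero ⟨r, s, α, x⟩ ⟨r, s, α, y⟩ hk (by omega)
        (modeIdx_large (A := ⟨r, s, α, x⟩) (B := ⟨r, s, α, y⟩) rfl (by omega) hκ')]
      rfl
    rw [this, smul_zero]
  have hval : (∑ κ ∈ (Finset.Icc (-(k + |p.1| + 2)) (k + |p.1| + 2)) ×ˢ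
      (Finset.univ : Finset (HalfCell M)), g κ) =
      (∑ α : ℤˣ, f α • (FinVec.incl M ∘ₗ densityFin L a r s α p)) u := by
    rw [Finset.sum_product]
    simp only [g]
    have e1 : ∀ l : ℤ, (∑ m : HalfCell M, ∑ α : ℤˣ, (f α * C) • ∑ x : Cell M, ∑ y : Cell M,
        (Complex.exp (-Complex.I * ((boseK L p.2 * sitePos a y : ℝ) : ℂ)) *
        Complex.exp (2 * Real.pi * Complex.I *
          ((((m : ℤ) : ℂ) + 1 / 2) * (((x : ℤ) - (y : ℤ) : ℤ) : ℂ) / M))) • b α l x y) =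
        ∑ α : ℤˣ, f α • ∑ x : Cell M,
          Complex.exp (-Complex.I * ((boseK L p.2 * sitePos a x : ℝ) : ℂ)) • b α l x x := by
      intro l
      rw [Finset.sum_comm]
      refine Finset.sum_congr rfl fun α _ => ?_
      rw [← Finset.smul_sum, mul_smul]
      congr 1
      rw [Finset.sum_comm, Finset.smul_sum]
      refine Finset.sum_congr rfl fun x _ => ?_
      rw [Finset.sum_comm]
      have e2 : ∀ y : Cell M, (∑ m : HalfCell M,
          (Complex.exp (-Complex.I * ((boseK L p.2 * sitePos a y : ℝ) : ℂ)) *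
          Complex.exp (2 * Real.pi * Complex.I *
          ((((m : ℤ) : ℂ) + 1 / 2) * (((x : ℤ) - (y : ℤ) : ℤ) : ℂ) / M))) • b α l x y) =
          if x = y then (Complex.exp (-Complex.I * ((boseK L p.2 * sitePos a y : ℝ) : ℂ)) * M) •
            b α l x y else 0 := by
        intro y
        rw [← Finset.sum_smul, ← Finset.mul_sum, sum_halfCell_exp hM _ (cell_abs_sub_lt x y)]
        by_cases hxy : x = y
        · simp [hxy]
        · have : (x : ℤ) - y ≠ 0 := fun h => hxy (Subtype.ext (by omega))
          simp [hxy, this]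
      rw [Finset.sum_congr rfl fun y _ => e2 y, Finset.sum_ite_eq, if_pos (Finset.mem_univ _),
        smul_smul]
      congr 1
      rw [mul_left_comm, hC, mul_one]
    rw [Finset.sum_congr rfl fun l _ => e1 l, Finset.sum_comm, LinearMap.sum_apply]
    refine Finset.sum_congr rfl fun α _ => ?_
    rw [← Finset.smul_sum, LinearMap.smul_apply]
    congr 1
    rw [Finset.sum_comm, LinearMap.comp_apply, densityFin, LinearMap.sum_apply, map_sum]
    refine Finset.sum_congr rfl fun x _ => ?_
    rw [← Finset.smul_sum, LinearMap.smul_apply, map_smul]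
    congr 1
    rw [rhoC_apply ⟨r, s, α, x⟩ p.1 (u := u)
      (s := Finset.Icc (-(k + |p.1| + 2)) (k + |p.1| + 2)), map_sum]
    · rfl
    · intro l hl
      exact bilin_apply_eq_zero _ _ hk (by omega) (modeIdx_large rfl (by omega) hl)
  rw [← hval]
  refine (hι.hasSum_iff ?_).1 (hg.congr_fun ?_)
  · intro q hq
    have : ¬(q.1.1 + p.1 = q.2.1.1 ∧
        (q.1.2 : ℤ) + (p.2 : ℤ) = (q.2.1.2 : ℤ) + (M : ℤ) * q.2.2) := by
      rintro ⟨h1, h2⟩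
      refine hq ⟨q.1, ?_⟩
      have h3 := (hred _ _ _).1 h2
      simp only [ι, h1, ← h3]
    rw [if_neg this]
    rfl
  · intro κ
    have h0 : κ.1 + p.1 = (ι κ).2.1.1 ∧
        ((κ.2 : ℤ) + (p.2 : ℤ) = ((ι κ).2.1.2 : ℤ) + (M : ℤ) * (ι κ).2.2) :=
      ⟨rfl, (hred _ _ _).2 rfl⟩
    simp only [Function.comp_apply]
    rw [if_pos h0]
    have hphase := fun x y => sitePhase_mul ha hL hM h0.2 x y
    refine Eq.trans (b := ((∑ α : ℤˣ, ∑ β : ℤˣ, (((2 * Real.pi / L) ^ 2 : ℝ) *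
        Matrix.diagonal f α β : ℂ) • normalOrder ((ContinuousLinearMap.adjoint
          (psiHat L a r s α κ)).comp (psiHat L a r s β (ι κ).2.1))) (u : Fock M))) rfl ?_
    rw [sum_apply]
    refine Finset.sum_congr rfl fun α _ => ?_
    rw [Finset.sum_eq_single α, smul_apply, Matrix.diagonal_apply_eq, normalOrder_psiHat, smul_smul]
    · congr 1
      · simp only [C]
        ring
      · refine Finset.sum_congr rfl fun x _ => Finset.sum_congr rfl fun y _ => ?_
        rw [hphase]
    · intro β _ hβ
      rw [Matrix.diagonal_apply_ne' _ hβ, mul_zero, zero_smul]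
    · exact fun h => absurd (Finset.mem_univ _) h

end Densities

/-! ### Exponentials of locally nilpotent operators -/

section LocallyNilpotent

open scoped Nat

variable {V : Type*} [AddCommGroup V] [Module ℂ V]

/-- Every vector is annihilated by a power of the operator. -/
def LocNil (X : Module.End ℂ V) : Prop := ∀ v, ∃ n, (X ^ n) v = 0

theorem pow_apply_eq_zero_of_le {X : Module.End ℂ V} {v : V} {n m : ℕ} (h : (X ^ n) v = 0)
    (hm : n ≤ m) : (X ^ m) v = 0 := by
  obtain ⟨k, rfl⟩ := Nat.exists_eq_add_of_le' hm
  rw [pow_add, Module.End.mul_apply, h, map_zero]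

theorem LocNil.locFin {X : Module.End ℂ V} (h : LocNil X) :
    LocFin fun i : ℕ => ((i ! : ℂ)⁻¹) • X ^ i :=
  locFin_of_finset fun v => by
    obtain ⟨n, hn⟩ := h v
    refine ⟨Finset.range n, fun i hi => ?_⟩
    rw [LinearMap.smul_apply, pow_apply_eq_zero_of_le hn (by simpa using hi), smul_zero]

/-- The exponential series of a locally nilpotent operator. -/
noncomputable def lnExp (X : Module.End ℂ V) : Module.End ℂ V :=
  lfSum fun i : ℕ => ((i ! : ℂ)⁻¹) • X ^ i

theorem lnExp_apply {X : Module.End ℂ V} (h : LocNil X) {v : V} {n : ℕ} (hn : (X ^ n) v = 0) :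
    lnExp X v = ∑ i ∈ Finset.range n, ((i ! : ℂ)⁻¹) • (X ^ i) v := by
  rw [lnExp, lfSum_apply_eq_sum h.locFin (s := Finset.range n)]
  · rfl
  · intro i hi
    rw [LinearMap.smul_apply, pow_apply_eq_zero_of_le hn (by simpa using hi), smul_zero]

theorem lnExp_apply_of_apply_eq_zero {X : Module.End ℂ V} (h : LocNil X) {v : V} (hv : X v = 0) :
    lnExp X v = v := by
  rw [lnExp_apply h (n := 1) (by rwa [pow_one])]
  simp

theorem add_pow_div_factorial {X Y : Module.End ℂ V} (hXY : Commute X Y) (i : ℕ) :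
    ((i ! : ℂ)⁻¹) • (X + Y) ^ i =
      ∑ k ∈ Finset.range (i + 1), (((k ! : ℂ)⁻¹) • X ^ k) * (((i - k)! : ℂ)⁻¹ • Y ^ (i - k)) := by
  rw [hXY.add_pow, Finset.smul_sum]
  refine Finset.sum_congr rfl fun k hk => ?_
  have hk' : k ≤ i := by simpa [Nat.lt_succ_iff] using hk
  rw [← nsmul_eq_mul', ← Nat.cast_smul_eq_nsmul ℂ, smul_smul, smul_mul_smul_comm,
    Nat.cast_choose ℂ hk']
  congr 1
  have h1 : (i ! : ℂ) ≠ 0 := by exact_mod_cast i.factorial_ne_zero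
  field_simp

theorem lnExp_add {X Y : Module.End ℂ V} (hX : LocNil X) (hY : LocNil Y) (hXY : Commute X Y)
    (hs : LocNil (X + Y)) : lnExp (X + Y) = lnExp X * lnExp Y := by
  ext v
  obtain ⟨a, ha⟩ := hX v
  obtain ⟨b, hb⟩ := hY v
  obtain ⟨c, hc⟩ := hs v
  have hz : ∀ k l, a + b ≤ k + l → (X ^ k) ((Y ^ l) v) = 0 := by
    intro k l hkl
    rcases le_or_gt b l with h | h
    · rw [pow_apply_eq_zero_of_le hb h, map_zero]
    · rw [← Module.End.mul_apply, (hXY.pow_pow k l).eq, Module.End.mul_apply,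
        pow_apply_eq_zero_of_le ha (by omega), map_zero]
  -- One cutoff for all series: the powers of X + Y and all products X^k Y^l with k + l ≥ a + b
  -- annihilate v.
  obtain ⟨n, hn⟩ : ∃ n, n = a + b + c := ⟨_, rfl⟩
  rw [Module.End.mul_apply, lnExp_apply hs (pow_apply_eq_zero_of_le hc (by omega : c ≤ n)),
    lnExp_apply hY (pow_apply_eq_zero_of_le hb (by omega : b ≤ n)), map_sum]
  have hl : ∀ i, lnExp X (((i ! : ℂ)⁻¹) • (Y ^ i) v) =
      ∑ k ∈ Finset.range n, ((((k ! : ℂ)⁻¹) • X ^ k) * (((i)! : ℂ)⁻¹ • Y ^ i)) v := by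
    intro i
    rw [map_smul, lnExp_apply hX (n := n), Finset.smul_sum]
    · refine Finset.sum_congr rfl fun k _ => ?_
      simp only [Module.End.mul_apply, LinearMap.smul_apply, map_smul]
    · refine hz _ _ (by omega)
  simp_rw [hl]
  rw [Finset.sum_comm]
  have hr : ∀ i, ((i ! : ℂ)⁻¹) • ((X + Y) ^ i) v = ∑ k ∈ Finset.range (i + 1),
      ((((k ! : ℂ)⁻¹) • X ^ k) * (((i - k)! : ℂ)⁻¹ • Y ^ (i - k))) v := by
    intro i
    rw [← LinearMap.smul_apply, add_pow_div_factorial hXY, LinearMap.sum_apply]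
  simp_rw [hr]
  rw [Finset.sum_range_diag_flip n fun k l =>
    ((((k ! : ℂ)⁻¹) • X ^ k) * (((l)! : ℂ)⁻¹ • Y ^ l)) v]
  refine Finset.sum_congr rfl fun k _ => ?_
  -- Triangle against square: the additional terms have k + l ≥ n and vanish.
  refine Finset.sum_subset (fun l hl => ?_) fun l _ hl => ?_
  · simp only [Finset.mem_range] at hl ⊢
    omega
  · simp only [Finset.mem_range] at hl
    simp only [Module.End.mul_apply, LinearMap.smul_apply, map_smul]
    rw [hz _ _ (by omega), smul_zero, smul_zero]

theorem pow_mul_of_commutator {X Y : Module.End ℂ V} {c : ℂ}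
    (h : X * Y - Y * X = c • (1 : Module.End ℂ V)) (i : ℕ) :
    X ^ (i + 1) * Y = Y * X ^ (i + 1) + ((i + 1 : ℂ) * c) • X ^ i := by
  rw [sub_eq_iff_eq_add] at h
  induction i with
  | zero =>
    simp only [zero_add, pow_one, pow_zero, h, Nat.cast_zero, one_mul]
    abel
  | succ i ih =>
    rw [pow_succ' X (i + 1), mul_assoc, ih, mul_add, ← mul_assoc, h, add_mul, mul_assoc Y,
      mul_smul_comm, smul_mul_assoc, one_mul, ← pow_succ', ← pow_succ']
    push_cast
    rw [add_comm (c • X ^ (i + 1)), add_assoc, ← add_smul]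
    congr 2
    ring

/-- Conjugation of Y by e^X adds only the first commutator, since that is central. Term by term, i +
1 factors X yield i + 1 contractions, which cancels the step in the factorial. -/
theorem lnExp_mul_of_commutator {X Y : Module.End ℂ V} (hX : LocNil X) {c : ℂ}
    (h : X * Y - Y * X = c • (1 : Module.End ℂ V)) :
    lnExp X * Y = Y * lnExp X + c • lnExp X := by
  ext v
  obtain ⟨a, ha⟩ := hX v
  obtain ⟨b, hb⟩ := hX (Y v)
  obtain ⟨n, hn⟩ : ∃ n, n = a + b := ⟨_, rfl⟩
  rw [LinearMap.add_apply, LinearMap.smul_apply, Module.End.mul_apply, Module.End.mul_apply,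
    lnExp_apply hX (pow_apply_eq_zero_of_le hb (by omega : b ≤ n + 1))]
  nth_rewrite 1 [lnExp_apply hX (pow_apply_eq_zero_of_le ha (by omega : a ≤ n + 1))]
  rw [lnExp_apply hX (pow_apply_eq_zero_of_le ha (by omega : a ≤ n)), map_sum,
    Finset.sum_range_succ', Finset.sum_range_succ', Finset.smul_sum, add_right_comm,
    ← Finset.sum_add_distrib]
  congr 1
  · refine Finset.sum_congr rfl fun i _ => ?_
    have e := LinearMap.congr_fun (pow_mul_of_commutator h i) v
    rw [LinearMap.add_apply, LinearMap.smul_apply, Module.End.mul_apply, Module.End.mul_apply] at e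
    rw [e, map_smul, smul_add, smul_smul, smul_smul]
    congr 2
    have h1 : (i ! : ℂ) ≠ 0 := by exact_mod_cast i.factorial_ne_zero
    have h2 : (i + 1 : ℂ) ≠ 0 := by exact_mod_cast i.succ_ne_zero
    rw [Nat.factorial_succ]
    push_cast
    field_simp
  · simp

theorem lnExp_zero : lnExp (0 : Module.End ℂ V) = 1 := by
  ext v
  exact lnExp_apply_of_apply_eq_zero (fun v => ⟨1, by simp⟩) rfl

end LocallyNilpotent

/-! ### Annihilation operators -/

section Annihilation

open scoped Nat

variable {M : ℕ} (A : Flavor M)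

theorem rho_apply_eq_zero {m k : ℤ} {v : FinVec M} (hv : v ∈ energyLE M k) (h : k < 2 * m) :
    rho A m v = 0 :=
  eq_zero_of_mem_energyLE (by omega) (rho_mem_energyLE A m hv)

theorem locFin_annih (b : ℕ → ℂ) :
    LocFin fun m : ℕ => (b m / (m + 1)) • rho A (m + 1) :=
  locFin_of_finset fun v => by
    obtain ⟨k, hk⟩ := exists_mem_energyLE v
    refine ⟨Finset.range k, fun m hm => ?_⟩
    rw [Finset.mem_range, not_lt] at hm
    rw [LinearMap.smul_apply, rho_apply_eq_zero A hk (by omega), smul_zero]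

/-- The annihilation operator `∑_{m ≥ 1} (b_m / m) ρ(m)`; the coefficient `b_m` is `b (m - 1)`. -/
noncomputable def annih (b : ℕ → ℂ) : Module.End ℂ (FinVec M) :=
  lfSum fun m : ℕ => (b m / (m + 1)) • rho A (m + 1)

theorem annih_apply (b : ℕ → ℂ) {k : ℤ} {n : ℕ} {v : FinVec M} (hv : v ∈ energyLE M k)
    (hn : k < 2 * (n + 1)) :
    annih A b v = ∑ m ∈ Finset.range n, (b m / (m + 1)) • rho A (m + 1) v := by
  rw [annih, lfSum_apply_eq_sum (locFin_annih A b) (s := Finset.range n)]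
  · rfl
  · intro m hm
    rw [Finset.mem_range, not_lt] at hm
    rw [LinearMap.smul_apply, rho_apply_eq_zero A hv (by omega), smul_zero]

theorem annih_add (b c : ℕ → ℂ) : annih A (b + c) = annih A b + annih A c := by
  rw [annih, annih, annih, ← lfSum_add (locFin_annih A b) (locFin_annih A c)]
  congr 1
  funext m
  rw [← add_smul, ← add_div]
  rfl

theorem annih_smul (t : ℂ) (b : ℕ → ℂ) : annih A (t • b) = t • annih A b := by
  rw [annih, annih, ← lfSum_smul (locFin_annih A b)]
  congr 1
  funext m
  rw [smul_smul, ← mul_div_assoc]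
  rfl

theorem annih_neg (b : ℕ → ℂ) : annih A (-b) = -annih A b := by
  rw [← neg_one_smul ℂ b, annih_smul, neg_one_smul]

theorem annih_zero : annih A 0 = 0 := by
  rw [← zero_smul ℂ (0 : ℕ → ℂ), annih_smul, zero_smul]

theorem annih_mem_energyLE (b : ℕ → ℂ) {k : ℤ} {v : FinVec M} (hv : v ∈ energyLE M k) :
    annih A b v ∈ energyLE M (k - 2) := by
  rw [annih_apply A b (n := k.toNat) hv (by omega)]
  refine Submodule.sum_mem _ fun m _ => Submodule.smul_mem _ _ ?_
  exact energyLE_mono (by omega) (rho_mem_energyLE A _ hv)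

theorem annih_pow_mem_energyLE (b : ℕ → ℂ) {k : ℤ} {v : FinVec M} (hv : v ∈ energyLE M k) (i : ℕ) :
    (annih A b ^ i) v ∈ energyLE M (k - 2 * i) := by
  induction i with
  | zero => simpa using hv
  | succ i ih =>
    rw [pow_succ', Module.End.mul_apply]
    exact energyLE_mono (by push_cast; omega) (annih_mem_energyLE A b ih)

theorem annih_pow_apply_eq_zero (b : ℕ → ℂ) {k : ℤ} {v : FinVec M} (hv : v ∈ energyLE M k) {i : ℕ}
    (hi : k < 2 * i) : (annih A b ^ i) v = 0 :=
  eq_zero_of_mem_energyLE (by omega) (annih_pow_mem_energyLE A b hv i)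

theorem locNil_annih (b : ℕ → ℂ) : LocNil (annih A b) := fun v => by
  obtain ⟨k, hk⟩ := exists_mem_energyLE v
  exact ⟨k + 1, annih_pow_apply_eq_zero A b hk (by push_cast; omega)⟩

/-- On v and on Y v the annihilation operator is a finite sum, so the commutator may be taken
termwise after a common cutoff. The condition on c makes the resulting scalar independent of the
vector. -/
theorem annih_mul_of_commutator {Y : Module.End ℂ (FinVec M)} {c : ℕ → ℂ}
    (h : ∀ m : ℕ, rho A (m + 1) * Y - Y * rho A (m + 1) = c m • (1 : Module.End ℂ (FinVec M)))
    (b : ℕ → ℂ) {n : ℕ} (hc : ∀ m ≥ n, c m = 0) :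
    annih A b * Y - Y * annih A b =
      (∑ m ∈ Finset.range n, b m * c m / (m + 1)) • (1 : Module.End ℂ (FinVec M)) := by
  ext v
  obtain ⟨k, hk⟩ := exists_mem_energyLE v
  obtain ⟨l, hl⟩ := exists_mem_energyLE (Y v)
  obtain ⟨p, hp⟩ : ∃ p, p = n + k + l := ⟨_, rfl⟩
  rw [LinearMap.sub_apply, Module.End.mul_apply, Module.End.mul_apply,
    annih_apply A b (n := p) hk (by omega), annih_apply A b (n := p) hl (by omega), map_sum,
    ← Finset.sum_sub_distrib, LinearMap.smul_apply, Module.End.one_apply, Finset.sum_smul]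
  rw [Finset.sum_subset (Finset.range_subset_range.2 (by omega : n ≤ p))]
  · refine Finset.sum_congr rfl fun m _ => ?_
    have e := LinearMap.congr_fun (h m) v
    rw [LinearMap.sub_apply, Module.End.mul_apply, Module.End.mul_apply, LinearMap.smul_apply,
      Module.End.one_apply] at e
    rw [map_smul, ← smul_sub, e, smul_smul]
    congr 1
    ring
  · intro m _ hm
    rw [Finset.mem_range, not_lt] at hm
    rw [hc m hm]
    simp

theorem annih_mul_rho_neg (b : ℕ → ℂ) (m : ℕ) :
    annih A b * rho A (-(m + 1)) - rho A (-(m + 1)) * annih A b = b m • 1 := by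
  rw [annih_mul_of_commutator A (c := fun l => if l = m then (m + 1 : ℂ) else 0) (n := m + 1)]
  · congr 1
    rw [Finset.sum_eq_single m]
    · have h2 : (m + 1 : ℂ) ≠ 0 := by exact_mod_cast m.succ_ne_zero
      rw [if_pos rfl]
      field_simp
    · intro l _ hl
      simp [hl]
    · simp
  · intro l
    rw [rho_commutator]
    by_cases hl : l = m
    · subst hl
      simp
    · rw [if_neg (by omega), if_neg hl]
  · intro l hl
    rw [if_neg (by omega)]

theorem annih_mul_rho_pos (b : ℕ → ℂ) (m : ℕ) : Commute (annih A b) (rho A (m + 1)) := by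
  rw [commute_iff_eq, ← sub_eq_zero,
    annih_mul_of_commutator A (c := 0) (n := 0) (fun l => ?_) _ fun _ _ => rfl]
  · simp
  · rw [rho_commutator, if_neg (by omega)]
    rfl

theorem commute_annih (b c : ℕ → ℂ) : Commute (annih A b) (annih A c) := by
  rw [commute_iff_eq]
  have h : annih A b = lfSum fun m : ℕ => (b m / (m + 1)) • rho A (m + 1) := rfl
  rw [h, lfSum_mul (locFin_annih A b), mul_lfSum (locFin_annih A b)]
  congr 1
  funext m
  rw [smul_mul_assoc, mul_smul_comm, (annih_mul_rho_pos A c m).eq]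

/-- The exponential of the annihilation operator. -/
noncomputable def expAnnih (b : ℕ → ℂ) : Module.End ℂ (FinVec M) := lnExp (annih A b)

theorem expAnnih_add (b c : ℕ → ℂ) : expAnnih A (b + c) = expAnnih A b * expAnnih A c := by
  rw [expAnnih, annih_add]
  refine lnExp_add (locNil_annih A b) (locNil_annih A c) (commute_annih A b c) ?_
  rw [← annih_add]
  exact locNil_annih A _

theorem expAnnih_zero : expAnnih A 0 = 1 := by
  rw [expAnnih, annih_zero, lnExp_zero]

theorem expAnnih_apply (b : ℕ → ℂ) {k : ℤ} {v : FinVec M} (hv : v ∈ energyLE M k) {n : ℕ}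
    (hn : k < 2 * n) :
    expAnnih A b v = ∑ i ∈ Finset.range n, ((i ! : ℂ)⁻¹) • (annih A b ^ i) v :=
  lnExp_apply (locNil_annih A b) (annih_pow_apply_eq_zero A b hv hn)

theorem expAnnih_mem_energyLE (b : ℕ → ℂ) {k : ℤ} {v : FinVec M} (hv : v ∈ energyLE M k) :
    expAnnih A b v ∈ energyLE M k := by
  rw [expAnnih_apply A b (n := k.toNat + 1) hv (by push_cast; omega)]
  refine Submodule.sum_mem _ fun i _ => Submodule.smul_mem _ _ ?_
  exact energyLE_mono (by omega) (annih_pow_mem_energyLE A b hv i)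

theorem expAnnih_mul_rho_neg (b : ℕ → ℂ) (m : ℕ) :
    expAnnih A b * rho A (-(m + 1)) = rho A (-(m + 1)) * expAnnih A b + b m • expAnnih A b :=
  lnExp_mul_of_commutator (locNil_annih A b) (annih_mul_rho_neg A b m)

theorem lnExp_commute {X Y : Module.End ℂ (FinVec M)} (hX : LocNil X) (h : Commute X Y) :
    Commute (lnExp X) Y := by
  rw [commute_iff_eq, lnExp, lfSum_mul hX.locFin, mul_lfSum hX.locFin]
  congr 1
  funext i
  rw [smul_mul_assoc, mul_smul_comm, (h.pow_left i).eq]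

theorem expAnnih_mul_rho_pos (b : ℕ → ℂ) (m : ℕ) : Commute (expAnnih A b) (rho A (m + 1)) :=
  lnExp_commute (locNil_annih A b) (annih_mul_rho_pos A b m)

theorem expAnnih_mul_annih (b c : ℕ → ℂ) : Commute (expAnnih A b) (annih A c) :=
  lnExp_commute (locNil_annih A b) (commute_annih A b c)

/-- A boson of index m + 1 carries energy 2(m + 1), so vectors of bounded energy see only finitely
many coefficients. This is what allows sequences to be truncated at no cost on a given vector. -/
theorem annih_congr {b c : ℕ → ℂ} {k : ℤ} {v : FinVec M} (hv : v ∈ energyLE M k)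
    (h : ∀ m : ℕ, 2 * ((m : ℤ) + 1) ≤ k → b m = c m) : annih A b v = annih A c v := by
  rw [annih_apply A b (n := (k / 2).toNat) hv (by omega),
    annih_apply A c (n := (k / 2).toNat) hv (by omega)]
  refine Finset.sum_congr rfl fun m hm => ?_
  rw [Finset.mem_range] at hm
  rw [h m (by omega)]

theorem expAnnih_congr {b c : ℕ → ℂ} {k : ℤ} {v : FinVec M} (hv : v ∈ energyLE M k)
    (h : ∀ m : ℕ, 2 * ((m : ℤ) + 1) ≤ k → b m = c m) : expAnnih A b v = expAnnih A c v := by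
  have hp : ∀ i : ℕ, (annih A b ^ i) v = (annih A c ^ i) v := by
    intro i
    induction i with
    | zero => rfl
    | succ i ih =>
      rw [pow_succ', pow_succ', Module.End.mul_apply, Module.End.mul_apply, ih]
      exact annih_congr A (annih_pow_mem_energyLE A c hv i) fun m hm => h m (by omega)
  rw [expAnnih_apply A b (n := k.toNat + 1) hv (by push_cast; omega),
    expAnnih_apply A c (n := k.toNat + 1) hv (by push_cast; omega)]
  exact Finset.sum_congr rfl fun i _ => by rw [hp]

end Annihilation

/-! ### Exponentials of creation operators -/

section CreationExp

open scoped Nat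

variable {M : ℕ}

theorem IsAdj.pow {X Y : Module.End ℂ (FinVec M)} (h : IsAdj X Y) (n : ℕ) :
    IsAdj (X ^ n) (Y ^ n) := by
  induction n with
  | zero => exact IsAdj.one
  | succ n ih =>
    rw [pow_succ X, pow_succ' Y]
    exact ih.mul h

theorem mul_pow_of_commutator {P Q : Module.End ℂ (FinVec M)} {κ : ℂ}
    (h : P * Q - Q * P = κ • (1 : Module.End ℂ (FinVec M))) (i : ℕ) :
    P * Q ^ (i + 1) = Q ^ (i + 1) * P + ((i + 1 : ℂ) * κ) • Q ^ i := by
  have h' : Q * P - P * Q = (-κ) • (1 : Module.End ℂ (FinVec M)) := by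
    rw [neg_smul, ← h, neg_sub]
  rw [pow_mul_of_commutator h' i, mul_neg, neg_smul]
  abel

/-- Moving one Q to the other side gives ‖Q^{j+1} u‖² = ⟨P Q^{j+1} u, Q^j u⟩, and P Q^{j+1} =
Q^{j+1} P + (j+1) κ Q^j. Induction on the order at which P annihilates u controls the first term by
P u; the second produces the growth √(j!). -/
theorem norm_creation_pow_le {P Q : Module.End ℂ (FinVec M)} (hPQ : IsAdj P Q) {κ : ℂ}
    (h : P * Q - Q * P = κ • (1 : Module.End ℂ (FinVec M))) (n : ℕ) (u : FinVec M)
    (hu : (P ^ n) u = 0) :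
    ∃ C : ℝ, 0 ≤ C ∧ ∀ j : ℕ, ‖(Q ^ j) u‖ ≤ C * (1 + ‖κ‖) ^ j * √(j ! : ℝ) := by
  induction n generalizing u with
  | zero =>
    have : u = 0 := by simpa using hu
    subst this
    exact ⟨0, le_rfl, fun j => by simp⟩
  | succ n ih =>
    obtain ⟨C', hC', hb⟩ := ih (P u) (by rwa [pow_succ, Module.End.mul_apply] at hu)
    refine ⟨max C' ‖u‖, le_max_of_le_left hC', fun j => ?_⟩
    have hC0 : 0 ≤ max C' ‖u‖ := le_max_of_le_left hC'
    induction j with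
    | zero => simp
    | succ j ihj =>
      set C := max C' ‖u‖ with hC
      set K := 1 + ‖κ‖ with hK
      have hK0 : 0 ≤ ‖κ‖ := norm_nonneg κ
      set s := √(j ! : ℝ) with hs
      set s' := √((j + 1)! : ℝ) with hs'
      have hs0 : 0 ≤ s := Real.sqrt_nonneg _
      have hs0' : 0 ≤ s' := Real.sqrt_nonneg _
      have hss : s' ^ 2 = (j + 1) * s ^ 2 := by
        rw [hs, hs', Real.sq_sqrt (by positivity), Real.sq_sqrt (by positivity),
          Nat.factorial_succ]
        push_cast
        ring
      have hle : s ≤ s' := Real.sqrt_le_sqrt (by exact_mod_cast Nat.factorial_le (Nat.le_succ j))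
      have e1 : ⟪(Q ^ (j + 1)) u, (Q ^ (j + 1)) u⟫_ℂ =
          ⟪(Q ^ (j + 1)) (P u) + ((j + 1 : ℂ) * κ) • (Q ^ j) u, (Q ^ j) u⟫_ℂ := by
        have e2 := LinearMap.congr_fun (mul_pow_of_commutator h j) u
        rw [LinearMap.add_apply, Module.End.mul_apply, Module.End.mul_apply,
          LinearMap.smul_apply] at e2
        rw [← e2, hPQ]
        congr 1
        rw [pow_succ', Module.End.mul_apply]
      have e3 : ‖(Q ^ (j + 1)) u‖ ^ 2 ≤
          (‖(Q ^ (j + 1)) (P u)‖ + (j + 1) * ‖κ‖ * ‖(Q ^ j) u‖) * ‖(Q ^ j) u‖ := by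
        calc ‖(Q ^ (j + 1)) u‖ ^ 2 = ‖⟪(Q ^ (j + 1)) u, (Q ^ (j + 1)) u⟫_ℂ‖ := by
              rw [inner_self_eq_norm_sq_to_K, norm_pow, RCLike.norm_ofReal, abs_norm]
          _ ≤ _ := by
              rw [e1]
              refine (norm_inner_le_norm _ _).trans ?_
              gcongr
              refine (norm_add_le _ _).trans ?_
              gcongr
              rw [norm_smul, norm_mul]
              gcongr
              exact_mod_cast (Complex.norm_natCast (j + 1)).le
      have e4 : ‖(Q ^ (j + 1)) (P u)‖ ≤ C * K ^ (j + 1) * s' := by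
        refine (hb (j + 1)).trans ?_
        gcongr
        exact le_max_left _ _
      refine abs_le_of_sq_le_sq' ?_ (by positivity) |>.2
      calc ‖(Q ^ (j + 1)) u‖ ^ 2
          ≤ (C * K ^ (j + 1) * s' + (j + 1) * ‖κ‖ * (C * K ^ j * s)) * (C * K ^ j * s) := by
            refine e3.trans ?_
            gcongr
        _ = C ^ 2 * K ^ (2 * j) * (K * (s' * s) + ‖κ‖ * ((j + 1) * s ^ 2)) := by ring
        _ ≤ C ^ 2 * K ^ (2 * j) * (K * s' ^ 2 + ‖κ‖ * s' ^ 2) := by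
            rw [← hss]
            gcongr
            rw [sq]
            gcongr
        _ = C ^ 2 * K ^ (2 * j) * s' ^ 2 * (K + ‖κ‖) := by ring
        -- The choice K = 1 + ‖κ‖ is made for K + ‖κ‖ = 1 + 2‖κ‖ ≤ K².
        _ ≤ C ^ 2 * K ^ (2 * j) * s' ^ 2 * K ^ 2 := by
            gcongr
            rw [hK]
            nlinarith
        _ = (C * K ^ (j + 1) * s') ^ 2 := by ring

/-- The term K^j/√(j!) is the product of (2K)^j/√(j!) and 2^{-j}; the sum of their squares dominates
it and is summable. -/
theorem summable_pow_mul_sqrt_factorial (K : ℝ) :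
    Summable fun j : ℕ => ((j ! : ℝ)⁻¹) * (K ^ j * √(j ! : ℝ)) := by
  have h1 : Summable fun j : ℕ => (4 * K ^ 2) ^ j / (j ! : ℝ) := Real.summable_pow_div_factorial _
  have h2 : Summable fun j : ℕ => (1 / 4 : ℝ) ^ j :=
    summable_geometric_of_lt_one (by norm_num) (by norm_num)
  refine Summable.of_norm_bounded (h1.add h2) fun j => ?_
  have hf : (0 : ℝ) < j ! := by exact_mod_cast j.factorial_pos
  have hs : 0 < √(j ! : ℝ) := Real.sqrt_pos.2 hf
  have hss : (j ! : ℝ) = √(j ! : ℝ) ^ 2 := (Real.sq_sqrt hf.le).symm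
  set s := √(j ! : ℝ)
  rw [hss, Real.norm_eq_abs, abs_mul, abs_mul, abs_inv, abs_pow, abs_pow, abs_of_pos hs]
  have e1 : (s ^ 2)⁻¹ * (|K| ^ j * s) = (2 * |K|) ^ j / s * (1 / 2) ^ j := by
    rw [mul_pow, div_pow, one_pow]
    field_simp
  have e2 : (4 * K ^ 2) ^ j / s ^ 2 = ((2 * |K|) ^ j / s) ^ 2 := by
    rw [div_pow, ← pow_mul, mul_comm j 2, pow_mul, mul_pow 2, sq_abs]
    norm_num
  have e3 : (1 / 4 : ℝ) ^ j = ((1 / 2) ^ j) ^ 2 := by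
    rw [← pow_mul, mul_comm j 2, pow_mul]
    norm_num
  rw [e1, e2, e3]
  have h0 : 0 ≤ (2 * |K|) ^ j / s := by positivity
  have h0' : (0 : ℝ) ≤ (1 / 2) ^ j := by positivity
  nlinarith [sq_nonneg ((2 * |K|) ^ j / s - (1 / 2) ^ j)]

/-- The exponential series of `Q` at `u`, as a vector of the Fock space. -/
noncomputable def creationExp (Q : Module.End ℂ (FinVec M)) (u : FinVec M) : Fock M :=
  ∑' j : ℕ, ((j ! : ℂ)⁻¹) • (((Q ^ j) u : FinVec M) : Fock M)

theorem summable_creationExp {P Q : Module.End ℂ (FinVec M)} (hPQ : IsAdj P Q) (hP : LocNil P)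
    {κ : ℂ} (h : P * Q - Q * P = κ • (1 : Module.End ℂ (FinVec M))) (u : FinVec M) :
    Summable fun j : ℕ => ((j ! : ℂ)⁻¹) • (((Q ^ j) u : FinVec M) : Fock M) := by
  obtain ⟨n, hn⟩ := hP u
  obtain ⟨C, hC, hb⟩ := norm_creation_pow_le hPQ h n u hn
  refine Summable.of_norm_bounded ((summable_pow_mul_sqrt_factorial (1 + ‖κ‖)).mul_left C)
    fun j => ?_
  rw [norm_smul, norm_inv, Complex.norm_natCast, FinVec.norm_coe]
  calc ((j ! : ℝ)⁻¹) * ‖(Q ^ j) u‖ ≤ ((j ! : ℝ)⁻¹) * (C * (1 + ‖κ‖) ^ j * √(j ! : ℝ)) := by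
        gcongr
        exact hb j
    _ = _ := by ring

/-- Against a finite vector the exponential of creation operators becomes the exponential of their
adjoints, a finite sum. -/
theorem inner_creationExp {P Q : Module.End ℂ (FinVec M)} (hPQ : IsAdj P Q) (hP : LocNil P)
    {κ : ℂ} (h : P * Q - Q * P = κ • (1 : Module.End ℂ (FinVec M))) (u v : FinVec M) :
    ⟪(u : Fock M), creationExp Q v⟫_ℂ = ⟪lnExp P u, v⟫_ℂ := by
  obtain ⟨n, hn⟩ := hP u
  have h1 := (summable_creationExp hPQ hP h v).hasSum.mapL (innerSL ℂ (u : Fock M))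
  have h2 : ∀ j, innerSL ℂ (u : Fock M) (((j ! : ℂ)⁻¹) • (((Q ^ j) v : FinVec M) : Fock M)) =
      ⟪((j ! : ℂ)⁻¹) • (P ^ j) u, v⟫_ℂ := by
    intro j
    rw [innerSL_apply_apply, inner_smul_right, FinVec.inner_coe, ← hPQ.pow j, inner_smul_left]
    simp
  simp_rw [h2] at h1
  have h3 := h1.unique (hasSum_sum_of_ne_finset_zero (s := Finset.range n) fun j hj => by
    rw [pow_apply_eq_zero_of_le hn (by simpa using hj), smul_zero, inner_zero_left])
  rw [innerSL_apply_apply] at h3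
  rw [creationExp, h3, lnExp_apply hP hn, sum_inner]

theorem hasSum_exp_cauchy {a : ℕ → ℂ} {n : ℕ} (ha : ∀ k, n ≤ k → a k = 0) (z : ℂ) :
    ∑' j, ∑ k ∈ Finset.range (j + 1), a k * (z ^ (j - k) / ((j - k)! : ℂ)) =
      (∑ k ∈ Finset.range n, a k) * Complex.exp z := by
  have h1 : ∀ k ∉ Finset.range n, a k = 0 := fun k hk => ha k (by simpa using hk)
  rw [← tsum_eq_sum (L := SummationFilter.unconditional ℕ) h1, Complex.exp_eq_exp_ℂ, NormedSpace.exp_eq_tsum_div,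
    tsum_mul_tsum_eq_tsum_sum_range_of_summable_norm]
  · exact summable_of_ne_finset_zero (s := Finset.range n) fun k hk => by rw [h1 k hk, norm_zero]
  · exact NormedSpace.norm_expSeries_div_summable z

/-- Moved to the other side, e^{Q'} becomes e^{P'}, and e^{P'} Q = (Q + κ) e^{P'}. The exponential
of the scalar splits off as a Cauchy product in which one factor is finite, because P annihilates v
after finitely many steps. -/
theorem inner_creationExp_creationExp {P Q P' Q' : Module.End ℂ (FinVec M)} (hPQ : IsAdj P Q)
    (hP : LocNil P) {β : ℂ} (h : P * Q - Q * P = β • (1 : Module.End ℂ (FinVec M)))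
    (hPQ' : IsAdj P' Q') (hP' : LocNil P') {β' : ℂ}
    (h' : P' * Q' - Q' * P' = β' • (1 : Module.End ℂ (FinVec M))) {κ : ℂ}
    (hκ : P' * Q - Q * P' = κ • (1 : Module.End ℂ (FinVec M))) (u v : FinVec M) :
    ⟪creationExp Q u, creationExp Q' v⟫_ℂ =
      Complex.exp (starRingEnd ℂ κ) * ⟪lnExp P' u, lnExp P v⟫_ℂ := by
  obtain ⟨n, hn⟩ := hP v
  have h1 := (summable_creationExp hPQ hP h u).hasSum.mapL (innerSL ℂ (creationExp Q' v))
  -- A semiconjugation passes to all powers of Q at once.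
  have hsemi : SemiconjBy (lnExp P') Q (Q + κ • (1 : Module.End ℂ (FinVec M))) := by
    rw [SemiconjBy, lnExp_mul_of_commutator hP' hκ, add_mul, smul_mul_assoc, one_mul]
  have hadj : IsAdj (Q + κ • (1 : Module.End ℂ (FinVec M)))
      (P + starRingEnd ℂ κ • (1 : Module.End ℂ (FinVec M))) := hPQ.symm.add (IsAdj.one.smul κ)
  have h2 : ∀ j, starRingEnd ℂ (innerSL ℂ (creationExp Q' v)
      (((j ! : ℂ)⁻¹) • (((Q ^ j) u : FinVec M) : Fock M))) =
      ∑ k ∈ Finset.range (j + 1), ⟪lnExp P' u, ((k ! : ℂ)⁻¹) • (P ^ k) v⟫_ℂ *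
        (starRingEnd ℂ κ ^ (j - k) / ((j - k)! : ℂ)) := by
    intro j
    rw [innerSL_apply_apply, inner_smul_right, map_mul, inner_conj_symm,
      inner_creationExp hPQ' hP' h']
    have e1 := LinearMap.congr_fun (hsemi.pow_right j) u
    rw [Module.End.mul_apply, Module.End.mul_apply] at e1
    have e2 := LinearMap.congr_fun (add_pow_div_factorial (X := P)
      (Y := starRingEnd ℂ κ • (1 : Module.End ℂ (FinVec M)))
      ((Commute.one_right P).smul_right _) j) v
    rw [LinearMap.smul_apply, LinearMap.sum_apply] at e2
    rw [e1, hadj.pow j, map_inv₀, Complex.conj_natCast, ← inner_smul_right, e2, inner_sum]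
    refine Finset.sum_congr rfl fun k _ => ?_
    rw [smul_pow, one_pow, smul_smul, mul_smul_comm, mul_one, LinearMap.smul_apply,
      inner_smul_right, LinearMap.smul_apply, mul_comm]
    congr 1
    rw [mul_comm, div_eq_mul_inv]
  have h3 := (Complex.conjCLE : ℂ →L[ℝ] ℂ).hasSum h1
  have h4 : HasSum (fun j => ∑ k ∈ Finset.range (j + 1),
      ⟪lnExp P' u, ((k ! : ℂ)⁻¹) • (P ^ k) v⟫_ℂ *
        (starRingEnd ℂ κ ^ (j - k) / ((j - k)! : ℂ)))
      ⟪creationExp Q u, creationExp Q' v⟫_ℂ := by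
    have e : (Complex.conjCLE : ℂ →L[ℝ] ℂ) ((innerSL ℂ (creationExp Q' v))
        (∑' j : ℕ, ((j ! : ℂ)⁻¹) • (((Q ^ j) u : FinVec M) : Fock M))) =
        ⟪creationExp Q u, creationExp Q' v⟫_ℂ := by
      change starRingEnd ℂ ⟪creationExp Q' v, creationExp Q u⟫_ℂ = _
      rw [inner_conj_symm]
    rw [e] at h3
    exact h3.congr_fun fun j => (h2 j).symm
  rw [← h4.tsum_eq, hasSum_exp_cauchy (n := n), ← inner_sum, ← lnExp_apply hP hn, mul_comm]
  intro k hk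
  rw [pow_apply_eq_zero_of_le hn hk, smul_zero, inner_zero_right]

end CreationExp

/-! ### Weyl operators -/

section Pairing

/-- The pairing `∑_{m ≥ 1} b̄_m c_m / m`; the coefficient `b_m` is `b (m - 1)`. -/
noncomputable def pair (b c : ℕ → ℂ) : ℂ := ∑' m : ℕ, starRingEnd ℂ (b m) * c m / (m + 1)

theorem summable_pair {b c : ℕ → ℂ} (hb : Summable fun m => ‖b m‖) (hc : Summable fun m => ‖c m‖) :
    Summable fun m : ℕ => starRingEnd ℂ (b m) * c m / (m + 1) := by
  refine Summable.of_norm_bounded (hb.mul_right (∑' m, ‖c m‖)) fun m => ?_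
  rw [norm_div, norm_mul, RCLike.norm_conj]
  have h1 : (1 : ℝ) ≤ ‖(m + 1 : ℂ)‖ := by
    have : ‖((m + 1 : ℕ) : ℂ)‖ = ((m + 1 : ℕ) : ℝ) := Complex.norm_natCast _
    push_cast at this
    rw [this]
    have := m.cast_nonneg (α := ℝ)
    linarith
  calc ‖b m‖ * ‖c m‖ / ‖(m + 1 : ℂ)‖ ≤ ‖b m‖ * ‖c m‖ := div_le_self (by positivity) h1
    _ ≤ ‖b m‖ * ∑' m, ‖c m‖ := by
        gcongr
        exact hc.le_tsum m fun _ _ => norm_nonneg _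

theorem summable_of_support {b : ℕ → ℂ} {n : ℕ} (h : ∀ m ≥ n, b m = 0) : Summable fun m => ‖b m‖ :=
  summable_of_ne_finset_zero (s := Finset.range n) fun m hm => by
    rw [h m (by simpa using hm), norm_zero]

theorem summable_norm_add {b c : ℕ → ℂ} (hb : Summable fun m => ‖b m‖)
    (hc : Summable fun m => ‖c m‖) : Summable fun m => ‖(b + c) m‖ :=
  Summable.of_norm_bounded (hb.add hc) fun m => by
    rw [norm_norm]
    exact norm_add_le _ _

theorem summable_norm_smul {b : ℕ → ℂ} (hb : Summable fun m => ‖b m‖) (t : ℂ) :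
    Summable fun m => ‖(t • b) m‖ :=
  (hb.mul_left ‖t‖).congr fun m => (norm_smul t (b m)).symm

theorem summable_norm_neg {b : ℕ → ℂ} (hb : Summable fun m => ‖b m‖) :
    Summable fun m => ‖(-b) m‖ :=
  hb.congr fun m => (norm_neg (b m)).symm

theorem summable_norm_sub {b c : ℕ → ℂ} (hb : Summable fun m => ‖b m‖)
    (hc : Summable fun m => ‖c m‖) : Summable fun m => ‖(b - c) m‖ := by
  rw [sub_eq_add_neg]
  exact summable_norm_add hb (summable_norm_neg hc)

theorem conj_pair (b c : ℕ → ℂ) : starRingEnd ℂ (pair b c) = pair c b := by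
  rw [pair, Complex.conj_tsum]
  refine tsum_congr fun m => ?_
  simp [mul_comm]

theorem pair_add_left {b b' c : ℕ → ℂ} (hb : Summable fun m => ‖b m‖)
    (hb' : Summable fun m => ‖b' m‖) (hc : Summable fun m => ‖c m‖) :
    pair (b + b') c = pair b c + pair b' c := by
  rw [pair, pair, pair, ← (summable_pair hb hc).tsum_add (summable_pair hb' hc)]
  refine tsum_congr fun m => ?_
  rw [Pi.add_apply, map_add]
  ring

theorem pair_smul_left (t : ℂ) (b c : ℕ → ℂ) : pair (t • b) c = starRingEnd ℂ t * pair b c := by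
  rw [pair, pair, ← tsum_mul_left]
  refine tsum_congr fun m => ?_
  rw [Pi.smul_apply, smul_eq_mul, map_mul]
  ring

theorem pair_neg_left (b c : ℕ → ℂ) : pair (-b) c = -pair b c := by
  have := pair_smul_left (-1) b c
  simpa using this

theorem pair_add_right {b c c' : ℕ → ℂ} (hb : Summable fun m => ‖b m‖)
    (hc : Summable fun m => ‖c m‖) (hc' : Summable fun m => ‖c' m‖) :
    pair b (c + c') = pair b c + pair b c' := by
  rw [← conj_pair, pair_add_left hc hc' hb, map_add, conj_pair, conj_pair]

theorem pair_smul_right (t : ℂ) (b c : ℕ → ℂ) : pair b (t • c) = t * pair b c := by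
  rw [← conj_pair, pair_smul_left, map_mul, conj_pair, Complex.conj_conj]

theorem pair_neg_right (b c : ℕ → ℂ) : pair b (-c) = -pair b c := by
  rw [← conj_pair, pair_neg_left, map_neg, conj_pair]

theorem pair_neg_neg (b c : ℕ → ℂ) : pair (-b) (-c) = pair b c := by
  rw [pair_neg_left, pair_neg_right, neg_neg]

theorem pair_zero : pair 0 0 = 0 := by
  simp [pair]

theorem pair_sub_self {b c : ℕ → ℂ} (hb : Summable fun m => ‖b m‖) (hc : Summable fun m => ‖c m‖) :
    pair (c - b) (c - b) = pair c c + pair b b - pair b c - starRingEnd ℂ (pair b c) := by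
  have hb' := summable_norm_neg hb
  rw [sub_eq_add_neg, pair_add_left hc hb' (summable_norm_add hc hb'), pair_add_right hc hc hb',
    pair_add_right hb' hc hb', pair_neg_neg, pair_neg_left, pair_neg_right, conj_pair]
  ring

theorem pair_self_re (b : ℕ → ℂ) : ((pair b b).re : ℂ) = pair b b := by
  rw [← Complex.conj_eq_iff_re, conj_pair]

theorem pair_eq_sum {b c : ℕ → ℂ} {n : ℕ} (h : ∀ m ≥ n, b m = 0) :
    pair b c = ∑ m ∈ Finset.range n, starRingEnd ℂ (b m) * c m / (m + 1) :=
  tsum_eq_sum fun m hm => by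
    rw [h m (by simpa using hm)]
    simp

/-- The sequence `b` cut off at `n`. -/
def trunc (n : ℕ) (b : ℕ → ℂ) : ℕ → ℂ := fun m => if m < n then b m else 0

theorem trunc_of_ge {n : ℕ} (b : ℕ → ℂ) : ∀ m ≥ n, trunc n b m = 0 := fun _ hm =>
  if_neg hm.not_gt

theorem trunc_of_lt {n : ℕ} (b : ℕ → ℂ) {m : ℕ} (hm : m < n) : trunc n b m = b m := if_pos hm

theorem trunc_sub (n : ℕ) (b c : ℕ → ℂ) : trunc n b - trunc n c = trunc n (b - c) := by
  funext m
  simp only [trunc, Pi.sub_apply]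
  split_ifs <;> simp

theorem pair_trunc (n : ℕ) (b c : ℕ → ℂ) : pair (trunc n b) (trunc n c) =
    ∑ m ∈ Finset.range n, starRingEnd ℂ (b m) * c m / (m + 1) := by
  rw [pair_eq_sum (trunc_of_ge b)]
  refine Finset.sum_congr rfl fun m hm => ?_
  rw [Finset.mem_range] at hm
  rw [trunc_of_lt b hm, trunc_of_lt c hm]

theorem tendsto_pair_trunc {b c : ℕ → ℂ} (hb : Summable fun m => ‖b m‖)
    (hc : Summable fun m => ‖c m‖) :
    Filter.Tendsto (fun n => pair (trunc n b) (trunc n c)) Filter.atTop (nhds (pair b c)) := by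
  simp_rw [pair_trunc]
  exact (summable_pair hb hc).hasSum.tendsto_sum_nat

end Pairing

/-! ### Weyl operators on finite vectors as limits of finitely many bosons -/

section Weyl

variable {M : ℕ} (A : Flavor M)

/-- The creation operator `∑_{1 ≤ m ≤ n} (b̄_m / m) ρ(-m)`; the coefficient `b_m` is `b (m - 1)`. -/
noncomputable def creat (n : ℕ) (b : ℕ → ℂ) : Module.End ℂ (FinVec M) :=
  ∑ m ∈ Finset.range n, (starRingEnd ℂ (b m) / (m + 1)) • rho A (-(m + 1))

theorem isAdj_annih_creat {n : ℕ} {b : ℕ → ℂ} (h : ∀ m ≥ n, b m = 0) :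
    IsAdj (annih A b) (creat A n b) := by
  have e : annih A b = ∑ m ∈ Finset.range n, (b m / (m + 1)) • rho A (m + 1) := by
    ext v
    rw [annih, lfSum_apply_eq_sum (locFin_annih A b) (s := Finset.range n), LinearMap.sum_apply]
    intro m hm
    rw [h m (by simpa using hm), zero_div, zero_smul, LinearMap.zero_apply]
  rw [e, creat]
  refine IsAdj.sum _ fun m _ => ?_
  have h1 := (isAdj_rho A (m + 1)).smul (b m / (m + 1))
  rwa [map_div₀, map_add, map_one, Complex.conj_natCast] at h1

theorem annih_mul_creat (n : ℕ) (b c : ℕ → ℂ) :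
    annih A c * creat A n b - creat A n b * annih A c =
      (∑ m ∈ Finset.range n, starRingEnd ℂ (b m) * c m / (m + 1)) •
        (1 : Module.End ℂ (FinVec M)) := by
  rw [creat, Finset.mul_sum, Finset.sum_mul, ← Finset.sum_sub_distrib, Finset.sum_smul]
  refine Finset.sum_congr rfl fun m _ => ?_
  rw [mul_smul_comm, smul_mul_assoc, ← smul_sub, annih_mul_rho_neg, smul_smul]
  congr 1
  ring

/-- The Weyl operator of a finitely supported sequence on finite vectors. -/
noncomputable def weylFin (n : ℕ) (b : ℕ → ℂ) (v : FinVec M) : Fock M :=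
  Complex.exp (-(pair b b) / 2) • creationExp (creat A n b) (expAnnih A (-b) v)

/-- The matrix elements of the Weyl operator of `b`. -/
noncomputable def weylForm (b : ℕ → ℂ) (u v : FinVec M) : ℂ :=
  Complex.exp (-(pair b b) / 2) * ⟪expAnnih A b u, expAnnih A (-b) v⟫_ℂ

theorem inner_weylFin {n : ℕ} {b : ℕ → ℂ} (h : ∀ m ≥ n, b m = 0) (u v : FinVec M) :
    ⟪(u : Fock M), weylFin A n b v⟫_ℂ = weylForm A b u v := by
  rw [weylFin, inner_smul_right,
    inner_creationExp (isAdj_annih_creat A h) (locNil_annih A b) (annih_mul_creat A n b b)]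
  rfl

/-- The Weyl relation W(b)† W(c) = phase · W(c - b), in matrix elements. The contraction of the two
creation exponentials and the three Gaussian normalizations combine into the normalization of c - b
and a pure phase. -/
theorem inner_weylFin_weylFin {n n' : ℕ} {b c : ℕ → ℂ} (hb : ∀ m ≥ n, b m = 0)
    (hc : ∀ m ≥ n', c m = 0) (u v : FinVec M) :
    ⟪weylFin A n b u, weylFin A n' c v⟫_ℂ =
      Complex.exp ((starRingEnd ℂ (pair b c) - pair b c) / 2) * weylForm A (c - b) u v := by
  rw [weylFin, weylFin, inner_smul_left, inner_smul_right,
    inner_creationExp_creationExp (isAdj_annih_creat A hb) (locNil_annih A b)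
      (annih_mul_creat A n b b) (isAdj_annih_creat A hc) (locNil_annih A c)
      (annih_mul_creat A n' c c) (annih_mul_creat A n b c), ← pair_eq_sum hb, weylForm,
    pair_sub_self (summable_of_support hb) (summable_of_support hc), ← Complex.exp_conj]
  have e1 : expAnnih A c (expAnnih A (-b) u) = expAnnih A (c - b) u := by
    rw [sub_eq_add_neg, expAnnih_add, Module.End.mul_apply]
  have e2 : expAnnih A b (expAnnih A (-c) v) = expAnnih A (-(c - b)) v := by
    rw [neg_sub, sub_eq_add_neg, expAnnih_add, Module.End.mul_apply]
  change Complex.exp _ * (Complex.exp _ * (Complex.exp _ *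
    ⟪expAnnih A c (expAnnih A (-b) u), expAnnih A b (expAnnih A (-c) v)⟫_ℂ)) = _
  rw [e1, e2, ← mul_assoc, ← mul_assoc, ← mul_assoc, ← Complex.exp_add, ← Complex.exp_add,
    ← Complex.exp_add]
  congr 2
  rw [map_div₀, map_neg, conj_pair, map_ofNat]
  ring

theorem weylForm_zero (u v : FinVec M) : weylForm A 0 u v = ⟪u, v⟫_ℂ := by
  rw [weylForm, pair_zero, neg_zero, neg_zero, expAnnih_zero]
  simp

/-- Without bosons light enough to be absorbed by v, only the vacuum normalization remains. It is
applied to the difference of two truncations of one sequence. -/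
theorem weylForm_of_energyLE {b : ℕ → ℂ} {k : ℤ} {v : FinVec M} (hv : v ∈ energyLE M k)
    (hb : ∀ m : ℕ, 2 * ((m : ℤ) + 1) ≤ k → b m = 0) :
    weylForm A b v v = Complex.exp (-(pair b b) / 2) * ⟪v, v⟫_ℂ := by
  have h : expAnnih A (-b) v = expAnnih A 0 v := expAnnih_congr A hv fun m hm => by
    rw [Pi.neg_apply, hb m hm, neg_zero, Pi.zero_apply]
  rw [weylForm, h, expAnnih_congr A hv (c := 0) hb, expAnnih_zero, Module.End.one_apply]

theorem inner_weylFin_self {n : ℕ} {b : ℕ → ℂ} (hb : ∀ m ≥ n, b m = 0) (v : FinVec M) :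
    ⟪weylFin A n b v, weylFin A n b v⟫_ℂ = ⟪v, v⟫_ℂ := by
  rw [inner_weylFin_weylFin A hb hb, conj_pair, sub_self, sub_self, weylForm_zero]
  simp

/-- Both vectors have norm ‖v‖ and their overlap is e^{-δ/2}‖v‖², where δ is the boson norm of the
modes between the cutoffs. So the squared distance is 2(1 - e^{-δ/2})‖v‖² ≤ δ‖v‖². -/
theorem norm_sub_weylFin_le {b : ℕ → ℂ} {k : ℕ} {v : FinVec M} (hv : v ∈ energyLE M k) {n n' : ℕ}
    (hn : k ≤ n) (hn' : n ≤ n') :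
    ‖weylFin A n (trunc n b) v - weylFin A n' (trunc n' b) v‖ ^ 2 ≤
      ((∑ m ∈ Finset.range n', ‖b m‖ ^ 2 / (m + 1)) - ∑ m ∈ Finset.range n, ‖b m‖ ^ 2 / (m + 1)) *
        ‖v‖ ^ 2 := by
  have hsq : ∀ m : ℕ, starRingEnd ℂ (b m) * b m / ((m : ℂ) + 1) =
      ((‖b m‖ ^ 2 / (m + 1) : ℝ) : ℂ) := by
    intro m
    rw [Complex.conj_mul']
    push_cast
    rfl
  have hp : pair (trunc n b) (trunc n' b) =
      ((∑ m ∈ Finset.range n, ‖b m‖ ^ 2 / (m + 1) : ℝ) : ℂ) := by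
    rw [pair_eq_sum (trunc_of_ge b), Complex.ofReal_sum]
    refine Finset.sum_congr rfl fun m hm => ?_
    rw [Finset.mem_range] at hm
    rw [trunc_of_lt b hm, trunc_of_lt b (hm.trans_le hn'), hsq]
  have hps : ∀ l, pair (trunc l b) (trunc l b) =
      ((∑ m ∈ Finset.range l, ‖b m‖ ^ 2 / (m + 1) : ℝ) : ℂ) := by
    intro l
    rw [pair_trunc, Complex.ofReal_sum]
    exact Finset.sum_congr rfl fun m _ => hsq m
  have hself : ∀ l, ‖weylFin A l (trunc l b) v‖ ^ 2 = ‖v‖ ^ 2 := by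
    intro l
    have h := inner_weylFin_self A (trunc_of_ge (n := l) b) v
    rw [inner_self_eq_norm_sq_to_K, inner_self_eq_norm_sq_to_K] at h
    exact_mod_cast h
  set δ := (∑ m ∈ Finset.range n', ‖b m‖ ^ 2 / (m + 1)) -
    ∑ m ∈ Finset.range n, ‖b m‖ ^ 2 / (m + 1) with hδ
  have hcross : ⟪weylFin A n (trunc n b) v, weylFin A n' (trunc n' b) v⟫_ℂ =
      ((Real.exp (-δ / 2) * ‖v‖ ^ 2 : ℝ) : ℂ) := by
    rw [inner_weylFin_weylFin A (trunc_of_ge b) (trunc_of_ge b), hp, Complex.conj_ofReal, sub_self,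
      zero_div, Complex.exp_zero, one_mul, weylForm_of_energyLE A hv]
    · rw [pair_sub_self (summable_of_support (trunc_of_ge b)) (summable_of_support (trunc_of_ge b)),
        hps, hps, hp, Complex.conj_ofReal, inner_self_eq_norm_sq_to_K]
      push_cast
      congr 2
      rw [hδ]
      push_cast
      ring
    · intro m hm
      rw [Pi.sub_apply, trunc_of_lt b (by omega), trunc_of_lt b (by omega), sub_self]
  rw [@norm_sub_sq ℂ, hself, hself, hcross]
  have h1 := Real.add_one_le_exp (-δ / 2)
  have h2 : RCLike.re (((Real.exp (-δ / 2) * ‖v‖ ^ 2 : ℝ) : ℂ)) = Real.exp (-δ / 2) * ‖v‖ ^ 2 :=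
    Complex.ofReal_re _
  rw [h2]
  nlinarith [sq_nonneg ‖v‖]

theorem cauchySeq_weylFin {b : ℕ → ℂ} (hb : Summable fun m => ‖b m‖) (v : FinVec M) :
    CauchySeq fun n => weylFin A n (trunc n b) v := by
  have hs : Summable fun m : ℕ => ‖b m‖ ^ 2 / ((m : ℝ) + 1) := by
    refine (summable_pair hb hb).norm.congr fun m => ?_
    rw [Complex.conj_mul', norm_div, norm_pow, Complex.norm_real, norm_norm]
    congr 1
    exact_mod_cast Complex.norm_natCast (m + 1)
  obtain ⟨k, hk⟩ := exists_mem_energyLE v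
  have hc := hs.hasSum.tendsto_sum_nat.cauchySeq
  rw [Metric.cauchySeq_iff] at hc ⊢
  intro ε hε
  obtain ⟨N, hN⟩ := hc (ε ^ 2 / (‖v‖ ^ 2 + 1)) (by positivity)
  have key : ∀ n n', max N k ≤ n → n ≤ n' →
      ‖weylFin A n (trunc n b) v - weylFin A n' (trunc n' b) v‖ < ε := by
    intro n n' hn hn'
    have h1 := norm_sub_weylFin_le A (b := b) hk (le_of_max_le_right hn) hn'
    have h2 := hN n' (le_of_max_le_left (hn.trans hn')) n (le_of_max_le_left hn)
    rw [Real.dist_eq] at h2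
    have h3 := (le_abs_self _).trans_lt h2
    refine lt_of_pow_lt_pow_left₀ 2 hε.le (h1.trans_lt ?_)
    rw [lt_div_iff₀ (by positivity)] at h3
    have h4 : 0 ≤ (∑ m ∈ Finset.range n', ‖b m‖ ^ 2 / ((m : ℝ) + 1)) -
        ∑ m ∈ Finset.range n, ‖b m‖ ^ 2 / ((m : ℝ) + 1) := by
      rw [sub_nonneg]
      refine Finset.sum_le_sum_of_subset_of_nonneg (Finset.range_subset_range.2 hn') ?_
      intros
      positivity
    nlinarith
  refine ⟨max N k, fun n hn n' hn' => ?_⟩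
  rw [dist_eq_norm]
  rcases le_total n n' with h | h
  · exact key n n' hn h
  · rw [norm_sub_rev]
    exact key n' n hn' h

/-- The Weyl operator of a summable sequence, on finite vectors. -/
noncomputable def weylVec (b : ℕ → ℂ) (v : FinVec M) : Fock M :=
  Filter.limUnder Filter.atTop fun n => weylFin A n (trunc n b) v

theorem tendsto_weylVec {b : ℕ → ℂ} (hb : Summable fun m => ‖b m‖) (v : FinVec M) :
    Filter.Tendsto (fun n => weylFin A n (trunc n b) v) Filter.atTop (nhds (weylVec A b v)) :=
  (cauchySeq_weylFin A hb v).tendsto_limUnder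

theorem expAnnih_trunc (b : ℕ → ℂ) {k n : ℕ} {v : FinVec M} (hv : v ∈ energyLE M k) (hn : k ≤ n) :
    expAnnih A (trunc n b) v = expAnnih A b v :=
  expAnnih_congr A hv fun m hm => trunc_of_lt b (by omega)

theorem trunc_neg (n : ℕ) (b : ℕ → ℂ) : -trunc n b = trunc n (-b) := by
  funext m
  simp only [trunc, Pi.neg_apply]
  split_ifs <;> simp

theorem tendsto_weylForm_trunc {b : ℕ → ℂ} (hb : Summable fun m => ‖b m‖) (u v : FinVec M) :
    Filter.Tendsto (fun n => weylForm A (trunc n b) u v) Filter.atTop (nhds (weylForm A b u v)) := by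
  obtain ⟨k, hk⟩ := exists_mem_energyLE u
  obtain ⟨l, hl⟩ := exists_mem_energyLE v
  have h1 : Filter.Tendsto (fun n => Complex.exp (-(pair (trunc n b) (trunc n b)) / 2) *
      ⟪expAnnih A b u, expAnnih A (-b) v⟫_ℂ) Filter.atTop (nhds (weylForm A b u v)) :=
    (((tendsto_pair_trunc hb hb).neg.div_const 2).cexp).mul_const _
  refine h1.congr' ?_
  filter_upwards [Filter.eventually_ge_atTop (max k l)] with n hn
  rw [weylForm, trunc_neg, expAnnih_trunc A b hk (le_of_max_le_left hn),
    expAnnih_trunc A (-b) hl (le_of_max_le_right hn)]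

theorem inner_weylVec {b : ℕ → ℂ} (hb : Summable fun m => ‖b m‖) (u v : FinVec M) :
    ⟪(u : Fock M), weylVec A b v⟫_ℂ = weylForm A b u v := by
  refine tendsto_nhds_unique
    (tendsto_const_nhds.inner (tendsto_weylVec A hb v) (x := (u : Fock M)) (𝕜 := ℂ)) ?_
  simp_rw [inner_weylFin A (trunc_of_ge b)]
  exact tendsto_weylForm_trunc A hb u v

theorem inner_weylVec_weylVec {b c : ℕ → ℂ} (hb : Summable fun m => ‖b m‖)
    (hc : Summable fun m => ‖c m‖) (u v : FinVec M) :
    ⟪weylVec A b u, weylVec A c v⟫_ℂ =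
      Complex.exp ((starRingEnd ℂ (pair b c) - pair b c) / 2) * weylForm A (c - b) u v := by
  refine tendsto_nhds_unique ((tendsto_weylVec A hb u).inner (tendsto_weylVec A hc v)) ?_
  simp_rw [inner_weylFin_weylFin A (trunc_of_ge b) (trunc_of_ge c), trunc_sub]
  refine Filter.Tendsto.mul (Filter.Tendsto.cexp ?_)
    (tendsto_weylForm_trunc A (summable_norm_sub hc hb) u v)
  have h := tendsto_pair_trunc hb hc
  exact (((Complex.continuous_conj.tendsto _).comp h).sub h).div_const 2

end Weyl

/-! ### Weyl operators as unitaries on the Fock space and the Weyl relations -/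

section WeylUnitary

variable {M : ℕ}

/-- The embedding of finite vectors as a linear isometry. -/
noncomputable def FinVec.inclIso (M : ℕ) : FinVec M →ₗᵢ[ℂ] Fock M :=
  ⟨FinVec.incl M, fun _ => rfl⟩

theorem FinVec.denseRange_incl : DenseRange (FinVec.inclIso M) := by
  have h : Set.range (FinVec.inclIso M) = (finiteStates M : Set (Fock M)) := by
    ext v
    exact ⟨fun ⟨u, hu⟩ => hu ▸ u.mem, fun hv => ⟨FinVec.mk v hv, rfl⟩⟩
  rw [DenseRange, h]
  exact dense_finiteStates

/-- Closed properties that hold for finite vectors hold on the Fock space. -/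
theorem fock_induction {p : Fock M → Prop} (hp : IsClosed {v | p v}) (h : ∀ u : FinVec M, p u)
    (v : Fock M) : p v :=
  FinVec.denseRange_incl.induction_on v hp h

/-- The extension of an isometry from finite vectors to the Fock space. -/
noncomputable def extendIso (W : FinVec M →ₗᵢ[ℂ] Fock M) : Fock M →ₗᵢ[ℂ] Fock M :=
  ⟨(ContinuousLinearMap.extend W.toContinuousLinearMap
      (FinVec.inclIso M).toContinuousLinearMap : Fock M →L[ℂ] Fock M).toLinearMap,
    fun v => by
      refine fock_induction (p := fun v : Fock M => ‖(ContinuousLinearMap.extend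
        W.toContinuousLinearMap (FinVec.inclIso M).toContinuousLinearMap :
          Fock M →L[ℂ] Fock M) v‖ = ‖v‖) (isClosed_eq ?_ continuous_norm) (fun u => ?_) v
      · exact (ContinuousLinearMap.continuous _).norm
      · have h := ContinuousLinearMap.extend_eq W.toContinuousLinearMap
          (e := (FinVec.inclIso M).toContinuousLinearMap) FinVec.denseRange_incl
          (FinVec.inclIso M).isometry.isUniformInducing u
        exact (congrArg norm h).trans (W.norm_map u)⟩

theorem extendIso_coe (W : FinVec M →ₗᵢ[ℂ] Fock M) (u : FinVec M) : extendIso W u = W u :=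
  ContinuousLinearMap.extend_eq W.toContinuousLinearMap
    (e := (FinVec.inclIso M).toContinuousLinearMap) FinVec.denseRange_incl
    (FinVec.inclIso M).isometry.isUniformInducing u

variable (A : Flavor M)

/-- The Weyl operator as an isometry on finite vectors. -/
noncomputable def weylIsoFin {b : ℕ → ℂ} (hb : Summable fun m => ‖b m‖) :
    FinVec M →ₗᵢ[ℂ] Fock M where
  toFun := weylVec A b
  map_add' u v := fock_ext_fin fun w => by
    simp only [inner_add_right, inner_weylVec A hb, weylForm, map_add, mul_add]
  map_smul' c u := fock_ext_fin fun w => by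
    simp only [inner_smul_right, inner_weylVec A hb, weylForm, map_smul, RingHom.id_apply]
    ring
  norm_map' u := by
    have h := inner_weylVec_weylVec A hb hb u u
    rw [conj_pair, sub_self, sub_self, weylForm_zero, zero_div, Complex.exp_zero, one_mul,
      inner_self_eq_norm_sq_to_K, inner_self_eq_norm_sq_to_K] at h
    have h' : ‖weylVec A b u‖ ^ 2 = ‖u‖ ^ 2 := by exact_mod_cast h
    exact (sq_eq_sq₀ (norm_nonneg _) (norm_nonneg _)).1 h'

/-- The Weyl operator as an isometry. -/
noncomputable def weylIso {b : ℕ → ℂ} (hb : Summable fun m => ‖b m‖) : Fock M →ₗᵢ[ℂ] Fock M :=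
  extendIso (weylIsoFin A hb)

theorem weylIso_coe {b : ℕ → ℂ} (hb : Summable fun m => ‖b m‖) (u : FinVec M) :
    weylIso A hb u = weylVec A b u :=
  extendIso_coe _ u

theorem inner_weylIso {b : ℕ → ℂ} (hb : Summable fun m => ‖b m‖) (v w : Fock M) :
    ⟪v, weylIso A hb w⟫_ℂ = ⟪weylIso A (summable_norm_neg hb) v, w⟫_ℂ := by
  refine fock_induction (p := fun v => ⟪v, weylIso A hb w⟫_ℂ =
    ⟪weylIso A (summable_norm_neg hb) v, w⟫_ℂ) (isClosed_eq (by fun_prop) ?_) (fun u => ?_) v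
  · exact (LinearIsometry.continuous _).inner continuous_const
  · refine fock_induction (p := fun w => ⟪(u : Fock M), weylIso A hb w⟫_ℂ =
      ⟪weylIso A (summable_norm_neg hb) u, w⟫_ℂ) (isClosed_eq ?_ (by fun_prop)) (fun v => ?_) w
    · exact continuous_const.inner (LinearIsometry.continuous _)
    · rw [weylIso_coe, weylIso_coe, inner_weylVec A hb, ← inner_conj_symm,
        inner_weylVec A (summable_norm_neg hb), weylForm, weylForm, map_mul, inner_conj_symm,
        neg_neg, pair_neg_neg, ← Complex.exp_conj, map_div₀, map_neg, conj_pair, map_ofNat]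

/-- W(b) is moved to the other side as W(-b), and the scalar product of two Weyl vectors is known.
With c = -b this yields the inverse, so surjectivity of the isometries needs no separate argument.
-/
theorem weylIso_mul {b c : ℕ → ℂ} (hb : Summable fun m => ‖b m‖) (hc : Summable fun m => ‖c m‖)
    (v : Fock M) : weylIso A hb (weylIso A hc v) =
      Complex.exp ((pair b c - starRingEnd ℂ (pair b c)) / 2) •
        weylIso A (summable_norm_add hb hc) v := by
  refine fock_induction (p := fun v => weylIso A hb (weylIso A hc v) =
      Complex.exp ((pair b c - starRingEnd ℂ (pair b c)) / 2) •
        weylIso A (summable_norm_add hb hc) v) (isClosed_eq ?_ ?_) (fun v => ?_) v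
  · exact (LinearIsometry.continuous _).comp (LinearIsometry.continuous _)
  · exact (weylIso A (summable_norm_add hb hc)).continuous.const_smul (Complex.exp _)
  · refine fock_ext_fin fun u => ?_
    rw [inner_weylIso, weylIso_coe, weylIso_coe, weylIso_coe, inner_smul_right,
      inner_weylVec_weylVec A (summable_norm_neg hb) hc,
      inner_weylVec A (summable_norm_add hb hc), pair_neg_left, sub_neg_eq_add, map_neg]
    congr 2
    · ring
    · rw [sub_neg_eq_add, add_comm]

theorem weylIso_zero {b : ℕ → ℂ} (hb : Summable fun m => ‖b m‖) (h : b = 0) (v : Fock M) :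
    weylIso A hb v = v := by
  subst h
  refine fock_induction (p := fun v => weylIso A hb v = v)
    (isClosed_eq (LinearIsometry.continuous _) continuous_id) (fun v => ?_) v
  refine fock_ext_fin fun u => ?_
  rw [weylIso_coe, inner_weylVec A hb, weylForm_zero]
  rfl

theorem weylIso_neg_weylIso {b c : ℕ → ℂ} (hb : Summable fun m => ‖b m‖)
    (hc : Summable fun m => ‖c m‖) (h : c = -b) (v : Fock M) :
    weylIso A hb (weylIso A hc v) = v := by
  subst h
  rw [weylIso_mul, weylIso_zero A _ (add_neg_cancel b), pair_neg_right, map_neg, conj_pair]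
  simp

open Classical in
/-- The Weyl operator of a summable sequence. -/
noncomputable def weyl (b : ℕ → ℂ) : Fock M ≃ₗᵢ[ℂ] Fock M :=
  if hb : Summable fun m => ‖b m‖ then
    { weylIso A hb with
      invFun := weylIso A (summable_norm_neg hb)
      left_inv := weylIso_neg_weylIso A _ _ (neg_neg b).symm
      right_inv := weylIso_neg_weylIso A _ _ rfl }
  else 1

theorem weyl_apply {b : ℕ → ℂ} (hb : Summable fun m => ‖b m‖) (v : Fock M) :
    weyl A b v = weylIso A hb v := by
  rw [weyl, dif_pos hb]
  rfl

theorem inner_weyl_coe {b : ℕ → ℂ} (hb : Summable fun m => ‖b m‖) (u v : FinVec M) :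
    ⟪(u : Fock M), weyl A b v⟫_ℂ = weylForm A b u v := by
  rw [weyl_apply A hb, weylIso_coe, inner_weylVec A hb]

theorem weyl_mul {b c : ℕ → ℂ} (hb : Summable fun m => ‖b m‖) (hc : Summable fun m => ‖c m‖)
    (v : Fock M) : weyl A b (weyl A c v) =
      Complex.exp ((pair b c - starRingEnd ℂ (pair b c)) / 2) • weyl A (b + c) v := by
  rw [weyl_apply A hb, weyl_apply A hc, weyl_apply A (summable_norm_add hb hc), weylIso_mul]

theorem weyl_symm {b : ℕ → ℂ} (hb : Summable fun m => ‖b m‖) (v : Fock M) :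
    (weyl A b).symm v = weyl A (-b) v := by
  rw [LinearIsometryEquiv.symm_apply_eq, weyl_apply A hb, weyl_apply A (summable_norm_neg hb),
    weylIso_neg_weylIso A _ _ rfl]

theorem continuous_weylForm_smul (b : ℕ → ℂ) (u v : FinVec M) :
    Continuous fun t : ℝ => weylForm A ((t : ℂ) • b) u v := by
  obtain ⟨k, hk⟩ := exists_mem_energyLE u
  obtain ⟨l, hl⟩ := exists_mem_energyLE v
  have h1 : ∀ {k : ℕ} {u : FinVec M}, u ∈ energyLE M k → ∀ c : ℕ → ℂ,
      Continuous fun t : ℝ => expAnnih A ((t : ℂ) • c) u := by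
    intro k u hk c
    simp_rw [fun t : ℝ => expAnnih_apply A ((t : ℂ) • c) (n := k + 1) hk (by push_cast; omega),
      annih_smul, smul_pow, LinearMap.smul_apply]
    fun_prop
  have h2 : Continuous fun t : ℝ => expAnnih A (-((t : ℂ) • b)) v := by
    simp_rw [← smul_neg]
    exact h1 hl _
  unfold weylForm
  refine Continuous.mul ?_ ((h1 hk b).inner h2)
  simp_rw [pair_smul_left, pair_smul_right]
  fun_prop

theorem weyl_smul_add {b : ℕ → ℂ} (hb : Summable fun m => ‖b m‖) (s t : ℝ) (v : Fock M) :
    weyl A (((s + t : ℝ) : ℂ) • b) v = weyl A ((s : ℂ) • b) (weyl A ((t : ℂ) • b) v) := by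
  rw [weyl_mul A (summable_norm_smul hb s) (summable_norm_smul hb t), pair_smul_left,
    pair_smul_right, map_mul, map_mul, conj_pair, Complex.conj_conj, Complex.conj_ofReal,
    Complex.conj_ofReal, sub_self, zero_div, Complex.exp_zero, one_smul, ← add_smul,
    Complex.ofReal_add]

end WeylUnitary

/-! ### A core criterion for generators -/

section Core

variable {E : Type*} [NormedAddCommGroup E] [InnerProductSpace ℂ E]

/-- A norm bound makes convergence against a dense set into weak convergence. This is why a bounded
graph norm suffices for a core, without convergence of T along the sequence. -/
theorem tendsto_inner_of_dense {S : Set E} (hS : Dense S) {x : ℕ → E} {y : E} {C : ℝ}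
    (hC : ∀ n, ‖x n‖ ≤ C)
    (h : ∀ z ∈ S, Filter.Tendsto (fun n => ⟪z, x n⟫_ℂ) Filter.atTop (nhds ⟪z, y⟫_ℂ)) (z : E) :
    Filter.Tendsto (fun n => ⟪z, x n⟫_ℂ) Filter.atTop (nhds ⟪z, y⟫_ℂ) := by
  rw [Metric.tendsto_atTop]
  intro ε hε
  have hC0 : 0 ≤ C := (norm_nonneg _).trans (hC 0)
  obtain ⟨z', hz', hzz⟩ := hS.exists_dist_lt z (ε := ε / (2 * (C + ‖y‖ + 1))) (by positivity)
  obtain ⟨N, hN⟩ := Metric.tendsto_atTop.1 (h z' hz') (ε / 2) (by positivity)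
  refine ⟨N, fun n hn => ?_⟩
  have h1 := hN n hn
  rw [dist_eq_norm] at hzz h1 ⊢
  have e : ⟪z, x n⟫_ℂ - ⟪z, y⟫_ℂ = ⟪z - z', x n - y⟫_ℂ + (⟪z', x n⟫_ℂ - ⟪z', y⟫_ℂ) := by
    rw [← inner_sub_right, ← inner_sub_right, ← inner_add_left, sub_add_cancel]
  have h2 : ‖⟪z - z', x n - y⟫_ℂ‖ ≤ ε / 2 := by
    calc ‖⟪z - z', x n - y⟫_ℂ‖ ≤ ‖z - z'‖ * ‖x n - y‖ := norm_inner_le_norm _ _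
      _ ≤ ε / (2 * (C + ‖y‖ + 1)) * (C + ‖y‖ + 1) := by
          refine mul_le_mul hzz.le ?_ (norm_nonneg _) (by positivity)
          have := norm_sub_le (x n) y
          have := hC n
          linarith
      _ = ε / 2 := by
          have : C + ‖y‖ + 1 ≠ 0 := by positivity
          field_simp
  rw [e]
  have := norm_add_le ⟪z - z', x n - y⟫_ℂ (⟪z', x n⟫_ℂ - ⟪z', y⟫_ℂ)
  linarith

/-- A dense domain on which the derivative of a unitary group is known is a core if the orbits of
its vectors are limits of sequences in the domain that are bounded in the graph norm. -/
theorem generatesUnitaryGroup_of_core [CompleteSpace E] {T : E →ₗ.[ℂ] E} {U : ℝ → E ≃ₗᵢ[ℂ] E}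
    (hT : Dense (T.domain : Set E)) (hU : ∀ t u : ℝ, U (t + u) = U t * U u)
    (hc : ∀ v : E, Continuous fun t : ℝ => U t v)
    (hd : ∀ v : T.domain, HasDerivAt (fun t : ℝ => U t v) (T v) 0)
    (hcore : ∀ (v : T.domain) (t : ℝ), ∃ (x : ℕ → T.domain) (C : ℝ),
      Filter.Tendsto (fun n => (x n : E)) Filter.atTop (nhds (U t v)) ∧ ∀ n, ‖T (x n)‖ ≤ C) :
    GeneratesUnitaryGroup T U := by
  refine generatesUnitaryGroup_of_dense hU hc hd fun w hw => ?_
  have h0 := group_zero hU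
  have hw' : ∀ v : T.domain, ⟪w, T v⟫_ℂ = ⟪w, (v : E)⟫_ℂ := fun v => by
    rw [← sub_eq_zero, ← inner_sub_right]
    exact hw v
  -- Orthogonality of w to the range of T - 1 is carried along the orbit: T of the approximating
  -- vectors converges weakly to U_t T v, as skew-symmetry shows on the domain.
  have key : ∀ (v : T.domain) (t : ℝ), ⟪w, U t (T v)⟫_ℂ = ⟪w, U t v⟫_ℂ := by
    intro v t
    obtain ⟨x, C, hx, hC⟩ := hcore v t
    have hweak : ∀ z ∈ (T.domain : Set E), Filter.Tendsto (fun n => ⟪z, T (x n)⟫_ℂ) Filter.atTop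
        (nhds ⟪z, U t (T v)⟫_ℂ) := by
      intro z hz
      have h1 : ∀ n, ⟪z, T (x n)⟫_ℂ = -⟪T ⟨z, hz⟩, (x n : E)⟫_ℂ := fun n =>
        eq_neg_of_add_eq_zero_left (generator_skew h0 (hd ⟨z, hz⟩) (hd (x n)))
      have h2 : HasDerivAt (fun s => U s (U t v)) (U t (T v)) 0 := by
        have h3 := (group_hasDerivAt hU (hd v) (0 + t)).comp_add_const 0 t
        rw [zero_add] at h3
        refine h3.congr_of_eventuallyEq (Filter.Eventually.of_forall fun s => ?_)
        change _ = U (s + t) v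
        rw [hU]
        rfl
      rw [eq_neg_of_add_eq_zero_left (generator_skew h0 (hd ⟨z, hz⟩) h2)]
      simp_rw [h1]
      exact (tendsto_const_nhds.inner hx).neg
    have h3 := tendsto_inner_of_dense hT hC hweak w
    simp_rw [hw'] at h3
    exact tendsto_nhds_unique h3 (tendsto_const_nhds.inner hx)
  have hzero : ∀ v : T.domain, ⟪w, (v : E)⟫_ℂ = 0 := by
    intro v
    -- By the previous step ⟨w, U_t v⟩ solves f' = f, hence equals e^t ⟨w, v⟩. Being bounded for t →
    -- ∞, it is zero.
    have hf : ∀ t : ℝ, HasDerivAt (fun t : ℝ => (Real.exp (-t) : ℂ) * ⟪w, U t v⟫_ℂ) 0 t := by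
      intro t
      have h1 := (hasDerivAt_const t w).inner ℂ (group_hasDerivAt hU (hd v) t)
      have h2 : HasDerivAt (fun t : ℝ => ((Real.exp (-t) : ℝ) : ℂ)) ((-Real.exp (-t) : ℝ) : ℂ) t := by
        have := ((hasDerivAt_id t).neg.exp).ofReal_comp
        simpa using this
      have h3 := h2.mul h1
      rw [inner_zero_left, add_zero, key] at h3
      refine h3.congr_deriv ?_
      push_cast
      ring
    have hconst : ∀ t : ℝ, (Real.exp (-t) : ℂ) * ⟪w, U t v⟫_ℂ = ⟪w, (v : E)⟫_ℂ := by
      intro t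
      have h1 := is_const_of_deriv_eq_zero (fun t => (hf t).differentiableAt)
        (fun t => (hf t).deriv) t 0
      simpa [h0] using h1
    have hle : ∀ t : ℝ, ‖⟪w, (v : E)⟫_ℂ‖ ≤ Real.exp (-t) * (‖w‖ * ‖(v : E)‖) := by
      intro t
      rw [← hconst t, norm_mul, Complex.norm_real, Real.norm_of_nonneg (Real.exp_nonneg _)]
      gcongr
      simpa using norm_inner_le_norm (𝕜 := ℂ) w (U t v)
    have hlim : Filter.Tendsto (fun t : ℝ => Real.exp (-t) * (‖w‖ * ‖(v : E)‖)) Filter.atTop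
        (nhds (0 * (‖w‖ * ‖(v : E)‖))) := Real.tendsto_exp_neg_atTop_nhds_zero.mul_const _
    have := ge_of_tendsto' hlim hle
    rw [zero_mul] at this
    exact norm_le_zero_iff.1 this
  have hcl : IsClosed {z : E | ⟪w, z⟫_ℂ = 0} := isClosed_eq (by fun_prop) continuous_const
  have : w ∈ {z : E | ⟪w, z⟫_ℂ = 0} := by
    rw [← hcl.closure_eq]
    exact closure_mono (fun z hz => hzero ⟨z, hz⟩) (hT w)
  exact inner_self_eq_zero.1 this

/-- For isometries ‖U_t x - x‖² = 2‖x‖² - 2 Re⟨x, U_t x⟩, so weak continuity at 0 of diagonal matrix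
elements gives norm continuity; density of S and the group law do the rest. -/
theorem group_continuous {S : Set E} (hS : Dense S) {U : ℝ → E ≃ₗᵢ[ℂ] E}
    (hU : ∀ t u : ℝ, U (t + u) = U t * U u)
    (h : ∀ v ∈ S, ContinuousAt (fun t => ⟪v, U t v⟫_ℂ) 0) (v : E) :
    Continuous fun t : ℝ => U t v := by
  have h0 := group_zero hU
  have hlip : ∀ s t : ℝ, ∀ x y : E, dist (U s x) (U t x) ≤ dist (U s y) (U t y) + 2 * dist x y := by
    intro s t x y
    have h1 := dist_triangle4 (U s x) (U s y) (U t y) (U t x)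
    rw [(U s).dist_map, (U t).dist_map, dist_comm y x] at h1
    linarith
  have hS' : ∀ x ∈ S, Filter.Tendsto (fun t => dist (U t x) (U 0 x)) (nhds 0) (nhds 0) := by
    intro x hx
    have h1 : ∀ t, dist (U t x) (U 0 x) = √(2 * ‖x‖ ^ 2 - 2 * RCLike.re ⟪x, U t x⟫_ℂ) := by
      intro t
      rw [dist_eq_norm, ← Real.sqrt_sq (norm_nonneg (U t x - U 0 x)), @norm_sub_sq ℂ, h0,
        LinearIsometryEquiv.norm_map, LinearIsometryEquiv.norm_map, ← inner_conj_symm,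
        RCLike.conj_re]
      congr 1
      change ‖x‖ ^ 2 - 2 * RCLike.re ⟪x, U t x⟫_ℂ + ‖x‖ ^ 2 = _
      ring
    simp_rw [h1]
    have h2 := (h x hx).tendsto
    have h3 := (RCLike.continuous_re.tendsto _).comp h2
    have h4 := ((tendsto_const_nhds (x := 2 * ‖x‖ ^ 2)).sub (h3.const_mul 2)).sqrt
    have h5 : √(2 * ‖x‖ ^ 2 - 2 * RCLike.re ⟪x, U 0 x⟫_ℂ) = 0 := by
      rw [h0]
      change √(2 * ‖x‖ ^ 2 - 2 * RCLike.re ⟪x, x⟫_ℂ) = _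
      rw [inner_self_eq_norm_sq, sub_self, Real.sqrt_zero]
    rw [h5] at h4
    exact h4
  have hall : ∀ x : E, Filter.Tendsto (fun t => dist (U t x) (U 0 x)) (nhds 0) (nhds 0) := by
    intro x
    rw [Metric.tendsto_nhds]
    intro ε hε
    obtain ⟨y, hy, hxy⟩ := hS.exists_dist_lt x (ε := ε / 4) (by positivity)
    filter_upwards [Metric.tendsto_nhds.1 (hS' y hy) (ε / 2) (by positivity)] with t ht
    rw [Real.dist_0_eq_abs, abs_of_nonneg dist_nonneg] at ht ⊢
    have := hlip t 0 x y
    linarith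
  rw [continuous_iff_continuousAt]
  intro t
  rw [ContinuousAt, tendsto_iff_dist_tendsto_zero]
  have h1 : ∀ s, dist (U s v) (U t v) = dist (U (s - t) v) (U 0 v) := by
    intro s
    have h2 : U s v = U t (U (s - t) v) := by
      conv_lhs => rw [show s = t + (s - t) by ring, hU]
      rfl
    rw [h2, (U t).dist_map, h0]
    rfl
  simp_rw [h1]
  refine (hall v).comp ?_
  have : Filter.Tendsto (fun s : ℝ => s - t) (nhds t) (nhds (t - t)) := by
    exact (continuous_id.sub continuous_const).tendsto t
  rwa [sub_self] at this

end Core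

/-! ### The generators of the Weyl groups -/

section WeylGenerator

open scoped Nat

variable {M : ℕ} (A : Flavor M)

theorem inner_self_ofReal {E : Type*} [NormedAddCommGroup E] [InnerProductSpace ℂ E] (x : E) :
    ⟪x, x⟫_ℂ = ((‖x‖ ^ 2 : ℝ) : ℂ) := by
  rw [inner_self_eq_norm_sq_to_K]
  push_cast
  rfl

/-- The commutation relation gives ‖ρ(-m)v‖² = ‖ρ(m)v‖² + m‖v‖², and ρ(m)v = 0 for large m. Linear
growth is more than the true rate, but the coefficients b_m/m absorb it. -/
theorem exists_norm_rho_neg_le (v : FinVec M) :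
    ∃ C : ℝ, 0 ≤ C ∧ ∀ m : ℕ, ‖rho A (-(m + 1)) v‖ ≤ C * (m + 1) := by
  obtain ⟨k, hk⟩ := exists_mem_energyLE v
  set S : ℝ := ∑ m ∈ Finset.range k, ‖rho A (m + 1) v‖ with hS
  have hS0 : 0 ≤ S := Finset.sum_nonneg fun _ _ => norm_nonneg _
  refine ⟨S + ‖v‖, by positivity, fun m => ?_⟩
  have h1 : ‖rho A (m + 1) v‖ ≤ S := by
    by_cases hm : m < k
    · exact Finset.single_le_sum (f := fun m : ℕ => ‖rho A (m + 1) v‖)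
        (fun _ _ => norm_nonneg _) (Finset.mem_range.2 hm)
    · rw [rho_apply_eq_zero A hk (by omega), norm_zero]
      exact hS0
  have h2 : ‖rho A (-(m + 1)) v‖ ^ 2 = ‖rho A (m + 1) v‖ ^ 2 + (m + 1) * ‖v‖ ^ 2 := by
    have e1 := LinearMap.congr_fun (rho_commutator A (m + 1) (-(m + 1))) v
    rw [if_pos (by ring), LinearMap.sub_apply, Module.End.mul_apply, Module.End.mul_apply,
      sub_eq_iff_eq_add, LinearMap.smul_apply, Module.End.one_apply] at e1
    have e2 := isAdj_rho A (m + 1) (rho A (-(m + 1)) v) v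
    rw [e1, inner_add_left, inner_smul_left, (isAdj_rho A (m + 1)).symm (rho A (m + 1) v) v,
      inner_self_ofReal, inner_self_ofReal, inner_self_ofReal] at e2
    have e3 : starRingEnd ℂ (((m + 1 : ℤ) : ℂ)) = ((m : ℝ) + 1 : ℝ) := by
      rw [map_intCast]
      push_cast
      rfl
    rw [e3] at e2
    have e4 : ((m : ℝ) + 1) * ‖v‖ ^ 2 + ‖rho A (m + 1) v‖ ^ 2 = ‖rho A (-(m + 1)) v‖ ^ 2 := by
      exact_mod_cast e2
    linarith
  have hm1 : (1 : ℝ) ≤ m + 1 := by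
    have := m.cast_nonneg (α := ℝ)
    linarith
  have hv0 := norm_nonneg v
  have hx0 := norm_nonneg (rho A (m + 1) v)
  have hy0 := norm_nonneg (rho A (-(m + 1)) v)
  generalize ‖rho A (-(m + 1)) v‖ = y at h2 hy0 ⊢
  generalize ‖rho A (m + 1) v‖ = x at h1 h2 hx0
  generalize ‖v‖ = z at h2 hv0 ⊢
  generalize (m + 1 : ℝ) = n at h2 hm1 ⊢
  clear_value S
  have h3 : x ^ 2 ≤ S ^ 2 := by gcongr
  have h4 : S ^ 2 ≤ S ^ 2 * n ^ 2 := le_mul_of_one_le_right (by positivity) (by nlinarith)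
  have h5 : n * z ^ 2 ≤ n ^ 2 * z ^ 2 := by
    gcongr
    nlinarith
  have h6 : 0 ≤ 2 * S * z * n ^ 2 := by positivity
  have h7 : y ^ 2 ≤ ((S + z) * n) ^ 2 := by
    rw [h2]
    linarith [h3, h4, h5, h6, show ((S + z) * n) ^ 2 =
      S ^ 2 * n ^ 2 + n ^ 2 * z ^ 2 + 2 * S * z * n ^ 2 by ring]
  exact (abs_le_of_sq_le_sq' h7 (by positivity)).2

/-- The creation operator `∑_{m ≥ 1} (b̄_m / m) ρ(-m)`. -/
noncomputable def creatInf (b : ℕ → ℂ) (v : FinVec M) : Fock M :=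
  ∑' m : ℕ, (starRingEnd ℂ (b m) / (m + 1)) • ((rho A (-(m + 1)) v : FinVec M) : Fock M)

theorem norm_natCast_add_one (m : ℕ) : ‖(m + 1 : ℂ)‖ = m + 1 := by
  exact_mod_cast Complex.norm_natCast (m + 1)

theorem summable_creatInf {b : ℕ → ℂ} (hb : Summable fun m => ‖b m‖) (v : FinVec M) :
    Summable fun m : ℕ =>
      (starRingEnd ℂ (b m) / (m + 1)) • ((rho A (-(m + 1)) v : FinVec M) : Fock M) := by
  obtain ⟨C, hC, h⟩ := exists_norm_rho_neg_le A v
  refine Summable.of_norm_bounded (hb.mul_right C) fun m => ?_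
  rw [norm_smul, norm_div, RCLike.norm_conj, norm_natCast_add_one, FinVec.norm_coe]
  have hm : (0 : ℝ) < m + 1 := by positivity
  calc ‖b m‖ / (m + 1) * ‖rho A (-(m + 1)) v‖ ≤ ‖b m‖ / (m + 1) * (C * (m + 1)) := by
        gcongr
        exact h m
    _ = ‖b m‖ * C := by
        field_simp

theorem inner_creatInf {b : ℕ → ℂ} (hb : Summable fun m => ‖b m‖) (u v : FinVec M) :
    ⟪(u : Fock M), creatInf A b v⟫_ℂ = ⟪annih A b u, v⟫_ℂ := by
  obtain ⟨k, hk⟩ := exists_mem_energyLE u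
  have h1 := (summable_creatInf A hb v).hasSum.mapL (innerSL ℂ (u : Fock M))
  have h2 : ∀ m : ℕ, innerSL ℂ (u : Fock M) ((starRingEnd ℂ (b m) / (m + 1)) •
      ((rho A (-(m + 1)) v : FinVec M) : Fock M)) = ⟪(b m / (m + 1)) • rho A (m + 1) u, v⟫_ℂ := by
    intro m
    rw [innerSL_apply_apply, inner_smul_right, FinVec.inner_coe, ← isAdj_rho A (m + 1),
      inner_smul_left, map_div₀, map_add, map_one, Complex.conj_natCast]
  simp_rw [h2] at h1
  have h3 := h1.unique (hasSum_sum_of_ne_finset_zero (s := Finset.range k) fun m hm => by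
    rw [rho_apply_eq_zero A hk (by rw [Finset.mem_range] at hm; omega), smul_zero,
      inner_zero_left])
  rw [innerSL_apply_apply] at h3
  rw [creatInf, h3, annih_apply A b hk (n := k) (by omega), sum_inner]

theorem norm_creatInf_sq {b : ℕ → ℂ} (hb : Summable fun m => ‖b m‖) (v : FinVec M) :
    ‖creatInf A b v‖ ^ 2 = ‖annih A b v‖ ^ 2 + (pair b b).re * ‖v‖ ^ 2 := by
  obtain ⟨k, hk⟩ := exists_mem_energyLE v
  have h1 := (summable_creatInf A hb v).hasSum.mapL (innerSL ℂ (creatInf A b v))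
  -- The inner products with 0 drop out. The content is that moving ρ(-(m+1)) across `annih` leaves
  -- the scalar b_m, which sums to the pairing of b with itself.
  have h2 : ∀ m : ℕ, innerSL ℂ (creatInf A b v) ((starRingEnd ℂ (b m) / (m + 1)) •
      ((rho A (-(m + 1)) v : FinVec M) : Fock M)) =
      ⟪annih A b v, (0 : FinVec M)⟫_ℂ + ⟪(b m / (m + 1)) • rho A (m + 1) v, annih A b v⟫_ℂ -
        ⟪annih A b v, (0 : FinVec M)⟫_ℂ + starRingEnd ℂ (b m) * b m / (m + 1) * ⟪v, v⟫_ℂ := by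
    intro m
    have e := LinearMap.congr_fun (annih_mul_rho_neg A b m) v
    rw [LinearMap.sub_apply, Module.End.mul_apply, Module.End.mul_apply, sub_eq_iff_eq_add,
      LinearMap.smul_apply, Module.End.one_apply] at e
    rw [innerSL_apply_apply, inner_smul_right, ← inner_conj_symm, inner_creatInf A hb, e,
      inner_conj_symm, inner_add_right, inner_smul_right, ← isAdj_rho A (m + 1),
      inner_smul_left, map_div₀, map_add, map_one, Complex.conj_natCast]
    ring
  simp_rw [h2] at h1
  simp only [inner_zero_right, zero_add, sub_zero] at h1
  have h4 : HasSum (fun m : ℕ => ⟪(b m / (m + 1)) • rho A (m + 1) v, annih A b v⟫_ℂ)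
      ⟪annih A b v, annih A b v⟫_ℂ := by
    have := hasSum_sum_of_ne_finset_zero (L := SummationFilter.unconditional ℕ)
      (s := Finset.range k)
      (f := fun m : ℕ => ⟪(b m / (m + 1)) • rho A (m + 1) v, annih A b v⟫_ℂ) fun m hm => by
        rw [rho_apply_eq_zero A hk (by rw [Finset.mem_range] at hm; omega), smul_zero,
          inner_zero_left]
    rwa [← sum_inner, ← annih_apply A b hk (n := k) (by omega)] at this
  have h5 := h1.unique (h4.add ((summable_pair hb hb).hasSum.mul_right ⟪v, v⟫_ℂ))
  rw [innerSL_apply_apply] at h5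
  change ⟪creatInf A b v, creatInf A b v⟫_ℂ = _ + pair b b * _ at h5
  rw [inner_self_ofReal, inner_self_ofReal, inner_self_ofReal,
    ← pair_self_re] at h5
  exact_mod_cast h5

/-- Creation is controlled by annihilation, so graph norm bounds need only be proved for `annih`,
which acts within finite vectors. -/
theorem norm_creatInf_le {b : ℕ → ℂ} (hb : Summable fun m => ‖b m‖) (v : FinVec M) :
    ‖creatInf A b v‖ ≤ ‖annih A b v‖ + √(pair b b).re * ‖v‖ := by
  have h := norm_creatInf_sq A hb v
  have hp : (pair b b).re ≤ √(pair b b).re ^ 2 := by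
    rcases le_or_gt 0 (pair b b).re with h | h
    · rw [Real.sq_sqrt h]
    · exact h.le.trans (sq_nonneg _)
  refine abs_le_of_sq_le_sq' ?_ (by positivity) |>.2
  have h2 : 0 ≤ 2 * (‖annih A b v‖ * (√(pair b b).re * ‖v‖)) := by positivity
  nlinarith [sq_nonneg ‖v‖]

theorem hasDerivAt_expAnnih (b : ℕ → ℂ) (v : FinVec M) (s : ℝ) :
    HasDerivAt (fun s : ℝ => expAnnih A ((s : ℂ) • b) v)
      (annih A b (expAnnih A ((s : ℂ) • b) v)) s := by
  obtain ⟨k, hk⟩ := exists_mem_energyLE v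
  have h1 : ∀ (n : ℕ), k < n → ∀ s : ℝ, expAnnih A ((s : ℂ) • b) v =
      ∑ i ∈ Finset.range n, (((i ! : ℂ)⁻¹) * (s : ℂ) ^ i) • (annih A b ^ i) v := by
    intro n hn s
    rw [expAnnih_apply A _ (n := n) hk (by omega)]
    refine Finset.sum_congr rfl fun i _ => ?_
    rw [annih_smul, smul_pow, LinearMap.smul_apply, smul_smul]
  rw [funext (h1 (k + 2) (by omega)), h1 (k + 1) (by omega)]
  have h2 : ∀ i ∈ Finset.range (k + 2), HasDerivAt
      (fun s : ℝ => (((i ! : ℂ)⁻¹) * (s : ℂ) ^ i) • (annih A b ^ i) v)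
      ((((i ! : ℂ)⁻¹) * (i * (s : ℂ) ^ (i - 1))) • (annih A b ^ i) v) s := by
    intro i _
    have h3 : HasDerivAt (fun s : ℝ => (s : ℂ) ^ i) ((i : ℂ) * (s : ℂ) ^ (i - 1)) s := by
      exact (hasDerivAt_pow i (s : ℂ)).comp_ofReal
    exact (h3.const_mul _).smul_const _
  refine (HasDerivAt.fun_sum h2).congr_deriv ?_
  rw [Finset.sum_range_succ', map_sum]
  simp only [Nat.cast_zero, zero_mul, mul_zero, zero_smul, add_zero]
  refine Finset.sum_congr rfl fun i _ => ?_
  rw [map_smul, ← Module.End.mul_apply, ← pow_succ', Nat.factorial_succ, Nat.add_sub_cancel]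
  congr 1
  have hi : (i ! : ℂ) ≠ 0 := by exact_mod_cast i.factorial_ne_zero
  have hi' : (i + 1 : ℂ) ≠ 0 := by exact_mod_cast i.succ_ne_zero
  push_cast
  field_simp

theorem weylForm_rho_neg (c : ℕ → ℂ) (u v : FinVec M) (m : ℕ) :
    weylForm A c u (rho A (-(m + 1)) v) =
      Complex.exp (-(pair c c) / 2) * ⟪rho A (m + 1) (expAnnih A c u), expAnnih A (-c) v⟫_ℂ -
        c m * weylForm A c u v := by
  have e := LinearMap.congr_fun (expAnnih_mul_rho_neg A (-c) m) v
  rw [LinearMap.add_apply, Module.End.mul_apply, Module.End.mul_apply, LinearMap.smul_apply] at e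
  rw [weylForm, weylForm, e, inner_add_right, inner_smul_right, isAdj_rho A (m + 1), Pi.neg_apply]
  ring

theorem inner_weyl_creatInf {b : ℕ → ℂ} (hb : Summable fun m => ‖b m‖) {c : ℕ → ℂ}
    (hc : Summable fun m => ‖c m‖) (u v : FinVec M) :
    ⟪(u : Fock M), weyl A c (creatInf A b v)⟫_ℂ =
      Complex.exp (-(pair c c) / 2) * ⟪annih A b (expAnnih A c u), expAnnih A (-c) v⟫_ℂ -
        pair b c * weylForm A c u v := by
  obtain ⟨k, hk⟩ := exists_mem_energyLE (expAnnih A c u)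
  have h1 := (((summable_creatInf A hb v).hasSum.mapL
    ((weyl A c).toContinuousLinearEquiv : Fock M →L[ℂ] Fock M))).mapL (innerSL ℂ (u : Fock M))
  have h2 : ∀ m : ℕ, innerSL ℂ (u : Fock M)
      (((weyl A c).toContinuousLinearEquiv : Fock M →L[ℂ] Fock M)
        ((starRingEnd ℂ (b m) / (m + 1)) • ((rho A (-(m + 1)) v : FinVec M) : Fock M))) =
      Complex.exp (-(pair c c) / 2) *
        ⟪(b m / (m + 1)) • rho A (m + 1) (expAnnih A c u), expAnnih A (-c) v⟫_ℂ -
        starRingEnd ℂ (b m) * c m / (m + 1) * weylForm A c u v := by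
    intro m
    rw [innerSL_apply_apply, map_smul, inner_smul_right]
    change _ * ⟪(u : Fock M), weyl A c _⟫_ℂ = _
    rw [inner_weyl_coe A hc, weylForm_rho_neg, inner_smul_left, map_div₀, map_add, map_one,
      Complex.conj_natCast]
    ring
  simp_rw [h2] at h1
  have h4 : HasSum (fun m : ℕ =>
      ⟪(b m / (m + 1)) • rho A (m + 1) (expAnnih A c u), expAnnih A (-c) v⟫_ℂ)
      ⟪annih A b (expAnnih A c u), expAnnih A (-c) v⟫_ℂ := by
    have := hasSum_sum_of_ne_finset_zero (L := SummationFilter.unconditional ℕ)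
      (s := Finset.range k) (f := fun m : ℕ =>
        ⟪(b m / (m + 1)) • rho A (m + 1) (expAnnih A c u), expAnnih A (-c) v⟫_ℂ) fun m hm => by
        rw [rho_apply_eq_zero A hk (by rw [Finset.mem_range] at hm; omega), smul_zero,
          inner_zero_left]
    rwa [← sum_inner, ← annih_apply A b hk (n := k) (by omega)] at this
  exact h1.unique ((h4.mul_left _).sub ((summable_pair hb hc).hasSum.mul_right _))

/-- The two exponentials contribute the annihilation operator on either side. The derivative of the
Gaussian prefactor is the scalar that arises when the creation operator is commuted through the Weyl
operator. -/
theorem hasDerivAt_weylForm {b : ℕ → ℂ} (hb : Summable fun m => ‖b m‖) (u v : FinVec M) (s : ℝ) :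
    HasDerivAt (fun s : ℝ => weylForm A ((s : ℂ) • b) u v)
      ⟪(u : Fock M), weyl A ((s : ℂ) • b) (creatInf A b v - (annih A b v : FinVec M))⟫_ℂ s := by
  have hs := summable_norm_smul hb (s : ℂ)
  rw [map_sub, inner_sub_right, inner_weyl_creatInf A hb hs, inner_weyl_coe A hs]
  unfold weylForm
  have h1 := hasDerivAt_expAnnih A b u s
  have h2 := hasDerivAt_expAnnih A (-b) v s
  simp only [smul_neg] at h2
  have h3 := h1.inner ℂ h2
  have h4 : HasDerivAt (fun s : ℝ => Complex.exp (-(pair ((s : ℂ) • b) ((s : ℂ) • b)) / 2))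
      (Complex.exp (-(pair ((s : ℂ) • b) ((s : ℂ) • b)) / 2) * (-(s * pair b b))) s := by
    simp only [pair_smul_left, pair_smul_right, Complex.conj_ofReal]
    have h5 : HasDerivAt (fun s : ℝ => (s : ℂ)) 1 s := Complex.ofRealCLM.hasDerivAt
    have h6 := (h5.mul (h5.mul_const (pair b b))).neg.div_const 2
    refine (HasDerivAt.cexp h6).congr_deriv ?_
    congr 1
    ring
  refine (h4.mul h3).congr_deriv ?_
  have e : expAnnih A (-((s : ℂ) • b)) (annih A b v) = annih A b (expAnnih A (-((s : ℂ) • b)) v) :=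
    LinearMap.congr_fun (expAnnih_mul_annih A _ b).eq v
  rw [annih_neg, LinearMap.neg_apply, inner_neg_right, pair_smul_right (s : ℂ) b b, e]
  ring

theorem weyl_group {b : ℕ → ℂ} (hb : Summable fun m => ‖b m‖) (s t : ℝ) :
    weyl A (((s + t : ℝ) : ℂ) • b) = weyl A ((s : ℂ) • b) * weyl A ((t : ℂ) • b) :=
  LinearIsometryEquiv.ext fun v => weyl_smul_add A hb s t v

theorem continuous_weyl_smul {b : ℕ → ℂ} (hb : Summable fun m => ‖b m‖) (v : Fock M) :
    Continuous fun t : ℝ => weyl A ((t : ℂ) • b) v := by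
  refine group_continuous (dense_finiteStates (M := M)) (weyl_group A hb) (fun v hv => ?_) v
  have h : (fun t : ℝ => ⟪v, weyl A ((t : ℂ) • b) v⟫_ℂ) =
      fun t : ℝ => weylForm A ((t : ℂ) • b) (FinVec.mk v hv) (FinVec.mk v hv) := by
    funext t
    exact inner_weyl_coe A (summable_norm_smul hb t) (FinVec.mk v hv) (FinVec.mk v hv)
  rw [h]
  exact (continuous_weylForm_smul A b _ _).continuousAt

/-- Integrating the derivatives of matrix elements identifies W(tb)v - v with the integral of the
continuous orbit of the exponent applied to v, which is the integrated form of differentiability in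
norm. -/
theorem hasDerivAt_weyl {b : ℕ → ℂ} (hb : Summable fun m => ‖b m‖) (v : FinVec M) :
    HasDerivAt (fun t : ℝ => weyl A ((t : ℂ) • b) (v : Fock M))
      (creatInf A b v - (annih A b v : FinVec M)) 0 := by
  refine (group_sub_eq_integral (U := fun t : ℝ => weyl A ((t : ℂ) • b)) (weyl_group A hb)
    (continuous_weyl_smul A hb)).2 fun t => ?_
  have hcont := continuous_weyl_smul A hb (creatInf A b v - (annih A b v : FinVec M))
  refine fock_ext_fin fun u => ?_
  have h1 := ContinuousLinearMap.intervalIntegral_comp_comm (innerSL ℂ (u : Fock M))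
    (hcont.intervalIntegrable (μ := MeasureTheory.volume) 0 t)
  simp only [innerSL_apply_apply] at h1
  refine Eq.trans ?_ h1
  rw [intervalIntegral.integral_eq_sub_of_hasDerivAt
    (fun s _ => hasDerivAt_weylForm A hb u v s)
    ((continuous_const.inner hcont).intervalIntegrable _ _), inner_sub_right,
    inner_weyl_coe A (summable_norm_smul hb t)]
  congr 1
  rw [Complex.ofReal_zero, zero_smul, weylForm_zero]
  rfl

/-- The partial sums of the exponential series of a creation operator. -/
noncomputable def creatPartial (n : ℕ) (c : ℕ → ℂ) (u : FinVec M) (J : ℕ) : FinVec M :=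
  ∑ j ∈ Finset.range J, ((j ! : ℂ)⁻¹) • (creat A n c ^ j) u

theorem tendsto_creatPartial {n : ℕ} {c : ℕ → ℂ} (hc : ∀ m ≥ n, c m = 0) (u : FinVec M) :
    Filter.Tendsto (fun J => (creatPartial A n c u J : Fock M)) Filter.atTop
      (nhds (creationExp (creat A n c) u)) := by
  have h := (summable_creationExp (isAdj_annih_creat A hc) (locNil_annih A c)
    (annih_mul_creat A n c c) u).hasSum.tendsto_sum_nat
  refine h.congr fun J => ?_
  rw [creatPartial, FinVec.coe_sum]
  rfl

/-- Annihilation acts on a truncated exponential as on the full one, except that the contracted part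
loses one order of the truncation. -/
theorem annih_creatPartial (n : ℕ) (b c : ℕ → ℂ) (u : FinVec M) (J : ℕ) :
    annih A b (creatPartial A n c u (J + 1)) = creatPartial A n c (annih A b u) (J + 1) +
      (∑ m ∈ Finset.range n, starRingEnd ℂ (c m) * b m / (m + 1)) • creatPartial A n c u J := by
  set κ := ∑ m ∈ Finset.range n, starRingEnd ℂ (c m) * b m / ((m : ℂ) + 1) with hκ
  rw [creatPartial, creatPartial, map_sum, Finset.sum_range_succ', Finset.sum_range_succ',
    creatPartial, Finset.smul_sum, add_right_comm, ← Finset.sum_add_distrib]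
  congr 1
  · refine Finset.sum_congr rfl fun j _ => ?_
    have e := LinearMap.congr_fun (mul_pow_of_commutator (annih_mul_creat A n c b) j) u
    rw [LinearMap.add_apply, Module.End.mul_apply, Module.End.mul_apply,
      LinearMap.smul_apply, ← hκ] at e
    rw [map_smul, e, smul_add, smul_smul, smul_smul]
    congr 2
    have h1 : (j ! : ℂ) ≠ 0 := by exact_mod_cast j.factorial_ne_zero
    have h2 : (j + 1 : ℂ) ≠ 0 := by exact_mod_cast j.succ_ne_zero
    rw [Nat.factorial_succ]
    push_cast
    field_simp
  · simp

theorem norm_weylFin {n : ℕ} {c : ℕ → ℂ} (hc : ∀ m ≥ n, c m = 0) (v : FinVec M) :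
    ‖weylFin A n c v‖ = ‖v‖ := by
  have h := inner_weylFin_self A hc v
  rw [inner_self_ofReal, inner_self_ofReal] at h
  have h' : ‖weylFin A n c v‖ ^ 2 = ‖v‖ ^ 2 := by exact_mod_cast h
  exact (sq_eq_sq₀ (norm_nonneg _) (norm_nonneg _)).1 h'

theorem expAnnih_neg_apply (c : ℕ → ℂ) (v : FinVec M) :
    expAnnih A (-c) (expAnnih A c v) = v := by
  rw [← Module.End.mul_apply, ← expAnnih_add, neg_add_cancel, expAnnih_zero, Module.End.one_apply]

theorem norm_exp_smul_creationExp {n : ℕ} {c : ℕ → ℂ} (hc : ∀ m ≥ n, c m = 0) (u : FinVec M) :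
    ‖Complex.exp (-(pair c c) / 2) • creationExp (creat A n c) u‖ = ‖expAnnih A c u‖ := by
  rw [← norm_weylFin A hc (expAnnih A c u), weylFin, expAnnih_neg_apply]

/-- The creation exponential in the Weyl vector is cut at a high order J, which leaves a finite
vector. Commuting `annih` through it produces two vectors of the same kind, whose limits in J have
norms known from unitarity, uniformly in the cutoff n. -/
theorem exists_near_weylFin {b c : ℕ → ℂ} (hb : Summable fun m => ‖b m‖)
    (hc : Summable fun m => ‖c m‖) (v : FinVec M) :
    ∃ C : ℝ, ∃ k : ℕ, ∀ n ≥ k, ∀ ε > 0, ∃ x : FinVec M,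
      ‖(x : Fock M) - weylFin A n (trunc n c) v‖ < ε ∧
      ‖creatInf A b x - (annih A b x : FinVec M)‖ ≤ C := by
  obtain ⟨k, hk⟩ := exists_mem_energyLE v
  set u := expAnnih A (-c) v with hu
  have huk : u ∈ energyLE M k := expAnnih_mem_energyLE A _ hk
  set K := ∑' m : ℕ, ‖starRingEnd ℂ (c m) * b m / ((m : ℂ) + 1)‖ with hK
  set C₁ := ‖expAnnih A c (annih A b u)‖ with hC₁
  -- The exponent on x is at most 2‖annih x‖ + √(pair b b) ‖x‖. Here C₁ + K‖v‖ bounds the limit of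
  -- ‖annih x‖, ‖v‖ is the limit of ‖x‖, and each 1 is room for the truncation.
  refine ⟨2 * (C₁ + K * ‖v‖ + 1) + √(pair b b).re * (‖v‖ + 1), k, fun n hn ε hε => ?_⟩
  have hcn := trunc_of_ge (n := n) c
  set cn := trunc n c with hcn'
  set e := Complex.exp (-(pair cn cn) / 2) with he
  set κ := ∑ m ∈ Finset.range n, starRingEnd ℂ (cn m) * b m / ((m : ℂ) + 1) with hκ
  have hκK : ‖κ‖ ≤ K := by
    have h1 : κ = ∑ m ∈ Finset.range n, starRingEnd ℂ (c m) * b m / ((m : ℂ) + 1) :=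
      Finset.sum_congr rfl fun m hm => by rw [hcn', trunc_of_lt c (Finset.mem_range.1 hm)]
    rw [h1]
    exact (norm_sum_le _ _).trans
      ((summable_pair hc hb).norm.sum_le_tsum _ fun _ _ => norm_nonneg _)
  have hw : weylFin A n cn v = e • creationExp (creat A n cn) u := by
    rw [weylFin, hcn', trunc_neg, expAnnih_trunc A (-c) hk hn]
  have hcu : ∀ w ∈ energyLE M k, ‖e • creationExp (creat A n cn) w‖ = ‖expAnnih A c w‖ := by
    intro w hw
    rw [norm_exp_smul_creationExp A hcn, hcn', expAnnih_trunc A c hw hn]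
  have hnv : ‖e • creationExp (creat A n cn) u‖ = ‖v‖ := by
    rw [← hw, norm_weylFin A hcn]
  have t1 := (tendsto_creatPartial A hcn u).const_smul e
  have t1' := t1.comp (Filter.tendsto_add_atTop_nat 1)
  have t2 := ((tendsto_creatPartial A hcn (annih A b u)).const_smul e).comp
    (Filter.tendsto_add_atTop_nat 1)
  have t3 := (t2.add (t1.const_smul κ)).norm
  have t4 : ‖e • creationExp (creat A n cn) (annih A b u) + κ • e • creationExp (creat A n cn) u‖ <
      C₁ + K * ‖v‖ + 1 := by
    refine (norm_add_le _ _).trans_lt ?_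
    rw [norm_smul κ, hnv, hcu _ (energyLE_mono (by omega) (annih_mem_energyLE A b huk))]
    have := mul_le_mul_of_nonneg_right hκK (norm_nonneg v)
    linarith
  have t5 := t1'.norm
  rw [hnv] at t5
  have ev := (t3.eventually_lt_const t4).and ((t5.eventually_lt_const (lt_add_one ‖v‖)).and
    (Metric.tendsto_nhds.1 t1' ε hε))
  obtain ⟨J, h1, h2, h3⟩ := ev.exists
  refine ⟨e • creatPartial A n cn u (J + 1), ?_, ?_⟩
  · rw [hw, ← dist_eq_norm]
    exact h3
  · have h4 : ‖annih A b (e • creatPartial A n cn u (J + 1))‖ < C₁ + K * ‖v‖ + 1 := by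
      rw [map_smul, annih_creatPartial, smul_add, smul_comm e]
      exact h1
    have h5 : ‖e • creatPartial A n cn u (J + 1)‖ < ‖v‖ + 1 := h2
    refine (norm_sub_le _ _).trans ?_
    rw [FinVec.norm_coe]
    have h6 := norm_creatInf_le A hb (e • creatPartial A n cn u (J + 1))
    have h7 := mul_le_mul_of_nonneg_left h5.le (Real.sqrt_nonneg (pair b b).re)
    linarith

/-- The Weyl groups are generated by the differences of creation and annihilation operators. -/
theorem generatesUnitaryGroup_weyl {b : ℕ → ℂ} (hb : Summable fun m => ‖b m‖)
    {T : Fock M →ₗ.[ℂ] Fock M} {X : FinVec M →ₗ[ℂ] Fock M} (hT : ActsAs T X)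
    (hX : ∀ v, X v = creatInf A b v - (annih A b v : FinVec M)) :
    GeneratesUnitaryGroup T fun t : ℝ => weyl A ((t : ℂ) • b) := by
  have hmem : ∀ v : T.domain, (v : Fock M) ∈ finiteStates M := fun v => by
    rw [← hT.1]
    exact v.2
  have hTX : ∀ v : T.domain, T v = X (FinVec.mk v (hmem v)) := fun v =>
    hT.2 (FinVec.mk v (hmem v)) v.2
  have hdense : Dense (T.domain : Set (Fock M)) := by
    rw [hT.1]
    exact dense_finiteStates
  refine generatesUnitaryGroup_of_core hdense (weyl_group A hb) (continuous_weyl_smul A hb)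
    (fun v => ?_) fun v t => ?_
  · rw [hTX, hX]
    exact hasDerivAt_weyl A hb (FinVec.mk v (hmem v))
  · have ht := summable_norm_smul hb (t : ℂ)
    obtain ⟨C, k, h⟩ := exists_near_weylFin A hb ht (FinVec.mk v (hmem v))
    choose x hx1 hx2 using fun n : ℕ =>
      h (n + k) (by omega) (1 / ((n : ℝ) + 1)) (by positivity)
    have hxd : ∀ n, (x n : Fock M) ∈ T.domain := fun n => by
      rw [hT.1]
      exact (x n).mem
    refine ⟨fun n => ⟨x n, hxd n⟩, C, ?_, fun n => ?_⟩
    · have h1 := (tendsto_weylVec A ht (FinVec.mk v (hmem v))).comp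
        (Filter.tendsto_add_atTop_nat k)
      have h2 : weyl A ((t : ℂ) • b) (v : Fock M) =
          weylVec A ((t : ℂ) • b) (FinVec.mk v (hmem v)) := by
        rw [weyl_apply A ht, ← weylIso_coe A ht]
        rfl
      rw [h2]
      refine tendsto_of_tendsto_of_dist h1 ?_
      refine squeeze_zero (fun _ => dist_nonneg) (fun n => ?_)
        tendsto_one_div_add_atTop_nhds_zero_nat
      rw [dist_comm, dist_eq_norm]
      exact (hx1 n).le
    · rw [hT.2 (x n) (hxd n), hX]
      exact hx2 n

end WeylGenerator

/-! ### Diagonal operators -/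

section Diagonal

variable {M : ℕ}

/-- The projection to a basis state. -/
noncomputable def projFin (S : Finset (Mode M)) : Module.End ℂ (FinVec M) where
  toFun v := ⟪fs S, v⟫_ℂ • fs S
  map_add' u v := by rw [inner_add_right, add_smul]
  map_smul' c v := by rw [inner_smul_right, mul_smul, RingHom.id_apply]

theorem projFin_apply (S : Finset (Mode M)) (v : FinVec M) :
    projFin S v = ⟪fs S, v⟫_ℂ • fs S := rfl

theorem exists_finset_inner_eq_zero (v : FinVec M) :
    ∃ s : Finset (Finset (Mode M)), ∀ S ∉ s, ⟪fs S, v⟫_ℂ = 0 := by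
  refine FinVec.induction (p := fun v => ∃ s : Finset (Finset (Mode M)),
    ∀ S ∉ s, ⟪fs S, v⟫_ℂ = 0) ⟨∅, fun S _ => inner_zero_right _⟩ ?_ ?_ ?_ v
  · rintro u v ⟨s, hs⟩ ⟨t, ht⟩
    refine ⟨s ∪ t, fun S hS => ?_⟩
    rw [Finset.notMem_union] at hS
    rw [inner_add_right, hs S hS.1, ht S hS.2, add_zero]
  · rintro c u ⟨s, hs⟩
    exact ⟨s, fun S hS => by rw [inner_smul_right, hs S hS, mul_zero]⟩
  · intro T
    refine ⟨{T}, fun S hS => ?_⟩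
    rw [inner_fs, if_neg (by simpa using hS)]

theorem locFin_projFin (g : Finset (Mode M) → ℂ) : LocFin fun S => g S • projFin S :=
  locFin_of_finset fun v => by
    obtain ⟨s, hs⟩ := exists_finset_inner_eq_zero v
    exact ⟨s, fun S hS => by
      rw [LinearMap.smul_apply, projFin_apply, hs S hS, zero_smul, smul_zero]⟩

/-- The diagonal operator with eigenvalues `g` on the basis states. -/
noncomputable def diagFin (g : Finset (Mode M) → ℂ) : Module.End ℂ (FinVec M) :=
  lfSum fun S => g S • projFin S

theorem diagFin_fs (g : Finset (Mode M) → ℂ) (S : Finset (Mode M)) :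
    diagFin g (fs S) = g S • fs S := by
  rw [diagFin, lfSum_apply_eq_sum (locFin_projFin g) (s := {S})]
  · rw [Finset.sum_singleton, LinearMap.smul_apply, projFin_apply, inner_fs, if_pos rfl, one_smul]
  · intro T hT
    rw [LinearMap.smul_apply, projFin_apply, inner_fs, if_neg (by simpa using hT), zero_smul,
      smul_zero]

theorem inner_fs_diagFin (g : Finset (Mode M) → ℂ) (S : Finset (Mode M)) (v : FinVec M) :
    ⟪fs S, diagFin g v⟫_ℂ = g S * ⟪fs S, v⟫_ℂ := by
  refine FinVec.induction (p := fun v => ⟪fs S, diagFin g v⟫_ℂ = g S * ⟪fs S, v⟫_ℂ) ?_ ?_ ?_ ?_ v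
  · simp
  · intro u v hu hv
    rw [map_add, inner_add_right, inner_add_right, hu, hv, mul_add]
  · intro c u hu
    rw [map_smul, inner_smul_right, inner_smul_right, hu]
    ring
  · intro T
    rw [diagFin_fs, inner_smul_right, inner_fs]
    split_ifs with h
    · rw [h]
    · simp

theorem FinVec.ext_fs {u v : FinVec M} (h : ∀ S, ⟪fs S, u⟫_ℂ = ⟪fs S, v⟫_ℂ) : u = v :=
  FinVec.ext (fock_ext h)

/-- An eigenvector of a diagonal operator has components only where g takes the eigenvalue. This
replaces functional calculus for the charge and the energy. -/
theorem diagFin_comp_apply {g : Finset (Mode M) → ℂ} {u : FinVec M} {c : ℂ}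
    (h : diagFin g u = c • u) (φ : ℂ → ℂ) : diagFin (fun S => φ (g S)) u = φ c • u := by
  refine FinVec.ext_fs fun S => ?_
  have h1 := inner_fs_diagFin g S u
  rw [h, inner_smul_right] at h1
  rw [inner_fs_diagFin, inner_smul_right]
  by_cases h0 : ⟪fs S, u⟫_ℂ = 0
  · rw [h0, mul_zero, mul_zero]
  · rw [mul_right_cancel₀ h0 h1]

theorem diagFin_comp_mul {g : Finset (Mode M) → ℂ} {X : Module.End ℂ (FinVec M)} {c : ℂ}
    (h : diagFin g * X = X * diagFin g + c • X) {φ : ℂ → ℂ} {d : ℂ}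
    (hφ : ∀ z, φ (z + c) = d * φ z) :
    diagFin (fun S => φ (g S)) * X = d • (X * diagFin fun S => φ (g S)) := by
  refine FinVec.linearMap_ext fun S => ?_
  have h1 := LinearMap.congr_fun h (fs S)
  rw [Module.End.mul_apply, LinearMap.add_apply, Module.End.mul_apply, LinearMap.smul_apply,
    diagFin_fs, map_smul, ← add_smul] at h1
  rw [Module.End.mul_apply, diagFin_comp_apply h1 φ, LinearMap.smul_apply, Module.End.mul_apply,
    diagFin_fs, map_smul, hφ, mul_smul]

theorem isAdj_diagFin (g : Finset (Mode M) → ℂ) :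
    IsAdj (diagFin g) (diagFin fun S => starRingEnd ℂ (g S)) := by
  intro u v
  refine FinVec.induction (p := fun u => ⟪diagFin g u, v⟫_ℂ =
    ⟪u, diagFin (fun S => starRingEnd ℂ (g S)) v⟫_ℂ) ?_ ?_ ?_ ?_ u
  · simp
  · intro u v hu hv
    rw [map_add, inner_add_left, inner_add_left, hu, hv]
  · intro c u hu
    rw [map_smul, inner_smul_left, inner_smul_left, hu]
  · intro S
    rw [inner_fs_diagFin, diagFin_fs, inner_smul_left]

/-- The unitary operator that multiplies the basis state `S` by `e^{i f(S)}`. -/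
noncomputable def diagPhase (f : Finset (Mode M) → ℝ) : Fock M ≃ₗᵢ[ℂ] Fock M :=
  have hn : ∀ g : Finset (Mode M) → ℝ, ∀ S, ‖Complex.exp (Complex.I * (g S : ℂ))‖ ≤ 1 := fun g S => by
    rw [mul_comm, Complex.norm_exp_ofReal_mul_I]
  have hle : ∀ (g : Finset (Mode M) → ℝ) (v : Fock M), ‖weightedComp
      (fun S => Complex.exp (Complex.I * (g S : ℂ))) id (hn g) (Function.injective_id.injOn) v‖ ≤
      ‖v‖ := fun g v => by
    have h := (weightedComp (fun S => Complex.exp (Complex.I * (g S : ℂ))) id (hn g)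
      (Function.injective_id.injOn)).le_of_opNorm_le
      (LinearMap.mkContinuous_norm_le _ zero_le_one _) v
    rwa [one_mul] at h
  let F := fun g : Finset (Mode M) → ℝ => weightedComp
    (fun S => Complex.exp (Complex.I * (g S : ℂ))) id (hn g) (Function.injective_id.injOn)
  have hFG : ∀ (g g' : Finset (Mode M) → ℝ) (v : Fock M), (∀ S, g S + g' S = 0) →
      F g (F g' v) = v := fun g g' v h => by
    ext S
    change Complex.exp (Complex.I * (g S : ℂ)) * (Complex.exp (Complex.I * (g' S : ℂ)) * v S) = v S
    rw [← mul_assoc, ← Complex.exp_add, ← mul_add, ← Complex.ofReal_add, h]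
    simp
  { toFun := F f
    invFun := F (-f)
    left_inv := fun v => hFG (-f) f v fun S => by simp
    right_inv := fun v => hFG f (-f) v fun S => by simp
    map_add' := (F f).map_add
    map_smul' := (F f).map_smul
    norm_map' := fun v => by
      refine le_antisymm (hle f v) ?_
      have h := hle (-f) (F f v)
      have h2 : F (-f) (F f v) = v := hFG (-f) f v fun S => by simp
      rw [show weightedComp (fun S => Complex.exp (Complex.I * ((-f) S : ℂ))) id (hn (-f))
        (Function.injective_id.injOn) (F f v) = v from h2] at h
      exact h }

theorem diagPhase_apply (f : Finset (Mode M) → ℝ) (v : Fock M) (S : Finset (Mode M)) :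
    (diagPhase f v : Fock M) S = Complex.exp (Complex.I * (f S : ℂ)) * v S := rfl

theorem diagPhase_state (f : Finset (Mode M) → ℝ) (S : Finset (Mode M)) :
    diagPhase f (state S) = Complex.exp (Complex.I * (f S : ℂ)) • state S := by
  ext T
  rw [diagPhase_apply, lp.coeFn_smul, Pi.smul_apply, smul_eq_mul, state_apply]
  split_ifs with h
  · rw [h]
  · simp

theorem diagPhase_coe (f : Finset (Mode M) → ℝ) (u : FinVec M) :
    diagPhase f (u : Fock M) =
      (diagFin (fun S => Complex.exp (Complex.I * (f S : ℂ))) u : FinVec M) := by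
  refine fock_ext fun S => ?_
  rw [inner_state_left, diagPhase_apply, ← inner_state_left]
  exact (inner_fs_diagFin (fun S => Complex.exp (Complex.I * (f S : ℂ))) S u).symm

theorem diagPhase_add (f g : Finset (Mode M) → ℝ) :
    diagPhase (f + g) = diagPhase f * diagPhase g := by
  refine LinearIsometryEquiv.ext fun v => ?_
  ext S
  change Complex.exp (Complex.I * ((f S + g S : ℝ) : ℂ)) * v S =
    Complex.exp (Complex.I * (f S : ℂ)) * (Complex.exp (Complex.I * (g S : ℂ)) * v S)
  rw [← mul_assoc, ← Complex.exp_add, ← mul_add, Complex.ofReal_add]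

theorem diagPhase_zero : diagPhase (0 : Finset (Mode M) → ℝ) = 1 := by
  refine LinearIsometryEquiv.ext fun v => ?_
  ext S
  change Complex.exp (Complex.I * ((0 : ℝ) : ℂ)) * v S = v S
  simp

theorem diagPhase_symm (f : Finset (Mode M) → ℝ) : (diagPhase f).symm = diagPhase (-f) := by
  refine LinearIsometryEquiv.ext fun v => ?_
  rw [LinearIsometryEquiv.symm_apply_eq]
  change v = (diagPhase f * diagPhase (-f)) v
  rw [← diagPhase_add, add_neg_cancel, diagPhase_zero]
  rfl

theorem diagPhase_smul_add (f : Finset (Mode M) → ℝ) (s t : ℝ) :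
    diagPhase ((s + t) • f) = diagPhase (s • f) * diagPhase (t • f) := by
  rw [add_smul, diagPhase_add]

theorem hasDerivAt_diagPhase {f : Finset (Mode M) → ℝ} {X : FinVec M →ₗ[ℂ] Fock M}
    (hX : ∀ S, X (fs S) = (Complex.I * (f S : ℂ)) • state S) (v : FinVec M) :
    HasDerivAt (fun t : ℝ => diagPhase (t • f) (v : Fock M)) (X v) 0 := by
  refine FinVec.induction (p := fun v => HasDerivAt
    (fun t : ℝ => diagPhase (t • f) (v : Fock M)) (X v) 0) ?_ ?_ ?_ ?_ v
  · simp only [FinVec.coe_zero, map_zero]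
    exact hasDerivAt_const _ _
  · intro u v hu hv
    simp only [FinVec.coe_add, map_add]
    exact hu.add hv
  · intro c u hu
    simp only [FinVec.coe_smul, map_smul]
    exact hu.const_smul c
  · intro S
    rw [hX]
    have h : (fun t : ℝ => diagPhase (t • f) ((fs S : FinVec M) : Fock M)) =
        fun t : ℝ => Complex.exp (Complex.I * ((t : ℂ) * (f S : ℂ))) • state S := by
      funext t
      refine (diagPhase_state _ S).trans ?_
      simp
    rw [h]
    refine HasDerivAt.smul_const ?_ _
    have h5 : HasDerivAt (fun s : ℝ => (s : ℂ)) 1 0 := Complex.ofRealCLM.hasDerivAt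
    have h6 := ((h5.mul_const (f S : ℂ)).const_mul Complex.I).cexp
    simpa using h6

theorem continuous_diagPhase (f : Finset (Mode M) → ℝ) (v : Fock M) :
    Continuous fun t : ℝ => diagPhase (t • f) v := by
  refine group_continuous (dense_finiteStates (M := M)) (diagPhase_smul_add f) (fun v hv => ?_) v
  have hcont : Continuous fun t : ℝ => diagPhase (t • f) v := by
    let v' := FinVec.mk v hv
    change Continuous fun t : ℝ => diagPhase (t • f) (v' : Fock M)
    refine FinVec.induction (p := fun v => Continuous
      (fun t : ℝ => diagPhase (t • f) (v : Fock M))) ?_ ?_ ?_ ?_ v'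
    · simp only [FinVec.coe_zero, map_zero]
      exact continuous_const
    · intro u v hu hv
      simp only [FinVec.coe_add, map_add]
      exact hu.add hv
    · intro c u hu
      simp only [FinVec.coe_smul, map_smul]
      exact hu.const_smul c
    · intro S
      have h : (fun t : ℝ => diagPhase (t • f) ((fs S : FinVec M) : Fock M)) =
          fun t : ℝ => Complex.exp (Complex.I * ((t : ℂ) * (f S : ℂ))) • state S := by
        funext t
        refine (diagPhase_state _ S).trans ?_
        simp
      rw [h]
      fun_prop
  exact (continuous_const.inner hcont).continuousAt

theorem generatesUnitaryGroup_diagPhase {f : Finset (Mode M) → ℝ} {T : Fock M →ₗ.[ℂ] Fock M}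
    {X : FinVec M →ₗ[ℂ] Fock M} (hT : ActsAs T X)
    (hX : ∀ S, X (fs S) = (Complex.I * (f S : ℂ)) • state S) :
    GeneratesUnitaryGroup T fun t : ℝ => diagPhase (t • f) := by
  have hmem : ∀ v : T.domain, (v : Fock M) ∈ finiteStates M := fun v => by
    rw [← hT.1]
    exact v.2
  refine generatesUnitaryGroup_of_dense (diagPhase_smul_add f) (continuous_diagPhase f)
    (fun v => ?_) fun w hw => ?_
  · have h := hT.2 (FinVec.mk v (hmem v)) v.2
    rw [show T v = X (FinVec.mk v (hmem v)) from h]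
    exact hasDerivAt_diagPhase hX (FinVec.mk v (hmem v))
  · refine fock_ext fun S => ?_
    have hS : (state S : Fock M) ∈ T.domain := by
      rw [hT.1]
      exact state_mem S
    have h1 := hw ⟨state S, hS⟩
    have h2 : T ⟨state S, hS⟩ = (Complex.I * (f S : ℂ)) • state S := (hT.2 (fs S) hS).trans (hX S)
    rw [h2, inner_sub_right, inner_smul_right, ← sub_one_mul] at h1
    -- An imaginary eigenvalue is never 1, so every basis state lies in the range of T - 1 up to a
    -- scalar.
    have h3 : Complex.I * (f S : ℂ) - 1 ≠ 0 := by
      intro h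
      have := congrArg Complex.re h
      simp at this
    rw [inner_zero_right, ← inner_conj_symm, (mul_eq_zero.1 h1).resolve_left h3, map_zero]

end Diagonal

/-! ### Energy and charge -/

section EnergyCharge

variable {M : ℕ}

/-- Twice the Hamiltonian. -/
noncomputable def ham (M : ℕ) : Module.End ℂ (FinVec M) := diagFin fun S => (energy S : ℂ)

theorem ham_mul_exc (i : Mode M) :
    ham M * exc i = exc i * ham M - ((|2 * i.n + 1| : ℤ) : ℂ) • exc i := by
  refine FinVec.linearMap_ext fun S => ?_
  rw [Module.End.mul_apply, LinearMap.sub_apply, Module.End.mul_apply, LinearMap.smul_apply, ham,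
    diagFin_fs, map_smul, exc_fs]
  split_ifs with h
  · rw [map_smul, diagFin_fs, energy_erase h]
    push_cast
    module
  · simp

theorem ham_mul_excDag (i : Mode M) :
    ham M * excDag i = excDag i * ham M + ((|2 * i.n + 1| : ℤ) : ℂ) • excDag i := by
  refine FinVec.linearMap_ext fun S => ?_
  rw [Module.End.mul_apply, LinearMap.add_apply, Module.End.mul_apply, LinearMap.smul_apply, ham,
    diagFin_fs, map_smul, excDag_fs]
  split_ifs with h
  · simp
  · rw [map_smul, diagFin_fs, energy_insert h]
    push_cast
    module

theorem ham_mul_dn (A : Flavor M) (n : ℤ) :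
    ham M * dn A n = dn A n * ham M - ((2 * n + 1 : ℤ) : ℂ) • dn A n := by
  unfold dn
  split_ifs with h
  · rw [ham_mul_exc]
    simp only [abs_modeIdx]
    rw [abs_of_pos (by omega)]
  · rw [ham_mul_excDag]
    simp only [abs_modeIdx]
    rw [abs_of_neg (by omega), Int.cast_neg, neg_smul, sub_eq_add_neg]

theorem ham_mul_dd (A : Flavor M) (n : ℤ) :
    ham M * dd A n = dd A n * ham M + ((2 * n + 1 : ℤ) : ℂ) • dd A n := by
  unfold dd
  split_ifs with h
  · rw [ham_mul_excDag]
    simp only [abs_modeIdx]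
    rw [abs_of_pos (by omega)]
  · rw [ham_mul_exc]
    simp only [abs_modeIdx]
    rw [abs_of_neg (by omega), Int.cast_neg, neg_smul, sub_neg_eq_add]

theorem ham_mul_rho (A : Flavor M) (m : ℤ) :
    ham M * rho A m = rho A m * ham M + ((-2 * m : ℤ) : ℂ) • rho A m := by
  have h : ∀ l, ham M * rhoTerm A m l =
      rhoTerm A m l * ham M + ((-2 * m : ℤ) : ℂ) • rhoTerm A m l := by
    intro l
    rw [rhoTerm, mul_sub, sub_mul, ← mul_assoc, ham_mul_dd, add_mul, mul_assoc, ham_mul_dn,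
      mul_sub, smul_mul_assoc, mul_smul_comm, mul_smul_comm, smul_mul_assoc, mul_one, one_mul,
      ← mul_assoc]
    by_cases hm : m = 0
    · subst hm
      push_cast
      simp only [add_zero, zero_smul]
      abel
    · rw [if_neg (by tauto)]
      push_cast
      module
  rw [rho, mul_lfSum (locFin_rhoTerm A m), lfSum_mul (locFin_rhoTerm A m),
    ← lfSum_smul (locFin_rhoTerm A m), ← lfSum_add ((locFin_rhoTerm A m).mul_right _)
      ((locFin_rhoTerm A m).smul _)]
  congr 1
  funext l
  exact h l

/-- The charge of flavor `A` of a basis state. -/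
def charge (A : Flavor M) (S : Finset (Mode M)) : ℤ :=
  ∑ i ∈ S, if i.flavor = A then (if 0 ≤ modeIdx A i.n then 1 else -1) else 0

theorem rho_zero_fs (A : Flavor M) (S : Finset (Mode M)) :
    rho A 0 (fs S) = (charge A S : ℂ) • fs S := by
  induction S using Finset.induction_on with
  | empty => rw [rho_vac A (isVac_vacuum A) le_rfl, charge, Finset.sum_empty]; simp
  | insert i S hi ih =>
    have hc : charge A (insert i S) =
        (if i.flavor = A then (if 0 ≤ modeIdx A i.n then 1 else -1) else 0) + charge A S :=
      Finset.sum_insert hi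
    have key : rho A 0 (excDag i (fs S)) = (charge A (insert i S) : ℂ) • excDag i (fs S) := by
      rw [excDag_eq]
      split_ifs with h
      · have e := LinearMap.congr_fun (rho_mul_dd A i.flavor 0 (modeIdx i.flavor i.n)) (fs S)
        rw [Module.End.mul_apply, LinearMap.add_apply, Module.End.mul_apply, ih] at e
        rw [e, hc]
        by_cases hA : i.flavor = A
        · rw [if_pos hA.symm, if_pos hA, if_pos (hA ▸ h), hA, sub_zero, map_smul]
          push_cast
          module
        · rw [if_neg (Ne.symm hA), if_neg hA, map_smul, LinearMap.zero_apply, add_zero, zero_add]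
      · have e := LinearMap.congr_fun (rho_mul_dn A i.flavor 0 (modeIdx i.flavor i.n)) (fs S)
        rw [Module.End.mul_apply, LinearMap.add_apply, Module.End.mul_apply, ih] at e
        rw [e, hc]
        by_cases hA : i.flavor = A
        · rw [if_pos hA.symm, if_pos hA, if_neg (hA ▸ h), hA, add_zero, map_smul,
            LinearMap.neg_apply]
          push_cast
          module
        · rw [if_neg (Ne.symm hA), if_neg hA, map_smul, LinearMap.zero_apply, add_zero, zero_add]
    rw [fs_insert hi, map_smul, key, smul_comm]

theorem rho_zero_eq (A : Flavor M) : rho A 0 = diagFin fun S => (charge A S : ℂ) :=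
  FinVec.linearMap_ext fun S => by rw [rho_zero_fs, diagFin_fs]

theorem up_mul_dn_other {A B : Flavor M} (h : B ≠ A) (n : ℤ) :
    up A * dn B n = -dn B n * up A := by
  unfold up
  split_ifs
  · rw [kleinFin_mul_dn_other h, neg_mul]
  · have e : kleinFin A * -dn B n = dn B n * kleinFin A := by
      rw [mul_neg, kleinFin_mul_dn_other h, neg_neg]
    exact kleinInvFin_conj e

theorem up_mul_dd_other {A B : Flavor M} (h : B ≠ A) (n : ℤ) :
    up A * dd B n = -dd B n * up A := by
  unfold up
  split_ifs
  · rw [kleinFin_mul_dd_other h, neg_mul]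
  · have e : kleinFin A * -dd B n = dd B n * kleinFin A := by
      rw [mul_neg, kleinFin_mul_dd_other h, neg_neg]
    exact kleinInvFin_conj e

/-- All basis states arise from the vacuum by fermion operators, so vanishing at the vacuum
propagates through any intertwining, even one with changed labels or signs. -/
theorem eq_zero_of_intertwine {D : Module.End ℂ (FinVec M)} (h0 : D (fs ∅) = 0)
    (h1 : ∀ B n, ∃ Y : Module.End ℂ (FinVec M), ∀ v, D (dn B n v) = Y (D v))
    (h2 : ∀ B n, ∃ Y : Module.End ℂ (FinVec M), ∀ v, D (dd B n v) = Y (D v)) : D = 0 := by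
  refine FinVec.linearMap_ext fun S => ?_
  induction S using Finset.induction_on with
  | empty => exact h0
  | insert i S hi ih =>
    rw [LinearMap.zero_apply] at ih ⊢
    rw [fs_insert hi, map_smul, excDag_eq]
    split_ifs
    · obtain ⟨Y, hY⟩ := h2 i.flavor (modeIdx i.flavor i.n)
      rw [hY, ih, map_zero, smul_zero]
    · obtain ⟨Y, hY⟩ := h1 i.flavor (modeIdx i.flavor i.n)
      rw [hY, ih, map_zero, smul_zero]

/-- Raising every fermion by one level costs twice the charge, plus 1 for the newly filled level.
The difference of the two sides intertwines fermion operators, with labels shifted for A and signs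
for the other flavors, and kills the vacuum. -/
theorem ham_up (A : Flavor M) (v : FinVec M) :
    ham M (up A v) = up A (ham M v) + (2 : ℂ) • up A (rho A 0 v) + up A v := by
  have hD : ham M * up A - up A * (ham M + (2 : ℂ) • rho A 0 + 1) = 0 := by
    have hDv : ∀ v, (ham M * up A - up A * (ham M + (2 : ℂ) • rho A 0 + 1)) v =
        ham M (up A v) - (up A (ham M v) + (2 : ℂ) • up A (rho A 0 v) + up A v) := by
      intro v
      simp only [LinearMap.sub_apply, Module.End.mul_apply, LinearMap.add_apply, map_add,
        LinearMap.smul_apply, map_smul, Module.End.one_apply]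
    have a1 : ∀ B n v, ham M (dn B n v) = dn B n (ham M v) - ((2 * n + 1 : ℤ) : ℂ) • dn B n v :=
      fun B n v => LinearMap.congr_fun (ham_mul_dn B n) v
    have a2 : ∀ B n v, ham M (dd B n v) = dd B n (ham M v) + ((2 * n + 1 : ℤ) : ℂ) • dd B n v :=
      fun B n v => LinearMap.congr_fun (ham_mul_dd B n) v
    have a3 : ∀ n v, up A (dn A n v) = dn A (n + 1) (up A v) :=
      fun n v => LinearMap.congr_fun (up_mul_dn A n) v
    have a4 : ∀ n v, up A (dd A n v) = dd A (n + 1) (up A v) :=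
      fun n v => LinearMap.congr_fun (up_mul_dd A n) v
    have a5 : ∀ n v, rho A 0 (dn A n v) = dn A n (rho A 0 v) - dn A n v := fun n v => by
      have := LinearMap.congr_fun (rho_mul_dn_self A 0 n) v
      rwa [add_zero] at this
    have a6 : ∀ n v, rho A 0 (dd A n v) = dd A n (rho A 0 v) + dd A n v := fun n v => by
      have := LinearMap.congr_fun (rho_mul_dd_self A 0 n) v
      rwa [sub_zero] at this
    refine eq_zero_of_intertwine ?_ (fun B n => ?_) fun B n => ?_
    · rw [hDv, up_fs (by simp), a2, rho_vac A (isVac_vacuum A) le_rfl, ham, diagFin_fs, map_zero]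
      have : energy (∅ : Finset (Mode M)) = 0 := rfl
      rw [this]
      simp
    · by_cases h : B = A
      · subst h
        refine ⟨dn B (n + 1), fun v => ?_⟩
        simp only [hDv, a1, a3, a5, map_sub, map_add, map_smul]
        push_cast
        module
      · have b1 : ∀ v, up A (dn B n v) = -dn B n (up A v) :=
          fun v => LinearMap.congr_fun (up_mul_dn_other h n) v
        have b2 : ∀ v, rho A 0 (dn B n v) = dn B n (rho A 0 v) := fun v => by
          have := LinearMap.congr_fun (rho_mul_dn A B 0 n) v
          rwa [if_neg (Ne.symm h), add_zero] at this
        refine ⟨-dn B n, fun v => ?_⟩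
        simp only [hDv, a1, b1, b2, map_sub, map_add, map_smul, map_neg, LinearMap.neg_apply]
        module
    · by_cases h : B = A
      · subst h
        refine ⟨dd B (n + 1), fun v => ?_⟩
        simp only [hDv, a2, a4, a6, map_sub, map_add, map_smul]
        push_cast
        module
      · have b1 : ∀ v, up A (dd B n v) = -dd B n (up A v) :=
          fun v => LinearMap.congr_fun (up_mul_dd_other h n) v
        have b2 : ∀ v, rho A 0 (dd B n v) = dd B n (rho A 0 v) := fun v => by
          have := LinearMap.congr_fun (rho_mul_dd A B 0 n) v
          rwa [if_neg (Ne.symm h), add_zero] at this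
        refine ⟨-dd B n, fun v => ?_⟩
        simp only [hDv, a2, b1, b2, map_sub, map_add, map_smul, map_neg, LinearMap.neg_apply]
        module
  have h := LinearMap.congr_fun hD v
  simp only [LinearMap.sub_apply, Module.End.mul_apply, LinearMap.add_apply, map_add,
    LinearMap.smul_apply, map_smul, Module.End.one_apply, LinearMap.zero_apply] at h
  rw [sub_eq_zero.1 h]

end EnergyCharge

/-! ### The densities, the zero modes and the exponent on the finite states -/

section Densities

variable {M : ℕ}

theorem hasSum_prod_of_fintype {β γ E : Type*} [Fintype γ] [AddCommMonoid E] [TopologicalSpace E]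
    [ContinuousAdd E] {g : β × γ → E} {S : γ → E}
    (h : ∀ j, HasSum (fun m => g (m, j)) (S j)) : HasSum g (∑ j, S j) := by
  classical
  have h1 : ∀ j, HasSum (fun p : β × γ => if p.2 = j then g p else 0) (S j) := fun j => by
    have hi : Function.Injective fun m : β => (m, j) := fun m m' e => (Prod.mk.inj e).1
    refine (hi.hasSum_iff fun p hp => if_neg fun e => hp ⟨p.1, ?_⟩).1 ?_
    · rw [← e]
    · simpa [Function.comp_def] using h j
  have h2 := hasSum_sum (s := Finset.univ) fun j _ => h1 j
  refine h2.congr_fun fun p => ?_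
  simp

theorem exists_actsAs_seriesOp {ι : Type*} [Nonempty ι] {T : ι → Fock M →ₗ.[ℂ] Fock M}
    {X : ι → FinVec M →ₗ[ℂ] Fock M} {f : FinVec M → Fock M} (h : ∀ i, ActsAs (T i) (X i))
    (hs : ∀ u, HasSum (fun i => X i u) (f u)) :
    ∃ Y, ActsAs (seriesOp T) Y ∧ ∀ u, Y u = f u := by
  let Y : FinVec M →ₗ[ℂ] Fock M :=
    { toFun := f
      map_add' := fun u v => by
        refine (hs (u + v)).unique ?_
        simpa only [map_add] using (hs u).add (hs v)
      map_smul' := fun c u => by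
        refine (hs (c • u)).unique ?_
        simpa only [map_smul, RingHom.id_apply] using (hs u).const_smul c }
  exact ⟨Y, ActsAs.seriesOp h hs, fun _ => rfl⟩

theorem boseK_mul_sitePos {L a : ℝ} (ha : 0 < a) (hL : L = M * a) (n : ℤ) (x : Cell M) :
    boseK L n * sitePos a x = 2 * Real.pi * (n * (x : ℤ) / M) := by
  unfold boseK sitePos
  rw [hL]
  rcases Nat.eq_zero_or_pos M with rfl | hM
  · simp
  · have : (M : ℝ) ≠ 0 := by exact_mod_cast hM.ne'
    field_simp

/-- Inverse lattice Fourier transform: the sum over transversal momenta isolates the site x. -/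
theorem sum_exp_smul_densityFin {L a : ℝ} (ha : 0 < a) (hL : L = M * a) (hM : 0 < M)
    (r s α : ℤˣ) (m : ℤ) (x : Cell M) (u : FinVec M) :
    ∑ j : Cell M, Complex.exp (Complex.I * ((boseK L j * sitePos a x : ℝ) : ℂ)) •
      densityFin L a r s α (m, j) u = (M : ℂ) • rhoC ⟨r, s, α, x⟩ m u := by
  have h : ∀ j : Cell M, Complex.exp (Complex.I * ((boseK L j * sitePos a x : ℝ) : ℂ)) •
      densityFin L a r s α (m, j) u = ∑ z : Cell M,
        Complex.exp (2 * Real.pi * Complex.I *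
          (((j : ℤ) : ℂ) * (((x : ℤ) - (z : ℤ) : ℤ) : ℂ) / M)) • rhoC ⟨r, s, α, z⟩ m u := by
    intro j
    rw [densityFin, LinearMap.sum_apply, Finset.smul_sum]
    refine Finset.sum_congr rfl fun z _ => ?_
    rw [LinearMap.smul_apply, smul_smul, ← Complex.exp_add, boseK_mul_sitePos ha hL,
      boseK_mul_sitePos ha hL]
    congr 2
    push_cast
    ring
  simp only [h]
  rw [Finset.sum_comm]
  simp only [← Finset.sum_smul]
  rw [Finset.sum_eq_single x]
  · rw [sum_cell_exp hM _ (by simpa using hM), if_pos (by simp)]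
  · intro z _ hz
    rw [sum_cell_exp hM _ (cell_abs_sub_lt x z), if_neg, zero_smul]
    intro h0
    exact hz (Subtype.ext (by omega))
  · simp

/-- For signs (1 + αβ)/2 = δ_{α,β}, so the charge and spin densities combine into the density of a
single spin. -/
theorem actsAs_densityJ {L a : ℝ} (ha : 0 < a) (hL : L = M * a) (hM : 0 < M) (r s α : ℤˣ)
    (p : BoseMom M) :
    ActsAs (densityJ L a r s α p) (FinVec.incl M ∘ₗ densityFin L a r s α p) := by
  have h0 := actsAs_nodalBilinear ha hL hM (fun _ => 1) r s p
  rw [Matrix.diagonal_one] at h0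
  have h3 := actsAs_nodalBilinear ha hL hM (fun α : ℤˣ => (((α : ℤˣ) : ℤ) : ℂ)) r s p
  refine ((h0.add (h3.smul (((α : ℤˣ) : ℤ) : ℂ))).smul (1 / 2 : ℂ)).congr ?_
  have hu : (Finset.univ : Finset ℤˣ) = {1, -1} := rfl
  rw [hu, Finset.sum_pair (by decide), Finset.sum_pair (by decide)]
  rcases Int.units_eq_one_or α with rfl | rfl
  · simp only [Units.val_one, Int.cast_one, one_smul, Units.val_neg, Int.cast_neg]
    module
  · simp only [Units.val_one, Int.cast_one, one_smul, Units.val_neg, Int.cast_neg]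
    module

theorem actsAs_zeroMode {L a : ℝ} (ha : 0 < a) (hL : L = M * a) (hM : 0 < M) (r s α : ℤˣ)
    (x : Cell M) :
    ActsAs (zeroMode L a r s α x) (FinVec.incl M ∘ₗ rho ⟨r, s, α, x⟩ 0) := by
  have := cell_nonempty hM
  have h := ActsAs.smul ((√(2 * Real.pi * a) : ℝ) : ℂ) (ActsAs.sum Finset.univ_nonempty
    fun (p : Cell M) _ => ActsAs.smul
      ((1 / L : ℝ) * Complex.exp (Complex.I * ((boseK L p * sitePos a x : ℝ) : ℂ)))
      (ActsAs.smul ((√(a / (2 * Real.pi)) : ℝ) : ℂ) (actsAs_densityJ ha hL hM r s α (0, p))))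
  refine ActsAs.congr (T := zeroMode L a r s α x) h (LinearMap.ext fun u => ?_)
  have hs := congrArg (FinVec.incl M) (sum_exp_smul_densityFin ha hL hM r s α 0 x u)
  rw [map_sum] at hs
  simp only [map_smul] at hs
  -- The two roots multiply to a, and a M/L = 1.
  have hc : √(2 * Real.pi * a) * (1 / L) * √(a / (2 * Real.pi)) * M = 1 := by
    have h1 : √(2 * Real.pi * a) * √(a / (2 * Real.pi)) = a := by
      rw [← Real.sqrt_mul (by positivity), show 2 * Real.pi * a * (a / (2 * Real.pi)) = a * a by
        field_simp, Real.sqrt_mul_self ha.le]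
    have hM' : (M : ℝ) ≠ 0 := by exact_mod_cast hM.ne'
    rw [hL]
    calc _ = √(2 * Real.pi * a) * √(a / (2 * Real.pi)) * M * (1 / (M * a)) := by ring
      _ = 1 := by rw [h1]; field_simp
  calc _ = (((√(2 * Real.pi * a) * (1 / L) * √(a / (2 * Real.pi)) : ℝ) : ℂ)) •
        ∑ j : Cell M, Complex.exp (Complex.I * ((boseK L j * sitePos a x : ℝ) : ℂ)) •
          FinVec.incl M (densityFin L a r s α (0, j) u) := by
        simp only [LinearMap.smul_apply, LinearMap.sum_apply, LinearMap.comp_apply,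
          Finset.smul_sum, smul_smul]
        refine Finset.sum_congr rfl fun j _ => ?_
        congr 1
        push_cast
        ring
    _ = _ := by
        rw [hs, smul_smul]
        rw [show (((√(2 * Real.pi * a) * (1 / L) * √(a / (2 * Real.pi)) : ℝ) : ℂ)) * (M : ℂ) = 1 by
          exact_mod_cast hc, one_smul, rhoC, mul_zero]
        rfl

/-- The coefficients of the exponent of a vertex operator with the parameter `w`. -/
def geomCoeff (w : ℂ) (m : ℕ) : ℂ := -w ^ (m + 1)

theorem summable_norm_geomCoeff {w : ℂ} (hw : ‖w‖ < 1) : Summable fun m => ‖geomCoeff w m‖ := by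
  simp only [geomCoeff, norm_neg, norm_pow]
  exact (summable_nat_add_iff 1).2 (summable_geometric_of_lt_one (norm_nonneg _) hw)

/-- Modes with positive index form a sum that is finite on u, with the sign of -`annih` because
`geomCoeff` carries a minus; those with negative index form the creation operator with conjugate
coefficients. -/
theorem hasSum_smul_rho (A : Flavor M) {w : ℂ} (hw : ‖w‖ < 1) {c : ℤ → ℂ} (h0 : c 0 = 0)
    (hpos : ∀ n : ℕ, c (n + 1) = w ^ (n + 1) / (n + 1))
    (hneg : ∀ n : ℕ, c (-(n + 1)) = -(starRingEnd ℂ w ^ (n + 1) / (n + 1))) (u : FinVec M) :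
    HasSum (fun m : ℤ => c m • FinVec.incl M (rho A m u))
      (creatInf A (geomCoeff w) u - (annih A (geomCoeff w) u : FinVec M)) := by
  obtain ⟨k, hk⟩ := exists_mem_energyLE u
  have h1 : HasSum (fun n : ℕ => c n • FinVec.incl M (rho A n u))
      (-(annih A (geomCoeff w) u : FinVec M) : Fock M) := by
    have h2 := hasSum_sum_of_ne_finset_zero (L := SummationFilter.unconditional ℕ)
      (s := Finset.range (k + 1))
      (f := fun n : ℕ => c n • FinVec.incl M (rho A n u)) fun n hn => by
        rw [Finset.mem_range, not_lt] at hn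
        rw [rho_apply_eq_zero A hk (by omega), map_zero, smul_zero]
    convert h2 using 1
    rw [Finset.sum_range_succ', annih_apply A _ (n := k) hk (by omega), Nat.cast_zero, h0, zero_smul,
      add_zero, FinVec.coe_sum, ← Finset.sum_neg_distrib]
    refine Finset.sum_congr rfl fun n _ => ?_
    rw [Nat.cast_add, Nat.cast_one, hpos, FinVec.coe_smul, ← neg_smul, geomCoeff]
    congr 1
    ring
  have h2 : HasSum (fun n : ℕ => c (-((n : ℤ) + 1)) • FinVec.incl M (rho A (-((n : ℤ) + 1)) u))
      (creatInf A (geomCoeff w) u) := by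
    refine (summable_creatInf A (summable_norm_geomCoeff hw) u).hasSum.congr_fun fun n => ?_
    rw [hneg, geomCoeff, map_neg, map_pow]
    change _ = _ • FinVec.incl M _
    congr 1
    ring
  have h3 := HasSum.of_nat_of_neg_add_one (f := fun m : ℤ => c m • FinVec.incl M (rho A m u)) h1 h2
  rwa [neg_add_eq_sub] at h3

/-- The parameter `e^{iθ} q` with `θ = 2π r y / L` and `q = e^{-π ε / L}`. -/
noncomputable def vertexParam (L : ℝ) (r : ℤˣ) (y ε : ℝ) : ℂ :=
  Complex.exp (Complex.I * ((((r : ℤˣ) : ℤ) : ℝ) * (2 * Real.pi * y / L) : ℝ)) *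
    (Real.exp (-(Real.pi * ε / L)) : ℝ)

theorem norm_vertexParam (L : ℝ) (r : ℤˣ) (y ε : ℝ) :
    ‖vertexParam L r y ε‖ = Real.exp (-(Real.pi * ε / L)) := by
  rw [vertexParam, norm_mul, mul_comm Complex.I, Complex.norm_exp_ofReal_mul_I, one_mul,
    Complex.norm_real, Real.norm_of_nonneg (Real.exp_nonneg _)]

theorem norm_vertexParam_lt_one {L : ℝ} (hL : 0 < L) (r : ℤˣ) (y : ℝ) {ε : ℝ} (hε : 0 < ε) :
    ‖vertexParam L r y ε‖ < 1 := by
  rw [norm_vertexParam, Real.exp_lt_one_iff]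
  have : 0 < Real.pi * ε / L := by positivity
  linarith

/-- The transversal sum localizes the exponent at the site x. There the phase e^{i p_s x_s}, the
regulator and 1/p_s combine into w^m/m for positive index and -w̄^|m|/m with |m| in place of m for
negative index, the direction of counting being turned for r = -. -/
theorem exists_actsAs_vertexExponent {L a : ℝ} (ha : 0 < a) (hL : L = M * a) (hM : 0 < M)
    (r s α : ℤˣ) (y : ℝ) (x : Cell M) {ε : ℝ} (hε : 0 < ε) :
    ∃ X, ActsAs (vertexExponent L a r s α y x ε) X ∧ ∀ u, X u =
      creatInf ⟨r, s, α, x⟩ (geomCoeff (vertexParam L r y ε)) u -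
        (annih ⟨r, s, α, x⟩ (geomCoeff (vertexParam L r y ε)) u : FinVec M) := by
  have hL0 : 0 < L := by
    have : (0 : ℝ) < M := by exact_mod_cast hM
    rw [hL]
    positivity
  have hMC : (M : ℂ) ≠ 0 := by exact_mod_cast hM.ne'
  have haC : (a : ℂ) ≠ 0 := by exact_mod_cast ha.ne'
  have hpi : (Real.pi : ℂ) ≠ 0 := by exact_mod_cast Real.pi_ne_zero
  set w := vertexParam L r y ε with hw
  have hw1 : ‖w‖ < 1 := norm_vertexParam_lt_one hL0 r y hε
  set φ : ℝ := 2 * Real.pi * y / L with hφ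
  set q : ℝ := Real.exp (-(Real.pi * ε / L)) with hq
  let c : ℤ → ℂ := fun m => Complex.exp (Complex.I * ((m * φ : ℝ) : ℂ)) *
    ((q ^ m.natAbs : ℝ) : ℂ) / m
  have hr2 : (((r : ℤˣ) : ℤ) : ℂ) * (((r : ℤˣ) : ℤ) : ℂ) = 1 := by
    rcases Int.units_eq_one_or r with rfl | rfl <;> simp
  have hr2' : ((r : ℤˣ) : ℤ) * ((r : ℤˣ) : ℤ) = 1 := by
    rcases Int.units_eq_one_or r with rfl | rfl <;> simp
  -- the series of one site
  have hsite : ∀ (z : Cell M) (u : FinVec M),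
      HasSum (fun m : ℤ => c m • FinVec.incl M (rhoC ⟨r, s, α, z⟩ m u))
        ((((r : ℤˣ) : ℤ) : ℂ) • (creatInf ⟨r, s, α, z⟩ (geomCoeff w) u -
          (annih ⟨r, s, α, z⟩ (geomCoeff w) u : FinVec M))) := by
    intro z u
    have hpos : ∀ n : ℕ, (((r : ℤˣ) : ℤ) : ℂ) * c (((r : ℤˣ) : ℤ) * (n + 1)) =
        w ^ (n + 1) / (n + 1) := by
      intro n
      have e1 : (((r : ℤˣ) : ℤ) * ((n : ℤ) + 1)).natAbs = n + 1 := by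
        rcases Int.units_eq_one_or r with rfl | rfl
        · simp only [Units.val_one]
          omega
        · simp only [Units.val_neg, Units.val_one]
          omega
      simp only [c, e1, hw, vertexParam, mul_pow, ← Complex.exp_nat_mul]
      rw [Complex.ofReal_pow, ← hq, ← hφ]
      have e2 : Complex.I * (((((((r : ℤˣ) : ℤ) * ((n : ℤ) + 1) : ℤ)) : ℝ) * φ : ℝ) : ℂ) =
          ((n + 1 : ℕ) : ℂ) * (Complex.I * (((((r : ℤˣ) : ℤ) : ℝ) * φ : ℝ) : ℂ)) := by
        push_cast
        ring
      rw [e2]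
      have hn : (n : ℂ) + 1 ≠ 0 := by exact_mod_cast Nat.succ_ne_zero n
      have hrne : (((r : ℤˣ) : ℤ) : ℂ) ≠ 0 := left_ne_zero_of_mul_eq_one hr2
      push_cast
      field_simp
    have hconj : ∀ m : ℤ, c (-m) = -starRingEnd ℂ (c m) := by
      intro m
      simp only [c, Int.natAbs_neg, map_div₀, map_mul, Complex.conj_ofReal, ← Complex.exp_conj,
        Complex.conj_I, map_intCast]
      push_cast
      rw [div_neg]
      congr 4
      ring
    have h := hasSum_smul_rho ⟨r, s, α, z⟩ hw1
      (c := fun m => (((r : ℤˣ) : ℤ) : ℂ) * c (((r : ℤˣ) : ℤ) * m)) (by simp [c]) hpos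
      (fun n => by
        have e : ∀ z₁ : ℂ, (((r : ℤˣ) : ℤ) : ℂ) * z₁ = w ^ (n + 1) / (n + 1) →
            (((r : ℤˣ) : ℤ) : ℂ) * starRingEnd ℂ z₁ = starRingEnd ℂ w ^ (n + 1) / (n + 1) :=
          fun z₁ h₁ => by simpa using congrArg (starRingEnd ℂ) h₁
        simp only [mul_neg, hconj, e _ (hpos n)]) u
    have h2 := h.const_smul (((r : ℤˣ) : ℤ) : ℂ)
    -- The label m is exchanged with r m, which turns `rhoC` into `rho`.
    have hinv : Function.Involutive fun m : ℤ => ((r : ℤˣ) : ℤ) * m := fun m => by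
      simp only [← mul_assoc, hr2', one_mul]
    rw [← (hinv.toPerm).hasSum_iff] at h2
    refine h2.congr_fun fun m => ?_
    simp only [Function.comp_apply, Function.Involutive.coe_toPerm, rhoC]
    rw [smul_smul, ← mul_assoc, hr2, one_mul, ← mul_assoc, hr2', one_mul]
  let F : BoseMom M → FinVec M →ₗ[ℂ] Fock M := fun p =>
    ((((2 * Real.pi / L) ^ 2 * (1 / boseK L p.1) : ℝ) : ℂ) *
      Complex.exp (Complex.I * ((boseK L p.1 * y + boseK L p.2 * sitePos a x : ℝ) : ℂ)) *
      ((Real.exp (-ε * |boseK L p.1| / 2) : ℝ) : ℂ)) •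
        (FinVec.incl M ∘ₗ densityFin L a r s α p)
  have hF : ∀ (p : BoseMom M) (u : FinVec M), F p u =
      ((2 * Real.pi / L : ℝ) : ℂ) • c p.1 •
        Complex.exp (Complex.I * ((boseK L p.2 * sitePos a x : ℝ) : ℂ)) •
          FinVec.incl M (densityFin L a r s α p u) := by
    intro p u
    simp only [F, LinearMap.smul_apply, LinearMap.comp_apply, smul_smul]
    congr 1
    have e1 : ((Real.exp (-ε * |boseK L p.1| / 2) : ℝ) : ℂ) = ((q ^ p.1.natAbs : ℝ) : ℂ) := by
      congr 1
      rw [hq, ← Real.exp_nat_mul, boseK, abs_mul, abs_of_nonneg (by positivity),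
        Nat.cast_natAbs, Int.cast_abs]
      congr 1
      field_simp
    rw [e1, Complex.ofReal_add, mul_add, Complex.exp_add]
    have e2 : boseK L p.1 * y = p.1 * φ := by
      rw [boseK, hφ]
      ring
    rw [e2]
    simp only [c]
    have hLC : (L : ℂ) ≠ 0 := by exact_mod_cast hL0.ne'
    have e3 : (((2 * Real.pi / L) ^ 2 * (1 / boseK L p.1) : ℝ) : ℂ) =
        ((2 * Real.pi / L : ℝ) : ℂ) * (1 / (p.1 : ℂ)) := by
      rw [boseK]
      push_cast
      rcases eq_or_ne (p.1 : ℂ) 0 with h | h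
      · simp [h]
      · field_simp
    rw [e3]
    ring
  have hne : Nonempty {p : BoseMom M // p.1 ≠ 0} :=
    ⟨⟨(1, (cell_nonempty hM).some), one_ne_zero⟩⟩
  have hsum : ∀ u : FinVec M, HasSum (fun p : {p : BoseMom M // p.1 ≠ 0} => F p.1 u)
      (((2 * Real.pi / L : ℝ) : ℂ) • (M : ℂ) • ((((r : ℤˣ) : ℤ) : ℂ) •
        (creatInf ⟨r, s, α, x⟩ (geomCoeff w) u -
          (annih ⟨r, s, α, x⟩ (geomCoeff w) u : FinVec M)))) := by
    intro u
    -- Momenta with p_s = 0 can be added: division by zero gives c 0 = 0. The index set is then a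
    -- product, and the transversal sum is finite.
    refine (hasSum_subtype_iff_of_support_subset (f := fun p => F p u)
      (s := {p : BoseMom M | p.1 ≠ 0}) fun p hp h0 => hp ?_).2 ?_
    · change F p u = 0
      rw [hF, show c p.1 = 0 by simp [c, h0], zero_smul, smul_zero]
    · have hj : ∀ j : Cell M, Summable fun m : ℤ => F (m, j) u := by
        intro j
        have h1 : Summable fun m : ℤ => ∑ z : Cell M,
            (((2 * Real.pi / L : ℝ) : ℂ) *
              Complex.exp (Complex.I * ((boseK L j * sitePos a x : ℝ) : ℂ)) *
              Complex.exp (-Complex.I * ((boseK L j * sitePos a z : ℝ) : ℂ))) •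
              c m • FinVec.incl M (rhoC ⟨r, s, α, z⟩ m u) :=
          summable_sum fun z _ => (hsite z u).summable.const_smul _
        refine h1.congr fun m => ?_
        rw [hF, densityFin, LinearMap.sum_apply, map_sum, Finset.smul_sum, Finset.smul_sum,
          Finset.smul_sum]
        refine Finset.sum_congr rfl fun z _ => ?_
        rw [LinearMap.smul_apply, map_smul]
        simp only [smul_smul]
        congr 1
        ring
      have h2 := hasSum_prod_of_fintype (g := fun p => F p u) fun j => (hj j).hasSum
      have h3 : HasSum (fun m : ℤ => ∑ j : Cell M, F (m, j) u) (∑ j, ∑' m : ℤ, F (m, j) u) :=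
        hasSum_sum fun j _ => (hj j).hasSum
      have h4 := ((hsite x u).const_smul (M : ℂ)).const_smul ((2 * Real.pi / L : ℝ) : ℂ)
      rw [h3.unique (h4.congr_fun fun m => ?_)] at h2
      · exact h2
      · have e := congrArg (FinVec.incl M) (sum_exp_smul_densityFin ha hL hM r s α m x u)
        rw [map_sum] at e
        simp only [map_smul] at e
        simp only [hF]
        rw [← Finset.smul_sum, ← Finset.smul_sum, e]
        rw [smul_comm (c m)]
  obtain ⟨Y, hY, hYu⟩ := exists_actsAs_seriesOp
    (fun p : {p : BoseMom M // p.1 ≠ 0} => ActsAs.smul _ (actsAs_densityJ ha hL hM r s α p.1)) hsum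
  refine ⟨_, ActsAs.smul _ hY, fun u => ?_⟩
  rw [LinearMap.smul_apply, hYu, smul_smul, smul_smul, smul_smul]
  -- The prefactor a/2π, the measure 2π/L and the M sites multiply to 1, and the two signs r cancel.
  have e : (((r : ℤˣ) : ℤ) : ℂ) * ((a / (2 * Real.pi) : ℝ) : ℂ) *
      ((2 * Real.pi / L : ℝ) : ℂ) * (M : ℂ) * (((r : ℤˣ) : ℤ) : ℂ) = 1 := by
    rw [hL]
    push_cast
    field_simp
    rw [sq, hr2]
  rw [e, one_smul]

end Densities

/-! ### The Klein factors -/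

section KleinFamily

variable {M : ℕ}

theorem kleinFin_mul_rho (A B : Flavor M) {m : ℤ} (hm : m ≠ 0) :
    kleinFin A * rho B m = rho B m * kleinFin A := by
  by_cases h : B = A
  · subst h
    have h1 := up_mul_rho B hm
    have h2 := down_mul_rho B hm
    unfold up at h1
    unfold down at h2
    split_ifs at h1 h2
    · exact h1
    · exact h2
  · exact kleinFin_mul_rho_other h m

theorem kleinFin_mul_rho_zero (A : Flavor M) :
    kleinFin A * rho A 0 = rho A 0 * kleinFin A - (((A.r : ℤˣ) : ℤ) : ℂ) • kleinFin A := by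
  have h := up_mul_rho_zero A
  by_cases hr : A.r = 1
  · simpa [up, hr] using h
  · rw [up, if_neg hr] at h
    have h1 : kleinFin A * rho A 0 * (kleinInvFin A * kleinFin A) =
        kleinFin A * (kleinInvFin A * rho A 0) * kleinFin A +
          kleinFin A * kleinInvFin A * kleinFin A := by
      rw [h]
      noncomm_ring
    rw [kleinInvFin_mul, mul_one, ← mul_assoc, kleinFin_mul_inv, one_mul, one_mul] at h1
    rw [h1, units_ne hr]
    simp

/-- The anticommutator intertwines all fermion operators, with a sign for flavors A and B and
without for the others, and on the vacuum it is an anticommutator of two creation operators. -/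
theorem kleinFin_anticomm {A B : Flavor M} (h : A ≠ B) :
    kleinFin A * kleinFin B + kleinFin B * kleinFin A = 0 := by
  have key : ∀ X : Flavor M → ℤ → Module.End ℂ (FinVec M),
      (∀ A n, kleinFin A * X A n = X A (n + ((A.r : ℤˣ) : ℤ)) * kleinFin A) →
      (∀ A B n, B ≠ A → kleinFin A * X B n = -(X B n * kleinFin A)) → ∀ C n,
      ∃ Y : Module.End ℂ (FinVec M), ∀ v, (kleinFin A * kleinFin B + kleinFin B * kleinFin A) (X C n v)
        = Y ((kleinFin A * kleinFin B + kleinFin B * kleinFin A) v) := by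
    intro X h1 h2 C n
    have h1' : ∀ A n v, kleinFin A (X A n v) = X A (n + ((A.r : ℤˣ) : ℤ)) (kleinFin A v) :=
      fun A n v => LinearMap.congr_fun (h1 A n) v
    have h2' : ∀ A B n v, B ≠ A → kleinFin A (X B n v) = -X B n (kleinFin A v) :=
      fun A B n v hBA => LinearMap.congr_fun (h2 A B n hBA) v
    by_cases hA : C = A
    · subst hA
      refine ⟨-X C (n + ((C.r : ℤˣ) : ℤ)), fun v => ?_⟩
      simp [h1', h2' _ _ _ _ h, add_comm]
    · by_cases hB : C = B
      · subst hB
        refine ⟨-X C (n + ((C.r : ℤˣ) : ℤ)), fun v => ?_⟩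
        simp [h1', h2' _ _ _ _ h.symm, add_comm]
      · refine ⟨X C n, fun v => ?_⟩
        simp [h2' _ _ _ _ hA, h2' _ _ _ _ hB]
  refine eq_zero_of_intertwine ?_ (key dn kleinFin_mul_dn fun A B n h => kleinFin_mul_dn_other h n)
    (key dd kleinFin_mul_dd fun A B n h => kleinFin_mul_dd_other h n)
  have h0 : ∀ A B : Flavor M, A ≠ B → kleinFin A (kleinFin B (fs ∅)) =
      -excDag ⟨B, 0⟩ (excDag ⟨A, 0⟩ (fs ∅)) := fun A B h => by
    have h3 := LinearMap.congr_fun (kleinFin_mul_excDag_other (A := A) (i := ⟨B, 0⟩) (Ne.symm h)) (fs ∅)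
    rw [kleinFin_fs_of_forall_ne (A := B) (by simp)]
    rw [Module.End.mul_apply, LinearMap.neg_apply, Module.End.mul_apply,
      kleinFin_fs_of_forall_ne (A := A) (by simp)] at h3
    exact h3
  rw [LinearMap.add_apply, Module.End.mul_apply, Module.End.mul_apply, h0 A B h, h0 B A h.symm]
  rw [← neg_add, add_comm]
  exact neg_eq_zero.2 (LinearMap.congr_fun (excDag_mul_excDag ⟨A, 0⟩ ⟨B, 0⟩) (fs ∅))

/-- The Klein factor is a bijection of the finite vectors, hence of the domain of T; this gives both
directions, including equality of domains. -/
theorem mem_graph_iff_klein {A : Flavor M} {T : Fock M →ₗ.[ℂ] Fock M}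
    {X : Module.End ℂ (FinVec M)} (hT : ActsAs T (FinVec.incl M ∘ₗ X)) {c : ℂ}
    (h : kleinFin A * X = X * kleinFin A - c • kleinFin A) (v w : Fock M) :
    (v, w) ∈ T.graph ↔ (klein A v, klein A w + c • klein A v) ∈ T.graph := by
  have h1 : ∀ u, X (kleinFin A u) = kleinFin A (X u) + c • kleinFin A u := fun u => by
    have := LinearMap.congr_fun h u
    rw [Module.End.mul_apply, LinearMap.sub_apply, LinearMap.smul_apply, Module.End.mul_apply] at this
    rw [this]
    abel
  rw [hT.mem_graph_iff, hT.mem_graph_iff]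
  constructor
  · rintro ⟨u, rfl, rfl⟩
    exact ⟨kleinFin A u, rfl, congrArg FinVec.toFock (h1 u)⟩
  · rintro ⟨u, hu, hw⟩
    have hu' : kleinFin A (kleinInvFin A u) = u := LinearMap.congr_fun (kleinFin_mul_inv A) u
    have hv : ((kleinInvFin A u : FinVec M) : Fock M) = v := by
      rw [coe_kleinInvFin, hu, LinearIsometryEquiv.symm_apply_apply]
    refine ⟨_, hv, ?_⟩
    rw [← hu', LinearMap.comp_apply, h1] at hw
    have h2 : klein A (X (kleinInvFin A u) : FinVec M) + c • klein A v = klein A w + c • klein A v := by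
      rw [← hw, ← hv]
      rfl
    exact (klein A).injective (add_right_cancel h2)

theorem isKleinFamily_klein {L a : ℝ} (ha : 0 < a) (hL : L = M * a) (hM : 0 < M) :
    IsKleinFamily L a M klein where
  comm_boson A r s α p hp v w := by
    have h : kleinFin A * densityFin L a r s α p = densityFin L a r s α p * kleinFin A := by
      rw [densityFin, Finset.mul_sum, Finset.sum_mul]
      refine Finset.sum_congr rfl fun z _ => ?_
      rw [mul_smul_comm, smul_mul_assoc, rhoC, kleinFin_mul_rho]
      exact mul_ne_zero (Units.ne_zero r) hp
    rw [mem_graph_iff_klein (A := A) (c := 0) (actsAs_densityJ ha hL hM r s α p) (by rw [h]; simp)]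
    simp
  comm_zeroMode A r s α x v w := by
    refine mem_graph_iff_klein (actsAs_zeroMode ha hL hM r s α x) ?_ v w
    split_ifs with h
    · rw [← h, kleinFin_mul_rho_zero]
    · rw [kleinFin_mul_rho_other h, zero_smul, sub_zero]
  anticomm A B v := by
    split_ifs with h
    · subst h
      rw [LinearIsometryEquiv.symm_apply_apply, LinearIsometryEquiv.apply_symm_apply, two_smul]
    · rw [zero_smul]
      have h1 : ∀ u, klein A (klein B u) + klein B (klein A u) = 0 := by
        refine fun u => fock_induction (p := fun u => klein A (klein B u) + klein B (klein A u) = 0)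
          (isClosed_eq (by fun_prop) continuous_const) (fun u => ?_) u
        exact congrArg FinVec.toFock (LinearMap.congr_fun (kleinFin_anticomm h) u)
      refine (klein B).injective ?_
      have h2 := h1 ((klein B).symm v)
      rw [LinearIsometryEquiv.apply_symm_apply] at h2
      rw [map_add, LinearIsometryEquiv.apply_symm_apply, map_zero, add_comm, h2]

end KleinFamily

/-! ### Rotations and the vertex operator -/

section Vertex

variable {M : ℕ}

theorem lnExp_intertwine {X Y T : Module.End ℂ (FinVec M)} (hX : LocNil X) (hY : LocNil Y)
    (h : X * T = T * Y) : lnExp X * T = T * lnExp Y := by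
  have hp : ∀ i : ℕ, X ^ i * T = T * Y ^ i := by
    intro i
    induction i with
    | zero => simp
    | succ i ih => rw [pow_succ, mul_assoc, h, ← mul_assoc, ih, mul_assoc, ← pow_succ]
  rw [lnExp, lnExp, lfSum_mul hX.locFin, mul_lfSum hY.locFin]
  congr 1
  funext i
  rw [smul_mul_assoc, mul_smul_comm, hp]

/-- The operator `e^{κ H}`, `H` being twice the Hamiltonian, on finite vectors. -/
noncomputable def rot (M : ℕ) (κ : ℂ) : Module.End ℂ (FinVec M) :=
  diagFin fun S => Complex.exp (κ * (energy S : ℂ))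

theorem rot_fs (κ : ℂ) (S : Finset (Mode M)) :
    rot M κ (fs S) = Complex.exp (κ * (energy S : ℂ)) • fs S := diagFin_fs _ S

theorem rot_mul_rho (κ : ℂ) (A : Flavor M) (m : ℤ) :
    rot M κ * rho A m = Complex.exp (-(2 * κ * m)) • (rho A m * rot M κ) := by
  refine diagFin_comp_mul (φ := fun z => Complex.exp (κ * z)) (ham_mul_rho A m) fun z => ?_
  rw [← Complex.exp_add]
  congr 1
  push_cast
  ring

/-- Conjugation by e^{κH} multiplies a boson by a power fixed by its energy, so it rescales a
geometric sequence into one with another parameter. Imaginary κ rotates θ; real κ moves q. -/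
theorem expAnnih_mul_rot (A : Flavor M) (κ : ℂ) {b b' : ℕ → ℂ}
    (h : ∀ m : ℕ, b' m = Complex.exp (2 * κ * (m + 1)) * b m) :
    expAnnih A b' * rot M (-κ) = rot M (-κ) * expAnnih A b := by
  refine lnExp_intertwine (locNil_annih A b') (locNil_annih A b) ?_
  rw [annih, annih, lfSum_mul (locFin_annih A b'), mul_lfSum (locFin_annih A b)]
  congr 1
  funext m
  rw [smul_mul_assoc, mul_smul_comm, rot_mul_rho, smul_smul, h]
  congr 1
  rw [show -(2 * -κ * ((m + 1 : ℤ) : ℂ)) = 2 * κ * (m + 1) by push_cast; ring]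
  ring

theorem rho_zero_up_fs (A : Flavor M) (S : Finset (Mode M)) :
    rho A 0 (up A (fs S)) = ((charge A S : ℂ) + 1) • up A (fs S) := by
  have h := LinearMap.congr_fun (up_mul_rho_zero A) (fs S)
  rw [Module.End.mul_apply, LinearMap.sub_apply, Module.End.mul_apply, rho_zero_fs, map_smul] at h
  rw [add_smul, h, one_smul, sub_add_cancel]

theorem diagFin_charge_up (A : Flavor M) (φ : ℂ → ℂ) (S : Finset (Mode M)) :
    diagFin (fun S => φ (charge A S : ℂ)) (up A (fs S)) = φ ((charge A S : ℂ) + 1) • up A (fs S) :=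
  diagFin_comp_apply (by rw [← rho_zero_eq, rho_zero_up_fs]) φ

theorem diagFin_energy_up (A : Flavor M) (φ : ℂ → ℂ) (S : Finset (Mode M)) :
    diagFin (fun S => φ (energy S : ℂ)) (up A (fs S)) =
      φ ((energy S : ℂ) + 2 * charge A S + 1) • up A (fs S) := by
  refine diagFin_comp_apply (g := fun S => (energy S : ℂ)) ?_ φ
  have h := ham_up A (fs S)
  rw [rho_zero_fs, ham, diagFin_fs, map_smul, map_smul] at h
  rw [h]
  module

/-- The unitary operator that raises the charge of flavor `A`. -/
noncomputable def upIso (A : Flavor M) : Fock M ≃ₗᵢ[ℂ] Fock M :=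
  if A.r = 1 then klein A else (klein A).symm

theorem coe_up (A : Flavor M) (v : FinVec M) : (up A v : Fock M) = upIso A v := by
  unfold up upIso
  split_ifs <;> rfl

theorem coe_down (A : Flavor M) (v : FinVec M) : (down A v : Fock M) = (upIso A).symm v := by
  unfold down upIso
  split_ifs <;> rfl

/-- The phase `e^{i θ N/2}` of the charge `N` of flavor `A`. -/
noncomputable def chargePhase (A : Flavor M) (θ : ℝ) : Fock M ≃ₗᵢ[ℂ] Fock M :=
  diagPhase fun S => θ / 2 * charge A S

/-- The rotation `e^{i θ H/2}`, `H` being twice the Hamiltonian. -/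
noncomputable def rotIso (M : ℕ) (θ : ℝ) : Fock M ≃ₗᵢ[ℂ] Fock M :=
  diagPhase fun S => θ / 2 * energy S

theorem chargePhase_add (A : Flavor M) (θ θ' : ℝ) (v : Fock M) :
    chargePhase A (θ + θ') v = chargePhase A θ (chargePhase A θ' v) := by
  have h := diagPhase_add (fun S => θ / 2 * (charge A S : ℝ)) (fun S => θ' / 2 * (charge A S : ℝ))
  have h2 : (fun S => (θ + θ') / 2 * (charge A S : ℝ)) =
      (fun S => θ / 2 * (charge A S : ℝ)) + fun S => θ' / 2 * (charge A S : ℝ) := by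
    funext S
    simp only [Pi.add_apply]
    ring
  rw [chargePhase, h2, h]
  rfl

theorem chargePhase_symm (A : Flavor M) (θ : ℝ) :
    (chargePhase A θ).symm = chargePhase A (-θ) := by
  rw [chargePhase, diagPhase_symm, chargePhase]
  congr 1
  funext S
  simp only [Pi.neg_apply]
  ring

theorem rotIso_symm (θ : ℝ) : (rotIso M θ).symm = rotIso M (-θ) := by
  rw [rotIso, diagPhase_symm, rotIso]
  congr 1
  funext S
  simp only [Pi.neg_apply]
  ring

theorem continuous_rotIso (v : Fock M) : Continuous fun θ : ℝ => rotIso M θ v := by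
  refine (continuous_diagPhase (fun S => (1 / 2 : ℝ) * energy S) v).congr fun θ => ?_
  congr 2
  funext S
  simp only [Pi.smul_apply, smul_eq_mul]
  ring

theorem rotIso_coe (θ : ℝ) (u : FinVec M) :
    rotIso M θ (u : Fock M) = (rot M (Complex.I * (θ / 2)) u : FinVec M) := by
  rw [rotIso, diagPhase_coe, rot]
  congr 3
  funext S
  push_cast
  ring_nf

theorem rotIso_state (θ : ℝ) (S : Finset (Mode M)) :
    rotIso M θ (state S) = Complex.exp (Complex.I * (θ / 2 * energy S)) • state S := by
  rw [rotIso, diagPhase_state]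
  push_cast
  rfl

theorem chargePhase_coe (A : Flavor M) (θ : ℝ) (u : FinVec M) :
    chargePhase A θ (u : Fock M) =
      (diagFin (fun S => Complex.exp (Complex.I * (θ / 2) * (charge A S : ℂ))) u : FinVec M) := by
  rw [chargePhase, diagPhase_coe]
  congr 3
  funext S
  push_cast
  ring_nf

/-- The operator `√(2πaε) ψ(𝐱; ε)`, with the parameters `q = e^{-πε/L}` and `θ = 2π r x_s / L`. -/
noncomputable def vertexOp (A : Flavor M) (q θ : ℝ) : Fock M ≃ₗᵢ[ℂ] Fock M :=
  chargePhase A θ * (upIso A).symm * chargePhase A θ *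
    weyl A (geomCoeff (Complex.exp (Complex.I * θ) * q))

theorem vertexOp_apply (A : Flavor M) (q θ : ℝ) (v : Fock M) :
    vertexOp A q θ v = chargePhase A θ ((upIso A).symm (chargePhase A θ
      (weyl A (geomCoeff (Complex.exp (Complex.I * θ) * q)) v))) := rfl

theorem norm_exp_I_mul (θ q : ℝ) : ‖Complex.exp (Complex.I * θ) * q‖ = |q| := by
  rw [norm_mul, mul_comm Complex.I, Complex.norm_exp_ofReal_mul_I, one_mul, Complex.norm_real,
    Real.norm_eq_abs]

theorem summable_vertex {q : ℝ} (hq : |q| < 1) (θ : ℝ) :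
    Summable fun m => ‖geomCoeff (Complex.exp (Complex.I * θ) * q) m‖ :=
  summable_norm_geomCoeff (by rwa [norm_exp_I_mul])

theorem geomCoeff_exp_mul (κ w : ℂ) (m : ℕ) :
    geomCoeff (Complex.exp (2 * κ) * w) m = Complex.exp (2 * κ * (m + 1)) * geomCoeff w m := by
  rw [geomCoeff, geomCoeff, mul_pow, ← Complex.exp_nat_mul]
  push_cast
  ring_nf

theorem pair_mul_self {c b b' : ℕ → ℂ} (hc : ∀ m, ‖c m‖ = 1) (h : ∀ m, b' m = c m * b m) :
    pair b' b' = pair b b := by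
  refine tsum_congr fun m => ?_
  have : starRingEnd ℂ (c m) * c m = 1 := by
    rw [← Complex.normSq_eq_conj_mul_self, Complex.normSq_eq_norm_sq, hc]
    simp
  rw [h, map_mul]
  linear_combination (starRingEnd ℂ (b m) * b m / (m + 1)) * this

theorem norm_exp_two_I (θ : ℝ) (m : ℕ) :
    ‖Complex.exp (2 * (Complex.I * (θ / 2)) * (m + 1))‖ = 1 := by
  rw [show 2 * (Complex.I * (θ / 2)) * ((m : ℂ) + 1) = ((θ * (m + 1) : ℝ) : ℂ) * Complex.I by
    push_cast; ring, Complex.norm_exp_ofReal_mul_I]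

/-- The rotation removes the phase from the parameter of the Weyl operator; the Gaussian
normalization depends on moduli only and does not change. -/
theorem rotIso_weyl (A : Flavor M) {q : ℝ} (hq : |q| < 1) (θ : ℝ) (v : Fock M) :
    rotIso M θ (weyl A (geomCoeff (Complex.exp (Complex.I * θ) * q)) v) =
      weyl A (geomCoeff (q : ℂ)) (rotIso M θ v) := by
  set b' := geomCoeff (Complex.exp (Complex.I * θ) * q) with hb'
  have hb : Summable fun m => ‖geomCoeff (q : ℂ) m‖ := summable_norm_geomCoeff (by simpa using hq)
  have hs := summable_vertex hq θ
  have hκ : ∀ m, b' m = Complex.exp (2 * (Complex.I * (θ / 2)) * (m + 1)) * geomCoeff (q : ℂ) m :=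
    fun m => by rw [← geomCoeff_exp_mul, hb']; congr 3; ring
  refine fock_induction (p := fun v => rotIso M θ (weyl A b' v) =
    weyl A (geomCoeff (q : ℂ)) (rotIso M θ v)) (isClosed_eq (by fun_prop) (by fun_prop))
    (fun v => ?_) v
  refine fock_ext_fin fun u => ?_
  have h1 : ⟪(u : Fock M), rotIso M θ (weyl A b' v)⟫_ℂ =
      ⟪((rot M (-(Complex.I * (θ / 2))) u : FinVec M) : Fock M), weyl A b' v⟫_ℂ := by
    rw [← (rotIso M θ).inner_map_map (((rot M (-(Complex.I * (θ / 2))) u : FinVec M) : Fock M))]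
    congr 1
    have h2 := rotIso_coe (-θ) u
    rw [show Complex.I * (((-θ : ℝ) : ℂ) / 2) = -(Complex.I * (θ / 2)) by push_cast; ring] at h2
    rw [← h2, ← rotIso_symm, LinearIsometryEquiv.apply_symm_apply]
  rw [h1, inner_weyl_coe A hs, rotIso_coe, inner_weyl_coe A hb, weylForm, weylForm,
    pair_mul_self (norm_exp_two_I θ) hκ]
  have e1 := LinearMap.congr_fun (expAnnih_mul_rot A _ hκ) u
  have e2 := expAnnih_mul_rot A _ (b' := -b') (b := -geomCoeff (q : ℂ))
    fun m => by rw [Pi.neg_apply, Pi.neg_apply, hκ, mul_neg]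
  have e3 : rot M (Complex.I * (θ / 2)) * rot M (-(Complex.I * (θ / 2))) = 1 :=
    FinVec.linearMap_ext fun S => by
      rw [Module.End.mul_apply, rot_fs, map_smul, rot_fs, smul_smul, ← Complex.exp_add, neg_mul,
        neg_add_cancel, Complex.exp_zero, one_smul, Module.End.one_apply]
  have e4 : rot M (-(Complex.I * (θ / 2))) * rot M (Complex.I * (θ / 2)) = 1 :=
    FinVec.linearMap_ext fun S => by
      rw [Module.End.mul_apply, rot_fs, map_smul, rot_fs, smul_smul, ← Complex.exp_add, neg_mul,
        add_neg_cancel, Complex.exp_zero, one_smul, Module.End.one_apply]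
  have e5 : expAnnih A (-geomCoeff (q : ℂ)) (rot M (Complex.I * (θ / 2)) v) =
      rot M (Complex.I * (θ / 2)) (expAnnih A (-b') v) := by
    have e6 : expAnnih A (-geomCoeff (q : ℂ)) * rot M (Complex.I * (θ / 2)) =
        rot M (Complex.I * (θ / 2)) * expAnnih A (-b') := by
      calc _ = rot M (Complex.I * (θ / 2)) * (rot M (-(Complex.I * (θ / 2))) *
            expAnnih A (-geomCoeff (q : ℂ))) * rot M (Complex.I * (θ / 2)) := by
            rw [← mul_assoc, e3, one_mul]
        _ = _ := by rw [← e2, mul_assoc, mul_assoc, e4, mul_one]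
    exact LinearMap.congr_fun e6 v
  rw [e5]
  rw [Module.End.mul_apply, Module.End.mul_apply] at e1
  rw [e1]
  congr 1
  rw [← FinVec.inner_coe, ← FinVec.inner_coe, ← rotIso_coe]
  have h2 := rotIso_coe (-θ) (expAnnih A (geomCoeff (q : ℂ)) u)
  rw [show Complex.I * (((-θ : ℝ) : ℂ) / 2) = -(Complex.I * (θ / 2)) by push_cast; ring] at h2
  rw [← h2, ← (rotIso M θ).inner_map_map, ← rotIso_symm, LinearIsometryEquiv.apply_symm_apply]

/-- Conjugating the lowering operator with rotations produces the phases of the charge. -/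
theorem rotIso_chargePhase (A : Flavor M) (θ : ℝ) (v : Fock M) :
    rotIso M θ (chargePhase A θ ((upIso A).symm (chargePhase A θ v))) =
      (upIso A).symm (rotIso M θ v) := by
  refine fock_induction (p := fun v => rotIso M θ (chargePhase A θ ((upIso A).symm
    (chargePhase A θ v))) = (upIso A).symm (rotIso M θ v))
    (isClosed_eq (by fun_prop) (by fun_prop)) (fun v => ?_) v
  set z := diagFin (fun S => Complex.exp (Complex.I * (θ / 2) * (charge A S : ℂ))) with hz
  set r := rot M (Complex.I * (θ / 2)) with hr
  -- Multiplied by `up A` on the right, everything acts on eigenvectors. With charge N, the two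
  -- phases of z contribute θ/2 (N + 1) and θ/2 N, and their sum θ/2 (2N + 1) is the energy gained
  -- by `up A`.
  have h : r * z * down A * z * up A = down A * r * up A := by
    refine FinVec.linearMap_ext fun S => ?_
    have hd : ∀ v, down A (up A v) = v := fun v => LinearMap.congr_fun (down_mul_up A) v
    simp only [Module.End.mul_apply]
    rw [hz, diagFin_charge_up A (fun c => Complex.exp (Complex.I * (θ / 2) * c)), map_smul, hd,
      map_smul, diagFin_fs, hr, rot,
      diagFin_energy_up A (fun c => Complex.exp (Complex.I * (θ / 2) * c)),
      map_smul, map_smul, map_smul, hd, diagFin_fs, smul_smul, smul_smul, ← Complex.exp_add,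
      ← Complex.exp_add]
    congr 2
    ring
  have h2 := LinearMap.congr_fun h (down A v)
  simp only [Module.End.mul_apply] at h2
  rw [show up A (down A v) = v from LinearMap.congr_fun (up_mul_down A) v] at h2
  rw [chargePhase_coe, ← coe_down, chargePhase_coe, rotIso_coe, rotIso_coe, ← coe_down]
  exact congrArg FinVec.toFock h2

theorem rotIso_vertexOp (A : Flavor M) {q : ℝ} (hq : |q| < 1) (θ : ℝ) (v : Fock M) :
    rotIso M θ (vertexOp A q θ v) =
      (upIso A).symm (weyl A (geomCoeff (q : ℂ)) (rotIso M θ v)) := by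
  rw [vertexOp_apply, rotIso_chargePhase, rotIso_weyl A hq]

/-- All dependence on θ sits in two rotations. This gives strong continuity in θ without studying
how Weyl operators depend on their parameter, and it makes matrix elements between basis states pure
exponentials in θ. -/
theorem vertexOp_eq (A : Flavor M) {q : ℝ} (hq : |q| < 1) (θ : ℝ) (v : Fock M) :
    vertexOp A q θ v =
      rotIso M (-θ) ((upIso A).symm (weyl A (geomCoeff (q : ℂ)) (rotIso M θ v))) := by
  rw [← rotIso_vertexOp A hq, ← rotIso_symm, LinearIsometryEquiv.symm_apply_apply]

theorem continuous_isometry_comp {E : Type*} [NormedAddCommGroup E] [InnerProductSpace ℂ E]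
    {U : ℝ → E ≃ₗᵢ[ℂ] E} (hU : ∀ v, Continuous fun t => U t v) {f : ℝ → E} (hf : Continuous f) :
    Continuous fun t => U t (f t) := by
  rw [continuous_iff_continuousAt]
  intro t₀
  have h1 : Filter.Tendsto (fun t => U t (f t - f t₀)) (nhds t₀) (nhds 0) := by
    rw [tendsto_zero_iff_norm_tendsto_zero]
    simp only [LinearIsometryEquiv.norm_map]
    have := (hf.tendsto t₀).sub_const (f t₀)
    rw [sub_self] at this
    simpa using this.norm
  have h2 := h1.add ((hU (f t₀)).tendsto t₀)
  rw [zero_add] at h2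
  refine h2.congr fun t => ?_
  rw [map_sub, sub_add_cancel]

theorem continuous_vertexOp (A : Flavor M) {q : ℝ} (hq : |q| < 1) (v : Fock M) :
    Continuous fun θ => vertexOp A q θ v := by
  simp only [vertexOp_eq A hq]
  refine continuous_isometry_comp (U := fun θ => rotIso M (-θ))
    (fun v => (continuous_rotIso v).comp continuous_neg) ?_
  exact (LinearIsometryEquiv.continuous _).comp
    ((LinearIsometryEquiv.continuous _).comp (continuous_rotIso v))

theorem continuous_vertexOp_symm (A : Flavor M) {q : ℝ} (hq : |q| < 1) (v : Fock M) :
    Continuous fun θ => (vertexOp A q θ).symm v := by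
  have h : ∀ θ, (vertexOp A q θ).symm v = rotIso M (-θ) ((weyl A (geomCoeff (q : ℂ))).symm
      (upIso A (rotIso M θ v))) := by
    intro θ
    rw [LinearIsometryEquiv.symm_apply_eq, vertexOp_eq A hq, ← rotIso_symm]
    simp
  simp only [h]
  refine continuous_isometry_comp (U := fun θ => rotIso M (-θ))
    (fun v => (continuous_rotIso v).comp continuous_neg) ?_
  exact (LinearIsometryEquiv.continuous _).comp
    ((LinearIsometryEquiv.continuous _).comp (continuous_rotIso v))

end Vertex

/-! ### The regularized field as a vertex operator -/

section RegularizedField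

variable {M : ℕ}

theorem ActsAs.dense_domain {T : Fock M →ₗ.[ℂ] Fock M} {X : FinVec M →ₗ[ℂ] Fock M}
    (h : ActsAs T X) : Dense (T.domain : Set (Fock M)) := by
  rw [h.1]
  exact dense_finiteStates

theorem zeroModePhase_eq {L a : ℝ} (ha : 0 < a) (hL : L = M * a) (hM : 0 < M) (r s α : ℤˣ) (y : ℝ)
    (x : Cell M) : zeroModePhase L a r s α y x =
      ((chargePhase ⟨r, s, α, x⟩ ((((r : ℤˣ) : ℤ) : ℝ) * (2 * Real.pi * y / L))
        ).toContinuousLinearEquiv : Fock M →L[ℂ] Fock M) := by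
  have hT := (actsAs_zeroMode ha hL hM r s α x).smul
    (Complex.I * (((((r : ℤˣ) : ℤ) : ℝ) * Real.pi * y / L : ℝ) : ℂ))
  have hU := generatesUnitaryGroup_diagPhase
    (f := fun S => (((r : ℤˣ) : ℤ) : ℝ) * Real.pi * y / L * charge ⟨r, s, α, x⟩ S) hT fun S => by
    rw [LinearMap.smul_apply, LinearMap.comp_apply, rho_zero_fs, map_smul, smul_smul]
    change _ • state S = _
    congr 1
    push_cast
    ring
  rw [zeroModePhase, expOp_eq hT.dense_domain hU, chargePhase]
  congr 3
  funext S
  simp only [Pi.smul_apply, smul_eq_mul]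
  ring

theorem expOp_vertexExponent {L a : ℝ} (ha : 0 < a) (hL : L = M * a) (hM : 0 < M) (r s α : ℤˣ)
    (y : ℝ) (x : Cell M) {ε : ℝ} (hε : 0 < ε) : expOp (vertexExponent L a r s α y x ε) =
      ((weyl ⟨r, s, α, x⟩ (geomCoeff (vertexParam L r y ε))).toContinuousLinearEquiv :
        Fock M →L[ℂ] Fock M) := by
  have hL0 : 0 < L := by
    have : (0 : ℝ) < M := by exact_mod_cast hM
    rw [hL]
    positivity
  obtain ⟨X, hT, hX⟩ := exists_actsAs_vertexExponent ha hL hM r s α y x hε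
  have hU := generatesUnitaryGroup_weyl ⟨r, s, α, x⟩
    (summable_norm_geomCoeff (norm_vertexParam_lt_one hL0 r y hε)) hT hX
  rw [expOp_eq hT.dense_domain hU]
  simp only [Complex.ofReal_one, one_smul]

theorem klein_zpow (A : Flavor M) : klein A ^ (-((A.r : ℤˣ) : ℤ)) = (upIso A).symm := by
  unfold upIso
  split_ifs with h
  · rw [h, Units.val_one, zpow_neg_one]
    rfl
  · rw [units_ne h, Units.val_neg, Units.val_one, neg_neg, zpow_one]
    rfl

theorem psiReg_eq {L a : ℝ} (ha : 0 < a) (hL : L = M * a) (hM : 0 < M) (r s α : ℤˣ)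
    (y : ℝ) (x : Cell M) {ε : ℝ} (hε : 0 < ε) : psiReg L a r s α y x ε =
      ((1 / √(2 * Real.pi * a * ε) : ℝ) : ℂ) •
        ((vertexOp ⟨r, s, α, x⟩ (Real.exp (-(Real.pi * ε / L)))
          ((((r : ℤˣ) : ℤ) : ℝ) * (2 * Real.pi * y / L))).toContinuousLinearEquiv :
          Fock M →L[ℂ] Fock M) := by
  rw [psiReg, zeroModePhase_eq ha hL hM, expOp_vertexExponent ha hL hM r s α y x hε,
    klein_zpow ⟨r, s, α, x⟩]
  rfl

theorem toContinuousLinearEquiv_mem_unitary (U : Fock M ≃ₗᵢ[ℂ] Fock M) :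
    (U.toContinuousLinearEquiv : Fock M →L[ℂ] Fock M) ∈ unitary (Fock M →L[ℂ] Fock M) := by
  have h : star (U.toContinuousLinearEquiv : Fock M →L[ℂ] Fock M) =
      (U.symm.toContinuousLinearEquiv : Fock M →L[ℂ] Fock M) := by
    rw [ContinuousLinearMap.star_eq_adjoint]
    refine ContinuousLinearMap.ext fun v => ext_inner_left ℂ fun w => ?_
    rw [ContinuousLinearMap.adjoint_inner_right]
    change ⟪U w, v⟫_ℂ = ⟪w, U.symm v⟫_ℂ
    rw [← U.inner_map_map w, U.apply_symm_apply]
  rw [Unitary.mem_iff, h]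
  constructor
  · exact ContinuousLinearMap.ext fun v => U.symm_apply_apply v
  · exact ContinuousLinearMap.ext fun v => U.apply_symm_apply v

theorem smul_psiReg_mem_unitary {L a : ℝ} (ha : 0 < a) (hL : L = M * a) (hM : 0 < M) (r s α : ℤˣ)
    (y : ℝ) (x : Cell M) {ε : ℝ} (hε : 0 < ε) :
    ((√(2 * Real.pi * a * ε) : ℝ) : ℂ) • psiReg L a r s α y x ε ∈
      unitary (Fock M →L[ℂ] Fock M) := by
  have h : √(2 * Real.pi * a * ε) ≠ 0 := (Real.sqrt_pos.2 (by positivity)).ne'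
  rw [psiReg_eq ha hL hM r s α y x hε, smul_smul, ← Complex.ofReal_mul, mul_one_div_cancel h,
    Complex.ofReal_one, one_smul]
  exact toContinuousLinearEquiv_mem_unitary _

theorem exp_regulator_mem {L ε : ℝ} (hL : 0 < L) (hε : 0 < ε) :
    |Real.exp (-(Real.pi * ε / L))| < 1 := by
  rw [Real.abs_exp, Real.exp_lt_one_iff]
  have : 0 < Real.pi * ε / L := by positivity
  linarith

theorem fourierIntegrand_eq {L a : ℝ} (ha : 0 < a) (hL : L = M * a) (hM : 0 < M) (r s α : ℤˣ)
    (k : FermiMom M) {ε : ℝ} (hε : 0 < ε) (x : Cell M) (v : Fock M) (y : ℝ) :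
    fourierIntegrand L a r s α k ε x v y =
      Complex.exp (-Complex.I * ((fermiK L k.1 * y + fermiK L k.2 * sitePos a x : ℝ) : ℂ)) •
        ((1 / √(2 * Real.pi * a * ε) : ℝ) : ℂ) •
          vertexOp ⟨r, s, α, x⟩ (Real.exp (-(Real.pi * ε / L)))
            ((((r : ℤˣ) : ℤ) : ℝ) * (2 * Real.pi * y / L)) v := by
  rw [fourierIntegrand, psiReg_eq ha hL hM r s α y x hε]
  rfl

theorem continuous_fourierIntegrand {L a : ℝ} (ha : 0 < a) (hL : L = M * a) (hM : 0 < M)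
    (r s α : ℤˣ) (k : FermiMom M) {ε : ℝ} (hε : 0 < ε) (x : Cell M) (v : Fock M) :
    Continuous (fourierIntegrand L a r s α k ε x v) := by
  have hL0 : 0 < L := by
    have : (0 : ℝ) < M := by exact_mod_cast hM
    rw [hL]
    positivity
  rw [funext (fourierIntegrand_eq ha hL hM r s α k hε x v)]
  have h1 := (continuous_vertexOp ⟨r, s, α, x⟩ (exp_regulator_mem hL0 hε) v).comp
    (f := fun y : ℝ => (((r : ℤˣ) : ℤ) : ℝ) * (2 * Real.pi * y / L)) (by fun_prop)
  have h2 : Continuous fun y : ℝ =>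
      Complex.exp (-Complex.I * ((fermiK L k.1 * y + fermiK L k.2 * sitePos a x : ℝ) : ℂ)) := by
    fun_prop
  exact h2.smul (h1.const_smul ((1 / √(2 * Real.pi * a * ε) : ℝ) : ℂ))

/-- The Fourier mode `∫_{-π}^{π} e^{-i (n + 1/2) θ} g(θ) dθ`. -/
noncomputable def halfMode {E : Type*} [NormedAddCommGroup E] [NormedSpace ℂ E] (g : ℝ → E)
    (n : ℤ) : E :=
  ∫ θ in (-Real.pi)..Real.pi, Complex.exp (-Complex.I * (((n : ℝ) + 1 / 2) * θ : ℝ)) • g θ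

/-- Substitution θ = 2π r y/L. For r = - the momentum changes sign with θ, which is the reflection
in `modeIdx`. -/
theorem integral_fourierIntegrand {L a : ℝ} (ha : 0 < a) (hL : L = M * a) (hM : 0 < M)
    (r s α : ℤˣ) (k : FermiMom M) {ε : ℝ} (hε : 0 < ε) (x : Cell M) (v : Fock M) :
    ∫ y in (-L / 2)..(L / 2), fourierIntegrand L a r s α k ε x v y =
      ((1 / √(2 * Real.pi * a * ε) * (L / (2 * Real.pi)) : ℝ) : ℂ) • sitePhase L a k.2 x •
        halfMode (fun θ => vertexOp ⟨r, s, α, x⟩ (Real.exp (-(Real.pi * ε / L))) θ v)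
          (modeIdx ⟨r, s, α, x⟩ k.1) := by
  have hL0 : 0 < L := by
    have : (0 : ℝ) < M := by exact_mod_cast hM
    rw [hL]
    positivity
  have hpi := Real.pi_pos
  set q := Real.exp (-(Real.pi * ε / L))
  set A : Flavor M := ⟨r, s, α, x⟩ with hA
  set G : ℝ → Fock M := fun θ =>
    Complex.exp (-Complex.I * (((modeIdx A k.1 : ℝ) + 1 / 2) * θ : ℝ)) • vertexOp A q θ v with hG
  set c := (((r : ℤˣ) : ℤ) : ℝ) * (2 * Real.pi / L) with hc
  have hr : (((r : ℤˣ) : ℤ) : ℝ) = 1 ∨ (((r : ℤˣ) : ℤ) : ℝ) = -1 := by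
    rcases Int.units_eq_one_or r with rfl | rfl <;> simp
  have hk : ((modeIdx A k.1 : ℝ) + 1 / 2) = (((r : ℤˣ) : ℤ) : ℝ) * ((k.1 : ℝ) + 1 / 2) := by
    unfold modeIdx
    rcases Int.units_eq_one_or r with rfl | rfl
    · simp [hA]
    · rw [if_neg (show ¬((-1 : ℤˣ) = 1) by decide)]
      push_cast
      ring
  have hr2 : (((r : ℤˣ) : ℤ) : ℝ) * (((r : ℤˣ) : ℤ) : ℝ) = 1 := by
    rcases hr with h | h <;> rw [h] <;> norm_num
  have h1 : ∀ y, fourierIntegrand L a r s α k ε x v y =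
      ((1 / √(2 * Real.pi * a * ε) : ℝ) : ℂ) • sitePhase L a k.2 x • G (c * y) := by
    intro y
    rw [fourierIntegrand_eq ha hL hM r s α k hε, hG, sitePhase]
    simp only [smul_smul]
    have e : (((r : ℤˣ) : ℤ) : ℝ) * (2 * Real.pi * y / L) = c * y := by
      rw [hc]
      ring
    rw [e]
    congr 1
    have e2 : (modeIdx A k.1 + 1 / 2 : ℝ) * (c * y) = fermiK L k.1 * y := by
      rw [hk, hc, fermiK]
      linear_combination (2 * Real.pi / L * ((k.1 : ℝ) + 1 / 2) * y) * hr2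
    rw [e2, Complex.ofReal_add, mul_add, Complex.exp_add]
    ring
  simp only [h1]
  rw [intervalIntegral.integral_smul, intervalIntegral.integral_smul]
  have hc0 : c ≠ 0 := by
    rw [hc]
    rcases hr with h | h <;> rw [h] <;> positivity
  have h2 : ∫ y in (-L / 2)..(L / 2), G (c * y) = ((L / (2 * Real.pi) : ℝ) : ℂ) •
      ∫ θ in (-Real.pi)..Real.pi, G θ := by
    rw [intervalIntegral.integral_comp_mul_left _ hc0, Complex.coe_smul]
    rcases hr with h | h
    · rw [hc, h]
      congr 2 <;> field_simp
    -- For r = - the interval is traversed backwards; this sign cancels that of the Jacobian.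
    · rw [hc, h, intervalIntegral.integral_symm, smul_neg, ← neg_smul]
      congr 2 <;> field_simp
  rw [h2, halfMode, smul_comm (sitePhase L a k.2 x), smul_smul, ← Complex.ofReal_mul, hG]
  rfl

end RegularizedField

/-! ### Bosonization of the fermion operators -/

section Bosonization

variable {M : ℕ} {A : Flavor M}

theorem IsLowest.dn_eq_zero {N : ℤ} {v : FinVec M} (h : IsLowest A N v) :
    ∀ n, N ≤ n → dn A n v = 0 := by
  induction h with
  | fs hS => exact (isVac_fs hS).1
  | @up N v _ ih =>
    intro n hn
    have e := LinearMap.congr_fun (up_mul_dn A (n - 1)) v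
    rw [Module.End.mul_apply, Module.End.mul_apply, ih _ (by omega), map_zero, sub_add_cancel] at e
    exact e.symm
  | @down N v _ ih =>
    intro n hn
    have e := LinearMap.congr_fun (down_mul_dn A (n + 1)) v
    rw [Module.End.mul_apply, Module.End.mul_apply, ih _ (by omega), map_zero, add_sub_cancel_right]
      at e
    exact e.symm

theorem IsLowest.dd_eq_zero {N : ℤ} {v : FinVec M} (h : IsLowest A N v) :
    ∀ n, n < N → dd A n v = 0 := by
  induction h with
  | fs hS => exact (isVac_fs hS).2
  | @up N v _ ih =>
    intro n hn
    have e := LinearMap.congr_fun (up_mul_dd A (n - 1)) v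
    rw [Module.End.mul_apply, Module.End.mul_apply, ih _ (by omega), map_zero, sub_add_cancel] at e
    exact e.symm
  | @down N v _ ih =>
    intro n hn
    have e := LinearMap.congr_fun (down_mul_dd A (n + 1)) v
    rw [Module.End.mul_apply, Module.End.mul_apply, ih _ (by omega), map_zero, add_sub_cancel_right]
      at e
    exact e.symm

theorem IsLowest.up_eq {N : ℤ} {v : FinVec M} (h : IsLowest A N v) :
    NodalBoson.up A v = dd A N v := by
  induction h with
  | fs hS => exact up_fs hS
  | @up N v _ ih =>
    have e := LinearMap.congr_fun (up_mul_dd A N) v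
    rw [Module.End.mul_apply, Module.End.mul_apply, ← ih] at e
    exact e
  | @down N v _ ih =>
    have e := LinearMap.congr_fun (down_mul_dd A N) v
    rw [Module.End.mul_apply, Module.End.mul_apply, ← ih] at e
    rw [← e]
    exact (LinearMap.congr_fun (up_mul_down A) v).trans (LinearMap.congr_fun (down_mul_up A) v).symm

theorem IsLowest.rho_eq_zero {N : ℤ} {v : FinVec M} (h : IsLowest A N v) {m : ℤ} (hm : 0 < m) :
    rho A m v = 0 := by
  induction h with
  | fs hS => exact rho_vac A (isVac_fs hS) hm.le
  | @up N v _ ih =>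
    have e := LinearMap.congr_fun (up_mul_rho A hm.ne') v
    rw [Module.End.mul_apply, Module.End.mul_apply, ih, map_zero] at e
    exact e.symm
  | @down N v _ ih =>
    have e := LinearMap.congr_fun (down_mul_rho A hm.ne') v
    rw [Module.End.mul_apply, Module.End.mul_apply, ih, map_zero] at e
    exact e.symm

theorem IsLowest.rho_zero {N : ℤ} {v : FinVec M} (h : IsLowest A N v) :
    rho A 0 v = (N : ℂ) • v := by
  induction h with
  | fs hS => rw [rho_vac A (isVac_fs hS) le_rfl, Int.cast_zero, zero_smul]
  | @up N v _ ih =>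
    have e := LinearMap.congr_fun (up_mul_rho_zero A) v
    rw [Module.End.mul_apply, LinearMap.sub_apply, Module.End.mul_apply, ih, map_smul,
      eq_sub_iff_add_eq] at e
    rw [← e]
    push_cast
    module
  | @down N v _ ih =>
    have e := LinearMap.congr_fun (up_mul_rho_zero A) (NodalBoson.down A v)
    have e2 : NodalBoson.up A (NodalBoson.down A v) = v := LinearMap.congr_fun (up_mul_down A) v
    rw [Module.End.mul_apply, LinearMap.sub_apply, Module.End.mul_apply, e2, ih] at e
    have e3 := congrArg (NodalBoson.down A) e
    rw [show ∀ w, NodalBoson.down A (NodalBoson.up A w) = w from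
      fun w => LinearMap.congr_fun (down_mul_up A) w] at e3
    rw [e3, map_sub, map_smul]
    push_cast
    module

theorem inner_eq_zero_of_charge_ne {m n : ℤ} (hmn : m ≠ n) {u v : FinVec M}
    (hu : rho A 0 u = (m : ℂ) • u) (hv : rho A 0 v = (n : ℂ) • v) : ⟪u, v⟫_ℂ = 0 := by
  have h := isAdj_rho A 0 u v
  rw [neg_zero, hu, hv, inner_smul_left, inner_smul_right, map_intCast] at h
  by_contra h0
  exact hmn (by exact_mod_cast mul_right_cancel₀ h0 h)

variable (A)

/-- The matrix elements of `∑ n, dn A n`. -/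
noncomputable def fermionForm (u v : FinVec M) : ℂ := ∑' n : ℤ, ⟪u, dn A n v⟫_ℂ

theorem summable_fermionForm (u v : FinVec M) : Summable fun n : ℤ => ⟪u, dn A n v⟫_ℂ := by
  obtain ⟨k, hk⟩ := exists_mem_energyLE u
  obtain ⟨l, hl⟩ := exists_mem_energyLE v
  refine summable_of_ne_finset_zero (s := Finset.Icc (-(k : ℤ) - 1) l) fun n hn => ?_
  rw [Finset.mem_Icc, not_and_or, not_le, not_le] at hn
  rcases hn with hn | hn
  · rw [← (isAdj_dn A n).symm u v, eq_zero_of_mem_energyLE (by omega) (dd_mem_energyLE A n hk),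
      inner_zero_left]
  · rw [eq_zero_of_mem_energyLE (by omega) (dn_mem_energyLE A n hl), inner_zero_right]

/-- The commutator of ρ(m) with a fermion operator shifts its label, and the sum over all labels
absorbs the shift: the field at θ = 0 is an eigenvector of commutation with every density. -/
theorem fermionForm_rho (m : ℤ) (u v : FinVec M) :
    fermionForm A (rho A (-m) u) v = fermionForm A u (rho A m v) - fermionForm A u v := by
  have h1 : ∀ n, ⟪rho A (-m) u, dn A n v⟫_ℂ =
      ⟪u, dn A n (rho A m v)⟫_ℂ - ⟪u, dn A (n + m) v⟫_ℂ := by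
    intro n
    have e := isAdj_rho A (-m) u (dn A n v)
    rw [neg_neg] at e
    have e2 := LinearMap.congr_fun (rho_mul_dn_self A m n) v
    rw [Module.End.mul_apply, LinearMap.sub_apply, Module.End.mul_apply] at e2
    rw [e, e2, inner_sub_right]
  have h2 : Summable fun n : ℤ => ⟪u, dn A (n + m) v⟫_ℂ :=
    ((Equiv.addRight m).summable_iff (f := fun n : ℤ => ⟪u, dn A n v⟫_ℂ)).2
      (summable_fermionForm A u v)
  have h3 : ∑' n : ℤ, ⟪u, dn A (n + m) v⟫_ℂ = fermionForm A u v :=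
    (Equiv.addRight m).tsum_eq fun n : ℤ => ⟪u, dn A n v⟫_ℂ
  have h4 := ((summable_fermionForm A u (rho A m v)).hasSum.sub h2.hasSum).tsum_eq
  rw [h3] at h4
  exact (tsum_congr h1).trans h4

/-- The matrix elements, up to normalization, of the vertex operator at the boundary of the unit
disc. -/
noncomputable def bosonForm (u v : FinVec M) : ℂ :=
  ⟪expAnnih A (geomCoeff 1) (up A u), expAnnih A (-geomCoeff 1) v⟫_ℂ

theorem geomCoeff_one (m : ℕ) : geomCoeff 1 m = -1 := by simp [geomCoeff]

/-- The same relation as for the fermion form. For each sign of m the density commutes with one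
exponential and picks up the scalar ∓1 from the other. -/
theorem bosonForm_rho {m : ℤ} (hm : m ≠ 0) (u v : FinVec M) :
    bosonForm A (rho A (-m) u) v = bosonForm A u (rho A m v) - bosonForm A u v := by
  have hup : ∀ w, up A (rho A (-m) w) = rho A (-m) (up A w) :=
    fun w => LinearMap.congr_fun (up_mul_rho A (neg_ne_zero.2 hm)) w
  have hadj : ∀ x y, ⟪rho A (-m) x, y⟫_ℂ = ⟪x, rho A m y⟫_ℂ := fun x y => by
    have e := isAdj_rho A (-m) x y
    rwa [neg_neg] at e
  unfold bosonForm
  rw [hup]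
  rcases lt_or_gt_of_ne hm with h | h
  · obtain ⟨n, hn⟩ : ∃ n : ℕ, m = -((n : ℤ) + 1) := ⟨(-m - 1).toNat, by omega⟩
    have e1 := LinearMap.congr_fun (expAnnih_mul_rho_pos A (geomCoeff 1) n).eq (up A u)
    have e2 := LinearMap.congr_fun (expAnnih_mul_rho_neg A (-geomCoeff 1) n) v
    rw [Module.End.mul_apply, LinearMap.add_apply, LinearMap.smul_apply, Module.End.mul_apply,
      Pi.neg_apply, geomCoeff_one, neg_neg, one_smul, ← hn] at e2
    rw [Module.End.mul_apply, Module.End.mul_apply, show (n : ℤ) + 1 = -m by omega] at e1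
    rw [e1, hadj, e2, inner_add_right, add_sub_cancel_right]
  · obtain ⟨n, hn⟩ : ∃ n : ℕ, m = (n : ℤ) + 1 := ⟨(m - 1).toNat, by omega⟩
    have e1 := LinearMap.congr_fun (expAnnih_mul_rho_pos A (-geomCoeff 1) n).eq v
    have e2 := LinearMap.congr_fun (expAnnih_mul_rho_neg A (geomCoeff 1) n) (up A u)
    rw [Module.End.mul_apply, LinearMap.add_apply, LinearMap.smul_apply, Module.End.mul_apply,
      geomCoeff_one, ← hn] at e2
    rw [Module.End.mul_apply, Module.End.mul_apply, ← hn] at e1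
    rw [e2, e1, inner_add_left, inner_smul_left, hadj, map_neg, map_one, neg_one_mul,
      ← sub_eq_add_neg]

theorem expAnnih_lowest {N : ℤ} {v : FinVec M} (h : IsLowest A N v) (b : ℕ → ℂ) :
    expAnnih A b v = v := by
  refine lnExp_apply_of_apply_eq_zero (locNil_annih A b) ?_
  obtain ⟨k, hk⟩ := exists_mem_energyLE v
  rw [annih_apply A b (n := k) hk (by omega)]
  exact Finset.sum_eq_zero fun m _ => by rw [h.rho_eq_zero (by omega), smul_zero]

/-- On lowest states the exponentials are trivial. Between charges N' and N only N' = N - 1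
contributes, and there only the label n = N' survives: it is too small to be annihilated on v and
too large on u. -/
theorem bosonForm_lowest {N N' : ℤ} {u v : FinVec M} (hu : IsLowest A N' u) (hv : IsLowest A N v) :
    bosonForm A u v = fermionForm A u v := by
  have h1 : ∀ n, rho A 0 (dn A n v) = ((N - 1 : ℤ) : ℂ) • dn A n v := by
    intro n
    have e := LinearMap.congr_fun (rho_mul_dn_self A 0 n) v
    rw [Module.End.mul_apply, LinearMap.sub_apply, Module.End.mul_apply, hv.rho_zero, map_smul,
      add_zero] at e
    rw [e]
    push_cast
    module
  rw [bosonForm, expAnnih_lowest A hu.up, expAnnih_lowest A hv, fermionForm]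
  by_cases h : N' = N - 1
  · rw [tsum_eq_single N' fun n hn => ?_, hu.up_eq]
    · exact ((isAdj_dn A N').symm u v)
    · rcases lt_or_gt_of_ne hn with h2 | h2
      · rw [← (isAdj_dn A n).symm u v, hu.dd_eq_zero n h2, inner_zero_left]
      · rw [hv.dn_eq_zero n (by omega), inner_zero_right]
  · rw [inner_eq_zero_of_charge_ne (A := A) (by omega : N' + 1 ≠ N) hu.up.rho_zero hv.rho_zero]
    refine (Eq.trans (tsum_congr fun n => ?_) tsum_zero).symm
    exact inner_eq_zero_of_charge_ne h hu.rho_zero (h1 n)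

/-- Equality is extended from lowest states by completeness: first in u, using that densities moved
onto a lowest v annihilate it, then in v, using equality for all u. -/
theorem bosonForm_eq_fermionForm (u v : FinVec M) : bosonForm A u v = fermionForm A u v := by
  let W₁ : FinVec M → Submodule ℂ (FinVec M) := fun v₀ =>
    { carrier := {u | bosonForm A u v₀ = fermionForm A u v₀}
      add_mem' := fun {u u'} hu hu' => by
        change bosonForm A (u + u') v₀ = fermionForm A (u + u') v₀
        have e : fermionForm A (u + u') v₀ = fermionForm A u v₀ + fermionForm A u' v₀ := by
          simp only [fermionForm, inner_add_left]
          exact (summable_fermionForm A u v₀).tsum_add (summable_fermionForm A u' v₀)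
        rw [e, ← show bosonForm A u v₀ = fermionForm A u v₀ from hu,
          ← show bosonForm A u' v₀ = fermionForm A u' v₀ from hu']
        simp only [bosonForm, map_add, inner_add_left]
      zero_mem' := by
        change bosonForm A 0 v₀ = fermionForm A 0 v₀
        simp [bosonForm, fermionForm]
      smul_mem' := fun c u hu => by
        change bosonForm A (c • u) v₀ = fermionForm A (c • u) v₀
        have e : fermionForm A (c • u) v₀ = starRingEnd ℂ c * fermionForm A u v₀ := by
          simp only [fermionForm, inner_smul_left]
          exact tsum_mul_left
        rw [e, ← show bosonForm A u v₀ = fermionForm A u v₀ from hu]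
        simp only [bosonForm, map_smul, inner_smul_left] }
  let W₂ : Submodule ℂ (FinVec M) :=
    { carrier := {v | ∀ u, bosonForm A u v = fermionForm A u v}
      add_mem' := fun {v v'} hv hv' u => by
        have e : fermionForm A u (v + v') = fermionForm A u v + fermionForm A u v' := by
          simp only [fermionForm, map_add, inner_add_right]
          exact (summable_fermionForm A u v).tsum_add (summable_fermionForm A u v')
        rw [e, ← hv u, ← hv' u]
        simp only [bosonForm, map_add, inner_add_right]
      zero_mem' := fun u => by simp [bosonForm, fermionForm]
      smul_mem' := fun c v hv u => by
        have e : fermionForm A u (c • v) = c * fermionForm A u v := by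
          simp only [fermionForm, map_smul, inner_smul_right]
          exact tsum_mul_left
        rw [e, ← hv u]
        simp only [bosonForm, map_smul, inner_smul_right] }
  have key : ∀ {m : ℤ} (_ : m ≠ 0) (u v : FinVec M),
      (bosonForm A (rho A (-m) u) v = fermionForm A (rho A (-m) u) v) ↔
        bosonForm A u (rho A m v) - bosonForm A u v =
          fermionForm A u (rho A m v) - fermionForm A u v := fun hm u v => by
    rw [bosonForm_rho A hm, fermionForm_rho A]
  have h1 : ∀ {N : ℤ} {v₀ : FinVec M} (_ : IsLowest A N v₀) (u : FinVec M),
      bosonForm A u v₀ = fermionForm A u v₀ := by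
    intro N v₀ hv u
    have hle : bosonSpan A ≤ W₁ v₀ := by
      refine bosonSpan_le (fun N' u hu => bosonForm_lowest A hu hv) fun m hm u hu => ?_
      change bosonForm A (rho A m u) v₀ = fermionForm A (rho A m u) v₀
      have hz : rho A (-m) v₀ = 0 := hv.rho_eq_zero (by omega)
      have h := (key (m := -m) (by omega) u v₀).2
      rw [neg_neg] at h
      refine h ?_
      rw [show bosonForm A u v₀ = fermionForm A u v₀ from hu, hz]
      simp [bosonForm, fermionForm]
    exact hle ((bosonSpan_eq_top A).symm ▸ Submodule.mem_top)
  have hle : bosonSpan A ≤ W₂ := by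
    refine bosonSpan_le (fun N v hv => h1 hv) fun m hm v hv u => ?_
    have h := (key hm.ne u v).1 (hv _)
    rw [hv u] at h
    exact sub_left_injective h
  exact (hle ((bosonSpan_eq_top A).symm ▸ Submodule.mem_top) : v ∈ W₂) u

end Bosonization

/-! ### Fourier modes of pairs of functions with an exchange relation -/

section FourierModes

variable {E : Type*} [NormedAddCommGroup E] [InnerProductSpace ℂ E]

/-- The exponential `e^{-i (n + 1/2) θ}`. -/
noncomputable def halfExp (n : ℤ) (θ : ℝ) : ℂ :=
  Complex.exp (-Complex.I * (((n : ℝ) + 1 / 2) * θ : ℝ))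

@[fun_prop]
theorem continuous_halfExp (n : ℤ) : Continuous (halfExp n) := by
  unfold halfExp
  fun_prop

theorem conj_halfExp (n : ℤ) (θ : ℝ) : starRingEnd ℂ (halfExp n θ) = halfExp (-n - 1) θ := by
  rw [halfExp, halfExp, ← Complex.exp_conj, map_mul, map_neg, Complex.conj_I, Complex.conj_ofReal]
  congr 1
  push_cast
  ring

theorem halfExp_sub_one (n : ℤ) (θ : ℝ) :
    halfExp (n - 1) θ = Complex.exp (Complex.I * θ) * halfExp n θ := by
  rw [halfExp, halfExp, ← Complex.exp_add]
  congr 1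
  push_cast
  ring

theorem integral_exp_int_mul (k : ℤ) :
    ∫ θ in (-Real.pi)..Real.pi, Complex.exp (Complex.I * k * (θ : ℂ)) =
      if k = 0 then (2 * Real.pi : ℂ) else 0 := by
  split_ifs with h
  · subst h
    simp
    ring
  · have hk : Complex.I * (k : ℂ) ≠ 0 := mul_ne_zero Complex.I_ne_zero (by exact_mod_cast h)
    rw [integral_exp_mul_complex hk, div_eq_zero_iff]
    left
    rw [sub_eq_zero, Complex.exp_eq_exp_iff_exists_int]
    refine ⟨k, ?_⟩
    push_cast
    ring

theorem integral_halfExp_mul (m n : ℤ) :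
    ∫ θ in (-Real.pi)..Real.pi, halfExp n θ * starRingEnd ℂ (halfExp m θ) =
      if m = n then (2 * Real.pi : ℂ) else 0 := by
  have h : ∀ θ : ℝ, halfExp n θ * starRingEnd ℂ (halfExp m θ) =
      Complex.exp (Complex.I * ((m - n : ℤ) : ℂ) * (θ : ℂ)) := fun θ => by
    rw [conj_halfExp, halfExp, halfExp, ← Complex.exp_add]
    congr 1
    push_cast
    ring
  simp only [h, integral_exp_int_mul, sub_eq_zero]

theorem halfMode_eq (g : ℝ → E) (n : ℤ) :
    halfMode g n = ∫ θ in (-Real.pi)..Real.pi, halfExp n θ • g θ := rfl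

variable [CompleteSpace E]

theorem inner_halfMode_right {g : ℝ → E} (hg : Continuous g) (n : ℤ) (c : E) :
    ⟪c, halfMode g n⟫_ℂ = ∫ θ in (-Real.pi)..Real.pi, halfExp n θ * ⟪c, g θ⟫_ℂ := by
  have hi : IntervalIntegrable (fun θ => halfExp n θ • g θ) MeasureTheory.volume (-Real.pi) Real.pi :=
    Continuous.intervalIntegrable (by fun_prop) _ _
  have h := (innerSL ℂ c).intervalIntegral_comp_comm hi
  rw [halfMode_eq]
  refine (h.symm.trans ?_)
  simp only [innerSL_apply_apply, inner_smul_right]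

theorem inner_halfMode_left {g : ℝ → E} (hg : Continuous g) (n : ℤ) (c : E) :
    ⟪halfMode g n, c⟫_ℂ =
      ∫ θ in (-Real.pi)..Real.pi, starRingEnd ℂ (halfExp n θ) * ⟪g θ, c⟫_ℂ := by
  rw [← inner_conj_symm, inner_halfMode_right hg, ← intervalIntegral.intervalIntegral_conj]
  simp only [map_mul, inner_conj_symm]

/-- Bessel's inequality for the Fourier modes. -/
theorem sum_norm_halfMode_sq_le {g : ℝ → E} (hg : Continuous g) {K : ℝ} (hK : ∀ θ, ‖g θ‖ = K)
    (s : Finset ℤ) : ∑ n ∈ s, ‖halfMode g n‖ ^ 2 ≤ (2 * Real.pi * K) ^ 2 := by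
  have hpi := Real.pi_pos
  -- T is 2π times the projection of g onto the chosen modes; the inequality is positivity of the
  -- integral of ‖2πg - T‖².
  let T : ℝ → E := fun θ => ∑ n ∈ s, starRingEnd ℂ (halfExp n θ) • halfMode g n
  have hT : Continuous T := by
    simp only [T, conj_halfExp]
    fun_prop
  have h1 : ∀ {f : ℝ → E}, Continuous f → ∫ θ in (-Real.pi)..Real.pi, ⟪T θ, f θ⟫_ℂ =
      ∑ n ∈ s, ⟪halfMode g n, halfMode f n⟫_ℂ := by
    intro f hf
    simp only [inner_halfMode_right hf, T, sum_inner, inner_smul_left, Complex.conj_conj]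
    exact intervalIntegral.integral_finsetSum fun n _ =>
      Continuous.intervalIntegrable (by fun_prop) _ _
  have h2 : ∀ n ∈ s, halfMode T n = (2 * Real.pi : ℂ) • halfMode g n := by
    intro n hn
    simp only [halfMode_eq T, T, Finset.smul_sum, smul_smul]
    rw [intervalIntegral.integral_finsetSum fun m _ =>
      Continuous.intervalIntegrable (by simp only [conj_halfExp]; fun_prop) _ _]
    simp only [intervalIntegral.integral_smul_const, integral_halfExp_mul, ite_smul, zero_smul]
    rw [Finset.sum_ite_eq' s n, if_pos hn]
  set B : ℝ := ∑ n ∈ s, ‖halfMode g n‖ ^ 2 with hB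
  have e1 : ∫ θ in (-Real.pi)..Real.pi, ⟪T θ, g θ⟫_ℂ = (B : ℂ) := by
    rw [h1 hg, hB]
    push_cast
    exact Finset.sum_congr rfl fun n _ => inner_self_eq_norm_sq_to_K _
  have e2 : ∫ θ in (-Real.pi)..Real.pi, ⟪T θ, T θ⟫_ℂ = ((2 * Real.pi * B : ℝ) : ℂ) := by
    rw [h1 hT, hB, Finset.mul_sum]
    push_cast
    refine Finset.sum_congr rfl fun n hn => ?_
    rw [h2 n hn, inner_smul_right, inner_self_eq_norm_sq_to_K]
    rfl
  have e3 : ∫ θ in (-Real.pi)..Real.pi, ⟪g θ, T θ⟫_ℂ = (B : ℂ) := by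
    have : ∀ θ, ⟪g θ, T θ⟫_ℂ = starRingEnd ℂ ⟪T θ, g θ⟫_ℂ := fun θ => (inner_conj_symm _ _).symm
    simp only [this, intervalIntegral.intervalIntegral_conj, e1, Complex.conj_ofReal]
  have e4 : ∫ θ in (-Real.pi)..Real.pi, ⟪g θ, g θ⟫_ℂ = ((2 * Real.pi * K ^ 2 : ℝ) : ℂ) := by
    have : ∀ θ, ⟪g θ, g θ⟫_ℂ = ((K ^ 2 : ℝ) : ℂ) := fun θ => by
      rw [inner_self_eq_norm_sq_to_K, hK]
      push_cast
      rfl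
    simp only [this, intervalIntegral.integral_const, Complex.real_smul]
    push_cast
    ring
  have e5 : ∫ θ in (-Real.pi)..Real.pi, ‖(2 * Real.pi : ℂ) • g θ - T θ‖ ^ 2 =
      (2 * Real.pi) * ((2 * Real.pi * K) ^ 2 - B) := by
    have e6 : ∀ θ, ((‖(2 * Real.pi : ℂ) • g θ - T θ‖ ^ 2 : ℝ) : ℂ) =
        (2 * Real.pi) ^ 2 * ⟪g θ, g θ⟫_ℂ - (2 * Real.pi) * ⟪g θ, T θ⟫_ℂ -
          (2 * Real.pi) * ⟪T θ, g θ⟫_ℂ + ⟪T θ, T θ⟫_ℂ := by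
      intro θ
      have := inner_self_eq_norm_sq_to_K (𝕜 := ℂ) ((2 * Real.pi : ℂ) • g θ - T θ)
      push_cast
      refine this.symm.trans ?_
      rw [inner_sub_left, inner_sub_right, inner_sub_right, inner_smul_left, inner_smul_left,
        inner_smul_right, inner_smul_right, map_mul, Complex.conj_ofReal, Complex.conj_ofNat]
      ring
    have e7 : ((∫ θ in (-Real.pi)..Real.pi, ‖(2 * Real.pi : ℂ) • g θ - T θ‖ ^ 2 : ℝ) : ℂ) =
        (((2 * Real.pi) * ((2 * Real.pi * K) ^ 2 - B) : ℝ) : ℂ) := by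
      rw [← intervalIntegral.integral_ofReal]
      simp only [e6]
      rw [intervalIntegral.integral_add, intervalIntegral.integral_sub,
        intervalIntegral.integral_sub, intervalIntegral.integral_const_mul,
        intervalIntegral.integral_const_mul, intervalIntegral.integral_const_mul, e1, e2, e3, e4]
      · push_cast
        ring
      all_goals exact Continuous.intervalIntegrable (by fun_prop) _ _
    exact_mod_cast e7
  have e8 : 0 ≤ (2 * Real.pi) * ((2 * Real.pi * K) ^ 2 - B) := by
    rw [← e5]
    exact intervalIntegral.integral_nonneg (by linarith) fun θ _ => by positivity
  have e9 := nonneg_of_mul_nonneg_right e8 (by positivity)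
  linarith

theorem tendsto_norm_halfMode_sq {g : ℝ → E} (hg : Continuous g) {K : ℝ} (hK : ∀ θ, ‖g θ‖ = K)
    {f : ℕ → ℤ} (hf : Function.Injective f) :
    Filter.Tendsto (fun k => ‖halfMode g (f k)‖ ^ 2) Filter.atTop (nhds 0) := by
  have h := summable_of_sum_le (f := fun k => ‖halfMode g (f k)‖ ^ 2) (fun _ => by positivity)
    (c := (2 * Real.pi * K) ^ 2) fun s => by
      have := sum_norm_halfMode_sq_le hg hK (s.map ⟨f, hf⟩)
      rwa [Finset.sum_map] at this
  exact h.tendsto_atTop_zero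

/-- The recurrence that an exchange relation implies for the norms of the Fourier modes. -/
theorem norm_halfMode_recurrence {g h : ℝ → E} (hg : Continuous g) (hh : Continuous h) {q : ℝ}
    (hrel : ∀ θ θ' : ℝ, (Complex.exp (Complex.I * (θ - θ')) - q ^ 2) * ⟪g θ', g θ⟫_ℂ =
      (1 - q ^ 2 * Complex.exp (Complex.I * (θ - θ'))) * ⟪h θ, h θ'⟫_ℂ) (n : ℤ) :
    ‖halfMode g (n - 1)‖ ^ 2 - q ^ 2 * ‖halfMode g n‖ ^ 2 =
      ‖halfMode h (-n - 1)‖ ^ 2 - q ^ 2 * ‖halfMode h (-n)‖ ^ 2 := by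
  have hlin : ∀ (f : ℝ → ℝ → ℂ) (_ : Continuous (Function.uncurry f)) (m : ℤ),
      Continuous (Function.uncurry fun θ θ' : ℝ =>
        halfExp m θ * (starRingEnd ℂ (halfExp m θ') * f θ θ')) := fun f hf m => by
    simp only [conj_halfExp]
    have : Continuous fun p : ℝ × ℝ => f p.1 p.2 := hf
    change Continuous fun p : ℝ × ℝ => halfExp m p.1 * (halfExp (-m - 1) p.2 * f p.1 p.2)
    fun_prop
  let D : (ℝ → ℝ → ℂ) → ℤ → ℂ := fun f m =>
    ∫ θ in (-Real.pi)..Real.pi, halfExp m θ *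
      ∫ θ' in (-Real.pi)..Real.pi, starRingEnd ℂ (halfExp m θ') * f θ θ'
  have hD : ∀ f m, D f m = ∫ θ in (-Real.pi)..Real.pi, ∫ θ' in (-Real.pi)..Real.pi,
      halfExp m θ * (starRingEnd ℂ (halfExp m θ') * f θ θ') := fun f m => by
    simp only [D, intervalIntegral.integral_const_mul]
  have hsub : ∀ (f : ℝ → ℝ → ℂ) (_ : Continuous (Function.uncurry f)) (m m' : ℤ) (c c' : ℂ),
      c * D f m - c' * D f m' = ∫ θ in (-Real.pi)..Real.pi, ∫ θ' in (-Real.pi)..Real.pi,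
        (c * (halfExp m θ * (starRingEnd ℂ (halfExp m θ') * f θ θ')) -
          c' * (halfExp m' θ * (starRingEnd ℂ (halfExp m' θ') * f θ θ'))) := by
    intro f hf m m' c c'
    have hin : ∀ m θ, Continuous fun θ' =>
        halfExp m θ * (starRingEnd ℂ (halfExp m θ') * f θ θ') := fun m θ =>
      (hlin f hf m).comp (by fun_prop : Continuous fun θ' : ℝ => (θ, θ'))
    have hout : ∀ m, Continuous fun θ => ∫ θ' in (-Real.pi)..Real.pi,
        halfExp m θ * (starRingEnd ℂ (halfExp m θ') * f θ θ') := fun m =>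
      intervalIntegral.continuous_parametric_intervalIntegral_of_continuous' (hlin f hf m) _ _
    rw [hD, hD, ← intervalIntegral.integral_const_mul, ← intervalIntegral.integral_const_mul,
      ← intervalIntegral.integral_sub ((hout m).const_mul c |>.intervalIntegrable _ _)
        ((hout m').const_mul c' |>.intervalIntegrable _ _)]
    refine intervalIntegral.integral_congr fun θ _ => ?_
    rw [← intervalIntegral.integral_const_mul, ← intervalIntegral.integral_const_mul,
      ← intervalIntegral.integral_sub ((hin m θ).const_mul c |>.intervalIntegrable _ _)
        ((hin m' θ).const_mul c' |>.intervalIntegrable _ _)]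
  have hgD : ∀ m, ((‖halfMode g m‖ ^ 2 : ℝ) : ℂ) = D (fun θ θ' => ⟪g θ', g θ⟫_ℂ) m := by
    intro m
    push_cast
    refine (inner_self_eq_norm_sq_to_K (𝕜 := ℂ) (halfMode g m)).symm.trans ?_
    rw [inner_halfMode_right hg]
    simp only [inner_halfMode_left hg, D]
  -- In the exchange relation h enters with its arguments in the opposite order, which reflects the
  -- half-integer label m + 1/2 to -m - 1/2.
  have hhD : ∀ m, ((‖halfMode h (-m - 1)‖ ^ 2 : ℝ) : ℂ) = D (fun θ θ' => ⟪h θ, h θ'⟫_ℂ) m := by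
    intro m
    push_cast
    refine (inner_self_eq_norm_sq_to_K (𝕜 := ℂ) (halfMode h (-m - 1))).symm.trans ?_
    rw [inner_halfMode_left hh]
    simp only [inner_halfMode_right hh, ← conj_halfExp, Complex.conj_conj, D]
  have key : ((‖halfMode g (n - 1)‖ ^ 2 : ℝ) : ℂ) - q ^ 2 * ((‖halfMode g n‖ ^ 2 : ℝ) : ℂ) =
      ((‖halfMode h (-n - 1)‖ ^ 2 : ℝ) : ℂ) - q ^ 2 * ((‖halfMode h (-n)‖ ^ 2 : ℝ) : ℂ) := by
    have hn : (-n : ℤ) = -(n - 1) - 1 := by ring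
    rw [hn, hhD, hgD, hgD, show -(n - 1) - 1 - 1 = -n - 1 by ring, hhD]
    rw [← one_mul (D _ (n - 1)), hsub _ (by
        change Continuous fun p : ℝ × ℝ => ⟪g p.2, g p.1⟫_ℂ
        fun_prop),
      ← one_mul (D (fun θ θ' => ⟪h θ, h θ'⟫_ℂ) n), hsub _ (by
        change Continuous fun p : ℝ × ℝ => ⟪h p.1, h p.2⟫_ℂ
        fun_prop)]
    refine intervalIntegral.integral_congr fun θ _ =>
      intervalIntegral.integral_congr fun θ' _ => ?_
    -- The factor e^{i(θ-θ')} lowers the label of both Fourier exponentials by one, so the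
    -- recurrence is the exchange relation integrated against halfExp n θ times the conjugate of
    -- halfExp n θ'.
    have e := hrel θ θ'
    have e2 : Complex.exp (Complex.I * (θ - θ')) =
        Complex.exp (Complex.I * θ) * starRingEnd ℂ (Complex.exp (Complex.I * θ')) := by
      rw [← Complex.exp_conj, ← Complex.exp_add, map_mul, Complex.conj_I, Complex.conj_ofReal]
      congr 1
      ring
    rw [e2] at e
    rw [halfExp_sub_one, halfExp_sub_one, map_mul]
    linear_combination (halfExp n θ * starRingEnd ℂ (halfExp n θ')) * e
  exact_mod_cast key

/-- The Fourier modes of a function with an exchange relation are small. -/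
theorem norm_halfMode_sq_le {g h : ℝ → E} (hg : Continuous g) (hh : Continuous h) {K : ℝ}
    (hgK : ∀ θ, ‖g θ‖ = K) (hhK : ∀ θ, ‖h θ‖ = K) {q : ℝ} (hq : q ^ 2 ≤ 1)
    (hrel : ∀ θ θ' : ℝ, (Complex.exp (Complex.I * (θ - θ')) - q ^ 2) * ⟪g θ', g θ⟫_ℂ =
      (1 - q ^ 2 * Complex.exp (Complex.I * (θ - θ'))) * ⟪h θ, h θ'⟫_ℂ) (n : ℤ) :
    ‖halfMode g n‖ ^ 2 ≤ (1 - q ^ 2) * (2 * Real.pi * K) ^ 2 := by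
  -- With both kinds of modes on one side, the sum is conserved from m - 1 to m up to terms of order
  -- 1 - q²; the one with a favorable sign is dropped.
  have hstep : ∀ m : ℤ, ‖halfMode g m‖ ^ 2 + ‖halfMode h (-m - 1)‖ ^ 2 ≤
      ‖halfMode g (m - 1)‖ ^ 2 + ‖halfMode h (-m)‖ ^ 2 + (1 - q ^ 2) * ‖halfMode g m‖ ^ 2 := by
    intro m
    have h1 := norm_halfMode_recurrence hg hh hrel m
    have h2 : 0 ≤ (1 - q ^ 2) * ‖halfMode h (-m)‖ ^ 2 :=
      mul_nonneg (by linarith) (by positivity)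
    linarith
  have hsum : ∀ k : ℕ, ‖halfMode g n‖ ^ 2 + ‖halfMode h (-n - 1)‖ ^ 2 ≤
      ‖halfMode g (n - k)‖ ^ 2 + ‖halfMode h (-(n - k) - 1)‖ ^ 2 +
        (1 - q ^ 2) * ∑ i ∈ Finset.range k, ‖halfMode g (n - i)‖ ^ 2 := by
    intro k
    induction k with
    | zero => simp
    | succ k ih =>
      have h1 := hstep (n - k)
      rw [Finset.sum_range_succ, mul_add]
      have e1 : n - ((k + 1 : ℕ) : ℤ) = n - k - 1 := by push_cast; ring
      have e2 : -(n - (k : ℤ) - 1) - 1 = -(n - k) := by ring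
      rw [e1, e2]
      linarith
  have hinj : Function.Injective fun k : ℕ => n - (k : ℤ) := fun k l e => by
    have e' : n - (k : ℤ) = n - l := e
    omega
  have hinj2 : Function.Injective fun k : ℕ => -(n - (k : ℤ)) - 1 := fun k l e => by
    have e' : -(n - (k : ℤ)) - 1 = -(n - l) - 1 := e
    omega
  have hlim := ((tendsto_norm_halfMode_sq hg hgK hinj).add
    (tendsto_norm_halfMode_sq hh hhK hinj2)).add_const ((1 - q ^ 2) * (2 * Real.pi * K) ^ 2)
  rw [zero_add, zero_add] at hlim
  -- After k steps the boundary terms tend to zero as k → ∞, modes being square summable, and the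
  -- accumulated errors are bounded by Bessel's inequality.
  refine ge_of_tendsto' hlim fun k => ?_
  have h1 := sum_norm_halfMode_sq_le hg hgK ((Finset.range k).map ⟨fun k : ℕ => n - (k : ℤ), hinj⟩)
  rw [Finset.sum_map] at h1
  have h2 := mul_le_mul_of_nonneg_left h1 (by linarith : 0 ≤ 1 - q ^ 2)
  have h3 : 0 ≤ ‖halfMode h (-n - 1)‖ ^ 2 := by positivity
  have h4 := hsum k
  simp only [Function.Embedding.coeFn_mk] at h2
  linarith

end FourierModes

/-! ### The exchange relation of the vertex operators -/

section Exchange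

variable {M : ℕ} (A : Flavor M)

theorem expAnnih_commute {X : Module.End ℂ (FinVec M)} (h : ∀ m : ℤ, m ≠ 0 → Commute (rho A m) X)
    (b : ℕ → ℂ) : Commute (expAnnih A b) X := by
  refine lnExp_commute (locNil_annih A b) ?_
  rw [commute_iff_eq, annih, lfSum_mul (locFin_annih A b), mul_lfSum (locFin_annih A b)]
  congr 1
  funext m
  rw [smul_mul_assoc, mul_smul_comm, (h (m + 1) (by omega)).eq]

/-- A unitary operator that commutes with the bosons commutes with the Weyl operators. -/
theorem commute_weyl {X X' : Module.End ℂ (FinVec M)} {U : Fock M ≃ₗᵢ[ℂ] Fock M}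
    (hX : ∀ v : FinVec M, U (v : Fock M) = (X v : FinVec M))
    (hX' : ∀ v : FinVec M, U.symm (v : Fock M) = (X' v : FinVec M))
    (hc : ∀ m : ℤ, m ≠ 0 → Commute (rho A m) X) (hc' : ∀ m : ℤ, m ≠ 0 → Commute (rho A m) X')
    {b : ℕ → ℂ} (hb : Summable fun m => ‖b m‖) (v : Fock M) :
    U (weyl A b v) = weyl A b (U v) := by
  refine fock_induction (p := fun v => U (weyl A b v) = weyl A b (U v))
    (isClosed_eq (by fun_prop) (by fun_prop)) (fun v => ?_) v
  refine fock_ext_fin fun u => ?_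
  have hadj : ∀ x : Fock M, ∀ y, ⟪x, U y⟫_ℂ = ⟪U.symm x, y⟫_ℂ := fun x y => by
    rw [← U.inner_map_map (U.symm x), U.apply_symm_apply]
  rw [hadj, hX', hX, inner_weyl_coe A hb, inner_weyl_coe A hb, weylForm, weylForm]
  have e1 := LinearMap.congr_fun (expAnnih_commute A hc' b).eq u
  have e2 := LinearMap.congr_fun (expAnnih_commute A hc (-b)).eq v
  rw [Module.End.mul_apply, Module.End.mul_apply] at e1 e2
  rw [e1, e2, ← FinVec.inner_coe, ← FinVec.inner_coe, ← hX, ← hX', hadj]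

theorem upIso_weyl {b : ℕ → ℂ} (hb : Summable fun m => ‖b m‖) (v : Fock M) :
    upIso A (weyl A b v) = weyl A b (upIso A v) :=
  commute_weyl A (fun v => (coe_up A v).symm) (fun v => (coe_down A v).symm)
    (fun _ hm => (up_mul_rho A hm).symm) (fun _ hm => (down_mul_rho A hm).symm) hb v

theorem upIso_symm_weyl {b : ℕ → ℂ} (hb : Summable fun m => ‖b m‖) (v : Fock M) :
    (upIso A).symm (weyl A b v) = weyl A b ((upIso A).symm v) := by
  rw [LinearIsometryEquiv.symm_apply_eq, upIso_weyl A hb, LinearIsometryEquiv.apply_symm_apply]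

theorem commute_rho_charge (φ : ℂ → ℂ) (m : ℤ) :
    Commute (rho A m) (diagFin fun S => φ (charge A S : ℂ)) := by
  have h : diagFin (fun S => (charge A S : ℂ)) * rho A m =
      rho A m * diagFin (fun S => (charge A S : ℂ)) + (0 : ℂ) • rho A m := by
    rw [← rho_zero_eq, zero_smul, add_zero, ← sub_eq_zero, rho_commutator]
    simp
  have h2 := diagFin_comp_mul h (φ := φ) (d := 1) fun z => by rw [add_zero, one_mul]
  rw [one_smul] at h2
  exact h2.symm

theorem chargePhase_weyl (θ : ℝ) {b : ℕ → ℂ} (hb : Summable fun m => ‖b m‖) (v : Fock M) :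
    chargePhase A θ (weyl A b v) = weyl A b (chargePhase A θ v) := by
  refine commute_weyl A (chargePhase_coe A θ) (fun v => ?_)
    (fun m _ => commute_rho_charge A (fun z => Complex.exp (Complex.I * (θ / 2) * z)) m)
    (fun m _ => commute_rho_charge A (fun z => Complex.exp (Complex.I * ((-θ : ℝ) / 2) * z)) m) hb v
  rw [chargePhase_symm, chargePhase_coe]

theorem chargePhase_upIso (θ : ℝ) (v : Fock M) :
    chargePhase A θ (upIso A v) =
      Complex.exp (Complex.I * (θ / 2)) • upIso A (chargePhase A θ v) := by
  refine fock_induction (p := fun v => chargePhase A θ (upIso A v) =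
    Complex.exp (Complex.I * (θ / 2)) • upIso A (chargePhase A θ v))
    (isClosed_eq (by fun_prop) (by fun_prop)) (fun v => ?_) v
  set z := diagFin (fun S => Complex.exp (Complex.I * (θ / 2) * (charge A S : ℂ))) with hz
  have h : z * up A = Complex.exp (Complex.I * (θ / 2)) • (up A * z) := by
    refine FinVec.linearMap_ext fun S => ?_
    rw [Module.End.mul_apply, LinearMap.smul_apply, Module.End.mul_apply, hz,
      diagFin_charge_up A (fun c => Complex.exp (Complex.I * (θ / 2) * c)), diagFin_fs, map_smul,
      smul_smul, ← Complex.exp_add]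
    congr 2
    ring
  rw [← coe_up, chargePhase_coe, chargePhase_coe, ← coe_up]
  exact congrArg FinVec.toFock (LinearMap.congr_fun h v)

theorem upIso_chargePhase (θ : ℝ) (v : Fock M) :
    upIso A (chargePhase A θ v) =
      Complex.exp (-(Complex.I * (θ / 2))) • chargePhase A θ (upIso A v) := by
  rw [chargePhase_upIso, smul_smul, ← Complex.exp_add, neg_add_cancel, Complex.exp_zero, one_smul]

theorem upIso_symm_chargePhase (θ : ℝ) (v : Fock M) :
    (upIso A).symm (chargePhase A θ v) =
      Complex.exp (Complex.I * (θ / 2)) • chargePhase A θ ((upIso A).symm v) := by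
  rw [LinearIsometryEquiv.symm_apply_eq, map_smul, upIso_chargePhase,
    LinearIsometryEquiv.apply_symm_apply, smul_smul, ← Complex.exp_add, add_neg_cancel,
    Complex.exp_zero, one_smul]

theorem vertexOp_eq_smul {q : ℝ} (hq : |q| < 1) (θ : ℝ) (v : Fock M) :
    vertexOp A q θ v = Complex.exp (Complex.I * (θ / 2)) • chargePhase A (θ + θ)
      (weyl A (geomCoeff (Complex.exp (Complex.I * θ) * q)) ((upIso A).symm v)) := by
  rw [vertexOp_apply, upIso_symm_chargePhase, map_smul, ← chargePhase_add,
    upIso_symm_weyl A (summable_vertex hq θ)]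

theorem vertexOp_symm_eq_smul {q : ℝ} (hq : |q| < 1) (θ : ℝ) (v : Fock M) :
    (vertexOp A q θ).symm v = Complex.exp (-(Complex.I * (θ / 2))) • upIso A
      (weyl A (-geomCoeff (Complex.exp (Complex.I * θ) * q)) (chargePhase A (-(θ + θ)) v)) := by
  rw [LinearIsometryEquiv.symm_apply_eq, map_smul, vertexOp_eq_smul A hq, smul_smul,
    ← Complex.exp_add, neg_add_cancel, Complex.exp_zero, one_smul,
    LinearIsometryEquiv.symm_apply_apply, ← weyl_symm A (summable_vertex hq θ),
    LinearIsometryEquiv.apply_symm_apply, ← chargePhase_symm, LinearIsometryEquiv.apply_symm_apply]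

/-- The pairing of two geometric sequences is the Taylor series of -log(1 - w̄'w). -/
theorem exp_neg_pair_geomCoeff {w w' : ℂ} (h : ‖starRingEnd ℂ w' * w‖ < 1) :
    Complex.exp (-pair (geomCoeff w') (geomCoeff w)) = 1 - starRingEnd ℂ w' * w := by
  have h1 := Complex.hasSum_taylorSeries_neg_log' h
  have h3 : pair (geomCoeff w') (geomCoeff w) = -Complex.log (1 - starRingEnd ℂ w' * w) := by
    rw [pair]
    refine Eq.trans (tsum_congr fun m => ?_) h1.tsum_eq
    rw [geomCoeff, geomCoeff, map_neg, map_pow, neg_mul_neg, ← mul_pow]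
  rw [h3, neg_neg, Complex.exp_log]
  intro h0
  rw [← sub_eq_zero.1 h0, norm_one] at h
  exact lt_irrefl _ h

/-- Both products reduce to the charge phase times W(b - b'), with different scalars. The Weyl
phases give the ratio of 1 - q² e^{i(θ-θ')} to its conjugate, and the charge moved by the shift
gives e^{i(θ-θ')}. -/
theorem vertexOp_exchange {q : ℝ} (hq : |q| < 1) (θ θ' : ℝ) (v : Fock M) :
    (Complex.exp (Complex.I * (θ - θ')) - q ^ 2) • (vertexOp A q θ').symm (vertexOp A q θ v) =
      (1 - q ^ 2 * Complex.exp (Complex.I * (θ - θ'))) •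
        vertexOp A q θ ((vertexOp A q θ').symm v) := by
  set b := geomCoeff (Complex.exp (Complex.I * θ) * q) with hb
  set b' := geomCoeff (Complex.exp (Complex.I * θ') * q) with hb'
  have hs : Summable fun m => ‖b m‖ := summable_vertex hq θ
  have hs' : Summable fun m => ‖b' m‖ := summable_vertex hq θ'
  have hs'' := summable_norm_neg hs'
  set p := pair b' b with hp
  have e1 : (vertexOp A q θ').symm (vertexOp A q θ v) =
      (Complex.exp (-(Complex.I * (θ' / 2))) * Complex.exp (Complex.I * (θ / 2)) *
        Complex.exp (-(Complex.I * (θ - θ'))) *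
        Complex.exp ((starRingEnd ℂ p - p) / 2)) •
        chargePhase A (2 * (θ - θ')) (weyl A (b - b') v) := by
    rw [vertexOp_symm_eq_smul A hq, vertexOp_eq_smul A hq, ← hb, ← hb', map_smul, map_smul,
      ← chargePhase_add, ← chargePhase_weyl A _ hs'', weyl_mul A hs'' hs, map_smul, map_smul, map_smul,
      upIso_chargePhase, pair_neg_left, ← hp,
      upIso_weyl A (summable_norm_add hs'' hs), LinearIsometryEquiv.apply_symm_apply,
      show -b' + b = b - b' by ring, show -(θ' + θ') + (θ + θ) = 2 * (θ - θ') by ring]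
    simp only [smul_smul]
    congr 1
    rw [map_neg]
    push_cast
    ring_nf
  have e2 : vertexOp A q θ ((vertexOp A q θ').symm v) =
      (Complex.exp (-(Complex.I * (θ' / 2))) * Complex.exp (Complex.I * (θ / 2)) *
        Complex.exp ((p - starRingEnd ℂ p) / 2)) •
        chargePhase A (2 * (θ - θ')) (weyl A (b - b') v) := by
    rw [vertexOp_symm_eq_smul A hq, map_smul, vertexOp_eq_smul A hq, ← hb, ← hb',
      LinearIsometryEquiv.symm_apply_apply, weyl_mul A hs hs'', map_smul,
      ← chargePhase_weyl A _ (summable_norm_add hs hs''), ← chargePhase_add, pair_neg_right,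
      ← conj_pair b' b, ← hp, show b + -b' = b - b' by ring,
      show θ + θ + -(θ' + θ') = 2 * (θ - θ') by ring]
    simp only [smul_smul]
    congr 1
    rw [map_neg, Complex.conj_conj]
    ring_nf
  set w := Complex.exp (Complex.I * (θ - θ')) with hw
  have hz : starRingEnd ℂ (Complex.exp (Complex.I * θ') * q) * (Complex.exp (Complex.I * θ) * q) =
      q ^ 2 * w := by
    rw [map_mul, Complex.conj_ofReal, ← Complex.exp_conj, map_mul, Complex.conj_I,
      Complex.conj_ofReal, hw,
      show Complex.I * ((θ : ℂ) - θ') = -Complex.I * θ' + Complex.I * θ by ring, Complex.exp_add]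
    ring
  have hzn : ‖starRingEnd ℂ (Complex.exp (Complex.I * θ') * q) * (Complex.exp (Complex.I * θ) * q)‖
      < 1 := by
    rw [norm_mul, RCLike.norm_conj, norm_exp_I_mul, norm_exp_I_mul]
    nlinarith [abs_nonneg q]
  have hp1 : Complex.exp (-p) = 1 - q ^ 2 * w := by rw [hp, exp_neg_pair_geomCoeff hzn, hz]
  have hww : w * Complex.exp (-(Complex.I * (θ - θ'))) = 1 := by
    rw [hw, ← Complex.exp_add, add_neg_cancel, Complex.exp_zero]
  have hwc : starRingEnd ℂ w = Complex.exp (-(Complex.I * (θ - θ'))) := by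
    rw [hw, ← Complex.exp_conj, map_mul, Complex.conj_I, map_sub, Complex.conj_ofReal,
      Complex.conj_ofReal, neg_mul]
  have hp2 : Complex.exp (-starRingEnd ℂ p) = 1 - q ^ 2 * Complex.exp (-(Complex.I * (θ - θ'))) := by
    have := congrArg (starRingEnd ℂ) hp1
    rw [← Complex.exp_conj, map_neg, map_sub, map_one, map_mul, map_pow, Complex.conj_ofReal,
      hwc] at this
    exact this
  have hpp : Complex.exp (-starRingEnd ℂ p) * Complex.exp ((starRingEnd ℂ p - p) / 2) =
      Complex.exp (-p) * Complex.exp ((p - starRingEnd ℂ p) / 2) := by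
    rw [← Complex.exp_add, ← Complex.exp_add]
    congr 1
    ring
  rw [hp1, hp2] at hpp
  rw [e1, e2, smul_smul, smul_smul]
  congr 1
  linear_combination (Complex.exp (-(Complex.I * (θ' / 2))) * Complex.exp (Complex.I * (θ / 2))) *
    hpp + (Complex.exp (-(Complex.I * (θ' / 2))) * Complex.exp (Complex.I * (θ / 2)) *
      Complex.exp ((starRingEnd ℂ p - p) / 2)) * hww

/-- The Fourier modes of the vertex operator are bounded by the inverse of its normalization. -/
theorem norm_halfMode_vertexOp_le {q : ℝ} (hq : |q| < 1) (n : ℤ) (v : Fock M) :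
    ‖halfMode (fun θ => vertexOp A q θ v) n‖ ≤ √(1 - q ^ 2) * (2 * Real.pi) * ‖v‖ := by
  have hq2 : q ^ 2 ≤ 1 := by
    rw [← sq_abs]
    nlinarith [abs_nonneg q]
  have h := norm_halfMode_sq_le (continuous_vertexOp A hq v) (continuous_vertexOp_symm A hq v)
    (fun θ => (vertexOp A q θ).norm_map v) (fun θ => (vertexOp A q θ).symm.norm_map v) hq2
    (fun θ θ' => by
      have hadj : ∀ (U : Fock M ≃ₗᵢ[ℂ] Fock M) x y, ⟪U.symm x, y⟫_ℂ = ⟪x, U y⟫_ℂ := fun U x y => by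
        rw [← U.inner_map_map (U.symm x), U.apply_symm_apply]
      have hadj' : ∀ (U : Fock M ≃ₗᵢ[ℂ] Fock M) x y, ⟪U x, y⟫_ℂ = ⟪x, U.symm y⟫_ℂ := fun U x y => by
        rw [← U.inner_map_map x (U.symm y), U.apply_symm_apply]
      rw [hadj', hadj, ← inner_smul_right, ← inner_smul_right, vertexOp_exchange A hq]) n
  refine abs_le_of_sq_le_sq' ?_ (by positivity) |>.2
  rw [mul_pow, mul_pow, Real.sq_sqrt (by linarith)]
  linarith

end Exchange

/-! ### The limit of the Fourier modes -/

section Limit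

variable {M : ℕ}

theorem finite_setOf_energy_le (k : ℤ) : {S : Finset (Mode M) | energy S ≤ k}.Finite := by
  classical
  have : Finite (Flavor M) := Finite.of_injective
    (fun A : Flavor M => (A.r, A.s, A.α, A.x)) fun A B h => by
      simpa [Flavor.ext_iff] using h
  have hF : {i : Mode M | i.n ∈ Finset.Icc (-k - 1) k}.Finite := by
    refine Set.Finite.subset (((Set.finite_univ (α := Flavor M)).prod
      (Finset.Icc (-k - 1) k).finite_toSet).image fun p => (⟨p.1, p.2⟩ : Mode M)) fun i hi => ?_
    exact ⟨(i.flavor, i.n), ⟨Set.mem_univ _, hi⟩, rfl⟩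
  refine (hF.toFinset.powerset.finite_toSet).subset fun S hS => ?_
  rw [Finset.mem_coe, Finset.mem_powerset]
  intro i hi
  have h1 : |2 * i.n + 1| ≤ energy S :=
    Finset.single_le_sum (f := fun i : Mode M => |2 * i.n + 1|) (fun _ _ => abs_nonneg _) hi
  have h2 : energy S ≤ k := hS
  rw [Set.Finite.mem_toFinset, Set.mem_ofPred_eq, Finset.mem_Icc]
  have h3 := abs_le.1 (h1.trans h2)
  omega

theorem eq_sum_of_inner_eq_zero {v : Fock M} {s : Finset (Finset (Mode M))}
    (h : ∀ S ∉ s, ⟪(state S : Fock M), v⟫_ℂ = 0) : v = ∑ S ∈ s, ⟪(state S : Fock M), v⟫_ℂ • state S := by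
  classical
  refine fock_ext fun S => ?_
  simp only [inner_sum, inner_smul_right, inner_state_state, mul_ite, mul_one, mul_zero]
  rw [Finset.sum_ite_eq]
  split_ifs with hS
  · rfl
  · exact h S hS

theorem rot_mul_rot (κ κ' : ℂ) : rot M κ * rot M κ' = rot M (κ + κ') :=
  FinVec.linearMap_ext fun S => by
    rw [Module.End.mul_apply, rot_fs, map_smul, rot_fs, smul_smul, ← Complex.exp_add, rot_fs,
      ← add_mul, add_comm]

theorem isAdj_rot (κ : ℝ) : IsAdj (rot M (κ : ℂ)) (rot M (κ : ℂ)) := by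
  have h := isAdj_diagFin fun S : Finset (Mode M) => Complex.exp ((κ : ℂ) * (energy S : ℂ))
  have h2 : (fun S : Finset (Mode M) => starRingEnd ℂ (Complex.exp ((κ : ℂ) * (energy S : ℂ)))) =
      fun S => Complex.exp ((κ : ℂ) * (energy S : ℂ)) := by
    funext S
    rw [← Complex.exp_conj, map_mul, Complex.conj_ofReal, map_intCast]
  rw [h2] at h
  exact h

theorem continuous_inner_rot (u v : FinVec M) :
    Continuous fun κ : ℝ => ⟪u, rot M ((κ : ℝ) : ℂ) v⟫_ℂ := by
  refine FinVec.induction (p := fun v => Continuous fun κ : ℝ => ⟪u, rot M ((κ : ℝ) : ℂ) v⟫_ℂ)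
    ?_ ?_ ?_ ?_ v
  · simp only [map_zero, inner_zero_right]
    exact continuous_const
  · intro v w hv hw
    simp only [map_add, inner_add_right]
    exact hv.add hw
  · intro c v hv
    simp only [map_smul, inner_smul_right]
    exact continuous_const.mul hv
  · intro S
    simp only [rot_fs, inner_smul_right]
    fun_prop

/-- The matrix elements of the vertex operator, up to its normalization. -/
theorem tendsto_vertexForm (A : Flavor M) (S S₀ : Finset (Mode M)) :
    Filter.Tendsto (fun q : ℝ => ⟪expAnnih A (geomCoeff (q : ℂ)) (up A (fs S)),
      expAnnih A (-geomCoeff (q : ℂ)) (fs S₀)⟫_ℂ) (nhdsWithin 1 (Set.Iio 1))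
      (nhds (bosonForm A (fs S) (fs S₀))) := by
  set X := expAnnih A (geomCoeff 1) (up A (fs S)) with hX
  set Y := expAnnih A (-geomCoeff 1) (fs S₀) with hY
  set e : ℤ := energy S + 2 * charge A S + 1 + energy S₀ with he
  -- With q = e^{2κ}, real rotations carry the sequence of parameter q to that of parameter 1. The
  -- dependence on q is then a finite combination of exponentials of κ, continuous at κ = 0, that is
  -- q = 1.
  let G : ℝ → ℂ := fun κ => Complex.exp (κ * e) * ⟪X, rot M ((-2 * κ : ℝ) : ℂ) Y⟫_ℂ
  have hG : Continuous G :=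
    Continuous.mul (by fun_prop) ((continuous_inner_rot X Y).comp (by fun_prop))
  have hG0 : G 0 = bosonForm A (fs S) (fs S₀) := by
    have : rot M (((-2 * 0 : ℝ)) : ℂ) = 1 := FinVec.linearMap_ext fun S => by
      rw [rot_fs]
      simp
    simp only [G, this]
    simp [bosonForm, hX, hY]
  have hlim : Filter.Tendsto (fun q : ℝ => G (Real.log q / 2)) (nhdsWithin 1 (Set.Iio 1))
      (nhds (G 0)) := by
    refine (hG.tendsto 0).comp ?_
    have h1 : Filter.Tendsto (fun q : ℝ => Real.log q / 2) (nhds 1) (nhds (Real.log 1 / 2)) :=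
      (Real.continuousAt_log one_ne_zero).div_const 2
    rw [Real.log_one, zero_div] at h1
    exact h1.mono_left nhdsWithin_le_nhds
  rw [← hG0]
  refine hlim.congr' ?_
  have hev : ∀ᶠ q : ℝ in nhdsWithin 1 (Set.Iio 1), 0 < q :=
    nhdsWithin_le_nhds (lt_mem_nhds one_pos)
  filter_upwards [hev] with q hq
  set κ : ℝ := Real.log q / 2 with hκ
  have hqκ : (q : ℂ) = Complex.exp (2 * (κ : ℂ)) * 1 := by
    rw [mul_one, hκ, ← Real.exp_log hq]
    push_cast
    rw [Real.log_exp]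
    ring_nf
  have hb : ∀ m, geomCoeff (q : ℂ) m = Complex.exp (2 * (κ : ℂ) * (m + 1)) * geomCoeff 1 m :=
    fun m => by rw [hqκ, geomCoeff_exp_mul]
  have e1 := LinearMap.congr_fun (expAnnih_mul_rot A (κ : ℂ) hb) (up A (fs S))
  have e2 := LinearMap.congr_fun (expAnnih_mul_rot A (κ : ℂ) (b' := -geomCoeff (q : ℂ))
    (b := -geomCoeff 1) fun m => by rw [Pi.neg_apply, Pi.neg_apply, hb, mul_neg]) (fs S₀)
  rw [Module.End.mul_apply, Module.End.mul_apply, rot_fs, map_smul, ← hY] at e2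
  rw [Module.End.mul_apply, Module.End.mul_apply, ← hX, rot,
    diagFin_energy_up A (fun z => Complex.exp (-(κ : ℂ) * z)), map_smul, ← rot] at e1
  have c1 : ∀ z : ℂ, Complex.exp ((κ : ℂ) * z) * Complex.exp (-(κ : ℂ) * z) = 1 := fun z => by
    rw [← Complex.exp_add, neg_mul, add_neg_cancel, Complex.exp_zero]
  have f1 : expAnnih A (geomCoeff (q : ℂ)) (up A (fs S)) =
      Complex.exp ((κ : ℂ) * (energy S + 2 * charge A S + 1)) • rot M (-(κ : ℂ)) X := by
    rw [← e1, smul_smul, c1, one_smul]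
  have f2 : expAnnih A (-geomCoeff (q : ℂ)) (fs S₀) =
      Complex.exp ((κ : ℂ) * energy S₀) • rot M (-(κ : ℂ)) Y := by
    rw [← e2, smul_smul, c1, one_smul]
  have hadj := isAdj_rot (M := M) (-κ) X (rot M (-(κ : ℂ)) Y)
  rw [f1, f2, inner_smul_left, inner_smul_right]
  have hrr : rot M (-(κ : ℂ)) (rot M (-(κ : ℂ)) Y) = rot M (-(κ : ℂ) + -(κ : ℂ)) Y :=
    LinearMap.congr_fun (rot_mul_rot _ _) Y
  rw [Complex.ofReal_neg, hrr] at hadj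
  rw [hadj, ← Complex.exp_conj]
  simp only [G]
  rw [he, ← mul_assoc, ← Complex.exp_add]
  congr 2
  · simp only [map_mul, map_add, Complex.conj_ofReal, map_intCast, map_one, map_ofNat]
    push_cast
    ring
  · congr 2
    push_cast
    ring

theorem exp_neg_pair_half {q : ℝ} (hq : |q| < 1) :
    Complex.exp (-pair (geomCoeff (q : ℂ)) (geomCoeff (q : ℂ)) / 2) = (√(1 - q ^ 2) : ℝ) := by
  set p := pair (geomCoeff (q : ℂ)) (geomCoeff (q : ℂ)) with hp
  have hn : ‖starRingEnd ℂ (q : ℂ) * q‖ < 1 := by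
    rw [Complex.conj_ofReal, ← Complex.ofReal_mul, Complex.norm_real, Real.norm_eq_abs, abs_mul]
    nlinarith [abs_nonneg q]
  have h1 := exp_neg_pair_geomCoeff hn
  have h2 : p = (p.re : ℂ) := (pair_self_re _).symm
  rw [← hp, h2, Complex.conj_ofReal] at h1
  have h3 : Real.exp (-p.re) = 1 - q ^ 2 := by
    have : ((Real.exp (-p.re) : ℝ) : ℂ) = ((1 - q ^ 2 : ℝ) : ℂ) := by
      push_cast
      rw [h1]
      ring
    exact_mod_cast this
  rw [← h3, ← Real.exp_half, h2]
  push_cast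
  rfl

theorem inner_state_vertexOp (A : Flavor M) {q : ℝ} (hq : |q| < 1) (θ : ℝ)
    (S S₀ : Finset (Mode M)) : ⟪(state S : Fock M), vertexOp A q θ (state S₀)⟫_ℂ =
      Complex.exp (Complex.I * (θ / 2 * ((energy S₀ - energy S : ℤ) : ℂ))) *
        ⟪(state S : Fock M), (upIso A).symm (weyl A (geomCoeff (q : ℂ)) (state S₀))⟫_ℂ := by
  rw [vertexOp_eq A hq, ← rotIso_symm, ← (rotIso M θ).inner_map_map (state S),
    LinearIsometryEquiv.apply_symm_apply, rotIso_state, rotIso_state, map_smul, map_smul,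
    inner_smul_left, inner_smul_right, ← mul_assoc, ← Complex.exp_conj, ← Complex.exp_add]
  congr 2
  simp only [map_mul, map_div₀, Complex.conj_ofReal, map_intCast, Complex.conj_I, Complex.conj_ofNat]
  push_cast
  ring

/-- The charge is an integer, so the double phase is periodic, and the shift contributes e^{iθ/2}.
Antiperiodicity forces odd energy differences in nonzero matrix elements, matching half-integer
Fourier labels. -/
theorem vertexOp_two_pi (A : Flavor M) {q : ℝ} (hq : |q| < 1) (S₀ : Finset (Mode M)) :
    vertexOp A q (2 * Real.pi) (state S₀) = -vertexOp A q 0 (state S₀) := by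
  have h1 : Complex.exp (Complex.I * ((2 * Real.pi : ℝ) : ℂ)) = Complex.exp (Complex.I * (0 : ℝ)) := by
    push_cast
    rw [mul_zero, Complex.exp_zero, mul_comm, Complex.exp_two_pi_mul_I]
  have h2 : ∀ v, chargePhase A (2 * Real.pi + 2 * Real.pi) v = chargePhase A (0 + 0) v := by
    intro v
    refine fock_induction (p := fun v => chargePhase A (2 * Real.pi + 2 * Real.pi) v =
      chargePhase A (0 + 0) v) (isClosed_eq (by fun_prop) (by fun_prop)) (fun v => ?_) v
    rw [chargePhase_coe, chargePhase_coe]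
    congr 3
    funext S
    rw [Complex.exp_eq_exp_iff_exists_int]
    refine ⟨charge A S, ?_⟩
    push_cast
    ring
  rw [vertexOp_eq_smul A hq, vertexOp_eq_smul A hq, h1, h2, ← neg_smul]
  congr 1
  push_cast
  rw [zero_div, mul_zero, Complex.exp_zero, mul_div_cancel_left₀ _ two_ne_zero, mul_comm,
    Complex.exp_pi_mul_I]

/-- The integrand is a single exponential whose frequency is half the energy difference, so the mode
is nonzero for one difference only, where it carries the Weyl normalization √(1-q²). -/
theorem inner_state_halfMode (A : Flavor M) {q : ℝ} (hq : |q| < 1) (j : ℤ)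
    (S S₀ : Finset (Mode M)) :
    ⟪(state S : Fock M), halfMode (fun θ => vertexOp A q θ (state S₀)) j⟫_ℂ =
      if energy S = energy S₀ - (2 * j + 1) then
        ((2 * Real.pi * √(1 - q ^ 2) : ℝ) : ℂ) * ⟪expAnnih A (geomCoeff (q : ℂ)) (up A (fs S)),
          expAnnih A (-geomCoeff (q : ℂ)) (fs S₀)⟫_ℂ
      else 0 := by
  set x := ⟪(state S : Fock M), (upIso A).symm (weyl A (geomCoeff (q : ℂ)) (state S₀))⟫_ℂ with hx
  have hxv : x = ((√(1 - q ^ 2) : ℝ) : ℂ) * ⟪expAnnih A (geomCoeff (q : ℂ)) (up A (fs S)),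
      expAnnih A (-geomCoeff (q : ℂ)) (fs S₀)⟫_ℂ := by
    have h1 := inner_weyl_coe A (summable_norm_geomCoeff (w := (q : ℂ)) (by simpa using hq))
      (up A (fs S)) (fs S₀)
    rw [weylForm, exp_neg_pair_half hq, coe_up] at h1
    rw [← h1, hx, ← (upIso A).inner_map_map (state S), LinearIsometryEquiv.apply_symm_apply]
    rfl
  have hpar : Complex.exp (Real.pi * Complex.I * ((energy S₀ - energy S : ℤ) : ℂ)) * x = -x := by
    have h1 := congrArg (fun v => ⟪(state S : Fock M), v⟫_ℂ) (vertexOp_two_pi A hq S₀)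
    simp only [inner_neg_right, inner_state_vertexOp A hq] at h1
    rw [← hx] at h1
    have e1 : Complex.I * (((2 * Real.pi : ℝ) : ℂ) / 2 * ((energy S₀ - energy S : ℤ) : ℂ)) =
        Real.pi * Complex.I * ((energy S₀ - energy S : ℤ) : ℂ) := by
      push_cast
      ring
    rw [e1, Complex.ofReal_zero, zero_div, zero_mul, mul_zero, Complex.exp_zero, one_mul] at h1
    exact h1
  rw [inner_halfMode_right (continuous_vertexOp A hq _)]
  simp only [inner_state_vertexOp A hq, ← hx]
  rcases eq_or_ne x 0 with h0 | h0
  · have h1 : ((√(1 - q ^ 2) : ℝ) : ℂ) * ⟪expAnnih A (geomCoeff (q : ℂ)) (up A (fs S)),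
      expAnnih A (-geomCoeff (q : ℂ)) (fs S₀)⟫_ℂ = 0 := by rw [← hxv, h0]
    rw [h0]
    push_cast
    rw [mul_assoc, h1]
    simp
  · have h1 : Complex.exp (Real.pi * Complex.I * ((energy S₀ - energy S : ℤ) : ℂ)) = -1 :=
      mul_right_cancel₀ h0 (by rw [hpar, neg_one_mul])
    obtain ⟨t, ht⟩ : ∃ t : ℤ, energy S₀ - energy S = 2 * t + 1 := by
      rcases Int.even_or_odd' (energy S₀ - energy S) with ⟨t, ht | ht⟩
      · exfalso
        rw [ht, show Real.pi * Complex.I * ((2 * t : ℤ) : ℂ) = t * (2 * Real.pi * Complex.I) by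
          push_cast; ring, Complex.exp_int_mul_two_pi_mul_I] at h1
        norm_num at h1
      · exact ⟨t, ht⟩
    have h2 : ∀ θ : ℝ, halfExp j θ *
        (Complex.exp (Complex.I * (θ / 2 * ((energy S₀ - energy S : ℤ) : ℂ))) * x) =
        Complex.exp (Complex.I * ((t - j : ℤ) : ℂ) * θ) * x := fun θ => by
      rw [← mul_assoc, halfExp, ← Complex.exp_add, ht]
      congr 2
      push_cast
      ring
    simp only [h2]
    rw [intervalIntegral.integral_mul_const, integral_exp_int_mul, hxv]
    by_cases h : t = j
    · rw [if_pos (by omega), if_pos (by omega)]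
      push_cast
      ring
    · rw [if_neg (by omega), if_neg (by omega), zero_mul]

theorem inner_fs_dn_eq_zero (A : Flavor M) {n : ℤ} {S S₀ : Finset (Mode M)}
    (h : energy S ≠ energy S₀ - (2 * n + 1)) : ⟪fs S, dn A n (fs S₀)⟫_ℂ = 0 := by
  have h1 := inner_fs_diagFin (fun S => (energy S : ℂ)) S (dn A n (fs S₀))
  have h2 := LinearMap.congr_fun (ham_mul_dn A n) (fs S₀)
  rw [Module.End.mul_apply, LinearMap.sub_apply, Module.End.mul_apply, LinearMap.smul_apply, ham,
    diagFin_fs, map_smul, ← sub_smul] at h2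
  rw [h2, inner_smul_right] at h1
  by_contra h0
  have h3 := mul_right_cancel₀ h0 h1
  exact h (by exact_mod_cast h3.symm)

theorem fermionForm_fs (A : Flavor M) {j : ℤ} {S S₀ : Finset (Mode M)}
    (h : energy S = energy S₀ - (2 * j + 1)) :
    fermionForm A (fs S) (fs S₀) = ⟪fs S, dn A j (fs S₀)⟫_ℂ :=
  tsum_eq_single j fun n hn => inner_fs_dn_eq_zero A (by omega)

/-- The normalized Fourier modes of the vertex operator. -/
noncomputable def vertexMode (A : Flavor M) (j : ℤ) (q : ℝ) (v : Fock M) : Fock M :=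
  ((1 / (2 * Real.pi * √(1 - q ^ 2)) : ℝ) : ℂ) • halfMode (fun θ => vertexOp A q θ v) j

theorem one_sub_sq_pos {q : ℝ} (hq : |q| < 1) : 0 < 1 - q ^ 2 := by
  rw [← sq_abs]
  nlinarith [abs_nonneg q]

/-- Both sides live on the finitely many states of the selected energy, so convergence of matrix
elements is convergence in norm. At that energy the sum over all fermion labels in `fermionForm` has
the single term j. -/
theorem tendsto_vertexMode_state (A : Flavor M) (j : ℤ) (S₀ : Finset (Mode M)) :
    Filter.Tendsto (fun q => vertexMode A j q (state S₀)) (nhdsWithin 1 (Set.Iio 1))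
      (nhds (dn A j (fs S₀) : FinVec M)) := by
  set e := energy S₀ - (2 * j + 1) with he
  set s := (finite_setOf_energy_le (M := M) e).toFinset with hs
  have hsS : ∀ S ∉ s, energy S ≠ e := fun S hS h => hS (by
    rw [hs, Set.Finite.mem_toFinset]
    exact h.le)
  have hD := eq_sum_of_inner_eq_zero (v := ((dn A j (fs S₀) : FinVec M) : Fock M)) (s := s)
    fun S hS => inner_fs_dn_eq_zero A (hsS S hS)
  have hev : ∀ᶠ q : ℝ in nhdsWithin 1 (Set.Iio 1), |q| < 1 := by
    filter_upwards [nhdsWithin_le_nhds (lt_mem_nhds (zero_lt_one (α := ℝ))),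
      self_mem_nhdsWithin] with q h1 h2
    rwa [abs_of_pos h1]
  have hV : ∀ q : ℝ, |q| < 1 → vertexMode A j q (state S₀) = ∑ S ∈ s, (if energy S = e then
      ⟪expAnnih A (geomCoeff (q : ℂ)) (up A (fs S)),
        expAnnih A (-geomCoeff (q : ℂ)) (fs S₀)⟫_ℂ else 0) • (state S : Fock M) := by
    intro q hq
    have hsq : 2 * Real.pi * √(1 - q ^ 2) ≠ 0 :=
      mul_ne_zero (by positivity) (Real.sqrt_pos.2 (one_sub_sq_pos hq)).ne'
    have h1 : ∀ S, ⟪(state S : Fock M), vertexMode A j q (state S₀)⟫_ℂ = if energy S = e then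
        ⟪expAnnih A (geomCoeff (q : ℂ)) (up A (fs S)),
          expAnnih A (-geomCoeff (q : ℂ)) (fs S₀)⟫_ℂ else 0 := by
      intro S
      rw [vertexMode, inner_smul_right, inner_state_halfMode A hq]
      split_ifs
      · rw [← mul_assoc, ← Complex.ofReal_mul, one_div_mul_cancel hsq, Complex.ofReal_one, one_mul]
      · rw [mul_zero]
    have h2 := eq_sum_of_inner_eq_zero (v := vertexMode A j q (state S₀)) (s := s) fun S hS => by
      rw [h1, if_neg (hsS S hS)]
    rw [h2]
    simp only [h1]
  rw [hD]
  refine Filter.Tendsto.congr' (hev.mono fun q hq => (hV q hq).symm) ?_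
  refine tendsto_finsetSum _ fun S _ => Filter.Tendsto.smul_const ?_ _
  split_ifs with h
  · have h1 := tendsto_vertexForm A S S₀
    rw [bosonForm_eq_fermionForm, fermionForm_fs A h] at h1
    exact h1
  · rw [show ⟪(state S : Fock M), ((dn A j (fs S₀) : FinVec M) : Fock M)⟫_ℂ = 0 from
      inner_fs_dn_eq_zero A h]
    exact tendsto_const_nhds

theorem vertexMode_add (A : Flavor M) (j : ℤ) {q : ℝ} (hq : |q| < 1) (u v : Fock M) :
    vertexMode A j q (u + v) = vertexMode A j q u + vertexMode A j q v := by
  have hi : ∀ v, IntervalIntegrable (fun θ => halfExp j θ • vertexOp A q θ v)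
      MeasureTheory.volume (-Real.pi) Real.pi := fun v =>
    ((continuous_halfExp j).smul (continuous_vertexOp A hq v)).intervalIntegrable _ _
  rw [vertexMode, vertexMode, vertexMode, ← smul_add, halfMode_eq, halfMode_eq, halfMode_eq]
  refine congrArg _ (Eq.trans ?_ (intervalIntegral.integral_add (hi u) (hi v)))
  simp only [map_add, smul_add]

theorem vertexMode_smul (A : Flavor M) (j : ℤ) (q : ℝ) (c : ℂ) (v : Fock M) :
    vertexMode A j q (c • v) = c • vertexMode A j q v := by
  have h : ∀ θ, halfExp j θ • vertexOp A q θ (c • v) = c • halfExp j θ • vertexOp A q θ v :=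
    fun θ => by rw [map_smul, smul_comm]
  rw [vertexMode, vertexMode, smul_comm c, halfMode_eq, halfMode_eq]
  simp only [h]
  rw [intervalIntegral.integral_smul]

theorem norm_vertexMode_le (A : Flavor M) (j : ℤ) {q : ℝ} (hq : |q| < 1) (v : Fock M) :
    ‖vertexMode A j q v‖ ≤ ‖v‖ := by
  have h1 := Real.sqrt_pos.2 (one_sub_sq_pos hq)
  have h2 : 0 < 2 * Real.pi * √(1 - q ^ 2) := by positivity
  rw [vertexMode, norm_smul, Complex.norm_real, Real.norm_of_nonneg (by positivity), one_div,
    inv_mul_le_iff₀ h2]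
  refine (norm_halfMode_vertexOp_le A hq j v).trans (le_of_eq ?_)
  ring

theorem eventually_abs_lt_one : ∀ᶠ q : ℝ in nhdsWithin 1 (Set.Iio 1), |q| < 1 := by
  filter_upwards [nhdsWithin_le_nhds (lt_mem_nhds (zero_lt_one (α := ℝ))),
    self_mem_nhdsWithin] with q h1 h2
  rwa [abs_of_pos h1]

theorem tendsto_vertexMode_coe (A : Flavor M) (n : ℤ) (u : FinVec M) :
    Filter.Tendsto (fun q => vertexMode A (modeIdx A n) q (u : Fock M)) (nhdsWithin 1 (Set.Iio 1))
      (nhds ((dn A (modeIdx A n) u : FinVec M) : Fock M)) := by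
  generalize modeIdx A n = j
  induction u using FinVec.induction with
  | h0 =>
    have h0 : ∀ q, vertexMode A j q (0 : Fock M) = 0 := fun q => by
      have := vertexMode_smul A j q 0 0
      rwa [zero_smul, zero_smul] at this
    rw [map_zero, FinVec.coe_zero]
    exact tendsto_const_nhds.congr fun q => (h0 q).symm
  | hadd u v hu hv =>
    rw [map_add, FinVec.coe_add, FinVec.coe_add]
    exact (hu.add hv).congr' (eventually_abs_lt_one.mono fun q hq =>
      (vertexMode_add A j hq _ _).symm)
  | hsmul c u hu =>
    rw [map_smul, FinVec.coe_smul, FinVec.coe_smul]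
    exact (hu.const_smul c).congr fun q => (vertexMode_smul A j q c _).symm
  | hs S => exact tendsto_vertexMode_state A j S

/-- The normalized Fourier modes converge strongly to the fermion operators. -/
theorem tendsto_vertexMode (A : Flavor M) (n : ℤ) (v : Fock M) :
    Filter.Tendsto (fun q => vertexMode A (modeIdx A n) q v) (nhdsWithin 1 (Set.Iio 1))
      (nhds (fermionC A n v)) := by
  have hfin := fun u : FinVec M => coe_dn_modeIdx A n u ▸ tendsto_vertexMode_coe A n u
  generalize modeIdx A n = j at hfin ⊢
  rw [Metric.tendsto_nhds]
  intro ε hε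
  have hB : 0 < ‖fermionC A n‖ + 1 := by positivity
  obtain ⟨u, hu⟩ := FinVec.denseRange_incl.exists_dist_lt v
    (show 0 < ε / (2 * (‖fermionC A n‖ + 1)) by positivity)
  change dist v (u : Fock M) < _ at hu
  rw [dist_eq_norm, lt_div_iff₀ (by positivity)] at hu
  filter_upwards [eventually_abs_lt_one, (Metric.tendsto_nhds.1 (hfin u)) (ε / 2) (by positivity)] with q hq hqu
  rw [dist_eq_norm] at hqu ⊢
  -- The two terms with v - u are small uniformly in q, the first by the bound from the exchange
  -- relation; the middle one converges on finite vectors.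
  have h1 : vertexMode A j q v - fermionC A n v = vertexMode A j q (v - u) +
      (vertexMode A j q (u : Fock M) - fermionC A n u) - fermionC A n (v - u) := by
    have := vertexMode_add A j hq (v - u) (u : Fock M)
    rw [sub_add_cancel] at this
    rw [this, map_sub]
    abel
  have h2 := norm_vertexMode_le A j hq (v - u)
  have h3 := (fermionC A n).le_opNorm (v - u)
  rw [h1]
  refine (norm_sub_le _ _).trans_lt ?_
  have h4 := norm_add_le (vertexMode A j q (v - u))
    (vertexMode A j q (u : Fock M) - fermionC A n u)
  nlinarith

end Limit

/-! ### The reconstruction of the fermion field -/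

section Reconstruction

variable {M : ℕ}

/-- With c = 2π/L this is the limit of (1 - q²)/ε, which fixes the normalization. -/
theorem tendsto_one_sub_exp_div {c : ℝ} : Filter.Tendsto (fun ε : ℝ => (1 - Real.exp (-(c * ε))) / ε)
    (nhdsWithin 0 (Set.Ioi 0)) (nhds c) := by
  have h1 : HasDerivAt (fun ε : ℝ => 1 - Real.exp (-(c * ε))) c 0 := by
    have h := (((hasDerivAt_id (0 : ℝ)).const_mul c).neg.exp).const_sub 1
    simpa using h
  refine (h1.tendsto_slope_zero_right).congr fun ε => ?_
  simp [div_eq_inv_mul]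

theorem tendsto_regulator {L : ℝ} (hL : 0 < L) : Filter.Tendsto
    (fun ε : ℝ => Real.exp (-(Real.pi * ε / L))) (nhdsWithin 0 (Set.Ioi 0))
    (nhdsWithin 1 (Set.Iio 1)) := by
  refine tendsto_nhdsWithin_iff.2 ⟨?_, ?_⟩
  · have h : Continuous fun ε : ℝ => Real.exp (-(Real.pi * ε / L)) := by fun_prop
    have h1 := h.tendsto 0
    simp only [mul_zero, zero_div, neg_zero, Real.exp_zero] at h1
    exact h1.mono_left nhdsWithin_le_nhds
  · filter_upwards [self_mem_nhdsWithin] with ε hε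
    have hε0 : 0 < ε := hε
    rw [Set.mem_Iio, Real.exp_lt_one_iff]
    have : 0 < Real.pi * ε / L := by positivity
    linarith

/-- The normalization 2π√(1-q²) of the modes meets 1/√(2πaε) of the field, the weight a of a site,
L/2π from the change of variables and 1/2π from the transform. Under the root the product tends to
a/L. -/
theorem psiRegFourier_eq {L a : ℝ} (ha : 0 < a) (hL : L = M * a) (hM : 0 < M) (r s α : ℤˣ)
    (k : FermiMom M) {ε : ℝ} (hε : 0 < ε) (v : Fock M) :
    psiRegFourier L a r s α k ε v = ((L / (2 * Real.pi) *
      √(a / (2 * Real.pi) * ((1 - Real.exp (-(2 * Real.pi / L * ε))) / ε)) : ℝ) : ℂ) •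
        ∑ x : Cell M, sitePhase L a k.2 x • vertexMode ⟨r, s, α, x⟩ (modeIdx ⟨r, s, α, x⟩ k.1)
          (Real.exp (-(Real.pi * ε / L))) v := by
  have hL0 : 0 < L := by
    have : (0 : ℝ) < M := by exact_mod_cast hM
    rw [hL]
    positivity
  have hq := one_sub_sq_pos (exp_regulator_mem hL0 hε)
  set q := Real.exp (-(Real.pi * ε / L)) with hqdef
  have hq2 : Real.exp (-(2 * Real.pi / L * ε)) = q ^ 2 := by
    rw [hqdef, ← Real.exp_nat_mul]
    congr 1
    push_cast
    ring
  have hs := Real.sqrt_pos.2 hq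
  have hroot : √(a / (2 * Real.pi) * ((1 - q ^ 2) / ε)) =
      a * √(1 - q ^ 2) / √(2 * Real.pi * a * ε) := by
    rw [show a / (2 * Real.pi) * ((1 - q ^ 2) / ε) = a ^ 2 * (1 - q ^ 2) / (2 * Real.pi * a * ε) by
      field_simp, Real.sqrt_div (by positivity), Real.sqrt_mul (by positivity), Real.sqrt_sq ha.le]
  rw [psiRegFourier, Finset.smul_sum, Finset.smul_sum]
  refine Finset.sum_congr rfl fun x _ => ?_
  have hh : halfMode (fun θ => vertexOp ⟨r, s, α, x⟩ q θ v) (modeIdx ⟨r, s, α, x⟩ k.1) =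
      ((2 * Real.pi * √(1 - q ^ 2) : ℝ) : ℂ) •
        vertexMode ⟨r, s, α, x⟩ (modeIdx ⟨r, s, α, x⟩ k.1) q v := by
    rw [vertexMode, smul_smul, ← Complex.ofReal_mul, mul_one_div_cancel (by positivity),
      Complex.ofReal_one, one_smul]
  rw [integral_fourierIntegrand ha hL hM r s α k hε x v, ← hqdef, hh, hq2, hroot]
  simp only [smul_smul]
  congr 1
  have hpi : (Real.pi : ℂ) ≠ 0 := Complex.ofReal_ne_zero.2 Real.pi_ne_zero
  have hn : ((√(2 * Real.pi * a * ε) : ℝ) : ℂ) ≠ 0 :=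
    Complex.ofReal_ne_zero.2 (Real.sqrt_pos.2 (by positivity)).ne'
  push_cast
  field_simp

theorem tendsto_psiRegFourier {L a : ℝ} (ha : 0 < a) (hL : L = M * a) (hM : 0 < M) (r s α : ℤˣ)
    (k : FermiMom M) (v : Fock M) : Filter.Tendsto (fun ε : ℝ => psiRegFourier L a r s α k ε v)
      (nhdsWithin 0 (Set.Ioi 0)) (nhds (psiHat L a r s α k v)) := by
  have hL0 : 0 < L := by
    have : (0 : ℝ) < M := by exact_mod_cast hM
    rw [hL]
    positivity
  have hscal : Filter.Tendsto (fun ε : ℝ => L / (2 * Real.pi) *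
      √(a / (2 * Real.pi) * ((1 - Real.exp (-(2 * Real.pi / L * ε))) / ε)))
      (nhdsWithin 0 (Set.Ioi 0)) (nhds (L / (2 * Real.pi) * √(a / L))) := by
    have h := (Real.continuous_sqrt.tendsto _).comp
      ((tendsto_one_sub_exp_div (c := 2 * Real.pi / L)).const_mul (a / (2 * Real.pi)))
    rw [show a / (2 * Real.pi) * (2 * Real.pi / L) = a / L by field_simp] at h
    exact h.const_mul _
  have hpsi : psiHat L a r s α k v = ((L / (2 * Real.pi) * √(a / L) : ℝ) : ℂ) •
      ∑ x : Cell M, sitePhase L a k.2 x • fermionC ⟨r, s, α, x⟩ k.1 v := by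
    simp only [psiHat, sitePhase, smul_apply, sum_apply]
  rw [hpsi]
  refine Filter.Tendsto.congr' ?_ (((Complex.continuous_ofReal.tendsto _).comp hscal).smul
    (tendsto_finsetSum Finset.univ fun x _ =>
      ((tendsto_vertexMode ⟨r, s, α, x⟩ k.1 v).comp (tendsto_regulator hL0)).const_smul
        (sitePhase L a k.2 x)))
  filter_upwards [self_mem_nhdsWithin] with ε hε
  exact (psiRegFourier_eq ha hL hM r s α k hε v).symm

end Reconstruction

end NodalBoson

theorem propositionC3 (M : ℕ) (hM : 0 < M) (L a : ℝ) (ha : 0 < a) (hL : L = M * a) :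
    NodalBoson.IsKleinFamily L a M NodalBoson.klein ∧
    ∀ r s α : ℤˣ,
      (∀ ε : ℝ, 0 < ε → ∀ y ∈ Set.Ico (-L / 2) (L / 2), ∀ x : NodalBoson.Cell M,
        ((√(2 * Real.pi * a * ε) : ℝ) : ℂ) • NodalBoson.psiReg L a r s α y x ε ∈
          unitary (NodalBoson.Fock M →L[ℂ] NodalBoson.Fock M)) ∧
      ∀ (k : NodalBoson.FermiMom M) (v : NodalBoson.Fock M),
        (∀ ε : ℝ, 0 < ε → ∀ x : NodalBoson.Cell M,
          IntervalIntegrable (NodalBoson.fourierIntegrand L a r s α k ε x v)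
            MeasureTheory.volume (-L / 2) (L / 2)) ∧
        Filter.Tendsto (fun ε : ℝ => NodalBoson.psiRegFourier L a r s α k ε v)
          (nhdsWithin 0 (Set.Ioi 0)) (nhds (NodalBoson.psiHat L a r s α k v)) :=
  ⟨NodalBoson.isKleinFamily_klein ha hL hM, fun r s α =>
    ⟨fun _ hε y _ x => NodalBoson.smul_psiReg_mem_unitary ha hL hM r s α y x hε, fun k v =>
      ⟨fun _ hε x => (NodalBoson.continuous_fourierIntegrand ha hL hM r s α k hε x
        v).intervalIntegrable _ _, NodalBoson.tendsto_psiRegFourier ha hL hM r s α k v⟩⟩⟩
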